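/- Let $L/k$ be a finite Galois extension of fields, let $k\subsetneq K\subseteq L$ be an intermediate field such that $L$ is the Galois closure of $K/k$, and put $G=\mathrm{Gal}(L/k)$, $H=\mathrm{Gal}(L/K)\lneq G$. Let $T=R^{(1)}_{K/k}(\mathbb G_m)$ be the norm one torus of $K/k$, i.e. the kernel of the norm map $R_{K/k}(\mathbb G_m)\to\mathbb G_m$. Let $I_{G/H}$ be the kernel of the augmentation map $\varepsilon:\mathbb Z[G/H]\to\mathbb Z$ and $J_{G/H}=\mathrm{Hom}_{\mathbb Z}(I_{G/H},\mathbb Z)$; then $T$ is a $k$-torus of dimension $[K:k]-1$ which splits over $L$ and has character module $\widehat T\simeq J_{G/H}$. A permutation $G$-lattice is a $G$-lattice with a $\mathbb Z$-basis permuted by $G$. A $G$-lattice $F$ is flabby if $\widehat H^{-1}(S,F)=0$ for all subgroups $S\le G$, and stably permutation if $F\oplus P\simeq P'$ for some permutation $G$-lattices $P,P'$. We write $F=[J_{G/H}]^{fl}$ if $F$ is flabby and there is an exact sequence of $G$-lattices $0\to J_{G/H}\to P\to F\to 0$ with $P$ permutation. In each case below, $G$ has subgroups of all the isomorphism types that are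 named, and the isomorphism holds for any choice of subgroups of $G$ of these types. ($D_n$ is the dihedral group of order $2n$, and $V_4=(C_2)^2$.) 1. If $G\simeq S_3$ and $H=\{1\}$ ($[G:H]=6$), there is $F=[J_{G/H}]^{fl}$ with $\mathrm{rank}_{\mathbb Z}F=7$ and $$\mathbb Z[G/C_2]^{\oplus 2}\oplus\mathbb Z[G/C_3]\simeq\mathbb Z\oplus F\qquad(r=2\cdot 3+2=1+7=8).$$ 2. If $G\simeq S_3$ and $H\simeq C_2$ ($[G:H]=3$), there is $F=[J_{G/H}]^{fl}$ with $\mathrm{rank}_{\mathbb Z}F=4$ and $$\mathbb Z[G/C_2]\oplus\mathbb Z[G/C_3]\simeq\mathbb Z\oplus F\qquad(r=3+2=1+4=5);$$ in particular $\mathbb Z[G/C_2]^{\oplus 2}\oplus\mathbb Z[G/C_3]\simeq\mathbb Z\oplus(\mathbb Z[G/C_2]\oplus F)$, of rank $8$. 3. If $G\simeq A_5$ and $H\simeq V_4$ ($[G:H]=15$), there is $F=[J_{G/H}]^{fl}$ with $\mathrm{rank}_{\mathbb Z}F=21$ and $$\mathbb Z[G/C_5]\oplus\mathbb Z[G/A_4]^{\oplus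 2}\simeq\mathbb Z\oplus F\qquad(r=12+2\cdot 5=1+21=22).$$ 4. If $G\simeq A_5$ and $H\simeq A_4$ ($[G:H]=5$), there is $F=[J_{G/H}]^{fl}$ with $\mathrm{rank}_{\mathbb Z}F=16$ and $$\mathbb Z[G/C_5]\oplus\mathbb Z[G/S_3]\simeq\mathbb Z[G/D_5]\oplus F\qquad(r=12+10=6+16=22).$$ 5. If $G\simeq \mathrm{PSL}_2(\mathbb F_8)$ and $H\simeq (C_2)^3$ ($[G:H]=63$), there is $F=[J_{G/H}]^{fl}$ with $\mathrm{rank}_{\mathbb Z}F=73$ and $$\mathbb Z[G/S_3]\oplus\mathbb Z[G/C_9]\oplus\mathbb Z[G/((C_2)^3\rtimes C_7)]^{\oplus 2}\simeq\mathbb Z[G/S_3]\oplus\mathbb Z\oplus F\qquad(r=84+56+2\cdot 9=84+1+73=158).$$ 6. If $G\simeq \mathrm{PSL}_2(\mathbb F_8)$ and $H\simeq (C_2)^3\rtimes C_7$ ($[G:H]=9$), there is $F=[J_{G/H}]^{fl}$ with $\mathrm{rank}_{\mathbb Z}F=64$ and $$\mathbb Z[G/C_3]\oplus\mathbb Z[G/C_9]\oplus\mathbb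 Z[G/D_7]\simeq\mathbb Z[G/C_3]\oplus\mathbb Z[G/D_9]\oplus F\qquad(r=168+56+36=168+28+64=260).$$ Moreover, in each of the cases 1–6, $F$ is stably permutation, $T$ is stably $k$-rational, and there is a $k$-torus $T'$ of dimension $r$ (that is, $r=8,5,22,22,158,260$ respectively) which splits over $L$ and is $k$-rational, whose character module $\widehat{T'}$ is isomorphic to the permutation $G$-lattice of rank $r$ on the left-hand side of the (first) displayed isomorphism, and such that $T\times T'$ is $k$-rational. -/

import Mathlib

open scoped TensorProduct

noncomputable section

namespace NormOne

universe u v w w'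

section Construction

variable (k : Type u) (K : Type v) [Field k] [Field K] [Algebra k K] [FiniteDimensional k K]

/-- The generic element `∑ Xᵢ ⊗ bᵢ` of `K`, for a `k`-basis `(bᵢ)` of `K`. -/
def genericElement : MvPolynomial (Fin (Module.finrank k K)) k ⊗[k] K :=
  ∑ i, MvPolynomial.X i ⊗ₜ[k] Module.finBasis k K i

/-- The norm form of `K/k`: the norm of the generic element. -/
def normForm : MvPolynomial (Fin (Module.finrank k K)) k :=
  Algebra.norm (MvPolynomial (Fin (Module.finrank k K)) k) (genericElement k K)

/-- The coordinate ring `k[X₁, …, Xₘ] / (N(X₁, …, Xₘ) - 1)` of the norm one torus of `K/k`. -/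
def CoordRing : Type u :=
  MvPolynomial (Fin (Module.finrank k K)) k ⧸ Ideal.span {normForm k K - 1}

instance : CommRing (CoordRing k K) :=
  inferInstanceAs (CommRing (_ ⧸ Ideal.span {normForm k K - 1}))

instance : Algebra k (CoordRing k K) :=
  inferInstanceAs (Algebra k (_ ⧸ Ideal.span {normForm k K - 1}))

/-- The quotient map `k[X₁, …, Xₘ] → k[X₁, …, Xₘ] / (N - 1)`. -/
def CoordRing.mk : MvPolynomial (Fin (Module.finrank k K)) k →ₐ[k] CoordRing k K :=
  Ideal.Quotient.mkₐ k (Ideal.span {normForm k K - 1})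

/-- The universal element of norm one. -/
def universalPoint : CoordRing k K ⊗[k] K :=
  Algebra.TensorProduct.map (CoordRing.mk k K) (AlgHom.id k K) (genericElement k K)

variable {k}
variable {R : Type w} [CommRing R] [Algebra k R] {S : Type w'} [CommRing S] [Algebra k S]

/-- Base change `R ⊗ K → S ⊗ K` along `f : R → S`. -/
abbrev baseMap (f : R →ₐ[k] S) : R ⊗[k] K →ₐ[k] S ⊗[k] K :=
  Algebra.TensorProduct.map f (AlgHom.id k K)

theorem repr_baseMap (f : R →ₐ[k] S) (z : R ⊗[k] K) (i) :
    (Algebra.TensorProduct.basis S (Module.finBasis k K)).repr (baseMap K f z) i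
      = f ((Algebra.TensorProduct.basis R (Module.finBasis k K)).repr z i) := by
  induction z with
  | zero => simp
  | tmul r y => simp
  | add a b ha hb => simp [ha, hb]

theorem norm_baseMap (f : R →ₐ[k] S) (x : R ⊗[k] K) :
    Algebra.norm S (baseMap K f x) = f (Algebra.norm R x) := by
  classical
  rw [Algebra.norm_eq_matrix_det (Algebra.TensorProduct.basis S (Module.finBasis k K)),
    Algebra.norm_eq_matrix_det (Algebra.TensorProduct.basis R (Module.finBasis k K)),
    AlgHom.map_det]
  congr 1
  ext i j
  rw [AlgHom.mapMatrix_apply, Matrix.map_apply, Algebra.leftMulMatrix_eq_repr_mul,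
    Algebra.leftMulMatrix_eq_repr_mul, ← repr_baseMap, map_mul (baseMap K f)]
  simp

variable {K}

/-- The `R`-points of the norm one torus as elements of `R ⊗ K`. By `norm_pt`, `pt_injective` and
`exists_pt_eq` this is a bijection from `Hom_k(CoordRing k K, R)`, natural in `R`, onto the elements
of norm one, i.e. (such elements being units) onto the kernel of the norm map from
`(R ⊗ K)ˣ = R_{K/k}(𝔾ₘ)(R)` to `Rˣ = 𝔾ₘ(R)`. -/
def pt (f : CoordRing k K →ₐ[k] R) : R ⊗[k] K := baseMap K f (universalPoint k K)

theorem pt_comp (f : CoordRing k K →ₐ[k] R) (g : R →ₐ[k] S) :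
    pt (g.comp f) = baseMap K g (pt f) := by
  simp only [pt, baseMap]
  rw [← AlgHom.comp_apply, ← Algebra.TensorProduct.map_comp]
  rfl

theorem norm_pt (f : CoordRing k K →ₐ[k] R) : Algebra.norm R (pt f) = 1 := by
  have h : Algebra.norm (CoordRing k K) (universalPoint k K) = 1 := by
    rw [universalPoint, norm_baseMap, ← map_one (CoordRing.mk k K)]
    exact Ideal.Quotient.eq.mpr (Ideal.subset_span rfl)
  rw [pt, norm_baseMap, h, map_one]

theorem pt_injective : Function.Injective (pt : (CoordRing k K →ₐ[k] R) → R ⊗[k] K) := by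
  intro f g h
  have h' : f.comp (CoordRing.mk k K) = g.comp (CoordRing.mk k K) := by
    ext i
    have := congrArg
      (fun z => (Algebra.TensorProduct.basis R (Module.finBasis k K)).repr z i) h
    simpa [pt, universalPoint, genericElement, Finsupp.single_apply] using this
  exact Ideal.Quotient.algHom_ext _ h'

theorem exists_pt_eq (x : R ⊗[k] K) (hx : Algebra.norm R x = 1) :
    ∃ f : CoordRing k K →ₐ[k] R, pt f = x := by
  let b := Algebra.TensorProduct.basis R (Module.finBasis k K)
  let φ : MvPolynomial (Fin (Module.finrank k K)) k →ₐ[k] R :=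
    MvPolynomial.aeval fun i => b.repr x i
  have hφ : baseMap K φ (genericElement k K) = x := by
    rw [← b.sum_repr x]
    simp [genericElement, φ, b, TensorProduct.smul_tmul']
  have hker : ∀ a ∈ Ideal.span {normForm k K - 1}, φ a = 0 := by
    have : Ideal.span {normForm k K - 1} ≤ RingHom.ker φ := by
      rw [Ideal.span_le, Set.singleton_subset_iff, SetLike.mem_coe, RingHom.mem_ker,
        map_sub, map_one, normForm, ← norm_baseMap, hφ, hx, sub_self]
    exact fun a ha => this ha
  let ψ : CoordRing k K →ₐ[k] R := Ideal.Quotient.liftₐ _ φ hker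
  have hψ : ψ.comp (CoordRing.mk k K) = φ := Ideal.Quotient.liftₐ_comp _ φ hker
  refine ⟨ψ, ?_⟩
  rw [← hφ, ← hψ, pt, universalPoint]
  simp only [baseMap]
  rw [← AlgHom.comp_apply, ← Algebra.TensorProduct.map_comp]
  rfl

/-- The `R`-point that belongs to an element of norm one in `R ⊗ K`. -/
def ofPt (x : R ⊗[k] K) (hx : Algebra.norm R x = 1) : CoordRing k K →ₐ[k] R :=
  (exists_pt_eq x hx).choose

theorem pt_ofPt (x : R ⊗[k] K) (hx : Algebra.norm R x = 1) : pt (ofPt x hx) = x :=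
  (exists_pt_eq x hx).choose_spec

variable (k K)

/-- The comultiplication: the product of the two projections in the group of points. -/
def comulHom : CoordRing k K →ₐ[k] CoordRing k K ⊗[k] CoordRing k K :=
  ofPt (pt Algebra.TensorProduct.includeLeft * pt Algebra.TensorProduct.includeRight)
    (by rw [map_mul, norm_pt, norm_pt, mul_one])

/-- The counit: the neutral element of the group of `k`-points. -/
def counitHom : CoordRing k K →ₐ[k] k := ofPt 1 (map_one _)

theorem exists_inv : ∃ y : CoordRing k K ⊗[k] K, pt (AlgHom.id k (CoordRing k K)) * y = 1 := by
  have h : IsUnit (LinearMap.det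
      (Algebra.lmul (CoordRing k K) _ (pt (AlgHom.id k (CoordRing k K))))) := by
    rw [← Algebra.norm_apply, norm_pt]
    exact isUnit_one
  exact ((Module.End.isUnit_iff _).mp
    (LinearMap.isUnit_iff_isUnit_det _ |>.mpr h)).surjective 1

theorem norm_inv : Algebra.norm (CoordRing k K) (exists_inv k K).choose = 1 := by
  have h := congrArg (Algebra.norm (CoordRing k K)) (exists_inv k K).choose_spec
  rwa [map_mul, norm_pt, one_mul, map_one] at h

/-- The antipode: the inverse of the universal point. -/
def antipodeHom : CoordRing k K →ₐ[k] CoordRing k K := ofPt (exists_inv k K).choose (norm_inv k K)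

theorem pt_comul_comp (f : CoordRing k K ⊗[k] CoordRing k K →ₐ[k] R) :
    pt (f.comp (comulHom k K)) = pt (f.comp Algebra.TensorProduct.includeLeft) *
      pt (f.comp Algebra.TensorProduct.includeRight) := by
  rw [pt_comp, comulHom, pt_ofPt, map_mul, ← pt_comp, ← pt_comp]

theorem pt_counit_comp (f : k →ₐ[k] R) : pt (f.comp (counitHom k K)) = 1 := by
  rw [pt_comp, counitHom, pt_ofPt, map_one]

open Algebra.TensorProduct in
theorem coassoc_aux {A : Type u} [CommRing A] [Algebra k A] (Δ : A →ₐ[k] A ⊗[k] A) :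
    ((Algebra.TensorProduct.assoc k k k A A A).toAlgHom.comp (map Δ (.id k A))).comp includeLeft =
      ((Algebra.TensorProduct.assoc k k k A A A).toAlgHom.comp includeLeft).comp Δ := by
  ext x
  simp

open Algebra.TensorProduct in
instance : Bialgebra k (CoordRing k K) :=
  Bialgebra.ofAlgHom (comulHom k K) (counitHom k K)
    (by
      apply pt_injective
      have h1 : ((map (.id k (CoordRing k K)) (comulHom k K)).comp includeRight) =
          (includeRight : _ →ₐ[k] CoordRing k K ⊗[k] (CoordRing k K ⊗[k] CoordRing k K)).comp
            (comulHom k K) := by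
        ext x
        simp
      have h2 : (map (.id k (CoordRing k K)) (comulHom k K)).comp includeLeft = includeLeft := by
        ext x
        simp
      have h3 : ((Algebra.TensorProduct.assoc k k k (CoordRing k K) (CoordRing k K)
          (CoordRing k K)).toAlgHom.comp includeLeft).comp includeLeft = includeLeft := by
        ext x
        simp [Algebra.TensorProduct.one_def]
      have h4 : ((Algebra.TensorProduct.assoc k k k (CoordRing k K) (CoordRing k K)
          (CoordRing k K)).toAlgHom.comp includeLeft).comp includeRight =
            includeRight.comp includeLeft := by
        ext x
        simp
      have h5 : ((Algebra.TensorProduct.assoc k k k (CoordRing k K) (CoordRing k K)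
          (CoordRing k K)).toAlgHom.comp (map (comulHom k K) (.id k _))).comp includeRight =
            includeRight.comp includeRight := by
        ext x
        simp [Algebra.TensorProduct.one_def]
      rw [← AlgHom.comp_assoc, pt_comul_comp, pt_comul_comp, coassoc_aux, pt_comul_comp,
        h1, h2, h3, h4, h5, pt_comul_comp, mul_assoc])
    (by
      apply pt_injective
      have h1 : (map (counitHom k K) (.id k (CoordRing k K))).comp includeLeft =
          (includeLeft : k →ₐ[k] k ⊗[k] CoordRing k K).comp (counitHom k K) := by
        ext x
        simp
      have h2 : (map (counitHom k K) (.id k (CoordRing k K))).comp includeRight =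
          ((Algebra.TensorProduct.lid k (CoordRing k K)).symm : _ →ₐ[k] _) := by
        ext x
        simp
      rw [pt_comul_comp, h1, h2, pt_counit_comp, one_mul])
    (by
      apply pt_injective
      have h1 : (map (.id k (CoordRing k K)) (counitHom k K)).comp includeRight =
          (includeRight : k →ₐ[k] CoordRing k K ⊗[k] k).comp (counitHom k K) := by
        ext x
        simp
      have h2 : (map (.id k (CoordRing k K)) (counitHom k K)).comp includeLeft =
          ((Algebra.TensorProduct.rid k k (CoordRing k K)).symm : _ →ₐ[k] _) := by
        ext x
        simp
      rw [pt_comul_comp, h1, h2, pt_counit_comp, mul_one])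

theorem pt_antipode : pt (AlgHom.id k (CoordRing k K)) * pt (antipodeHom k K) = 1 := by
  rw [antipodeHom, pt_ofPt]
  exact (exists_inv k K).choose_spec

/-- The group law on `R`-points that comes from `comulHom` is the multiplication of `R ⊗ K`. -/
theorem pt_mul (f g : CoordRing k K →ₐ[k] R) :
    pt ((Algebra.TensorProduct.lift f g fun _ _ => Commute.all _ _).comp (comulHom k K)) =
      pt f * pt g := by
  rw [pt_comul_comp, Algebra.TensorProduct.lift_comp_includeLeft,
    Algebra.TensorProduct.lift_comp_includeRight']

/-- The group scheme structure of the norm one torus, the one for which `pt` is multiplicative. -/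
instance : HopfAlgebra k (CoordRing k K) :=
  HopfAlgebra.ofAlgHom (antipodeHom k K)
    (by
      apply pt_injective
      refine (pt_comul_comp k K _).trans ((?_ : _ = (1 : CoordRing k K ⊗[k] K)).trans
        (pt_counit_comp k K (Algebra.ofId k (CoordRing k K))).symm)
      refine (congrArg₂ (fun f g => pt f * pt g) (Algebra.TensorProduct.lift_comp_includeLeft _ _ _)
        (Algebra.TensorProduct.lift_comp_includeRight' _ _ _)).trans ?_
      rw [mul_comm, pt_antipode])
    (by
      apply pt_injective
      refine (pt_comul_comp k K _).trans ((?_ : _ = (1 : CoordRing k K ⊗[k] K)).trans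
        (pt_counit_comp k K (Algebra.ofId k (CoordRing k K))).symm)
      exact (congrArg₂ (fun f g => pt f * pt g) (Algebra.TensorProduct.lift_comp_includeLeft _ _ _)
        (Algebra.TensorProduct.lift_comp_includeRight' _ _ _)).trans (pt_antipode k K))

end Construction

section Lattices

variable {G : Type*} [Group G]

/-- `M` is a permutation `G`-lattice: it has a finite `ℤ`-basis permuted by `G`. -/
def IsPermutationLattice {M : Type*} [AddCommGroup M] (ρ : Representation ℤ G M) : Prop :=
  ∃ (n : ℕ) (b : Module.Basis (Fin n) ℤ M), ∀ g i, ∃ j, ρ g (b i) = b j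

/-- `M` is stably permutation: `M ⊕ P ≃ P'` for some permutation `G`-lattices `P` and `P'`. -/
def IsStablyPermutation {M : Type*} [AddCommGroup M] (ρ : Representation ℤ G M) : Prop :=
  ∃ (m n : ℕ) (σ : Representation ℤ G (Fin m → ℤ)) (τ : Representation ℤ G (Fin n → ℤ)),
    IsPermutationLattice σ ∧ IsPermutationLattice τ ∧ Nonempty ((ρ.prod σ).Equiv τ)

/-- `M` is flabby: the Tate cohomology group `Ĥ⁻¹(S, M)`, the kernel of the norm of `S` modulo the
span of the elements `s • w - w`, vanishes for all subgroups `S` of the finite group `G`. -/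
def IsFlabby [Finite G] {M : Type*} [AddCommGroup M] (ρ : Representation ℤ G M) : Prop :=
  ∀ (S : Subgroup G) (v : M), ∑ᶠ s : S, ρ s v = 0 →
    v ∈ Submodule.span ℤ {x | ∃ (s : S) (w : M), x = ρ s w - w}

/-- The `G`-lattice `F` represents the flabby class `[M]^{fl}`: there is a flabby resolution, i.e.
a short exact sequence `0 → M → P → F → 0` of `G`-lattices with `P` permutation and `F` flabby. -/
def IsFlabbyClassOf [Finite G] {M F : Type*} [AddCommGroup M] [AddCommGroup F]
    (ρM : Representation ℤ G M) (ρF : Representation ℤ G F) : Prop :=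
  Module.Free ℤ F ∧ Module.Finite ℤ F ∧ IsFlabby ρF ∧
    ∃ (n : ℕ) (ρP : Representation ℤ G (Fin n → ℤ))
      (i : ρM.IntertwiningMap ρP) (p : ρP.IntertwiningMap ρF),
      IsPermutationLattice ρP ∧
        Function.Injective i ∧ Function.Exact i p ∧ Function.Surjective p

/-- The permutation `G`-lattice `ℤ[G/H]`. -/
abbrev cosetLattice (H : Subgroup G) : Representation ℤ G (MonoidAlgebra ℤ (G ⧸ H)) :=
  Representation.ofMulAction ℤ G (G ⧸ H)

/-- The augmentation map `ε : ℤ[G/H] → ℤ`, the sum of the coefficients. -/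
def augmentation (H : Subgroup G) :
    (cosetLattice H).IntertwiningMap (Representation.trivial ℤ G ℤ) where
  toLinearMap := Finsupp.linearCombination ℤ (fun _ : G ⧸ H => (1 : ℤ)) ∘ₗ
    (MonoidAlgebra.coeffLinearEquiv ℤ).toLinearMap
  isIntertwining' g := by
    ext x
    simp

/-- The Chevalley module `J_{G/H}`, the dual lattice of `I_{G/H} = Ker ε`. -/
abbrev chevalley (H : Subgroup G) :
    Representation ℤ G (Module.Dual ℤ (augmentation H).ker.toSubmodule) :=
  (augmentation H).ker.toRepresentation.dual

/-- The trivial `G`-lattice `ℤ`. -/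
abbrev trivialLattice (G : Type*) [Group G] : Representation ℤ G ℤ :=
  Representation.trivial ℤ G ℤ

/-- The rank over `ℤ` of the underlying module of `ρ`. -/
abbrev latticeRank {M : Type*} [AddCommGroup M] (_ : Representation ℤ G M) : ℕ :=
  Module.finrank ℤ M

end Lattices

section Tori

variable (k : Type u) [Field k] (L : Type v) [Field L] [Algebra k L]

/-- `Spec A` is an `n`-dimensional algebraic `k`-torus which splits over `L`. -/
def IsTorusSplitBy (A : Type w) [CommRing A] [HopfAlgebra k A] (n : ℕ) : Prop :=
  Nonempty (L ⊗[k] A ≃ₐc[L] AddMonoidAlgebra L (Fin n → ℤ))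

/-- The character module of `T = Spec A` over `L` is isomorphic to the lattice `M` as a
`Gal(L/k)`-module. Characters `T_L → 𝔾ₘ` are the group-like elements of `L ⊗ A`, and `σ` acts on
them through `σ ⊗ id`. -/
def HasCharacterLattice (A : Type w) [CommRing A] [HopfAlgebra k A]
    {M : Type*} [AddCommGroup M] (ρ : Representation ℤ Gal(L/k) M) : Prop :=
  ∃ e : Multiplicative M ≃* GroupLike L (L ⊗[k] A),
    ∀ (σ : Gal(L/k)) (m : M), (e (Multiplicative.ofAdd (ρ σ m))).val =
      Algebra.TensorProduct.map (σ : L →ₐ[k] L) (AlgHom.id k A)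
        (e (Multiplicative.ofAdd m)).val

/-- The integral `k`-variety `Spec A` is `k`-rational: its function field is isomorphic over `k` to
a rational function field `k(x₁, …, xₙ)`. -/
def IsRational (A : Type w) [CommRing A] [Algebra k A] : Prop :=
  IsDomain A ∧
    ∃ n : ℕ, Nonempty (FractionRing A ≃ₐ[k] FractionRing (MvPolynomial (Fin n) k))

/-- The integral `k`-variety `Spec A` with function field `E` is stably `k`-rational: the field
`E(y₁, …, yₘ)` is isomorphic over `k` to some `k(x₁, …, xₙ)`. -/
def IsStablyRational (A : Type w) [CommRing A] [Algebra k A] : Prop :=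
  IsDomain A ∧
    ∃ m n : ℕ, Nonempty (FractionRing (MvPolynomial (Fin m) (FractionRing A)) ≃ₐ[k]
      FractionRing (MvPolynomial (Fin n) k))

/-- There is a rational `k`-torus `T'` of dimension `r` with character lattice `ρ` such that
`T × T'` is `k`-rational, where `T = Spec A`. -/
def HasRationalComplement (A : Type u) [CommRing A] [HopfAlgebra k A]
    {M : Type*} [AddCommGroup M] (ρ : Representation ℤ Gal(L/k) M) (r : ℕ) : Prop :=
  ∃ (B : Type u) (_ : CommRing B) (_ : HopfAlgebra k B),
    IsTorusSplitBy k L B r ∧ HasCharacterLattice k L B ρ ∧ IsRational k B ∧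
      IsRational k (A ⊗[k] B)

end Tori

/-- `S ≃ Cₙ`. -/
abbrev IsC (n : ℕ) (S : Type*) [Group S] : Prop := Nonempty (S ≃* Multiplicative (ZMod n))

/-- `S ≃ Dₙ`, the dihedral group of order `2n`. -/
abbrev IsD (n : ℕ) (S : Type*) [Group S] : Prop := Nonempty (S ≃* DihedralGroup n)

/-- `S ≃ Sₙ`. -/
abbrev IsS (n : ℕ) (S : Type*) [Group S] : Prop := Nonempty (S ≃* Equiv.Perm (Fin n))

/-- `S ≃ Aₙ`. -/
abbrev IsA (n : ℕ) (S : Type*) [Group S] : Prop := Nonempty (S ≃* alternatingGroup (Fin n))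

/-- `S ≃ (C₂)ⁿ`. -/
abbrev IsE (n : ℕ) (S : Type*) [Group S] : Prop :=
  Nonempty (S ≃* Multiplicative (Fin n → ZMod 2))

/-- `S ≃ (C₂)³ ⋊ C₇` (for some action of `C₇` on `(C₂)³`). -/
abbrev IsE8C7 (S : Type*) [Group S] : Prop :=
  ∃ φ : Multiplicative (ZMod 7) →* MulAut (Multiplicative (Fin 3 → ZMod 2)),
    Nonempty (S ≃* Multiplicative (Fin 3 → ZMod 2) ⋊[φ] Multiplicative (ZMod 7))

/-- `S ≃ PSL₂(𝔽₈)`. -/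
abbrev IsPSL28 (S : Type*) [Group S] : Prop :=
  Nonempty (S ≃* Matrix.ProjectiveSpecialLinearGroup (Fin 2) (GaloisField 2 3))

end NormOne

end

open NormOne

/-!
The theorem has a geometric part, the same for all cases, and a part on lattices, which is a finite
computation in each case.

**Tori.** A torus over `k` that splits over `L` with character lattice `M` has the coordinate ring
`L[M]^G`, for the semilinear action of `G = Gal(L/k)` on the group algebra `L[M]`, and the function
field `L(M)^G` (`IsDescent`, `IsFormOf`, `IsTorusOf`). For the norm one torus, `L ⊗ K` splits into
copies of `L` indexed by `G/H`, and the coordinates of the universal point are group-like elements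
that generate `L ⊗ CoordRing k K` with the one relation that their product is one; so
`M = J_{G/H}` (`isTorusOf_coordRing`). Conversely, every `G`-lattice belongs to a torus, by Galois
descent for the Hopf algebra `L[M]` (`exists_torus`). If `0 → M → N → Q → 0` is exact with a
permutation lattice `Q`, the monomials that belong to a basis of `Q` span a `G`-stable `L(M)`-space,
which has a basis of invariants; these generate `L(N)^G` as a purely transcendental extension of
`L(M)^G`. This is the no-name lemma, `fixedField_equiv` and `IsFormOf.fractionRing_equiv`. If
`0 → J_{G/H} → P → F → 0` is a flabby resolution and `σ ⊕ F ≃ ρ` with permutation lattices `ρ` and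
`σ`, then `J_{G/H} ⊕ ρ` and `P ⊕ σ` are both extensions of `ρ` by `J_{G/H}`, so that the product of
the norm one torus with the torus of `ρ` has the same function field as the torus of `P ⊕ σ`. The
latter is rational, by the same lemma with `M = 0` (`IsFormOf.rational_of_flabbyClass`,
`rational_of_equiv`).

**Lattices.** Let `π` be a map from a permutation lattice `ℤ[P]` onto the augmentation ideal
`I_{G/H}`. Its dual embeds `J_{G/H}` into `ℤ[P]`. If a map `f : ℤ[P] → ℤ[Q]` vanishes on the image,
and if there is a map `f₀ : ℤ[Q₀] → ℤ[Q]` such that `(f, f₀)` is onto and the ranks fit, then the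
cokernel `F` of the embedding is isomorphic to the image of `f`, and `F ⊕ ℤ[Q₀] ≃ ℤ[Q]`. In the
cases with the group `PSL₂(𝔽₈)`, `(f, f₀)` is not onto, but its cokernel is also the cokernel of an
injective endomorphism `w` of some `ℤ[Y]`, and as in Schanuel's lemma
`F ⊕ ℤ[Q₀] ⊕ ℤ[Y] ≃ ℤ[Q] ⊕ ℤ[Y]` (`exists_flabbyClass`). As a direct summand of a permutation
lattice, `F` is flabby.

The groups `S₃`, `A₅` and `PSL₂(𝔽₈)` are the groups `PSL₂(𝔽_q)` for `q = 2, 4, 8`; they act on the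
`q + 1` points of the projective line, and the `G`-sets in question are made of points, pairs of
points, triples of points, and elements of order `q + 1`. A `Certificate` gives the maps and the
solutions of the necessary equations at one point of each orbit. That these are correct is decided
by computation in the kernel (`Certificate.Holds`, `certificate₁_holds` and the following ones): a
group element is the number with the images of the points as its hexadecimal digits, a coset of a
subgroup is recognized by a numerical invariant, and a linear combination of cosets is collected in
a binary trie (`IsCoding`, `IsCosetKey`, `vanishes`). `Certificate.Holds.exists_equiv` is the
result.

**Subgroups.** The certificates are about particular subgroups. By Sylow's theorem all subgroups of
the types in the theorem are conjugate to these: each of them is a Sylow subgroup, or the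
normalizer of a Sylow subgroup, or a subgroup of a cyclic Sylow subgroup, or generated by a subgroup
of the latter kind and an involution (`IsCoding.areConj_of_card`, `IsCoding.areConj`,
`areConj_of_isCyclic`, `areConj_of_involution`).
-/

open scoped TensorProduct

noncomputable section

namespace NormOne

universe u v w w'

/-! ### Galois descent and the no-name lemma -/

section Descent

variable {G : Type*} [Group G] [Finite G] {E : Type*} [Field E] [MulSemiringAction G E]
  [FaithfulSMul G E]

/-- A subspace that is stable under a semilinear action is spanned by its fixed vectors: a linear
form that vanishes on all traces `∑ g • (a • v)` vanishes at `v`, as the automorphisms `g` are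
linearly independent. -/
theorem le_span_fixed {W : Type*} [AddCommGroup W] [Module E W] [DistribMulAction G W]
    (hW : ∀ (g : G) (c : E) (w : W), g • (c • w) = (g • c) • (g • w))
    (V : Submodule E W) (hV : ∀ (g : G), ∀ v ∈ V, g • v ∈ V) :
    V ≤ Submodule.span E {v | v ∈ V ∧ ∀ g : G, g • v = v} := by
  classical
  have := Fintype.ofFinite G
  intro v hv
  by_contra hnot
  obtain ⟨f, hf, hle⟩ := Submodule.exists_le_ker_of_notMem hnot
  -- `f` vanishes on the fixed vector `∑ g • (a • v)`.
  have htr : ∀ a : E, ∑ g : G, f (g • v) * (g • a) = 0 := by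
    intro a
    have hmem : ∑ g : G, g • (a • v) ∈
        Submodule.span E {v | v ∈ V ∧ ∀ g : G, g • v = v} := by
      refine Submodule.subset_span ⟨V.sum_mem fun g _ => hV g _ (V.smul_mem a hv), fun h => ?_⟩
      rw [Finset.smul_sum]
      exact Fintype.sum_equiv (Equiv.mulLeft h) _ _ fun g => by simp [mul_smul]
    have h0 := hle hmem
    rw [LinearMap.mem_ker, map_sum] at h0
    rw [← h0]
    exact Finset.sum_congr rfl fun g _ => by rw [hW, f.map_smul, smul_eq_mul, mul_comm]
  -- Dedekind: the automorphisms of `E` given by `G` are linearly independent.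
  have hind : LinearIndependent E
      (fun g : G => ((MulSemiringAction.toRingHom G E g : E →* E) : E → E)) := by
    refine (linearIndependent_monoidHom E E).comp
      (fun g : G => (MulSemiringAction.toRingHom G E g : E →* E)) ?_
    intro g h hgh
    exact FaithfulSMul.eq_of_smul_eq_smul fun a : E => DFunLike.congr_fun hgh a
  have h1 := Fintype.linearIndependent_iff.mp hind (fun g => f (g • v)) (by
    ext a
    simpa using htr a) 1
  rw [one_smul] at h1
  exact hf h1

/-- A finite-dimensional subspace stable under a semilinear action has a basis of fixed vectors. -/
theorem exists_fixed_basis {W : Type*} [AddCommGroup W] [Module E W] [DistribMulAction G W]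
    (hW : ∀ (g : G) (c : E) (w : W), g • (c • w) = (g • c) • (g • w))
    {r : ℕ} (y : Fin r → W) (hy : LinearIndependent E y)
    (hV : ∀ (g : G) (i : Fin r), g • y i ∈ Submodule.span E (Set.range y)) :
    ∃ z : Fin r → W, (∀ (g : G) i, g • z i = z i) ∧ LinearIndependent E z ∧
      Submodule.span E (Set.range z) = Submodule.span E (Set.range y) := by
  set V := Submodule.span E (Set.range y) with hVdef
  have hV' : ∀ (g : G), ∀ v ∈ V, g • v ∈ V := by
    intro g v hv
    induction hv using Submodule.span_induction with
    | mem x hx => obtain ⟨i, rfl⟩ := hx; exact hV g i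
    | zero => rw [smul_zero]; exact V.zero_mem
    | add a b _ _ ha hb => rw [smul_add]; exact V.add_mem ha hb
    | smul c a _ ha => rw [hW]; exact V.smul_mem _ ha
  set S := {v | v ∈ V ∧ ∀ g : G, g • v = v}
  have hS : Submodule.span E S = V :=
    le_antisymm (Submodule.span_le.mpr fun v hv => hv.1) (le_span_fixed hW V hV')
  obtain ⟨b, hbS, hbspan, hbind⟩ := exists_linearIndependent E S
  have hfin : FiniteDimensional E V := FiniteDimensional.span_of_finite E (Set.finite_range y)
  have hrank : Module.finrank E V = r := by
    rw [hVdef, finrank_span_eq_card hy, Fintype.card_fin]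
  have hspan : Submodule.span E (Set.range ((↑) : b → W)) = V := by
    rw [Subtype.range_coe, hbspan, hS]
  let B : Module.Basis b E V := (Module.Basis.span hbind).map (LinearEquiv.ofEq _ _ hspan)
  have : Fintype b := Module.Basis.fintypeIndexOfRankLtAleph0 B (Module.rank_lt_aleph0 E V)
  have hcard : Fintype.card b = r := by rw [← Module.finrank_eq_card_basis B, hrank]
  let e : Fin r ≃ b := (Fintype.equivFinOfCardEq hcard).symm
  refine ⟨fun i => (e i : W), fun g i => (hbS (e i).2).2 g, hbind.comp e e.injective, ?_⟩
  rw [← hspan]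
  congr 1
  ext w
  constructor
  · rintro ⟨i, rfl⟩; exact ⟨e i, rfl⟩
  · rintro ⟨i, rfl⟩; exact ⟨e.symm i, by simp⟩

end Descent

section NoName

variable {G : Type*} [Group G] {E Ω : Type*} [Field E] [Field Ω] [Algebra E Ω]
  [MulSemiringAction G E] [MulSemiringAction G Ω]

/-- Algebraic independence is invariant under an invertible linear substitution. -/
theorem algebraicIndependent_of_span_eq {r : ℕ} {y z : Fin r → Ω} (hy : AlgebraicIndependent E y)
    (hz : LinearIndependent E z)
    (h : Submodule.span E (Set.range z) = Submodule.span E (Set.range y)) :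
    AlgebraicIndependent E z := by
  classical
  have hz' : ∀ j, ∃ c : Fin r → E, ∑ i, c i • y i = z j := fun j =>
    (Submodule.mem_span_range_iff_exists_fun E).mp (h ▸ Submodule.subset_span ⟨j, rfl⟩)
  have hy' : ∀ j, ∃ c : Fin r → E, ∑ i, c i • z i = y j := fun j =>
    (Submodule.mem_span_range_iff_exists_fun E).mp (h ▸ Submodule.subset_span ⟨j, rfl⟩)
  choose B hB using hz'
  choose A hA using hy'
  have hBA : ∀ j l, ∑ i, B j i * A i l = if j = l then 1 else 0 := by
    intro j
    have h1 : ∑ l, (∑ i, B j i * A i l - if j = l then 1 else 0) • z l = 0 := by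
      simp only [sub_smul, Finset.sum_sub_distrib, ite_smul, one_smul, zero_smul,
        Finset.sum_ite_eq, Finset.mem_univ, if_true, sub_eq_zero]
      rw [← hB j]
      simp only [← hA, Finset.smul_sum, Finset.sum_smul, smul_smul]
      exact Finset.sum_comm
    intro l
    exact sub_eq_zero.mp (Fintype.linearIndependent_iff.mp hz _ h1 l)
  let sB : MvPolynomial (Fin r) E →ₐ[E] MvPolynomial (Fin r) E :=
    MvPolynomial.aeval fun j => ∑ i, B j i • MvPolynomial.X i
  let sA : MvPolynomial (Fin r) E →ₐ[E] MvPolynomial (Fin r) E :=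
    MvPolynomial.aeval fun j => ∑ i, A j i • MvPolynomial.X i
  have h1 : (MvPolynomial.aeval z : MvPolynomial (Fin r) E →ₐ[E] Ω) =
      (MvPolynomial.aeval y).comp sB := by
    ext j
    simp [sB, hB]
  have h2 : sA.comp sB = AlgHom.id E _ := by
    ext1 j
    simp only [AlgHom.comp_apply, AlgHom.id_apply, sB, sA, MvPolynomial.aeval_X, map_sum, map_smul,
      Finset.smul_sum, smul_smul]
    rw [Finset.sum_comm]
    simp only [← Finset.sum_smul, hBA, ite_smul, one_smul, zero_smul, Finset.sum_ite_eq,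
      Finset.mem_univ, if_true]
  intro p q hpq
  have h3 : sB p = sB q := hy (by
    have := hpq
    rw [h1] at this
    exact this)
  have h4 := congrArg sA h3
  rwa [← AlgHom.comp_apply, ← AlgHom.comp_apply, h2] at h4

/-- The action of `g` on the coefficients of a polynomial. -/
theorem smul_aeval (hc : ∀ (g : G) (c : E), g • algebraMap E Ω c = algebraMap E Ω (g • c))
    {r : ℕ} {z : Fin r → Ω} (hz : ∀ (g : G) i, g • z i = z i) (g : G)
    (p : MvPolynomial (Fin r) E) :
    g • MvPolynomial.aeval z p =
      MvPolynomial.aeval z (MvPolynomial.map (MulSemiringAction.toRingHom G E g) p) := by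
  induction p using MvPolynomial.induction_on with
  | C a => simp [hc]
  | add p q hp hq => simp [smul_add, hp, hq]
  | mul_X p i hp => simp [smul_mul', hp, hz]

variable [Finite G] [FaithfulSMul G E]

/-- If `Ω` is generated as a field over `E` by algebraically independent elements whose `E`-span
is stable under `G`, then it is also generated by algebraically independent elements that `G`
fixes, and a fixed element is a quotient of two polynomials in these whose coefficients are
fixed. -/
theorem exists_fixed_parameters
    (hc : ∀ (g : G) (c : E), g • algebraMap E Ω c = algebraMap E Ω (g • c))
    {r : ℕ} (y : Fin r → Ω) (hy : AlgebraicIndependent E y)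
    (hgen : ∀ ω : Ω, ∃ p q : MvPolynomial (Fin r) E, MvPolynomial.aeval y q ≠ 0 ∧
      ω * MvPolynomial.aeval y q = MvPolynomial.aeval y p)
    (hV : ∀ (g : G) (i : Fin r), g • y i ∈ Submodule.span E (Set.range y)) :
    ∃ z : Fin r → Ω, (∀ (g : G) i, g • z i = z i) ∧ AlgebraicIndependent E z ∧
      ∀ ω : Ω, (∀ g : G, g • ω = ω) → ∃ p q : MvPolynomial (Fin r) E,
        (∀ g : G, MvPolynomial.map (MulSemiringAction.toRingHom G E g) p = p) ∧
        (∀ g : G, MvPolynomial.map (MulSemiringAction.toRingHom G E g) q = q) ∧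
        MvPolynomial.aeval z q ≠ 0 ∧ ω * MvPolynomial.aeval z q = MvPolynomial.aeval z p := by
  classical
  have := Fintype.ofFinite G
  obtain ⟨z, hz, hzind, hspan⟩ := exists_fixed_basis (G := G)
    (fun g c w => by rw [Algebra.smul_def, Algebra.smul_def, smul_mul', hc]) y
    hy.linearIndependent hV
  have hzalg := algebraicIndependent_of_span_eq hy hzind hspan
  refine ⟨z, hz, hzalg, fun ω hω => ?_⟩
  have hsub : ∀ p : MvPolynomial (Fin r) E, ∃ p' : MvPolynomial (Fin r) E,
      MvPolynomial.aeval z p' = MvPolynomial.aeval y p := by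
    intro p
    have hle : Algebra.adjoin E (Set.range y) ≤ Algebra.adjoin E (Set.range z) := by
      refine Algebra.adjoin_le ?_
      rintro _ ⟨i, rfl⟩
      have : y i ∈ Submodule.span E (Set.range z) := hspan ▸ Submodule.subset_span ⟨i, rfl⟩
      exact Algebra.span_le_adjoin E _ this
    have : (MvPolynomial.aeval y p : Ω) ∈ Algebra.adjoin E (Set.range z) := by
      refine hle ?_
      rw [Algebra.adjoin_range_eq_range_aeval]
      exact ⟨p, rfl⟩
    rw [Algebra.adjoin_range_eq_range_aeval] at this
    exact this
  obtain ⟨p0, q0, hq0, h0⟩ := hgen ω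
  obtain ⟨p1, hp1⟩ := hsub p0
  obtain ⟨q1, hq1⟩ := hsub q0
  rw [← hq1] at hq0 h0
  rw [← hp1] at h0
  -- Make the denominator invariant: replace it by the product of its conjugates.
  let act (g : G) := MvPolynomial.map (σ := Fin r) (MulSemiringAction.toRingHom G E g)
  have hact : ∀ (g h : G) (s : MvPolynomial (Fin r) E), act g (act h s) = act (g * h) s := by
    intro g h s
    have : (MulSemiringAction.toRingHom G E g).comp (MulSemiringAction.toRingHom G E h) =
        MulSemiringAction.toRingHom G E (g * h) := by
      ext c
      simp [mul_smul]
    simp only [act, MvPolynomial.map_map, this]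
  let q : MvPolynomial (Fin r) E := ∏ g : G, act g q1
  have hq : ∀ g : G, act g q = q := by
    intro g
    simp only [q, map_prod, hact]
    exact Fintype.prod_equiv (Equiv.mulLeft g) _ _ fun _ => rfl
  let s : MvPolynomial (Fin r) E := ∏ g ∈ Finset.univ.erase (1 : G), act g q1
  have hqs : q = q1 * s := by
    simp only [q, s]
    rw [← Finset.mul_prod_erase Finset.univ (fun g => act g q1) (Finset.mem_univ 1)]
    congr 1
    simp only [act]
    convert MvPolynomial.map_id q1
    ext c
    simp
  have hωq : ω * MvPolynomial.aeval z q = MvPolynomial.aeval z (p1 * s) := by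
    rw [hqs, map_mul, map_mul, ← mul_assoc, h0]
  refine ⟨p1 * s, q, fun g => ?_, hq, ?_, hωq⟩
  · apply hzalg
    rw [← smul_aeval hc hz, ← hωq, smul_mul', hω, smul_aeval hc hz]
    congr 2
    exact hq g
  · simp only [q, map_prod]
    refine Finset.prod_ne_zero_iff.mpr fun g _ => ?_
    rw [← smul_aeval hc hz]
    exact (smul_ne_zero_iff_ne g).mpr hq0

/-- The no-name lemma: if `Ω` is generated as a field over `E` by algebraically independent
elements whose `E`-span is stable under `G`, then the fixed field of `Ω` is purely transcendental
over the fixed field of `E`. -/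
theorem fixedField_equiv
    {k : Type*} [Field k] [Algebra k E] [Algebra k Ω] [IsScalarTower k E Ω]
    {E₀ Ω₀ : Type*} [Field E₀] [Field Ω₀] [Algebra k E₀] [Algebra k Ω₀]
    (i : E₀ →ₐ[k] E) (hi : ∀ c : E, (∀ g : G, g • c = c) ↔ c ∈ Set.range i)
    (j : Ω₀ →ₐ[k] Ω) (hj : ∀ c : Ω, (∀ g : G, g • c = c) ↔ c ∈ Set.range j)
    (hc : ∀ (g : G) (c : E), g • algebraMap E Ω c = algebraMap E Ω (g • c))
    {r : ℕ} (y : Fin r → Ω) (hy : AlgebraicIndependent E y)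
    (hgen : ∀ ω : Ω, ∃ p q : MvPolynomial (Fin r) E, MvPolynomial.aeval y q ≠ 0 ∧
      ω * MvPolynomial.aeval y q = MvPolynomial.aeval y p)
    (hV : ∀ (g : G) (i : Fin r), g • y i ∈ Submodule.span E (Set.range y)) :
    Nonempty (FractionRing (MvPolynomial (Fin r) E₀) ≃ₐ[k] Ω₀) := by
  obtain ⟨z, hz, hzalg, hfix⟩ := exists_fixed_parameters (G := G) hc y hy hgen hV
  let φ : MvPolynomial (Fin r) E₀ →ₐ[k] Ω :=
    ((MvPolynomial.aeval z : MvPolynomial (Fin r) E →ₐ[E] Ω).restrictScalars k).comp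
      (MvPolynomial.mapAlgHom i)
  have hφinj : Function.Injective φ := by
    refine Function.Injective.comp (g := (MvPolynomial.aeval z : MvPolynomial (Fin r) E →ₐ[E] Ω))
      hzalg ?_
    exact MvPolynomial.map_injective (i : E₀ →+* E) i.toRingHom.injective
  have hmap : ∀ p : MvPolynomial (Fin r) E,
      (∀ g : G, MvPolynomial.map (MulSemiringAction.toRingHom G E g) p = p) →
      ∃ p₀, MvPolynomial.mapAlgHom (σ := Fin r) i p₀ = p := by
    intro p hp
    have : p ∈ Set.range (MvPolynomial.map (σ := Fin r) (i : E₀ →+* E)) := by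
      rw [MvPolynomial.mem_range_map_iff_coeffs_subset]
      intro c hcp
      obtain ⟨m, hm, rfl⟩ := MvPolynomial.mem_coeffs_iff.mp hcp
      have := (hi (p.coeff m)).mp fun g => by
        have := congrArg (MvPolynomial.coeff m) (hp g)
        rwa [MvPolynomial.coeff_map] at this
      exact this
    exact this
  have hφfix : ∀ p (g : G), g • φ p = φ p := by
    intro p g
    change g • MvPolynomial.aeval z _ = MvPolynomial.aeval z _
    rw [smul_aeval hc hz]
    congr 1
    change MvPolynomial.map _ (MvPolynomial.map _ p) = _
    rw [MvPolynomial.map_map]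
    have : (MulSemiringAction.toRingHom G E g).comp (i : E₀ →+* E) = (i : E₀ →+* E) := by
      ext c
      exact (hi (i c)).mpr ⟨c, rfl⟩ g
    exact congrArg (fun f => MvPolynomial.map f p) this
  let Φ : FractionRing (MvPolynomial (Fin r) E₀) →ₐ[k] Ω :=
    IsFractionRing.liftAlgHom (K := FractionRing (MvPolynomial (Fin r) E₀)) (g := φ) hφinj
  have hΦ : ∀ p, Φ (algebraMap _ _ p) = φ p := fun p =>
    (IsFractionRing.liftAlgHom_apply hφinj _).trans (IsFractionRing.lift_algebraMap hφinj p)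
  have hrange : Φ.range = j.range := by
    ext ω
    constructor
    · rintro ⟨x, rfl⟩
      refine (hj _).mp fun g => ?_
      obtain ⟨a, b, hb, rfl⟩ := IsFractionRing.div_surjective (A := MvPolynomial (Fin r) E₀) x
      change g • Φ _ = Φ _
      rw [map_div₀, smul_div₀', hΦ, hΦ, hφfix, hφfix]
    · intro hω
      obtain ⟨p, q, hp, hq, hq0, hpq⟩ := hfix ω ((hj ω).mpr hω)
      obtain ⟨p0, rfl⟩ := hmap p hp
      obtain ⟨q0, rfl⟩ := hmap q hq
      refine ⟨algebraMap _ _ p0 / algebraMap _ _ q0, ?_⟩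
      change Φ _ = _
      rw [map_div₀, hΦ, hΦ]
      exact (eq_div_iff (b := φ q0) hq0).mpr hpq |>.symm
  exact ⟨(AlgEquiv.ofInjective Φ Φ.toRingHom.injective).trans
    ((Subalgebra.equivOfEq _ _ hrange).trans
      (AlgEquiv.ofInjective j j.toRingHom.injective).symm)⟩

end NoName

/-! ### Function fields of tori -/

section Twisted

variable {k L : Type*} [Field k] [Field L] [Algebra k L]
variable {M : Type*} [AddCommGroup M]

/-- The group algebra `L[M]` of a `Gal(L/k)`-lattice `M`, a type synonym that carries the action
of `Gal(L/k)` on coefficients and exponents. The lattice `M` is also the character lattice of a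
torus over `k`, whose coordinate ring is the ring of invariants. -/
def TwistedAlgebra (_ρ : Representation ℤ Gal(L/k) M) : Type _ := AddMonoidAlgebra L M

namespace TwistedAlgebra

variable (ρ : Representation ℤ Gal(L/k) M)

instance : CommRing (TwistedAlgebra ρ) := inferInstanceAs (CommRing (AddMonoidAlgebra L M))
instance : Algebra L (TwistedAlgebra ρ) := inferInstanceAs (Algebra L (AddMonoidAlgebra L M))
instance : Algebra k (TwistedAlgebra ρ) := inferInstanceAs (Algebra k (AddMonoidAlgebra L M))
instance : IsScalarTower k L (TwistedAlgebra ρ) :=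
  inferInstanceAs (IsScalarTower k L (AddMonoidAlgebra L M))

/-- This implies that the group algebra of a lattice over a field is a domain. -/
theorem twoUniqueSums [Module.Free ℤ M] [Module.Finite ℤ M] : TwoUniqueSums M :=
  TwoUniqueSums.of_injective_addHom
    ⟨(Module.Free.chooseBasis ℤ M).repr, map_add _⟩
    (Module.Free.chooseBasis ℤ M).repr.injective inferInstance

instance [Module.Free ℤ M] [Module.Finite ℤ M] : IsDomain (TwistedAlgebra ρ) :=
  have := twoUniqueSums (M := M)
  have : NoZeroDivisors (TwistedAlgebra ρ) := inferInstanceAs (NoZeroDivisors (AddMonoidAlgebra L M))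
  have : Nontrivial (TwistedAlgebra ρ) := inferInstanceAs (Nontrivial (AddMonoidAlgebra L M))
  NoZeroDivisors.to_isDomain _

/-- The element `c xᵐ` of the group algebra. -/
def single (m : M) (c : L) : TwistedAlgebra ρ := AddMonoidAlgebra.single m c

variable {ρ}

theorem single_mul_single (m n : M) (c d : L) :
    single ρ m c * single ρ n d = single ρ (m + n) (c * d) := AddMonoidAlgebra.single_mul_single ..

theorem algebraMap_eq (c : L) : algebraMap L (TwistedAlgebra ρ) c = single ρ 0 c := rfl

theorem induction {P : TwistedAlgebra ρ → Prop} (x : TwistedAlgebra ρ) (h0 : P 0)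
    (hadd : ∀ x y, P x → P y → P (x + y)) (hs : ∀ m c, P (single ρ m c)) : P x :=
  AddMonoidAlgebra.induction_linear x h0 hadd hs

theorem ringHom_ext {S : Type*} [Semiring S] {f g : TwistedAlgebra ρ →+* S}
    (h : ∀ m c, f (single ρ m c) = g (single ρ m c)) : f = g := by
  ext x
  induction x using TwistedAlgebra.induction with
  | h0 => simp
  | hadd x y hx hy => simp [hx, hy]
  | hs m c => exact h m c

/-- The coefficient of `xᵐ`. -/
def coeff (m : M) : TwistedAlgebra ρ →+ L where
  toFun x := AddMonoidAlgebra.coeff (M := M) x m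
  map_zero' := rfl
  map_add' _ _ := rfl

theorem coeff_single [DecidableEq M] (m n : M) (c : L) :
    coeff m (single ρ n c) = if n = m then c else 0 := by
  change (AddMonoidAlgebra.single n c).coeff m = _
  rw [AddMonoidAlgebra.coeff_single, Finsupp.single_apply]

theorem ext_coeff {x y : TwistedAlgebra ρ} (h : ∀ m, coeff m x = coeff m y) : x = y :=
  AddMonoidAlgebra.ext (Finsupp.ext h)

variable (ρ) in
/-- The semilinear action of one automorphism. -/
def act (σ : Gal(L/k)) : TwistedAlgebra ρ →+* TwistedAlgebra ρ :=
  (AddMonoidAlgebra.mapDomainRingHom L (ρ σ).toAddMonoidHom).comp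
    (AddMonoidAlgebra.mapRingHom M (σ : L →+* L))

theorem act_single (σ : Gal(L/k)) (m : M) (c : L) :
    act ρ σ (single ρ m c) = single ρ (ρ σ m) (σ c) := by
  change AddMonoidAlgebra.mapDomain _ (AddMonoidAlgebra.map _ (AddMonoidAlgebra.single m c)) =
    AddMonoidAlgebra.single _ _
  simp

instance : MulSemiringAction Gal(L/k) (TwistedAlgebra ρ) where
  smul σ x := act ρ σ x
  one_smul x := by
    change act ρ 1 x = x
    have : act ρ 1 = RingHom.id _ := ringHom_ext fun m c => by simp [act_single]
    rw [this, RingHom.id_apply]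
  mul_smul σ τ x := by
    change act ρ (σ * τ) x = act ρ σ (act ρ τ x)
    have : act ρ (σ * τ) = (act ρ σ).comp (act ρ τ) :=
      ringHom_ext fun m c => by simp [act_single]
    rw [this, RingHom.comp_apply]
  smul_zero σ := map_zero (act ρ σ)
  smul_add σ := map_add (act ρ σ)
  smul_one σ := map_one (act ρ σ)
  smul_mul σ := map_mul (act ρ σ)

theorem smul_single (σ : Gal(L/k)) (m : M) (c : L) :
    σ • single ρ m c = single ρ (ρ σ m) (σ c) := act_single σ m c

theorem smul_smul_left (σ : Gal(L/k)) (c : L) (x : TwistedAlgebra ρ) :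
    σ • (c • x) = σ c • σ • x := by
  rw [Algebra.smul_def, Algebra.smul_def, smul_mul', algebraMap_eq, algebraMap_eq, smul_single,
    map_zero]

instance : FaithfulSMul Gal(L/k) (TwistedAlgebra ρ) where
  eq_of_smul_eq_smul {σ τ} h := by
    ext c
    have := h (single ρ 0 c)
    rw [smul_single, smul_single, map_zero, map_zero] at this
    have := congrArg (fun x : AddMonoidAlgebra L M => x.coeff 0) this
    simpa [single] using this

instance [Module.Free ℤ M] [Module.Finite ℤ M] :
    MulSemiringAction Gal(L/k) (FractionRing (TwistedAlgebra ρ)) :=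
  IsFractionRing.mulSemiringAction Gal(L/k) (TwistedAlgebra ρ) (FractionRing (TwistedAlgebra ρ))

variable [Module.Free ℤ M] [Module.Finite ℤ M]

theorem smul_toFractionRing (σ : Gal(L/k)) (x : TwistedAlgebra ρ) :
    σ • algebraMap _ (FractionRing (TwistedAlgebra ρ)) x = algebraMap _ _ (σ • x) :=
  IsFractionRing.ringEquivOfRingEquiv_algebraMap _ x

instance : FaithfulSMul Gal(L/k) (FractionRing (TwistedAlgebra ρ)) where
  eq_of_smul_eq_smul {σ τ} h := by
    refine FaithfulSMul.eq_of_smul_eq_smul (α := TwistedAlgebra ρ) fun x => ?_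
    have := h (algebraMap _ _ x)
    rw [smul_toFractionRing, smul_toFractionRing] at this
    exact IsFractionRing.injective _ _ this

end TwistedAlgebra

/-- The `k`-algebra homomorphism `j : A → L[M]` makes `A` a form of the group algebra of the
`Gal(L/k)`-lattice `M`: it induces an isomorphism `L ⊗ A ≃ L[M]` compatible with the Galois actions.
The isomorphism is encoded as the existence of a basis over `k` that is mapped to a basis over
`L`. -/
def IsDescent {A : Type w} [CommRing A] [Algebra k A] {ρ : Representation ℤ Gal(L/k) M}
    (j : A →ₐ[k] TwistedAlgebra ρ) : Prop :=
  (∀ (σ : Gal(L/k)) a, σ • j a = j a) ∧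
    ∃ (ι : Type w) (b : Module.Basis ι k A) (B : Module.Basis ι L (TwistedAlgebra ρ)),
      ∀ i, j (b i) = B i

/-- The `k`-algebra `A` is a form of the group algebra of the `Gal(L/k)`-lattice `M`: there is an
isomorphism `L ⊗ A ≃ L[M]` compatible with the Galois actions. -/
def IsFormOf (A : Type w) [CommRing A] [Algebra k A] (ρ : Representation ℤ Gal(L/k) M) : Prop :=
  ∃ j : A →ₐ[k] TwistedAlgebra ρ, IsDescent j

/-- The coordinates of an invariant element with respect to a basis of invariant elements lie in
the base field. -/
theorem TwistedAlgebra.exists_repr_eq [FiniteDimensional k L] [IsGalois k L]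
    {ρ : Representation ℤ Gal(L/k) M} {ι : Type*} (B : Module.Basis ι L (TwistedAlgebra ρ))
    (hB : ∀ (σ : Gal(L/k)) i, σ • B i = B i) {x : TwistedAlgebra ρ}
    (hx : ∀ σ : Gal(L/k), σ • x = x) (i : ι) : ∃ c : k, algebraMap k L c = B.repr x i := by
  classical
  have h1 : ∀ σ : Gal(L/k), σ (B.repr x i) = B.repr x i := by
    intro σ
    have h2 : B.repr (σ • x) i = σ (B.repr x i) := by
      conv_lhs => rw [← B.linearCombination_repr x, Finsupp.linearCombination_apply,
        Finsupp.sum, Finset.smul_sum]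
      simp only [TwistedAlgebra.smul_smul_left]
      simp only [hB, map_sum, map_smul, Module.Basis.repr_self, Finsupp.smul_single,
        smul_eq_mul, mul_one, Finsupp.coe_finsetSum, Finset.sum_apply, Finsupp.single_apply,
        Finset.sum_ite_eq']
      split_ifs with hi
      · rfl
      · rw [Finsupp.notMem_support_iff.mp hi, map_zero]
    rw [← h2, hx]
  exact (IsGalois.mem_range_algebraMap_iff_fixed _).mpr h1

theorem IsDescent.injective {A : Type*} [CommRing A] [Algebra k A]
    {ρ : Representation ℤ Gal(L/k) M} {j : A →ₐ[k] TwistedAlgebra ρ} (h : IsDescent j) :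
    Function.Injective j := by
  obtain ⟨hj, ι, b, B, hB⟩ := h
  have hjb : ∀ a, j a = ∑ i ∈ (b.repr a).support, algebraMap k L (b.repr a i) • B i := by
    intro a
    conv_lhs => rw [← b.linearCombination_repr a, Finsupp.linearCombination_apply, Finsupp.sum]
    simp [hB, algebraMap_smul]
  rw [injective_iff_map_eq_zero]
  intro a ha
  rw [hjb] at ha
  have := linearIndependent_iff'.mp B.linearIndependent _ _ ha
  apply b.repr.injective
  rw [map_zero]
  ext i
  by_cases hi : i ∈ (b.repr a).support
  · exact (algebraMap k L).injective (by simpa using this i hi)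
  · simpa using hi

/-- The image of `j` is the ring of invariants: an invariant is a linear combination of
the images of a basis of `A`, and its coefficients are fixed by the Galois group. -/
theorem IsDescent.mem_range_iff {A : Type*} [CommRing A] [Algebra k A] [FiniteDimensional k L]
    [IsGalois k L] {ρ : Representation ℤ Gal(L/k) M} {j : A →ₐ[k] TwistedAlgebra ρ}
    (h : IsDescent j) (x) : (∀ σ : Gal(L/k), σ • x = x) ↔ x ∈ Set.range j := by
  obtain ⟨hj, ι, b, B, hB⟩ := h
  constructor
  · intro hx
    choose c hc using TwistedAlgebra.exists_repr_eq B (fun σ i => by rw [← hB, hj]) hx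
    refine ⟨∑ i ∈ (B.repr x).support, c i • b i, ?_⟩
    rw [map_sum]
    conv_rhs => rw [← B.linearCombination_repr x, Finsupp.linearCombination_apply, Finsupp.sum]
    exact Finset.sum_congr rfl fun i _ => by rw [map_smul, hB, ← hc, algebraMap_smul]
  · rintro ⟨a, rfl⟩ σ
    exact hj σ a

theorem IsFormOf.isDomain {A : Type*} [CommRing A] [Algebra k A]
    [Module.Free ℤ M] [Module.Finite ℤ M]
    {ρ : Representation ℤ Gal(L/k) M} (h : IsFormOf A ρ) : IsDomain A := by
  obtain ⟨j, hj⟩ := h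
  exact hj.injective.isDomain j.toRingHom

/-- The function field of a form of `M` is the fixed field of the fraction field of `L[M]`: an
invariant fraction can be written with an invariant denominator. -/
theorem IsFormOf.exists_fractionRing_range {A : Type*} [CommRing A] [IsDomain A] [Algebra k A]
    [FiniteDimensional k L] [IsGalois k L] [Module.Free ℤ M] [Module.Finite ℤ M]
    {ρ : Representation ℤ Gal(L/k) M} (h : IsFormOf A ρ) :
    ∃ j : FractionRing A →ₐ[k] FractionRing (TwistedAlgebra ρ),
      ∀ x, (∀ σ : Gal(L/k), σ • x = x) ↔ x ∈ Set.range j := by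
  classical
  obtain ⟨j, h⟩ := h
  have hinj := h.injective
  have hj := h.mem_range_iff
  have hinj' : Function.Injective
      ((IsScalarTower.toAlgHom k (TwistedAlgebra ρ) (FractionRing (TwistedAlgebra ρ))).comp j) :=
    (IsFractionRing.injective (TwistedAlgebra ρ) (FractionRing (TwistedAlgebra ρ))).comp hinj
  let J : FractionRing A →ₐ[k] FractionRing (TwistedAlgebra ρ) :=
    IsFractionRing.liftAlgHom (K := FractionRing A) hinj'
  have hJ : ∀ a, J (algebraMap _ _ a) = algebraMap _ _ (j a) := fun p =>
    (IsFractionRing.liftAlgHom_apply hinj' _).trans (IsFractionRing.lift_algebraMap hinj' p)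
  refine ⟨J, fun x => ⟨fun hx => ?_, ?_⟩⟩
  · obtain ⟨p, q, hq, rfl⟩ := IsFractionRing.div_surjective (A := TwistedAlgebra ρ) x
    have hq0 : q ≠ 0 := nonZeroDivisors.ne_zero hq
    -- Replace the denominator by its norm, which is invariant.
    set n := ∏ σ : Gal(L/k), σ • q with hn
    set s := ∏ σ ∈ Finset.univ.erase (1 : Gal(L/k)), σ • q with hs
    have hns : n = q * s := by
      rw [hn, ← Finset.mul_prod_erase Finset.univ _ (Finset.mem_univ 1), one_smul]
    have hn0 : n ≠ 0 := Finset.prod_ne_zero_iff.mpr fun σ _ => (smul_ne_zero_iff_ne σ).mpr hq0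
    have hninv : ∀ σ : Gal(L/k), σ • n = n := by
      intro σ
      rw [hn, Finset.smul_prod']
      exact Fintype.prod_equiv (Equiv.mulLeft σ) _ _ fun τ => by simp [mul_smul]
    have hpn : algebraMap (TwistedAlgebra ρ) (FractionRing (TwistedAlgebra ρ)) (p * s) =
        algebraMap _ _ p / algebraMap _ _ q * algebraMap _ _ n := by
      have : algebraMap (TwistedAlgebra ρ) (FractionRing (TwistedAlgebra ρ)) q ≠ 0 := by
        simpa using hq0
      rw [hns, map_mul, map_mul]
      field_simp
    have hpinv : ∀ σ : Gal(L/k), σ • (p * s) = p * s := by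
      intro σ
      apply IsFractionRing.injective (TwistedAlgebra ρ) (FractionRing (TwistedAlgebra ρ))
      rw [← TwistedAlgebra.smul_toFractionRing, hpn, smul_mul', hx, TwistedAlgebra.smul_toFractionRing,
        hninv]
    obtain ⟨a, ha⟩ := (hj _).mp hpinv
    obtain ⟨b, hb⟩ := (hj _).mp hninv
    refine ⟨algebraMap _ _ a / algebraMap _ _ b, ?_⟩
    rw [map_div₀, hJ, hJ, ha, hb, hpn, mul_div_assoc, div_self (by simpa using hn0), mul_one]
  · rintro ⟨x, rfl⟩ σ
    obtain ⟨p, q, hq, rfl⟩ := IsFractionRing.div_surjective (A := A) x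
    rw [map_div₀, smul_div₀', hJ, hJ, TwistedAlgebra.smul_toFractionRing,
      TwistedAlgebra.smul_toFractionRing, (hj _).mpr ⟨p, rfl⟩, (hj _).mpr ⟨q, rfl⟩]

end Twisted

section FunctionField

variable {k L : Type*} [Field k] [Field L] [Algebra k L]
variable {M N Q : Type*} [AddCommGroup M] [AddCommGroup N] [AddCommGroup Q]
variable {ρM : Representation ℤ Gal(L/k) M} {ρN : Representation ℤ Gal(L/k) N}
  {ρQ : Representation ℤ Gal(L/k) Q}

namespace TwistedAlgebra

/-- Functoriality of the group algebra in the lattice. -/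
def map (i : ρM.IntertwiningMap ρN) : TwistedAlgebra ρM →ₐ[L] TwistedAlgebra ρN :=
  AddMonoidAlgebra.mapDomainAlgHom L L (i.toLinearMap.toAddMonoidHom)

theorem map_single (i : ρM.IntertwiningMap ρN) (m : M) (c : L) :
    map i (single ρM m c) = single ρN (i m) c := by
  change AddMonoidAlgebra.mapDomain _ (AddMonoidAlgebra.single m c) = AddMonoidAlgebra.single _ _
  simp

theorem map_injective {i : ρM.IntertwiningMap ρN} (hi : Function.Injective i) :
    Function.Injective (map i) :=
  AddMonoidAlgebra.mapDomain_injective hi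

theorem smul_map (i : ρM.IntertwiningMap ρN) (σ : Gal(L/k)) (x : TwistedAlgebra ρM) :
    σ • map i x = map i (σ • x) := by
  induction x using TwistedAlgebra.induction with
  | h0 => simp
  | hadd x y hx hy => simp [smul_add, hx, hy]
  | hs m c => simp only [map_single, smul_single, i.isIntertwining]

theorem coeff_map_mul_single {i : ρM.IntertwiningMap ρN} (hi : Function.Injective i)
    (x : TwistedAlgebra ρM) (n : N) (m : M) :
    coeff (i m + n) (map i x * single ρN n 1) = coeff m x := by
  classical
  induction x using TwistedAlgebra.induction with
  | h0 => simp
  | hadd x y hx hy => rw [map_add, add_mul, map_add, hx, hy, map_add]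
  | hs m' c =>
    rw [map_single, single_mul_single, coeff_single, coeff_single, mul_one]
    simp [hi.eq_iff]

theorem coeff_map_mul_single_of_notMem (i : ρM.IntertwiningMap ρN)
    (x : TwistedAlgebra ρM) (n l : N) (h : l - n ∉ Set.range i) :
    coeff l (map i x * single ρN n 1) = 0 := by
  classical
  induction x using TwistedAlgebra.induction with
  | h0 => simp
  | hadd x y hx hy => rw [map_add, add_mul, map_add, hx, hy, add_zero]
  | hs m c =>
    rw [map_single, single_mul_single, coeff_single, if_neg]
    rintro rfl
    exact h ⟨m, by abel⟩

variable (ρM ρN) in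
/-- The group algebra of a product is the tensor product of the group algebras. -/
def tensorEquiv : TwistedAlgebra ρM ⊗[L] TwistedAlgebra ρN ≃ₗ[L] TwistedAlgebra (ρM.prod ρN) :=
  AddMonoidAlgebra.tensorEquiv L

theorem tensorEquiv_tmul (x : TwistedAlgebra ρM) (y : TwistedAlgebra ρN) :
    tensorEquiv ρM ρN (x ⊗ₜ y) = map (Representation.IntertwiningMap.inl ℤ ρM ρN) x *
      map (Representation.IntertwiningMap.inr ℤ ρM ρN) y := by
  induction x using TwistedAlgebra.induction with
  | h0 => simp
  | hadd x x' hx hx' => rw [TensorProduct.add_tmul, map_add, hx, hx', map_add, add_mul]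
  | hs m c =>
    induction y using TwistedAlgebra.induction with
    | h0 => simp
    | hadd x x' hx hx' => rw [TensorProduct.tmul_add, map_add, hx, hx', map_add, mul_add]
    | hs m' c' =>
      rw [map_single, map_single, single_mul_single]
      refine (AddMonoidAlgebra.tensorEquiv_single_tmul_single m c m' c').trans ?_
      change AddMonoidAlgebra.single (m, m') (c * c') =
        AddMonoidAlgebra.single ((m, (0 : N)) + ((0 : M), m')) (c * c')
      simp

end TwistedAlgebra

open TwistedAlgebra

/-- The homomorphism `A ⊗ C → L[M × N]` given by homomorphisms `A → L[M]` and `C → L[N]`. -/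
def TwistedAlgebra.prodMap {A : Type w} {C : Type w'} [CommRing A] [CommRing C]
    [Algebra k A] [Algebra k C] (j : A →ₐ[k] TwistedAlgebra ρM) (j' : C →ₐ[k] TwistedAlgebra ρN) :
    A ⊗[k] C →ₐ[k] TwistedAlgebra (ρM.prod ρN) :=
  Algebra.TensorProduct.lift
    (((TwistedAlgebra.map (Representation.IntertwiningMap.inl ℤ ρM ρN)).restrictScalars k).comp j)
    (((TwistedAlgebra.map (Representation.IntertwiningMap.inr ℤ ρM ρN)).restrictScalars k).comp j')
    fun _ _ => Commute.all _ _

theorem TwistedAlgebra.prodMap_tmul {A : Type w} {C : Type w'} [CommRing A] [CommRing C]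
    [Algebra k A] [Algebra k C] (j : A →ₐ[k] TwistedAlgebra ρM) (j' : C →ₐ[k] TwistedAlgebra ρN)
    (a : A) (c : C) :
    prodMap j j' (a ⊗ₜ c) = TwistedAlgebra.map (Representation.IntertwiningMap.inl ℤ ρM ρN) (j a) *
      TwistedAlgebra.map (Representation.IntertwiningMap.inr ℤ ρM ρN) (j' c) :=
  Algebra.TensorProduct.lift_tmul ..

theorem IsDescent.prodMap {A : Type w} {C : Type w'} [CommRing A] [CommRing C]
    [Algebra k A] [Algebra k C] {j : A →ₐ[k] TwistedAlgebra ρM} {j' : C →ₐ[k] TwistedAlgebra ρN}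
    (h : IsDescent j) (h' : IsDescent j') : IsDescent (TwistedAlgebra.prodMap j j') := by
  obtain ⟨hj, ι, b, B, hB⟩ := h
  obtain ⟨hj', ι', b', B', hB'⟩ := h'
  refine ⟨fun σ z => ?_, ι × ι', b.tensorProduct b',
    (B.tensorProduct B').map (TwistedAlgebra.tensorEquiv ρM ρN), fun x => ?_⟩
  · induction z with
    | zero => simp
    | tmul a c => rw [prodMap_tmul, smul_mul', smul_map, smul_map, hj, hj']
    | add x y hx hy => rw [map_add, smul_add, hx, hy]
  · rw [Module.Basis.map_apply, Module.Basis.tensorProduct_apply',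
      Module.Basis.tensorProduct_apply', prodMap_tmul, hB, hB', tensorEquiv_tmul]

/-- The product of forms is a form of the group algebra of the product. -/
theorem IsFormOf.tensor {A : Type w} {C : Type w'} [CommRing A] [CommRing C]
    [Algebra k A] [Algebra k C] (hA : IsFormOf A ρM) (hC : IsFormOf C ρN) :
    IsFormOf (A ⊗[k] C) (ρM.prod ρN) :=
  let ⟨_, h⟩ := hA
  let ⟨_, h'⟩ := hC
  ⟨_, h.prodMap h'⟩

variable [FiniteDimensional k L] [IsGalois k L]
  [Module.Free ℤ M] [Module.Finite ℤ M] [Module.Free ℤ N] [Module.Finite ℤ N]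

/-- The no-name lemma for tori: a short exact sequence of lattices `0 → M → N → Q → 0` with `Q`
permutation makes the torus of `N` birational to the product of the torus of `M` with an affine
space. -/
theorem IsFormOf.fractionRing_equiv {A : Type w} {C : Type w'} [CommRing A] [CommRing C]
    [Algebra k A] [Algebra k C] [IsDomain A] [IsDomain C]
    (hA : IsFormOf A ρM) (hC : IsFormOf C ρN) (i : ρM.IntertwiningMap ρN)
    (p : ρN.IntertwiningMap ρQ) (hi : Function.Injective i) (hip : Function.Exact i p)
    (hp : Function.Surjective p) {r : ℕ} (b : Module.Basis (Fin r) ℤ Q)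
    (hb : ∀ (g : Gal(L/k)) l, ∃ l', ρQ g (b l) = b l') :
    Nonempty (FractionRing (MvPolynomial (Fin r) (FractionRing A)) ≃ₐ[k] FractionRing C) := by
  classical
  obtain ⟨jA, hjA⟩ := hA.exists_fractionRing_range
  obtain ⟨jC, hjC⟩ := hC.exists_fractionRing_range
  let R := TwistedAlgebra ρM
  let S := TwistedAlgebra ρN
  let E := FractionRing R
  let Ω := FractionRing S
  let : Algebra R S := (TwistedAlgebra.map i).toRingHom.toAlgebra
  have hRS : ∀ x, algebraMap R S x = TwistedAlgebra.map i x := fun _ => rfl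
  have hRΩ : Function.Injective (algebraMap R Ω) := by
    rw [IsScalarTower.algebraMap_eq R S Ω]
    exact (IsFractionRing.injective S Ω).comp (TwistedAlgebra.map_injective hi)
  have : FaithfulSMul R Ω := (faithfulSMul_iff_algebraMap_injective R Ω).mpr hRΩ
  let : Algebra E Ω := FractionRing.liftAlgebra R Ω
  have : IsScalarTower R E Ω := FractionRing.isScalarTower_liftAlgebra R Ω
  have : IsScalarTower k R S := IsScalarTower.of_algebraMap_eq fun c =>
    ((TwistedAlgebra.map i).restrictScalars k).commutes c |>.symm
  have : IsScalarTower k E Ω := IsScalarTower.of_algebraMap_eq fun c => by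
    rw [IsScalarTower.algebraMap_apply k R E, ← IsScalarTower.algebraMap_apply R E Ω,
      IsScalarTower.algebraMap_apply R S Ω, ← IsScalarTower.algebraMap_apply k R S,
      ← IsScalarTower.algebraMap_apply k S Ω]
  have hc : ∀ (g : Gal(L/k)) (c : E), g • algebraMap E Ω c = algebraMap E Ω (g • c) := by
    intro g c
    have h1 : ∀ x : R, g • algebraMap E Ω (algebraMap R E x) =
        algebraMap E Ω (g • algebraMap R E x) := by
      intro x
      rw [← IsScalarTower.algebraMap_apply R E Ω, IsScalarTower.algebraMap_apply R S Ω,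
        smul_toFractionRing, hRS, smul_map, smul_toFractionRing, ← IsScalarTower.algebraMap_apply R E Ω,
        IsScalarTower.algebraMap_apply R S Ω]
      rfl
    obtain ⟨x, y, hy, rfl⟩ := IsFractionRing.div_surjective (A := R) c
    rw [map_div₀, smul_div₀', smul_div₀', map_div₀, h1, h1]
  choose s hs using fun l => hp (b l)
  let y : Fin r → Ω := fun l => algebraMap S Ω (single ρN (s l) 1)
  -- The monomials in the `y l` are the exponentials of the lifts of the elements of `Q`.
  let v : (Fin r →₀ ℕ) → N := fun α => α.sum fun l n => n • s l
  have hv : ∀ α, MvPolynomial.aeval y (MvPolynomial.monomial α (1 : E)) =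
      algebraMap S Ω (single ρN (v α) 1) := by
    intro α
    rw [MvPolynomial.aeval_monomial, map_one, one_mul]
    have hpow : ∀ (l : Fin r) (n : ℕ), single ρN (s l) 1 ^ n = single ρN (n • s l) 1 := by
      intro l n
      induction n with
      | zero => rw [pow_zero, zero_smul]; rfl
      | succ n ih => rw [pow_succ, ih, single_mul_single, succ_nsmul, mul_one]
    have hprod : ∀ (t : Finset (Fin r)) (m : Fin r → N),
        ∏ l ∈ t, single ρN (m l) 1 = single ρN (∑ l ∈ t, m l) 1 := by
      intro t m
      induction t using Finset.induction_on with
      | empty => rfl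
      | insert a t ha ih =>
        rw [Finset.prod_insert ha, Finset.sum_insert ha, ih, single_mul_single, mul_one]
    rw [Finsupp.prod]
    simp only [y, ← map_pow, ← map_prod, hpow, hprod]
    rfl
  have hpv : ∀ α l, b.repr (p (v α)) l = α l := by
    intro α l
    simp only [v, Finsupp.sum, map_sum, map_nsmul, hs, Module.Basis.repr_self,
      Finsupp.coe_finsetSum, Finset.sum_apply, Finsupp.coe_smul, Pi.smul_apply,
      Finsupp.single_apply, smul_ite, smul_zero, Finset.sum_ite_eq']
    split_ifs with h
    · simp
    · simp [Finsupp.notMem_support_iff.mp h]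
  have hlin : LinearIndependent R fun α => algebraMap S Ω (single ρN (v α) 1) := by
    rw [linearIndependent_iff']
    intro t c hsum α hα
    have h0 : ∑ β ∈ t, TwistedAlgebra.map i (c β) * single ρN (v β) 1 = 0 := by
      apply IsFractionRing.injective S Ω
      rw [map_zero, ← hsum, map_sum]
      refine Finset.sum_congr rfl fun β _ => ?_
      rw [map_mul, Algebra.smul_def, IsScalarTower.algebraMap_apply R S Ω]
      rfl
    refine ext_coeff fun m => ?_
    have h2 := congrArg (coeff (i m + v α)) h0
    rw [map_sum, map_zero, Finset.sum_eq_single_of_mem α hα, coeff_map_mul_single hi] at h2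
    · rw [h2, map_zero]
    · intro β _ hβ
      refine coeff_map_mul_single_of_notMem i _ _ _ fun h => hβ ?_
      have h3 := (hip _).mpr h
      have h4 : p (i m) = 0 := (hip _).mpr ⟨m, rfl⟩
      rw [map_sub, map_add, h4, zero_add, sub_eq_zero] at h3
      ext l
      have := hpv β l
      rw [← h3, hpv] at this
      exact_mod_cast this.symm
  have hy : AlgebraicIndependent E y := by
    have hlin' := (LinearIndependent.iff_fractionRing R E).mp hlin
    have key : ∀ q : MvPolynomial (Fin r) E, Finsupp.linearCombination E
        (fun α => algebraMap S Ω (single ρN (v α) 1))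
        ((MvPolynomial.basisMonomials (Fin r) E).repr q) = MvPolynomial.aeval y q := by
      intro q
      have : (Finsupp.linearCombination E
          (fun α => algebraMap S Ω (single ρN (v α) 1))).comp
          (MvPolynomial.basisMonomials (Fin r) E).repr.toLinearMap =
            (MvPolynomial.aeval y).toLinearMap := by
        refine (MvPolynomial.basisMonomials (Fin r) E).ext fun α => ?_
        change Finsupp.linearCombination _ _ ((MvPolynomial.basisMonomials (Fin r) E).repr _) =
          MvPolynomial.aeval y _
        rw [Module.Basis.repr_self, Finsupp.linearCombination_single, one_smul,
          MvPolynomial.coe_basisMonomials, hv]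
      exact DFunLike.congr_fun this q
    intro q q' hqq
    apply (MvPolynomial.basisMonomials (Fin r) E).repr.injective
    apply hlin'
    rw [key, key]
    exact hqq
  refine fixedField_equiv (G := Gal(L/k)) (E := E) (Ω := Ω) jA hjA jC hjC hc y hy ?_ ?_
  · have htop : ∀ ω : Ω, ω ∈ IntermediateField.adjoin E (Set.range y) := by
      have hmem : ∀ n c, algebraMap S Ω (single ρN n c) ∈
          IntermediateField.adjoin E (Set.range y) := by
        intro n c
        have hgen : ∀ l, algebraMap S Ω (single ρN (s l) 1) ∈
            IntermediateField.adjoin E (Set.range y) :=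
          fun l => IntermediateField.subset_adjoin E _ ⟨l, rfl⟩
        have hneg : ∀ n : N, algebraMap S Ω (single ρN n 1) ∈
            IntermediateField.adjoin E (Set.range y) → algebraMap S Ω (single ρN (-n) 1) ∈
            IntermediateField.adjoin E (Set.range y) := by
          intro n hn
          have h1 : algebraMap S Ω (single ρN (-n) 1) = (algebraMap S Ω (single ρN n 1))⁻¹ := by
            refine eq_inv_of_mul_eq_one_left ?_
            rw [← map_mul, single_mul_single, neg_add_cancel, mul_one]
            exact map_one (algebraMap S Ω)
          rw [h1]
          exact inv_mem hn
        have hadd : ∀ n n' : N, ∀ c, algebraMap S Ω (single ρN n 1) ∈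
            IntermediateField.adjoin E (Set.range y) → algebraMap S Ω (single ρN n' c) ∈
            IntermediateField.adjoin E (Set.range y) → algebraMap S Ω (single ρN (n + n') c) ∈
            IntermediateField.adjoin E (Set.range y) := by
          intro n n' c hn hn'
          have h1 : algebraMap S Ω (single ρN (n + n') c) =
              algebraMap S Ω (single ρN n 1) * algebraMap S Ω (single ρN n' c) := by
            rw [← map_mul, single_mul_single, one_mul]
          rw [h1]
          exact mul_mem hn hn'
        have hbase : ∀ m c, algebraMap S Ω (single ρN (i m) c) ∈
            IntermediateField.adjoin E (Set.range y) := by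
          intro m c
          have h1 : algebraMap S Ω (single ρN (i m) c) =
              algebraMap E Ω (algebraMap R E (single ρM m c)) := by
            rw [← IsScalarTower.algebraMap_apply R E Ω, IsScalarTower.algebraMap_apply R S Ω, hRS,
              map_single]
          rw [h1]
          exact IntermediateField.algebraMap_mem _ _
        have hlat : ∀ q : Q, ∃ n', p n' = q ∧ algebraMap S Ω (single ρN n' 1) ∈
            IntermediateField.adjoin E (Set.range y) := by
          intro q
          have hq : q ∈ Submodule.span ℤ (Set.range b) := b.mem_span q
          induction hq using Submodule.span_induction with
          | mem q hq => obtain ⟨l, rfl⟩ := hq; exact ⟨s l, hs l, hgen l⟩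
          | zero => exact ⟨0, map_zero p, by
              have := hbase 0 1
              rwa [map_zero] at this⟩
          | add q q' _ _ h h' =>
            obtain ⟨n, hn, hn'⟩ := h
            obtain ⟨m, hm, hm'⟩ := h'
            exact ⟨n + m, by rw [map_add, hn, hm], hadd n m 1 hn' hm'⟩
          | smul z q _ h =>
            obtain ⟨n, rfl, hn'⟩ := h
            refine ⟨z • n, map_zsmul p z n, ?_⟩
            induction z with
            | zero => simpa using hbase 0 1
            | succ z ih => rw [add_zsmul, one_zsmul]; exact hadd _ _ 1 ih hn'
            | pred z ih => rw [sub_zsmul, one_zsmul]; exact hadd _ _ 1 ih (hneg _ hn')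
        obtain ⟨n', hn', hmem⟩ := hlat (p n)
        have : p (n - n') = 0 := by rw [map_sub, hn', sub_self]
        obtain ⟨m, hm⟩ := (hip _).mp this
        have := hadd n' (i m) c hmem (hbase m c)
        rwa [hm, add_sub_cancel] at this
      have hS : ∀ x : S, algebraMap S Ω x ∈ IntermediateField.adjoin E (Set.range y) := by
        intro x
        induction x using TwistedAlgebra.induction with
        | h0 => rw [map_zero]; exact zero_mem _
        | hadd x y hx hy => rw [map_add]; exact add_mem hx hy
        | hs m c => exact hmem m c
      intro ω
      obtain ⟨x, y, hy, rfl⟩ := IsFractionRing.div_surjective (A := S) ω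
      exact div_mem (hS x) (hS y)
    intro ω
    obtain ⟨f, g, hfg⟩ := (IntermediateField.mem_adjoin_range_iff E y ω).mp (htop ω)
    by_cases hg : MvPolynomial.aeval y g = (0 : Ω)
    · exact ⟨0, 1, by simp, by simp [hfg, hg]⟩
    · exact ⟨f, g, hg, by rw [hfg, div_mul_cancel₀ _ hg]⟩
  · intro g l
    obtain ⟨l', hl'⟩ := hb g l
    have : p (ρN g (s l) - s l') = 0 := by
      rw [map_sub, hs, p.isIntertwining, hs, hl', sub_self]
    obtain ⟨m, hm⟩ := (hip _).mp this
    have h2 : g • y l = algebraMap E Ω (algebraMap R E (single ρM m 1)) * y l' := by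
      rw [← IsScalarTower.algebraMap_apply R E Ω, IsScalarTower.algebraMap_apply R S Ω, hRS,
        map_single, ← map_mul, single_mul_single, hm, smul_toFractionRing, smul_single]
      simp only [map_one, mul_one, sub_add_cancel]
      rfl
    rw [h2, ← Algebra.smul_def]
    exact Submodule.smul_mem _ _ (Submodule.subset_span ⟨l', rfl⟩)

end FunctionField

section Rationality

variable {k : Type u} {L : Type*} [Field k] [Field L] [Algebra k L]
variable {M N : Type*} [AddCommGroup M] [AddCommGroup N]
variable {ρM : Representation ℤ Gal(L/k) M} {ρN : Representation ℤ Gal(L/k) N}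

theorem IsPermutationLattice.free {G : Type*} [Group G] {ρ : Representation ℤ G M}
    (h : IsPermutationLattice ρ) : Module.Free ℤ M :=
  let ⟨_, b, _⟩ := h; .of_basis b

theorem IsPermutationLattice.finite {G : Type*} [Group G] {ρ : Representation ℤ G M}
    (h : IsPermutationLattice ρ) : Module.Finite ℤ M :=
  let ⟨_, b, _⟩ := h; .of_basis b

/-- The representation carried over along a linear isomorphism. -/
def transport {G : Type*} [Group G] (ρ : Representation ℤ G M) (e : M ≃ₗ[ℤ] N) :
    Representation ℤ G N :=
  (e.conjRingEquiv : Module.End ℤ M →* Module.End ℤ N).comp ρ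

/-- The isomorphism that defines the representation carried over. -/
def transportEquiv {G : Type*} [Group G] (ρ : Representation ℤ G M) (e : M ≃ₗ[ℤ] N) :
    ρ.Equiv (transport ρ e) :=
  .mk e fun g => by
    ext x
    simp [transport]

/-- A lattice with a basis indexed by any finite type, permuted by the group. -/
theorem IsPermutationLattice.of_basis {G : Type*} [Group G] {ρ : Representation ℤ G M}
    {ι : Type*} [Finite ι] (b : Module.Basis ι ℤ M) (h : ∀ g i, ∃ j, ρ g (b i) = b j) :
    IsPermutationLattice ρ := by
  have := Fintype.ofFinite ι
  refine ⟨Fintype.card ι, b.reindex (Fintype.equivFin ι), fun g i => ?_⟩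
  obtain ⟨j, hj⟩ := h g ((Fintype.equivFin ι).symm i)
  exact ⟨Fintype.equivFin ι j, by simp [hj]⟩

theorem IsPermutationLattice.prod {G : Type*} [Group G] {ρ : Representation ℤ G M}
    {σ : Representation ℤ G N} (h : IsPermutationLattice ρ) (h' : IsPermutationLattice σ) :
    IsPermutationLattice (ρ.prod σ) := by
  obtain ⟨m, b, hb⟩ := h
  obtain ⟨n, c, hc⟩ := h'
  refine .of_basis (b.prod c) fun g i => ?_
  rcases i with i | i
  · obtain ⟨j, hj⟩ := hb g i
    exact ⟨.inl j, by simp [hj]⟩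
  · obtain ⟨j, hj⟩ := hc g i
    exact ⟨.inr j, by simp [hj]⟩

theorem IsPermutationLattice.equiv {G : Type*} [Group G] {ρ : Representation ℤ G M}
    {σ : Representation ℤ G N} (h : IsPermutationLattice ρ) (e : ρ.Equiv σ) :
    IsPermutationLattice σ := by
  obtain ⟨m, b, hb⟩ := h
  refine ⟨m, b.map e.toLinearEquiv, fun g i => ?_⟩
  obtain ⟨j, hj⟩ := hb g i
  refine ⟨j, ?_⟩
  rw [Module.Basis.map_apply, Module.Basis.map_apply, ← hj]
  exact (e.isIntertwining _ _ g (b i)).symm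

theorem IsFormOf.equiv {A : Type w} [CommRing A] [Algebra k A] (h : IsFormOf A ρM)
    (e : ρM.Equiv ρN) : IsFormOf A ρN := by
  obtain ⟨j, hj, ι, b, B, hB⟩ := h
  let f := TwistedAlgebra.map e.toIntertwiningMap
  have hf : Function.Bijective f := by
    refine ⟨TwistedAlgebra.map_injective e.toLinearEquiv.injective, fun y => ?_⟩
    induction y using TwistedAlgebra.induction with
    | h0 => exact ⟨0, map_zero f⟩
    | hadd x y hx hy =>
      obtain ⟨x, rfl⟩ := hx
      obtain ⟨y, rfl⟩ := hy
      exact ⟨x + y, map_add f x y⟩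
    | hs m c =>
      obtain ⟨m, rfl⟩ := e.toLinearEquiv.surjective m
      exact ⟨TwistedAlgebra.single _ m c, TwistedAlgebra.map_single _ _ _⟩
  refine ⟨(f.restrictScalars k).comp j, fun σ a => ?_, ι, b,
    B.map (LinearEquiv.ofBijective f.toLinearMap hf), fun i => ?_⟩
  · exact (TwistedAlgebra.smul_map _ _ _).trans (congrArg f (hj σ a))
  · exact congrArg f (hB i)

/-- The base field is the coordinate ring of the trivial torus. -/
theorem isDescent_ofId :
    IsDescent (Algebra.ofId k
      (TwistedAlgebra (1 : Representation ℤ Gal(L/k) PUnit.{u + 1}))) := by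
  refine ⟨fun σ a => ?_, PUnit.{u + 1}, Module.Basis.singleton PUnit k,
    AddMonoidAlgebra.basis PUnit L, fun i => ?_⟩
  · rw [Algebra.ofId_apply, IsScalarTower.algebraMap_apply k L, TwistedAlgebra.algebraMap_eq,
      TwistedAlgebra.smul_single]
    simp
  · rw [Module.Basis.singleton_apply, map_one]
    exact (AddMonoidAlgebra.basis_apply ..).symm

theorem fractionRing_mvPolynomial_congr {A B : Type*} [Field A] [Field B] [Algebra k A]
    [Algebra k B] (e : A ≃ₐ[k] B) (r : ℕ) :
    Nonempty (FractionRing (MvPolynomial (Fin r) A) ≃ₐ[k] FractionRing (MvPolynomial (Fin r) B)) :=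
  ⟨IsFractionRing.algEquivOfAlgEquiv (MvPolynomial.mapAlgEquiv (Fin r) e)⟩

variable [FiniteDimensional k L] [IsGalois k L]

/-- A torus whose character lattice is a permutation lattice is rational. -/
theorem IsFormOf.isRational {B : Type w} [CommRing B] [Algebra k B] (hB : IsFormOf B ρM)
    (h : IsPermutationLattice ρM) : IsRational k B := by
  have := h.free
  have := h.finite
  have := hB.isDomain
  obtain ⟨r, b, hb⟩ := h
  refine ⟨this, r, ?_⟩
  let i : Representation.IntertwiningMap (1 : Representation ℤ Gal(L/k) PUnit.{u + 1}) ρM := 0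
  obtain ⟨e⟩ := IsFormOf.fractionRing_equiv ⟨_, isDescent_ofId⟩ hB i (.id ρM) (fun _ _ _ => rfl)
    (fun x => ⟨fun h => ⟨0, h.symm⟩, fun ⟨_, h⟩ => h.symm⟩) (fun x => ⟨x, rfl⟩) b hb
  obtain ⟨e'⟩ := fractionRing_mvPolynomial_congr (FractionRing.algEquiv k k) r
  exact ⟨e.symm.trans e'⟩

/-- If the flabby class of the character lattice of a torus is stably permutation, say
`F ⊕ P ≃ P'`, then the torus is stably rational, and its product with a torus of character lattice
`P'` is rational. -/
theorem IsFormOf.rational_of_flabbyClass {A : Type w} {B : Type w'} [CommRing A] [CommRing B]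
    [Algebra k A] [Algebra k B] [Module.Free ℤ M] [Module.Finite ℤ M] (hA : IsFormOf A ρM)
    {F P P' : Type*} [AddCommGroup F] [AddCommGroup P] [AddCommGroup P']
    {ρF : Representation ℤ Gal(L/k) F} {σ : Representation ℤ Gal(L/k) P}
    {τ : Representation ℤ Gal(L/k) P'} (hF : IsFlabbyClassOf ρM ρF)
    (hσ : IsPermutationLattice σ) (hτ : IsPermutationLattice τ) (e : (ρF.prod σ).Equiv τ)
    (hB : IsFormOf B τ)
    (hex : ∀ (n : ℕ) (ρ : Representation ℤ Gal(L/k) (Fin n → ℤ)), IsPermutationLattice ρ →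
      ∃ (C : Type u) (_ : CommRing C) (_ : Algebra k C), IsFormOf C ρ) :
    IsStablyRational k A ∧ IsRational k (A ⊗[k] B) := by
  obtain ⟨-, -, -, n, ρP, i, p, hP, hi, hip, hp⟩ := hF
  have hN := hP.prod hσ
  have := hN.free
  have := hN.finite
  have := hτ.free
  have := hτ.finite
  have hAdom := hA.isDomain
  -- A torus with character lattice `P ⊕ σ`.
  obtain ⟨C, _, _, hC⟩ : ∃ (C : Type u) (_ : CommRing C) (_ : Algebra k C),
      IsFormOf C (ρP.prod σ) := by
    obtain ⟨m, b, -⟩ := id hN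
    let t := transportEquiv (ρP.prod σ) b.equivFun
    obtain ⟨C, iC, iC', hC⟩ := hex m _ (hN.equiv t)
    exact ⟨C, iC, iC', hC.equiv t.symm⟩
  have hCdom := hC.isDomain
  obtain ⟨-, n, ⟨eC⟩⟩ := hC.isRational hN
  have hAB := hA.tensor hB
  have hABdom := hAB.isDomain
  obtain ⟨r, b, hb⟩ := hτ
  obtain ⟨e1⟩ := hA.fractionRing_equiv hAB (.inl ℤ ρM τ) (.snd ℤ ρM τ)
    (fun x y h => congrArg Prod.fst h)
    (fun x => ⟨fun h => ⟨x.1, Prod.ext rfl h.symm⟩, by rintro ⟨y, rfl⟩; rfl⟩)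
    (fun y => ⟨(0, y), rfl⟩) b hb
  let i' : ρM.IntertwiningMap (ρP.prod σ) := (Representation.IntertwiningMap.inl ℤ ρP σ).comp i
  let q : (ρP.prod σ).IntertwiningMap (ρF.prod σ) :=
    (p.comp (.fst ℤ ρP σ)).prod (.snd ℤ ρP σ)
  let p' : (ρP.prod σ).IntertwiningMap τ := e.toIntertwiningMap.comp q
  have hp' : ∀ x, p' x = e.toLinearEquiv (p x.1, x.2) := fun x => rfl
  obtain ⟨e2⟩ := hA.fractionRing_equiv hC i' p'
    (fun x y h => hi (congrArg Prod.fst h))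
    (fun x => by
      rw [hp', LinearEquiv.map_eq_zero_iff, Prod.mk_eq_zero, hip]
      constructor
      · rintro ⟨⟨y, hy⟩, h2⟩
        exact ⟨y, Prod.ext hy h2.symm⟩
      · rintro ⟨y, rfl⟩
        exact ⟨⟨y, rfl⟩, rfl⟩)
    (fun y => by
      obtain ⟨⟨f, s⟩, rfl⟩ := e.toLinearEquiv.surjective y
      obtain ⟨x, rfl⟩ := hp f
      exact ⟨(x, s), rfl⟩) b hb
  exact ⟨⟨hAdom, r, n, ⟨e2.trans eC⟩⟩, hABdom, n, ⟨e1.symm.trans (e2.trans eC)⟩⟩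

end Rationality

/-! ### Tori and their character lattices -/

section Split

variable {k : Type u} {L : Type v} [Field k] [Field L] [Algebra k L]
variable {M N : Type*} [AddCommGroup M] [AddCommGroup N]
variable {ρM : Representation ℤ Gal(L/k) M} {ρN : Representation ℤ Gal(L/k) N}

/-- `Spec A` is the torus over `k`, split by `L`, that belongs to the `Gal(L/k)`-lattice `M`: over
`L` it becomes the diagonalizable group of `M`, and the descent datum is the natural one. -/
def IsTorusOf (A : Type w) [CommRing A] [HopfAlgebra k A] (ρ : Representation ℤ Gal(L/k) M) :
    Prop :=
  ∃ φ : L ⊗[k] A ≃ₐc[L] AddMonoidAlgebra L M, ∀ (σ : Gal(L/k)) z,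
    φ (Algebra.TensorProduct.map (σ : L →ₐ[k] L) (AlgHom.id k A) z) =
      TwistedAlgebra.act ρ σ (φ z)

/-- To show that `Spec A` is the torus of `M`, it suffices to give the characters. -/
theorem IsTorusOf.of_groupLike {A : Type w} [CommRing A] [HopfAlgebra k A]
    (ρ : Representation ℤ Gal(L/k) M) (ψ : AddMonoidAlgebra L M →ₐ[L] L ⊗[k] A)
    (hψ : Function.Bijective ψ)
    (hg : ∀ m, IsGroupLikeElem L (ψ (AddMonoidAlgebra.single m 1)))
    (hσ : ∀ (σ : Gal(L/k)) m,
      Algebra.TensorProduct.map (σ : L →ₐ[k] L) (AlgHom.id k A) (ψ (AddMonoidAlgebra.single m 1)) =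
        ψ (AddMonoidAlgebra.single (ρ σ m) 1)) :
    IsTorusOf A ρ := by
  let Ψ : AddMonoidAlgebra L M →ₐc[L] L ⊗[k] A := BialgHom.ofAlgHom ψ
    (by
      ext m
      · simpa using (hg _).counit_eq_one)
    (by
      ext m
      · simpa using (hg _).comul_eq_tmul_self.symm)
  have hΨ : ∀ x, Ψ x = ψ x := fun _ => rfl
  let φ := (BialgEquiv.ofBijective Ψ hψ).symm
  refine ⟨φ, fun σ z => ?_⟩
  obtain ⟨x, rfl⟩ := hψ.2 z
  have h1 : φ (ψ x) = x := (BialgEquiv.ofBijective Ψ hψ).symm_apply_apply x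
  rw [h1]
  have h2 : Algebra.TensorProduct.map (σ : L →ₐ[k] L) (AlgHom.id k A) (ψ x) =
      ψ (TwistedAlgebra.act ρ σ x) := by
    have : (Algebra.TensorProduct.map (σ : L →ₐ[k] L) (AlgHom.id k A)).toRingHom.comp
        ψ.toRingHom = ψ.toRingHom.comp (TwistedAlgebra.act ρ σ) := by
      refine AddMonoidAlgebra.ringHom_ext (fun c => ?_) fun m => ?_
      · change Algebra.TensorProduct.map (σ : L →ₐ[k] L) (AlgHom.id k A)
          (ψ (algebraMap L _ c)) = ψ (TwistedAlgebra.act ρ σ (TwistedAlgebra.single ρ 0 c))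
        rw [TwistedAlgebra.act_single, map_zero, AlgHom.commutes]
        refine Eq.trans ?_ (AlgHom.commutes ψ (σ c)).symm
        simp [Algebra.TensorProduct.algebraMap_apply]
      · change Algebra.TensorProduct.map (σ : L →ₐ[k] L) (AlgHom.id k A)
          (ψ (AddMonoidAlgebra.single m 1)) =
            ψ (TwistedAlgebra.act ρ σ (TwistedAlgebra.single ρ m 1))
        rw [TwistedAlgebra.act_single, hσ, map_one]
        rfl
    exact DFunLike.congr_fun this x
  rw [h2]
  exact (BialgEquiv.ofBijective Ψ hψ).symm_apply_apply _

theorem IsTorusOf.isFormOf {A : Type w} [CommRing A] [HopfAlgebra k A]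
    {ρ : Representation ℤ Gal(L/k) M} (h : IsTorusOf A ρ) : IsFormOf A ρ := by
  obtain ⟨φ, hφ⟩ := h
  let b := Module.Basis.ofVectorSpace k A
  let φ' : L ⊗[k] A ≃ₐ[L] TwistedAlgebra ρ := (φ : L ⊗[k] A ≃ₐ[L] AddMonoidAlgebra L M)
  refine ⟨(φ'.toAlgHom.restrictScalars k).comp Algebra.TensorProduct.includeRight,
    fun σ a => ?_, _, b, (Algebra.TensorProduct.basis L b).map φ'.toLinearEquiv, fun i => ?_⟩
  · have := hφ σ (1 ⊗ₜ a)
    simp only [Algebra.TensorProduct.map_tmul, map_one] at this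
    exact this.symm
  · rw [Module.Basis.map_apply, Algebra.TensorProduct.basis_apply]
    rfl

/-- The group-like elements of the group algebra `L[M]` are the elements of `M`. -/
theorem IsTorusOf.hasCharacterLattice {A : Type w} [CommRing A] [HopfAlgebra k A]
    {ρ : Representation ℤ Gal(L/k) M} (h : IsTorusOf A ρ) : HasCharacterLattice k L A ρ := by
  obtain ⟨φ, hφ⟩ := h
  have hgl : ∀ m, IsGroupLikeElem L (φ.symm (AddMonoidAlgebra.single m 1)) := fun m =>
    (AddMonoidAlgebra.isGroupLikeElem_of (R := L) (A := L) m).map φ.symm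
  let f : Multiplicative M →* GroupLike L (L ⊗[k] A) :=
    { toFun := fun m => ⟨φ.symm (AddMonoidAlgebra.single m.toAdd 1), hgl _⟩
      map_one' := GroupLike.val_injective (by
        exact map_one φ.symm)
      map_mul' := fun m n => GroupLike.val_injective (by
        change φ.symm _ = φ.symm _ * φ.symm _
        rw [← map_mul, AddMonoidAlgebra.single_mul_single, one_mul, toAdd_mul]) }
  have hf : Function.Bijective f := by
    constructor
    · intro m n hmn
      have h1 : φ.symm (AddMonoidAlgebra.single m.toAdd 1) =
        φ.symm (AddMonoidAlgebra.single n.toAdd 1) := congrArg GroupLike.val hmn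
      have h2 := congrArg (fun x : AddMonoidAlgebra L M => x.coeff m.toAdd) (φ.symm.injective h1)
      by_contra hne
      simp [hne, eq_comm] at h2
    · intro x
      have h1 : IsGroupLikeElem L (φ x.val) := x.isGroupLikeElem_val.map φ
      obtain ⟨m, hm⟩ := AddMonoidAlgebra.isGroupLikeElem_iff_mem_range_of.mp h1
      refine ⟨m, GroupLike.val_injective ?_⟩
      change φ.symm _ = _
      rw [← φ.symm_apply_apply x.val, ← hm]
      rfl
  refine ⟨MulEquiv.ofBijective f hf, fun σ m => ?_⟩
  change φ.symm (AddMonoidAlgebra.single (ρ σ m) 1) = Algebra.TensorProduct.map _ _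
    (φ.symm (AddMonoidAlgebra.single m 1))
  refine (EquivLike.injective φ) ?_
  change φ _ = φ _
  rw [hφ, φ.apply_symm_apply, φ.apply_symm_apply]
  refine Eq.trans ?_ (TwistedAlgebra.act_single σ m 1).symm
  rw [map_one]
  rfl

theorem IsTorusOf.isTorusSplitBy {A : Type w} [CommRing A] [HopfAlgebra k A]
    {ρ : Representation ℤ Gal(L/k) M} (h : IsTorusOf A ρ) {n : ℕ} (b : Module.Basis (Fin n) ℤ M) :
    IsTorusSplitBy k L A n := by
  obtain ⟨φ, -⟩ := h
  exact ⟨φ.trans (AddMonoidAlgebra.domCongrBialgEquiv L L b.equivFun.toAddEquiv)⟩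

theorem IsTorusOf.equiv {A : Type w} [CommRing A] [HopfAlgebra k A] (h : IsTorusOf A ρM)
    (e : ρM.Equiv ρN) : IsTorusOf A ρN := by
  obtain ⟨φ, hφ⟩ := h
  refine ⟨φ.trans (AddMonoidAlgebra.domCongrBialgEquiv L L e.toLinearEquiv.toAddEquiv), fun σ z => ?_⟩
  exact (congrArg (TwistedAlgebra.map e.toIntertwiningMap) (hφ σ z)).trans
    (TwistedAlgebra.smul_map e.toIntertwiningMap σ (φ z)).symm

end Split

section Descent

open Algebra.TensorProduct TwistedAlgebra

variable {k : Type u} {L : Type v} [Field k] [Field L] [Algebra k L]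
variable {M N M' N' : Type*} [AddCommGroup M] [AddCommGroup N] [AddCommGroup M'] [AddCommGroup N']

/-- Every algebra homomorphism between group algebras that commutes with the Galois actions
descends. -/
theorem exists_descended_hom {A : Type w} {C : Type w'} [CommRing A] [CommRing C]
    [Algebra k A] [Algebra k C] {ρM : Representation ℤ Gal(L/k) M}
    {ρN : Representation ℤ Gal(L/k) N} {j : A →ₐ[k] TwistedAlgebra ρM}
    {j' : C →ₐ[k] TwistedAlgebra ρN} (hj : ∀ (σ : Gal(L/k)) a, σ • j a = j a)
    (hinj : Function.Injective j')
    (hj' : ∀ x, (∀ σ : Gal(L/k), σ • x = x) ↔ x ∈ Set.range j')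
    (f : ρM.IntertwiningMap ρN) :
    ∃ F : A →ₐ[k] C, ∀ a, j' (F a) = TwistedAlgebra.map f (j a) := by
  have hmem : ∀ a, ((TwistedAlgebra.map f).restrictScalars k).comp j a ∈ j'.range := fun a =>
    (hj' _).mp fun σ => by
      rw [AlgHom.comp_apply, AlgHom.restrictScalars_apply, smul_map, hj]
  refine ⟨(AlgEquiv.ofInjective j' hinj).symm.toAlgHom.comp
    ((((TwistedAlgebra.map f).restrictScalars k).comp j).codRestrict j'.range hmem), fun a => ?_⟩
  exact congrArg Subtype.val ((AlgEquiv.ofInjective j' hinj).apply_symm_apply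
    ⟨((TwistedAlgebra.map f).restrictScalars k).comp j a, hmem a⟩)

theorem TwistedAlgebra.map_map {ρ : Representation ℤ Gal(L/k) M} {ρ' : Representation ℤ Gal(L/k) M'}
    {ρN : Representation ℤ Gal(L/k) N} (g : ρ'.IntertwiningMap ρN) (f : ρ.IntertwiningMap ρ')
    (x : TwistedAlgebra ρ) : map g (map f x) = map (g.comp f) x := by
  induction x using TwistedAlgebra.induction with
  | h0 => simp
  | hadd x y hx hy => simp [hx, hy]
  | hs m c => simp only [map_single]; rfl

theorem TwistedAlgebra.map_congr {ρ : Representation ℤ Gal(L/k) M}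
    {ρN : Representation ℤ Gal(L/k) N} {f g : ρ.IntertwiningMap ρN} (h : ∀ m, f m = g m)
    (x : TwistedAlgebra ρ) : map f x = map g x := by
  have : f = g := DFunLike.ext _ _ h
  rw [this]

theorem TwistedAlgebra.map_id {ρ : Representation ℤ Gal(L/k) M} (x : TwistedAlgebra ρ) :
    map (.id ρ) x = x := by
  induction x using TwistedAlgebra.induction with
  | h0 => simp
  | hadd x y hx hy => simp [hx, hy]
  | hs m c => simp only [map_single]; rfl

/-- The comultiplication of `L ⊗ A` is determined on `A` by that of `A`. -/
theorem map_comul_one_tmul {A : Type w} [CommRing A] [Bialgebra k A] {R : Type*} [CommRing R]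
    [Algebra k R] [Algebra L R] (D : (L ⊗[k] A) ⊗[L] (L ⊗[k] A) →ₐ[L] R) (J : A ⊗[k] A →ₐ[k] R)
    (h : ∀ a b, D ((1 ⊗ₜ a) ⊗ₜ (1 ⊗ₜ b)) = J (a ⊗ₜ b)) (a : A) :
    D (Coalgebra.comul (1 ⊗ₜ a)) = J (Coalgebra.comul a) := by
  rw [TensorProduct.comul_tmul, Bialgebra.comul_one]
  generalize (Coalgebra.comul a : A ⊗[k] A) = t
  induction t with
  | zero => simp
  | add x y hx hy => simp only [TensorProduct.tmul_add, map_add, hx, hy]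
  | tmul x y => exact h x y

section Compatibility

variable {A A' C C' : Type*} [CommRing A] [CommRing A'] [CommRing C] [CommRing C'] [Algebra k A]
  [Algebra k A'] [Algebra k C] [Algebra k C'] {ρ : Representation ℤ Gal(L/k) M}
  {ρ' : Representation ℤ Gal(L/k) M'} {τ : Representation ℤ Gal(L/k) N}
  {τ' : Representation ℤ Gal(L/k) N'}
  {j : A →ₐ[k] TwistedAlgebra ρ} {j' : A' →ₐ[k] TwistedAlgebra ρ'}
  {i : C →ₐ[k] TwistedAlgebra τ} {i' : C' →ₐ[k] TwistedAlgebra τ'}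

theorem prodMap_map {F : A →ₐ[k] C} {F' : A' →ₐ[k] C'} {f : ρ.IntertwiningMap τ}
    {f' : ρ'.IntertwiningMap τ'} (hF : ∀ a, i (F a) = TwistedAlgebra.map f (j a))
    (hF' : ∀ a, i' (F' a) = TwistedAlgebra.map f' (j' a)) (z : A ⊗[k] A') :
    prodMap i i' (Algebra.TensorProduct.map F F' z) =
      TwistedAlgebra.map ((f.comp (.fst ℤ ρ ρ')).prod (f'.comp (.snd ℤ ρ ρ'))) (prodMap j j' z) := by
  induction z with
  | zero => simp
  | add x y hx hy => simp [hx, hy]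
  | tmul a b =>
    rw [Algebra.TensorProduct.map_tmul, prodMap_tmul, hF, hF', prodMap_tmul, map_mul, map_map,
      map_map, map_map, map_map]
    exact congrArg₂ (· * ·) (map_congr (fun m => by exact Prod.ext rfl (map_zero f').symm) _)
      (map_congr (fun m => by exact Prod.ext (map_zero f).symm rfl) _)

theorem prodMap_assoc (z : (A ⊗[k] A') ⊗[k] C) :
    prodMap j (prodMap j' i) (Algebra.TensorProduct.assoc k k k A A' C z) =
      TwistedAlgebra.map (((Representation.IntertwiningMap.fst ℤ ρ ρ').comp
        (.fst ℤ (ρ.prod ρ') τ)).prod (((Representation.IntertwiningMap.snd ℤ ρ ρ').comp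
        (.fst ℤ (ρ.prod ρ') τ)).prod (.snd ℤ (ρ.prod ρ') τ))) (prodMap (prodMap j j') i z) := by
  induction z with
  | zero => simp
  | add x y hx hy => simp [hx, hy]
  | tmul x c =>
    induction x with
    | zero => simp
    | add x y hx hy => simp [TensorProduct.add_tmul, hx, hy]
    | tmul a b =>
      rw [Algebra.TensorProduct.assoc_tmul, prodMap_tmul, prodMap_tmul, prodMap_tmul, prodMap_tmul]
      simp only [map_mul, map_map, mul_assoc]
      rfl

theorem map_lift {F : A →ₐ[k] C} {F' : A' →ₐ[k] C} {f : ρ.IntertwiningMap τ}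
    {f' : ρ'.IntertwiningMap τ} (hF : ∀ a, i (F a) = TwistedAlgebra.map f (j a))
    (hF' : ∀ a, i (F' a) = TwistedAlgebra.map f' (j' a)) (z : A ⊗[k] A') :
    i (Algebra.TensorProduct.lift F F' (fun _ _ => Commute.all _ _) z) =
      TwistedAlgebra.map (f.comp (.fst ℤ ρ ρ') + f'.comp (.snd ℤ ρ ρ')) (prodMap j j' z) := by
  induction z with
  | zero => simp
  | add x y hx hy => simp [hx, hy]
  | tmul a b =>
    rw [Algebra.TensorProduct.lift_tmul, prodMap_tmul, map_mul, hF, hF', map_mul, map_map, map_map]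
    refine congrArg₂ (· * ·) (map_congr (fun m => ?_) _) (map_congr (fun m => ?_) _)
    · change f m = f m + f' 0
      rw [map_zero, add_zero]
    · change f' m = f 0 + f' m
      rw [map_zero, zero_add]

end Compatibility

variable [FiniteDimensional k L] [IsGalois k L]

namespace IsDescent

variable {A : Type w} [CommRing A] [Algebra k A] {ρ : Representation ℤ Gal(L/k) M}
  {j : A →ₐ[k] TwistedAlgebra ρ}

variable (ρ) in
/-- The diagonal map of a lattice. -/
abbrev diag : ρ.IntertwiningMap (ρ.prod ρ) := (Representation.IntertwiningMap.id ρ).prod (.id ρ)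

/-- The comultiplication of `L[M]` descends, as it belongs to the equivariant diagonal map of `M`.
-/
theorem exists_comul (h : IsDescent j) : ∃ F : A →ₐ[k] A ⊗[k] A,
    ∀ a, TwistedAlgebra.prodMap j j (F a) = TwistedAlgebra.map (diag ρ) (j a) :=
  exists_descended_hom h.1 (h.prodMap h).injective (h.prodMap h).mem_range_iff _

theorem exists_counit (h : IsDescent j) : ∃ F : A →ₐ[k] k, ∀ a,
    Algebra.ofId k (TwistedAlgebra (1 : Representation ℤ Gal(L/k) PUnit.{u + 1})) (F a) =
      TwistedAlgebra.map 0 (j a) :=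
  exists_descended_hom h.1 isDescent_ofId.injective isDescent_ofId.mem_range_iff _

theorem exists_antipode (h : IsDescent j) :
    ∃ F : A →ₐ[k] A, ∀ a, j (F a) = TwistedAlgebra.map (-.id ρ) (j a) :=
  exists_descended_hom h.1 h.injective h.mem_range_iff _

/-- The bialgebra structure of a form of a group algebra: comultiplication and counit descend. -/
abbrev bialgebra (h : IsDescent j) : Bialgebra k A :=
  Bialgebra.ofAlgHom h.exists_comul.choose h.exists_counit.choose
    (by
      ext a
      have hΔ := h.exists_comul.choose_spec
      have hid : ∀ a, j (AlgHom.id k A a) = TwistedAlgebra.map (.id ρ) (j a) := fun a =>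
        (map_id _).symm
      apply (h.prodMap (h.prodMap h)).injective
      refine (prodMap_assoc _).trans ?_
      refine (congrArg _ (prodMap_map hΔ hid _)).trans ?_
      refine Eq.trans ?_ (prodMap_map hid hΔ _).symm
      refine (congrArg (fun z => TwistedAlgebra.map _ (TwistedAlgebra.map _ z)) (hΔ a)).trans ?_
      refine Eq.trans ?_ (congrArg (TwistedAlgebra.map _) (hΔ a)).symm
      rw [map_map, map_map, map_map]
      rfl)
    (by
      ext a
      have hΔ := h.exists_comul.choose_spec
      have hε := h.exists_counit.choose_spec
      have hid : ∀ a, j (AlgHom.id k A a) = TwistedAlgebra.map (.id ρ) (j a) := fun a =>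
        (map_id _).symm
      apply (isDescent_ofId.prodMap h).injective
      refine (prodMap_map hε hid _).trans ?_
      refine (congrArg (TwistedAlgebra.map _) (hΔ a)).trans ?_
      rw [map_map]
      refine Eq.trans ?_ (prodMap_tmul _ _ 1 a).symm
      rw [map_one, map_one, one_mul]
      rfl)
    (by
      ext a
      have hΔ := h.exists_comul.choose_spec
      have hε := h.exists_counit.choose_spec
      have hid : ∀ a, j (AlgHom.id k A a) = TwistedAlgebra.map (.id ρ) (j a) := fun a =>
        (map_id _).symm
      apply (h.prodMap isDescent_ofId).injective
      refine (prodMap_map hid hε _).trans ?_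
      refine (congrArg (TwistedAlgebra.map _) (hΔ a)).trans ?_
      rw [map_map]
      refine Eq.trans ?_ (prodMap_tmul _ _ a 1).symm
      rw [map_one, map_one, mul_one]
      rfl)

/-- The Hopf algebra structure of a form of a group algebra. -/
abbrev hopfAlgebra (h : IsDescent j) : HopfAlgebra k A :=
  letI := h.bialgebra
  HopfAlgebra.ofAlgHom h.exists_antipode.choose
    (by
      ext a
      have hΔ := h.exists_comul.choose_spec
      have hε := h.exists_counit.choose_spec
      have hS := h.exists_antipode.choose_spec
      have hid : ∀ a, j (AlgHom.id k A a) = TwistedAlgebra.map (.id ρ) (j a) := fun a =>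
        (map_id _).symm
      apply h.injective
      refine (map_lift hS hid _).trans ?_
      have h1 : j (Algebra.ofId k A (h.exists_counit.choose a)) =
          TwistedAlgebra.map (0 : (1 : Representation ℤ Gal(L/k) PUnit.{u + 1}).IntertwiningMap ρ)
            (Algebra.ofId k _ (h.exists_counit.choose a)) :=
        (j.commutes _).trans (((TwistedAlgebra.map _).restrictScalars k).commutes _).symm
      refine Eq.trans ?_ h1.symm
      refine (congrArg _ (hΔ a)).trans ?_
      rw [hε, map_map, map_map]
      refine map_congr (fun m => ?_) _
      exact neg_add_cancel m)
    (by
      ext a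
      have hΔ := h.exists_comul.choose_spec
      have hε := h.exists_counit.choose_spec
      have hS := h.exists_antipode.choose_spec
      have hid : ∀ a, j (AlgHom.id k A a) = TwistedAlgebra.map (.id ρ) (j a) := fun a =>
        (map_id _).symm
      apply h.injective
      refine (map_lift hid hS _).trans ?_
      have h1 : j (Algebra.ofId k A (h.exists_counit.choose a)) =
          TwistedAlgebra.map (0 : (1 : Representation ℤ Gal(L/k) PUnit.{u + 1}).IntertwiningMap ρ)
            (Algebra.ofId k _ (h.exists_counit.choose a)) :=
        (j.commutes _).trans (((TwistedAlgebra.map _).restrictScalars k).commutes _).symm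
      refine Eq.trans ?_ h1.symm
      refine (congrArg _ (hΔ a)).trans ?_
      rw [hε, map_map, map_map]
      refine map_congr (fun m => ?_) _
      exact add_neg_cancel m)

/-- A form of the group algebra of a lattice is the coordinate ring of the torus of the lattice. -/
theorem isTorusOf (h : IsDescent j) : let := h.hopfAlgebra; IsTorusOf A ρ := by
  let := h.hopfAlgebra
  obtain ⟨hj, ι, b, B, hB⟩ := id h
  let φ : L ⊗[k] A →ₐ[L] TwistedAlgebra ρ := Algebra.TensorProduct.lift
    (Algebra.ofId L _) j fun _ _ => Commute.all _ _
  have hφ : ∀ c a, φ (c ⊗ₜ a) = c • j a := fun c a => by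
    rw [Algebra.TensorProduct.lift_tmul, Algebra.smul_def]
    rfl
  have hφbij : Function.Bijective φ := by
    let e := (Algebra.TensorProduct.basis L b).equiv B (Equiv.refl ι)
    have : φ.toLinearMap = e.toLinearMap := (Algebra.TensorProduct.basis L b).ext fun i => by
      rw [Algebra.TensorProduct.basis_apply]
      refine (hφ _ _).trans ?_
      rw [one_smul, hB, LinearEquiv.coe_coe, ← Algebra.TensorProduct.basis_apply,
        Module.Basis.equiv_apply]
      rfl
    have h2 : (φ : L ⊗[k] A → TwistedAlgebra ρ) = e := congrArg DFunLike.coe this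
    rw [h2]
    exact e.bijective
  let e : L ⊗[k] A ≃ₐ[L] TwistedAlgebra ρ := AlgEquiv.ofBijective φ hφbij
  let D : (L ⊗[k] A) ⊗[L] (L ⊗[k] A) →ₐ[L] TwistedAlgebra (ρ.prod ρ) :=
    Algebra.TensorProduct.lift ((TwistedAlgebra.map (.inl ℤ ρ ρ)).comp φ)
      ((TwistedAlgebra.map (.inr ℤ ρ ρ)).comp φ) fun _ _ => Commute.all _ _
  have hD : ∀ x y, D (x ⊗ₜ y) = TwistedAlgebra.map (.inl ℤ ρ ρ) (φ x) *
      TwistedAlgebra.map (.inr ℤ ρ ρ) (φ y) := fun x y => Algebra.TensorProduct.lift_tmul ..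
  have hDinj : Function.Injective D := by
    let E := (TensorProduct.congr e.toLinearEquiv e.toLinearEquiv).trans
      (TwistedAlgebra.tensorEquiv ρ ρ)
    have : ∀ x, D x = E x := by
      intro x
      induction x with
      | zero => simp
      | add x y hx hy => simp [hx, hy]
      | tmul x y => exact (hD x y).trans (tensorEquiv_tmul _ _).symm
    intro x y hxy
    exact E.injective (by rw [← this, ← this, hxy])
  have hcomul : ∀ z, D (Coalgebra.comul z) = TwistedAlgebra.map (diag ρ) (φ z) := by
    intro z
    have : D.comp (Bialgebra.comulAlgHom L (L ⊗[k] A)) =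
        (TwistedAlgebra.map (diag ρ)).comp φ := by
      ext a
      change D (Coalgebra.comul (1 ⊗ₜ a)) = TwistedAlgebra.map (diag ρ) (φ (1 ⊗ₜ a))
      rw [hφ, one_smul, ← h.exists_comul.choose_spec]
      refine map_comul_one_tmul D (TwistedAlgebra.prodMap j j) (fun x y => ?_) a
      rw [hD, hφ, hφ, prodMap_tmul, one_smul, one_smul]
    exact DFunLike.congr_fun this z
  refine IsTorusOf.of_groupLike ρ e.symm.toAlgHom e.symm.bijective (fun m => ?_) fun σ m => ?_
  · have hu : φ (e.symm (TwistedAlgebra.single ρ m 1)) = TwistedAlgebra.single ρ m 1 :=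
      e.apply_symm_apply _
    have hcm : Coalgebra.comul (R := L) (e.symm (TwistedAlgebra.single ρ m 1)) =
        e.symm (TwistedAlgebra.single ρ m 1) ⊗ₜ[L] e.symm (TwistedAlgebra.single ρ m 1) := by
      apply hDinj
      rw [hcomul, hD, hu, map_single, map_single, map_single, single_mul_single, one_mul]
      congr 1
      exact Prod.ext (add_zero m).symm (zero_add m).symm
    refine ⟨?_, hcm⟩
    -- The counit property gives `ε(u) u = u`.
    have h1 := Coalgebra.rTensor_counit_comul (R := L) (e.symm (TwistedAlgebra.single ρ m 1))
    rw [hcm, LinearMap.rTensor_tmul] at h1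
    have h2 := congrArg (fun z => φ (TensorProduct.lid L _ z)) h1
    simp only [TensorProduct.lid_tmul, map_smul, one_smul, hu] at h2
    rw [Algebra.smul_def, algebraMap_eq, single_mul_single, zero_add, mul_one] at h2
    classical
    have h3 := congrArg (TwistedAlgebra.coeff m) h2
    rw [coeff_single, coeff_single, if_pos rfl, if_pos rfl] at h3
    exact h3
  · apply e.injective
    have hσ : ∀ z, φ (Algebra.TensorProduct.map (σ : L →ₐ[k] L) (AlgHom.id k A) z) = σ • φ z := by
      intro z
      induction z with
      | zero => simp
      | add x y hx hy => simp only [map_add, smul_add, hx, hy]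
      | tmul c a =>
        rw [Algebra.TensorProduct.map_tmul, hφ, hφ, smul_smul_left, hj]
        rfl
    refine (hσ _).trans ?_
    change σ • e (e.symm (TwistedAlgebra.single ρ m 1)) =
      e (e.symm (TwistedAlgebra.single ρ (ρ σ m) 1))
    rw [e.apply_symm_apply, e.apply_symm_apply, smul_single, map_one]

end IsDescent

/-- The invariants of `L[M]` span it over `L`, by descent. -/
theorem span_invariants (ρ : Representation ℤ Gal(L/k) M) :
    Submodule.span L {x : TwistedAlgebra ρ | ∀ σ : Gal(L/k), σ • x = x} = ⊤ := by
  have hsemi : ∀ (σ : Gal(L/k)) (c : L) (x : TwistedAlgebra ρ),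
      σ • (c • x) = (σ • c) • (σ • x) := by
    intro σ c x
    rw [AlgEquiv.smul_def]
    exact smul_smul_left σ c x
  have h1 := @le_span_fixed Gal(L/k) _ _ L _ _ _ (TwistedAlgebra ρ) _ _ _ hsemi
  replace h1 := h1 ⊤ fun _ _ _ => Submodule.mem_top
  refine eq_top_iff.mpr (h1.trans (Submodule.span_mono ?_))
  exact fun x hx => hx.2

/-- The invariants of the group algebra of a lattice are a form of the group algebra. (The algebra
of invariants is replaced by a copy in the universe of the base field.) -/
theorem exists_isDescent [Small.{u} M] (ρ : Representation ℤ Gal(L/k) M) :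
    ∃ (B : Type u) (_ : CommRing B) (_ : Algebra k B) (j : B →ₐ[k] TwistedAlgebra ρ),
      IsDescent j := by
  classical
  let S : Subalgebra k (TwistedAlgebra ρ) :=
    { carrier := {x | ∀ σ : Gal(L/k), σ • x = x}
      mul_mem' := fun {x y} hx hy σ => by rw [smul_mul', hx, hy]
      add_mem' := fun {x y} hx hy σ => by rw [smul_add, hx, hy]
      algebraMap_mem' := fun c σ => by
        rw [IsScalarTower.algebraMap_apply k L, algebraMap_eq, smul_single]
        simp }
  have hLsmall : Small.{u} L :=
    small_map (Module.finBasis k L).equivFun.toEquiv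
  have hTsmall : Small.{u} (TwistedAlgebra ρ) := by
    have : Function.Injective fun (x : TwistedAlgebra ρ) (m : Shrink.{u} M) =>
      coeff ((equivShrink M).symm m) x :=
      fun x y h => ext_coeff fun m => by simpa using congrFun h (equivShrink M m)
    exact small_of_injective this
  obtain ⟨b, hbS, hbspan, hbind⟩ := exists_linearIndependent L
    {x : TwistedAlgebra ρ | ∀ σ : Gal(L/k), σ • x = x}
  let B : Module.Basis b L (TwistedAlgebra ρ) := Module.Basis.mk hbind (by
    rw [Subtype.range_coe, hbspan, span_invariants])
  have hB : ∀ (i : b), B i = i := fun i => by simp [B]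
  have hBfix : ∀ (σ : Gal(L/k)) i, σ • B i = B i := fun σ i => by rw [hB]; exact hbS i.2 σ
  let b₀ : b → S := fun i => ⟨i, hbS i.2⟩
  have hb₀ : ∀ i, (b₀ i : TwistedAlgebra ρ) = B i := fun i => (hB i).symm
  let B₀ : Module.Basis b k S := Module.Basis.mk (v := b₀)
    (by
      have h1 : LinearIndependent k fun i : b => (i : TwistedAlgebra ρ) :=
        hbind.restrict_scalars (R := k) fun x y hxy => by
            simpa [Algebra.smul_def] using hxy
      exact LinearIndependent.of_comp S.val.toLinearMap h1)
    (by
      rintro ⟨x, hx⟩ -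
      choose c hc using exists_repr_eq B hBfix hx
      have h1 : (⟨x, hx⟩ : S) = ∑ i ∈ (B.repr x).support, c i • b₀ i := by
        apply Subtype.ext
        rw [AddSubmonoidClass.coe_finsetSum]
        change x = _
        conv_lhs => rw [← B.linearCombination_repr x, Finsupp.linearCombination_apply, Finsupp.sum]
        refine Finset.sum_congr rfl fun i _ => ?_
        rw [← hc, algebraMap_smul, ← hb₀]
        rfl
      rw [h1]
      exact Submodule.sum_mem _ fun i _ =>
        Submodule.smul_mem _ _ (Submodule.subset_span ⟨i, rfl⟩))
  let e : Shrink.{u} S ≃ₐ[k] S := Shrink.algEquiv k S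
  refine ⟨Shrink.{u} S, inferInstance, inferInstance, S.val.comp e.toAlgHom, fun σ a => (e a).2 σ,
    Shrink.{u} b, (B₀.map e.symm.toLinearEquiv).reindex (equivShrink b),
    B.reindex (equivShrink b), fun i => ?_⟩
  simp only [Module.Basis.reindex_apply, Module.Basis.map_apply]
  change ((e (e.symm _) : S) : TwistedAlgebra ρ) = _
  rw [e.apply_symm_apply]
  simp [B₀, hb₀]

/-- Every lattice is the character lattice of a torus. -/
theorem exists_torus (n : ℕ) (ρ : Representation ℤ Gal(L/k) (Fin n → ℤ)) :
    ∃ (B : Type u) (_ : CommRing B) (_ : HopfAlgebra k B), IsTorusOf B ρ :=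
  let ⟨B, _, _, _, h⟩ := exists_isDescent ρ
  ⟨B, _, h.hopfAlgebra, h.isTorusOf⟩

end Descent

/-! ### The norm one torus -/

section Chevalley

variable {G : Type*} [Group G] (H : Subgroup G)

/-- The lattice `J_{G/H}`. -/
abbrev ChevalleyModule (H : Subgroup G) : Type _ := Module.Dual ℤ (augmentation H).ker.toSubmodule

/-- The coordinate function at the coset `x`, as an element of `J_{G/H}`. These elements generate
`J_{G/H}`; the only relation is that their sum is zero. -/
def coordinate (x : G ⧸ H) : ChevalleyModule H :=
  (Finsupp.lapply x ∘ₗ (MonoidAlgebra.coeffLinearEquiv ℤ).toLinearMap) ∘ₗ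
    (augmentation H).ker.toSubmodule.subtype

variable {H}

theorem coordinate_apply (x : G ⧸ H) (i : (augmentation H).ker.toSubmodule) :
    coordinate H x i = (i : MonoidAlgebra ℤ (G ⧸ H)).coeff x := rfl

theorem mem_augmentation_ker [Fintype (G ⧸ H)] (i : MonoidAlgebra ℤ (G ⧸ H)) :
    i ∈ (augmentation H).ker.toSubmodule ↔ ∑ x, i.coeff x = 0 := by
  change Finsupp.linearCombination ℤ (fun _ : G ⧸ H => (1 : ℤ)) i.coeff = 0 ↔ _
  rw [Finsupp.linearCombination_apply, Finsupp.sum_fintype _ _ (by simp)]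
  simp

theorem single_sub_single_mem [Finite (G ⧸ H)] (x y : G ⧸ H) :
    MonoidAlgebra.single x (1 : ℤ) - MonoidAlgebra.single y 1 ∈
      (augmentation H).ker.toSubmodule := by
  classical
  have := Fintype.ofFinite (G ⧸ H)
  rw [mem_augmentation_ker]
  simp [Finsupp.single_apply]

theorem sum_coordinate [Fintype (G ⧸ H)] : ∑ x, coordinate H x = 0 := by
  refine LinearMap.ext fun i => ?_
  rw [LinearMap.sum_apply]
  exact (mem_augmentation_ker _).mp i.2

theorem chevalley_coordinate (g : G) (x : G ⧸ H) :
    chevalley H g (coordinate H x) = coordinate H (g • x) := by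
  refine LinearMap.ext fun i => ?_
  change ((cosetLattice H) g⁻¹ (i : MonoidAlgebra ℤ (G ⧸ H))).coeff x =
    (i : MonoidAlgebra ℤ (G ⧸ H)).coeff (g • x)
  generalize (i : MonoidAlgebra ℤ (G ⧸ H)) = j
  induction j using MonoidAlgebra.induction_linear with
  | zero => simp
  | add a b ha hb => simp [ha, hb]
  | single a b =>
    classical
    rw [Representation.ofMulAction_single]
    simp only [MonoidAlgebra.coeff_single, Finsupp.single_apply, inv_smul_eq_iff]

/-- The coordinates generate `J_{G/H}`. -/
theorem sum_smul_coordinate [Fintype (G ⧸ H)] (x₀ : G ⧸ H)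
    (φ : ChevalleyModule H) :
    ∑ x, φ ⟨_, single_sub_single_mem x x₀⟩ • coordinate H x = φ := by
  classical
  refine LinearMap.ext fun i => ?_
  rw [LinearMap.sum_apply]
  have h : i = ∑ x, (i : MonoidAlgebra ℤ (G ⧸ H)).coeff x •
      (⟨_, single_sub_single_mem x x₀⟩ : (augmentation H).ker.toSubmodule) := by
    apply Subtype.ext
    rw [AddSubmonoidClass.coe_finsetSum]
    ext y
    have h0 := (mem_augmentation_ker _).mp i.2
    simp only [SetLike.val_smul, smul_sub, Finset.sum_sub_distrib, ← Finset.sum_smul, h0, zero_smul,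
      sub_zero]
    simp [MonoidAlgebra.coeff_sum]
  conv_rhs => rw [h, map_sum]
  refine Finset.sum_congr rfl fun x _ => ?_
  rw [map_smul, LinearMap.smul_apply, coordinate_apply, smul_eq_mul, smul_eq_mul, mul_comm]

theorem chevalley_hom_ext [Finite (G ⧸ H)] {A : Type*} [CommMonoid A]
    {f g : Multiplicative (ChevalleyModule H) →* A}
    (h : ∀ x, f (.ofAdd (coordinate H x)) = g (.ofAdd (coordinate H x))) : f = g := by
  have := Fintype.ofFinite (G ⧸ H)
  let F := MonoidHom.toAdditiveRight f.toHomUnits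
  let F' := MonoidHom.toAdditiveRight g.toHomUnits
  have hF : F = F' := by
    ext φ : 1
    rw [← sum_smul_coordinate (QuotientGroup.mk 1) φ, map_sum, map_sum]
    refine Finset.sum_congr rfl fun x _ => ?_
    rw [map_zsmul, map_zsmul]
    congr 1
    exact Units.ext (h x)
  refine MonoidHom.ext fun φ => ?_
  exact congrArg Units.val (DFunLike.congr_fun hF φ.toAdd)

theorem chevalley_algHom_ext [Finite (G ⧸ H)] {R A : Type*} [CommSemiring R] [CommSemiring A]
    [Algebra R A] {f g : AddMonoidAlgebra R (ChevalleyModule H) →ₐ[R] A}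
    (h : ∀ x, f (.single (coordinate H x) 1) = g (.single (coordinate H x) 1)) : f = g :=
  (AddMonoidAlgebra.lift R A (ChevalleyModule H)).symm.injective (chevalley_hom_ext h)

/-- `J_{G/H}` is free of rank `[G : H] - 1`. -/
theorem exists_basis_chevalley [Finite (G ⧸ H)] : Nonempty (Module.Basis (Fin (H.index - 1)) ℤ
    (ChevalleyModule H)) := by
  have := Fintype.ofFinite (G ⧸ H)
  have : Module.Free ℤ (MonoidAlgebra ℤ (G ⧸ H)) :=
    .of_equiv (MonoidAlgebra.coeffLinearEquiv ℤ).symm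
  have : Module.Finite ℤ (MonoidAlgebra ℤ (G ⧸ H)) :=
    .equiv (MonoidAlgebra.coeffLinearEquiv ℤ).symm
  have h1 : Module.finrank ℤ (augmentation H).ker.toSubmodule = H.index - 1 := by
    have h2 := Submodule.finrank_quotient_add_finrank
      (LinearMap.ker (augmentation H).toLinearMap)
    have h3 : Function.Surjective (augmentation H).toLinearMap := fun n =>
      ⟨MonoidAlgebra.single (QuotientGroup.mk 1) n, by simp [augmentation]⟩
    rw [((augmentation H).toLinearMap.quotKerEquivOfSurjective h3).finrank_eq,
      Module.finrank_self, (MonoidAlgebra.coeffLinearEquiv ℤ).finrank_eq,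
      Module.finrank_finsupp_self, ← Nat.card_eq_fintype_card] at h2
    exact (Nat.sub_eq_of_eq_add (h2.symm.trans (add_comm _ _))).symm
  exact ⟨Module.finBasisOfFinrankEq ℤ _ (by rw [Module.finrank_linearMap_self, h1])⟩

end Chevalley

section NormOneTorus

variable {k : Type u} {L : Type v} [Field k] [Field L] [Algebra k L] (K : IntermediateField k L)

/-- The embedding of `K` into `L` that belongs to a coset of `Gal(L/K)`. -/
def cosetEmbedding (x : Gal(L/k) ⧸ K.fixingSubgroup) : K →ₐ[k] L :=
  Quotient.liftOn' x (fun g => (g : L →ₐ[k] L).comp K.val) fun g h hgh => by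
    rw [QuotientGroup.leftRel_apply] at hgh
    ext y
    have := (IntermediateField.mem_fixingSubgroup_iff K _).mp hgh y y.2
    exact (AlgEquiv.eq_symm_apply g |>.mp this.symm)

variable {K}

theorem cosetEmbedding_mk (g : Gal(L/k)) (y : K) : cosetEmbedding K (QuotientGroup.mk g) y = g y :=
  rfl

theorem cosetEmbedding_smul (g : Gal(L/k)) (x : Gal(L/k) ⧸ K.fixingSubgroup) (y : K) :
    cosetEmbedding K (g • x) y = g (cosetEmbedding K x y) := by
  induction x using QuotientGroup.induction_on with
  | H h => rfl

theorem cosetEmbedding_injective : Function.Injective (cosetEmbedding K) := by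
  intro x y hxy
  induction x using QuotientGroup.induction_on with
  | H g =>
  induction y using QuotientGroup.induction_on with
  | H h =>
  rw [QuotientGroup.eq, IntermediateField.mem_fixingSubgroup_iff]
  intro a ha
  have := DFunLike.congr_fun hxy ⟨a, ha⟩
  rw [cosetEmbedding_mk, cosetEmbedding_mk] at this
  exact (AlgEquiv.symm_apply_eq g).mpr this.symm

section Evaluation

variable {R : Type*} [CommRing R] [Algebra k R] [Algebra L R] [IsScalarTower k L R]
variable {S : Type*} [CommRing S] [Algebra k S] [Algebra L S] [IsScalarTower k L S]

variable (R) in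
/-- The projection of `R ⊗ K ≃ Rⁿ` that belongs to an embedding of `K` into `L`. -/
def evalAt (x : Gal(L/k) ⧸ K.fixingSubgroup) : R ⊗[k] K →ₐ[R] R :=
  Algebra.TensorProduct.lift (AlgHom.id R R)
    (((Algebra.ofId L R).restrictScalars k).comp (cosetEmbedding K x)) fun _ _ => Commute.all _ _

theorem evalAt_tmul (x : Gal(L/k) ⧸ K.fixingSubgroup) (r : R) (y : K) :
    evalAt R x (r ⊗ₜ y) = r * algebraMap L R (cosetEmbedding K x y) :=
  Algebra.TensorProduct.lift_tmul ..

theorem evalAt_baseMap (σ : Gal(L/k)) (f : R →ₐ[k] S)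
    (hf : ∀ c, f (algebraMap L R c) = algebraMap L S (σ c)) (x : Gal(L/k) ⧸ K.fixingSubgroup)
    (z : R ⊗[k] K) : f (evalAt R x z) = evalAt S (σ • x) (baseMap K f z) := by
  induction z with
  | zero => simp
  | add a b ha hb => simp [ha, hb]
  | tmul r y =>
    rw [evalAt_tmul, baseMap, Algebra.TensorProduct.map_tmul, evalAt_tmul, map_mul, hf,
      cosetEmbedding_smul]
    rfl

theorem evalAt_baseMap' (f : R →ₐ[L] S) (x : Gal(L/k) ⧸ K.fixingSubgroup) (z : R ⊗[k] K) :
    f (evalAt R x z) = evalAt S x (baseMap K (f.restrictScalars k) z) := by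
  have := evalAt_baseMap 1 (f.restrictScalars k) (fun c => f.commutes c) x z
  rwa [one_smul] at this

variable [FiniteDimensional k L] [IsGalois k L] [Fintype (Gal(L/k) ⧸ K.fixingSubgroup)]

variable (K) in
/-- A basis of `K` indexed by the embeddings of `K` into `L`. -/
def embeddingBasis : Module.Basis (Gal(L/k) ⧸ K.fixingSubgroup) k K :=
  (Module.finBasisOfFinrankEq k K (n := Fintype.card (Gal(L/k) ⧸ K.fixingSubgroup))
    (by rw [IntermediateField.finrank_eq_fixingSubgroup_index, Subgroup.index,
      Nat.card_eq_fintype_card])).reindex (Fintype.equivFin _).symm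

variable (K R) in
/-- The matrix of the conjugates of a basis of `K`. -/
def embeddingMatrix : Matrix (Gal(L/k) ⧸ K.fixingSubgroup) (Gal(L/k) ⧸ K.fixingSubgroup) R :=
  .of fun x y => algebraMap L R (cosetEmbedding K x (embeddingBasis K y))

variable (R) in
/-- Dedekind: the embeddings of `K` into `L` are linearly independent, so their matrix is invertible
over `L`, hence over every `L`-algebra. -/
theorem isUnit_embeddingMatrix [DecidableEq (Gal(L/k) ⧸ K.fixingSubgroup)] :
    IsUnit (embeddingMatrix K R) := by
  have h : IsUnit (embeddingMatrix K L) := by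
    rw [← Matrix.linearIndependent_rows_iff_isUnit]
    have h1 := (linearIndependent_toLinearMap k K L).comp _ (cosetEmbedding_injective (K := K))
    exact h1.map' ((embeddingBasis K).constr L).symm.toLinearMap (LinearEquiv.ker _)
  have h2 := h.map (algebraMap L R).mapMatrix
  exact h2

theorem evalAt_eq_sum (x : Gal(L/k) ⧸ K.fixingSubgroup) (z : R ⊗[k] K) :
    evalAt R x z = ∑ y, embeddingMatrix K R x y *
      (Algebra.TensorProduct.basis R (embeddingBasis K)).repr z y := by
  conv_lhs => rw [← (Algebra.TensorProduct.basis R (embeddingBasis K)).sum_repr z, map_sum]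
  refine Finset.sum_congr rfl fun y _ => ?_
  rw [map_smul, Algebra.TensorProduct.basis_apply, evalAt_tmul, one_mul, smul_eq_mul, mul_comm]
  rfl

variable (R) in
/-- Over an `L`-algebra the algebra `K` splits: `R ⊗ K` is a product of copies of `R`. -/
theorem bijective_evalAt :
    Function.Bijective fun (z : R ⊗[k] K) (x : Gal(L/k) ⧸ K.fixingSubgroup) => evalAt R x z := by
  classical
  have h : (fun (z : R ⊗[k] K) (x : Gal(L/k) ⧸ K.fixingSubgroup) => evalAt R x z) =
      (embeddingMatrix K R).mulVec ∘
        (Algebra.TensorProduct.basis R (embeddingBasis K)).equivFun :=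
    funext fun z => funext fun x => evalAt_eq_sum x z
  rw [h]
  have hA := (Matrix.isUnit_iff_isUnit_det _).mp (isUnit_embeddingMatrix (K := K) R)
  refine Function.Bijective.comp (Function.bijective_iff_has_inverse.mpr
    ⟨(embeddingMatrix K R)⁻¹.mulVec, fun v => ?_, fun v => ?_⟩) (LinearEquiv.bijective _)
  · rw [Matrix.mulVec_mulVec, Matrix.nonsing_inv_mul _ hA, Matrix.one_mulVec]
  · rw [Matrix.mulVec_mulVec, Matrix.mul_nonsing_inv _ hA, Matrix.one_mulVec]

/-- In the split situation the norm is the product of the coordinates. -/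
theorem norm_eq_prod_evalAt (z : R ⊗[k] K) :
    Algebra.norm R z = ∏ x : Gal(L/k) ⧸ K.fixingSubgroup, evalAt R x z := by
  classical
  let B := Algebra.TensorProduct.basis R (embeddingBasis K)
  have h : embeddingMatrix K R * Algebra.leftMulMatrix B z =
      Matrix.diagonal (fun x : Gal(L/k) ⧸ K.fixingSubgroup => evalAt R x z) * embeddingMatrix K R := by
    ext x y
    rw [Matrix.mul_apply, Matrix.diagonal_mul]
    simp_rw [Algebra.leftMulMatrix_eq_repr_mul]
    rw [← evalAt_eq_sum, map_mul]
    congr 1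
    rw [Algebra.TensorProduct.basis_apply, evalAt_tmul, one_mul]
    rfl
  have h2 := congrArg Matrix.det h
  rw [Matrix.det_mul, Matrix.det_mul, Matrix.det_diagonal, mul_comm] at h2
  rw [Algebra.norm_eq_matrix_det B]
  exact ((Matrix.isUnit_iff_isUnit_det _).mp (isUnit_embeddingMatrix R)).mul_right_cancel h2

end Evaluation

section Splitting

variable [FiniteDimensional k L] [IsGalois k L]

variable (K) in
/-- The character of the norm one torus that belongs to an embedding of `K` into `L`, as a unit of
the coordinate ring. -/
def embeddingCharacter (x : Gal(L/k) ⧸ K.fixingSubgroup) : L ⊗[k] CoordRing k K :=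
  evalAt (L ⊗[k] CoordRing k K) x (pt Algebra.TensorProduct.includeRight)

theorem map_embeddingCharacter {R : Type*} [CommRing R] [Algebra k R] [Algebra L R]
    [IsScalarTower k L R] (f : L ⊗[k] CoordRing k K →ₐ[L] R)
    (x : Gal(L/k) ⧸ K.fixingSubgroup) :
    f (embeddingCharacter K x) =
      evalAt R x (pt ((f.restrictScalars k).comp Algebra.TensorProduct.includeRight)) := by
  rw [embeddingCharacter, evalAt_baseMap', pt_comp]

theorem galois_embeddingCharacter (σ : Gal(L/k)) (x : Gal(L/k) ⧸ K.fixingSubgroup) :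
    Algebra.TensorProduct.map (σ : L →ₐ[k] L) (AlgHom.id k (CoordRing k K))
      (embeddingCharacter K x) = embeddingCharacter K (σ • x) := by
  rw [embeddingCharacter, evalAt_baseMap σ _ (fun c => ?_), ← pt_comp]
  · congr 2
    ext a
    simp
  · simp [Algebra.TensorProduct.algebraMap_apply]

theorem isGroupLikeElem_embeddingCharacter (x : Gal(L/k) ⧸ K.fixingSubgroup) :
    IsGroupLikeElem L (embeddingCharacter K x) := by
  constructor
  · change Bialgebra.counitAlgHom L (L ⊗[k] CoordRing k K) _ = 1
    rw [map_embeddingCharacter]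
    have : ((Bialgebra.counitAlgHom L (L ⊗[k] CoordRing k K)).restrictScalars k).comp
        Algebra.TensorProduct.includeRight = (Algebra.ofId k L).comp (counitHom k K) := by
      ext a
      change Coalgebra.counit (R := L) ((1 : L) ⊗ₜ[k] a) = algebraMap k L (Coalgebra.counit a)
      rw [TensorProduct.counit_tmul]
      simp [Algebra.smul_def]
    rw [this, pt_counit_comp]
    exact (evalAt L x).map_one'
  · change Bialgebra.comulAlgHom L (L ⊗[k] CoordRing k K) _ = _
    let iL : L ⊗[k] CoordRing k K →ₐ[L] (L ⊗[k] CoordRing k K) ⊗[L] (L ⊗[k] CoordRing k K) :=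
      Algebra.TensorProduct.includeLeft
    let iR : L ⊗[k] CoordRing k K →ₐ[L] (L ⊗[k] CoordRing k K) ⊗[L] (L ⊗[k] CoordRing k K) :=
      Algebra.TensorProduct.includeRight
    let J : CoordRing k K ⊗[k] CoordRing k K →ₐ[k]
        (L ⊗[k] CoordRing k K) ⊗[L] (L ⊗[k] CoordRing k K) :=
      Algebra.TensorProduct.lift
        ((iL.restrictScalars k).comp
          Algebra.TensorProduct.includeRight)
        ((iR.restrictScalars k).comp
          Algebra.TensorProduct.includeRight) fun _ _ => Commute.all _ _
    have : ((Bialgebra.comulAlgHom L (L ⊗[k] CoordRing k K)).restrictScalars k).comp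
        Algebra.TensorProduct.includeRight = J.comp (comulHom k K) := by
      ext a
      refine map_comul_one_tmul (AlgHom.id L _) J (fun a b => ?_) a
      simp [J, iL, iR]
    rw [map_embeddingCharacter, this, pt_comul_comp, map_mul,
      Algebra.TensorProduct.lift_comp_includeLeft, Algebra.TensorProduct.lift_comp_includeRight',
      ← map_embeddingCharacter iL, ← map_embeddingCharacter iR]
    simp [iL, iR]

/-- The universal point has norm one; this is the relation `∑ x, coordinate H x = 0` in `J_{G/H}`.
-/
theorem prod_embeddingCharacter [Fintype (Gal(L/k) ⧸ K.fixingSubgroup)] :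
    ∏ x, embeddingCharacter K x = 1 := by
  rw [← norm_pt (K := K) (Algebra.TensorProduct.includeRight : _ →ₐ[k] L ⊗[k] CoordRing k K),
    norm_eq_prod_evalAt]
  rfl

/-- The norm one torus of `K/k` is the torus of the lattice `J_{G/H}`. -/
theorem isTorusOf_coordRing :
    IsTorusOf (CoordRing k K) (chevalley K.fixingSubgroup) := by
  classical
  have := Fintype.ofFinite (Gal(L/k) ⧸ K.fixingSubgroup)
  let u : Gal(L/k) ⧸ K.fixingSubgroup → (L ⊗[k] CoordRing k K)ˣ := fun x =>
    Units.mkOfMulEqOne (embeddingCharacter K x)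
      (∏ y ∈ Finset.univ.erase x, embeddingCharacter K y) (by
        rw [Finset.mul_prod_erase _ _ (Finset.mem_univ x), prod_embeddingCharacter])
  have hu : ∏ x, u x = 1 := Units.ext (by
    rw [Units.coe_prod]
    exact prod_embeddingCharacter)
  let x₀ : Gal(L/k) ⧸ K.fixingSubgroup := QuotientGroup.mk 1
  let χ : Multiplicative (ChevalleyModule K.fixingSubgroup) →*
      (L ⊗[k] CoordRing k K)ˣ :=
    { toFun := fun φ => ∏ x, u x ^ (φ.toAdd ⟨_, single_sub_single_mem x x₀⟩)
      map_one' := by simp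
      map_mul' := fun φ φ' => by
        simp [zpow_add, Finset.prod_mul_distrib] }
  have hχ : ∀ x, χ (.ofAdd (coordinate _ x)) = u x := by
    intro x
    change ∏ y, u y ^ (coordinate _ x ⟨_, single_sub_single_mem y x₀⟩) = u x
    have h1 : ∀ y, coordinate _ x ⟨_, single_sub_single_mem y x₀⟩ =
        (if y = x then 1 else 0) - if x₀ = x then 1 else 0 := fun y => by
      simp [coordinate_apply, Finsupp.single_apply]
    simp only [h1, zpow_sub, Finset.prod_mul_distrib, ← inv_zpow]
    rw [Finset.prod_zpow, Finset.prod_inv_distrib, hu]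
    simp
  let ψ : AddMonoidAlgebra L (ChevalleyModule K.fixingSubgroup) →ₐ[L] L ⊗[k] CoordRing k K :=
    AddMonoidAlgebra.lift L _ _ ((Units.coeHom _).comp χ)
  let P := (Units.coeHom _).comp χ
  have hψ : ∀ φ, ψ (AddMonoidAlgebra.single φ 1) = P (.ofAdd φ) := fun φ => by
    simp [ψ, P, AddMonoidAlgebra.lift_single]
  have hP : ∀ x, P (.ofAdd (coordinate _ x)) = embeddingCharacter K x :=
    fun x => congrArg Units.val (hχ x)
  have hψ' : ∀ x, ψ (AddMonoidAlgebra.single (coordinate _ x) 1) = embeddingCharacter K x :=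
    fun x => by rw [hψ, hP]
  obtain ⟨z, hz⟩ := (bijective_evalAt (K := K)
    (AddMonoidAlgebra L (ChevalleyModule K.fixingSubgroup))).2
    fun x => AddMonoidAlgebra.single (coordinate _ x) 1
  replace hz := fun x => congrFun hz x
  dsimp only at hz
  have hzn : Algebra.norm (AddMonoidAlgebra L (ChevalleyModule K.fixingSubgroup)) z = 1 := by
    rw [norm_eq_prod_evalAt, Finset.prod_congr rfl fun x _ => hz x]
    have h1 := map_prod (AddMonoidAlgebra.of L (ChevalleyModule K.fixingSubgroup))
      (fun x => .ofAdd (coordinate K.fixingSubgroup x)) Finset.univ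
    rw [← ofAdd_sum, sum_coordinate] at h1
    exact h1.symm.trans (map_one _)
  let f := ofPt z hzn
  have hf : pt f = z := pt_ofPt z hzn
  let θ : L ⊗[k] CoordRing k K →ₐ[L] AddMonoidAlgebra L (ChevalleyModule K.fixingSubgroup) :=
    Algebra.TensorProduct.lift (Algebra.ofId L _) f fun _ _ => Commute.all _ _
  have hθf : (θ.restrictScalars k).comp Algebra.TensorProduct.includeRight = f := by
    ext a
    simp [θ]
  have hθ : ∀ x, θ (embeddingCharacter K x) = AddMonoidAlgebra.single (coordinate _ x) 1 :=
    fun x => by rw [map_embeddingCharacter, hθf, hf, hz]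
  have h1 : θ.comp ψ = AlgHom.id L _ := chevalley_algHom_ext fun x => by
    change θ (ψ _) = _
    rw [hψ', hθ]
    rfl
  have h2 : ψ.comp θ = AlgHom.id L _ := by
    have h3 : (ψ.restrictScalars k).comp f = Algebra.TensorProduct.includeRight := by
      apply pt_injective
      apply (bijective_evalAt _).1
      funext x
      dsimp only
      rw [pt_comp, hf, ← evalAt_baseMap', hz, hψ']
      rfl
    refine Algebra.TensorProduct.ext (AlgHom.ext fun c => ?_) (AlgHom.ext fun a => ?_)
    · exact (AlgHom.commutes (ψ.comp θ) c).trans (AlgHom.commutes (AlgHom.id L _) c).symm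
    · refine Eq.trans (congrArg ψ ?_) (DFunLike.congr_fun h3 a)
      exact DFunLike.congr_fun hθf a
  refine IsTorusOf.of_groupLike _ ψ
    ⟨fun a b hab => ?_, fun b => ⟨θ b, DFunLike.congr_fun h2 b⟩⟩ (fun φ => ⟨?_, ?_⟩) fun σ φ => ?_
  · have := congrArg θ hab
    change (θ.comp ψ) a = (θ.comp ψ) b at this
    rwa [h1] at this
  · have : ((Bialgebra.counitAlgHom L (L ⊗[k] CoordRing k K) : _ →* L)).comp P = 1 :=
      chevalley_hom_ext fun x => by
        refine (congrArg (Bialgebra.counitAlgHom L (L ⊗[k] CoordRing k K)) (hP x)).trans ?_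
        exact (isGroupLikeElem_embeddingCharacter x).counit_eq_one
    rw [hψ]
    exact DFunLike.congr_fun this _
  · let iL : L ⊗[k] CoordRing k K →ₐ[L] (L ⊗[k] CoordRing k K) ⊗[L] (L ⊗[k] CoordRing k K) :=
      Algebra.TensorProduct.includeLeft
    let iR : L ⊗[k] CoordRing k K →ₐ[L] (L ⊗[k] CoordRing k K) ⊗[L] (L ⊗[k] CoordRing k K) :=
      Algebra.TensorProduct.includeRight
    let mL : L ⊗[k] CoordRing k K →* (L ⊗[k] CoordRing k K) ⊗[L] (L ⊗[k] CoordRing k K) := iL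
    let mR : L ⊗[k] CoordRing k K →* (L ⊗[k] CoordRing k K) ⊗[L] (L ⊗[k] CoordRing k K) := iR
    let mΔ : L ⊗[k] CoordRing k K →* (L ⊗[k] CoordRing k K) ⊗[L] (L ⊗[k] CoordRing k K) :=
      Bialgebra.comulAlgHom L (L ⊗[k] CoordRing k K)
    have : mΔ.comp P = mL.comp P * mR.comp P := chevalley_hom_ext fun x => by
        simp only [MonoidHom.comp_apply, MonoidHom.mul_apply, hP]
        change Coalgebra.comul (R := L) (embeddingCharacter K x) =
          (embeddingCharacter K x ⊗ₜ 1) * (1 ⊗ₜ embeddingCharacter K x)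
        rw [(isGroupLikeElem_embeddingCharacter x).comul_eq_tmul_self]
        simp
    rw [hψ]
    refine (DFunLike.congr_fun this _).trans ?_
    change (P _ ⊗ₜ[L] 1) * (1 ⊗ₜ[L] P _) = _
    simp
  · have : ((Algebra.TensorProduct.map (σ : L →ₐ[k] L) (AlgHom.id k (CoordRing k K)) :
        _ →ₐ[k] _) : _ →* _).comp P = P.comp
          (AddMonoidHom.toMultiplicative ((chevalley K.fixingSubgroup σ).toAddMonoidHom)) :=
      chevalley_hom_ext fun x => by
        refine (congrArg _ (hP x)).trans ((galois_embeddingCharacter σ x).trans ?_)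
        refine (hP _).symm.trans (congrArg (fun y => P (.ofAdd y)) ?_)
        exact (chevalley_coordinate σ x).symm
    rw [hψ, hψ]
    exact DFunLike.congr_fun this _

theorem isTorusSplitBy_coordRing :
    IsTorusSplitBy k L (CoordRing k K) (Module.finrank k K - 1) := by
  rw [IntermediateField.finrank_eq_fixingSubgroup_index]
  exact isTorusOf_coordRing.isTorusSplitBy exists_basis_chevalley.some

end Splitting

end NormOneTorus

/-! ### Flabby lattices -/

section Flabby

variable {G : Type*} [Group G] {M N : Type*} [AddCommGroup M] [AddCommGroup N]

/-- The permutation lattice of a `G`-set. -/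
abbrev permLattice (G X : Type*) [Group G] [MulAction G X] :
    Representation ℤ G (MonoidAlgebra ℤ X) :=
  Representation.ofMulAction ℤ G X

/-- The basis of a permutation lattice. -/
def permBasis (X : Type*) : Module.Basis X ℤ (MonoidAlgebra ℤ X) :=
  .ofRepr (MonoidAlgebra.coeffLinearEquiv ℤ)

theorem permBasis_apply {X : Type*} (x : X) : permBasis X x = MonoidAlgebra.single x 1 := rfl

theorem isPermutationLattice_permLattice (X : Type*) [MulAction G X] [Finite X] :
    IsPermutationLattice (permLattice G X) :=
  .of_basis (permBasis X) fun g x => ⟨g • x, by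
    rw [permBasis_apply, permBasis_apply, Representation.ofMulAction_single]⟩

/-- A direct summand of a flabby lattice is flabby. -/
theorem IsFlabby.of_retract [Finite G] {ρ : Representation ℤ G M} {σ : Representation ℤ G N}
    (h : IsFlabby σ) (i : ρ.IntertwiningMap σ) (r : σ.IntertwiningMap ρ)
    (hr : ∀ x, r (i x) = x) : IsFlabby ρ := by
  intro S v hv
  have := Fintype.ofFinite S
  rw [finsum_eq_sum_of_fintype] at hv
  have h1 := h S (i v) (by
    rw [finsum_eq_sum_of_fintype]
    simp_rw [← i.isIntertwining]
    rw [← map_sum, hv, map_zero])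
  have h2 := Submodule.mem_map_of_mem (f := r.toLinearMap) h1
  rw [Submodule.map_span, r.toLinearMap_apply, hr] at h2
  refine Submodule.span_mono ?_ h2
  rintro _ ⟨_, ⟨s, w, rfl⟩, rfl⟩
  exact ⟨s, r w, by rw [map_sub, r.toLinearMap_apply, r.isIntertwining]; rfl⟩

/-- Permutation lattices are flabby: modulo the elements `s • w - w` every element is congruent to
one that is supported on representatives of the orbits, and such an element has nonzero norm. -/
theorem isFlabby_permLattice [Finite G] (X : Type*) [MulAction G X] [Finite X] :
    IsFlabby (permLattice G X) := by
  classical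
  intro S v hv
  have := Fintype.ofFinite S
  have := Fintype.ofFinite X
  rw [finsum_eq_sum_of_fintype] at hv
  let I := Submodule.span ℤ {x | ∃ (s : S) (w : MonoidAlgebra ℤ X), x = permLattice G X s w - w}
  let r : X → X := fun x => (Quotient.mk'' x : MulAction.orbitRel.Quotient S X).out
  have hr : ∀ x, ∃ s : S, s • x = r x := fun x => by
    have : (MulAction.orbitRel S X) (r x) x := Quotient.exact (Quotient.out_eq _)
    exact MulAction.orbitRel_apply.mp this
  have hr' : ∀ (s : S) x, r (s • x) = r x := fun s x => by
    have : (Quotient.mk'' (s • x) : MulAction.orbitRel.Quotient S X) = Quotient.mk'' x :=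
      Quotient.sound (MulAction.orbitRel_apply.mpr ⟨s, rfl⟩)
    exact congrArg Quotient.out this
  have hsingle : ∀ x : X, MonoidAlgebra.single x (1 : ℤ) - MonoidAlgebra.single (r x) 1 ∈ I := by
    intro x
    obtain ⟨s, hs⟩ := hr x
    rw [← neg_sub]
    refine I.neg_mem (Submodule.subset_span ⟨s, MonoidAlgebra.single x 1, ?_⟩)
    rw [Representation.ofMulAction_single, ← hs]
    rfl
  have hsum : v = ∑ x, v.coeff x • MonoidAlgebra.single x (1 : ℤ) :=
    ((permBasis X).sum_repr v).symm
  let v' := ∑ x, v.coeff x • MonoidAlgebra.single (r x) (1 : ℤ)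
  have hvv' : v - v' ∈ I := by
    rw [hsum, ← Finset.sum_sub_distrib]
    refine I.sum_mem fun x _ => ?_
    rw [← smul_sub]
    exact I.smul_mem _ (hsingle x)
  have hN : ∀ z ∈ I, ∑ s : S, permLattice G X s z = 0 := by
    intro z hz
    induction hz using Submodule.span_induction with
    | zero => simp
    | add a b _ _ ha hb => simp [Finset.sum_add_distrib, ha, hb]
    | smul c a _ ha => simp [← Finset.smul_sum, ha]
    | mem z hz =>
      obtain ⟨t, w, rfl⟩ := hz
      simp_rw [map_sub]
      rw [Finset.sum_sub_distrib, sub_eq_zero]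
      refine Fintype.sum_equiv (Equiv.mulRight t) _ _ fun s => ?_
      rw [Equiv.coe_mulRight, Subgroup.coe_mul, map_mul]
      rfl
  have hNv' : ∑ s : S, permLattice G X s v' = 0 := by
    have := hN _ hvv'
    simp_rw [map_sub] at this
    rw [Finset.sum_sub_distrib, hv, zero_sub, neg_eq_zero] at this
    exact this
  have hact : ∀ (s : S) (z : MonoidAlgebra ℤ X) y,
      (permLattice G X s z).coeff y = z.coeff (s⁻¹ • y) := by
    intro s z y
    induction z using MonoidAlgebra.induction_linear with
    | zero => simp
    | add a b ha hb => simp [ha, hb]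
    | single a b =>
      rw [Representation.ofMulAction_single]
      simp only [MonoidAlgebra.coeff_single, Finsupp.single_apply, eq_inv_smul_iff]
      rfl
  have hsupp : ∀ y, v'.coeff y ≠ 0 → r y = y := by
    intro y hy
    have h1 : v'.coeff y = ∑ x, if r x = y then v.coeff x else 0 := by
      simp [v', MonoidAlgebra.coeff_sum, Finsupp.single_apply]
    rw [h1] at hy
    obtain ⟨x, -, hx⟩ := Finset.exists_ne_zero_of_sum_ne_zero hy
    have hxy : r x = y := by
      by_contra h
      simp [h] at hx
    obtain ⟨s, hs⟩ := hr x
    rw [← hxy]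
    conv_lhs => rw [← hs, hr']
  have hv'0 : v' = 0 := by
    ext y
    by_contra hy
    have hy' := hsupp y hy
    have h1 := congrArg (fun z : MonoidAlgebra ℤ X => z.coeff y) hNv'
    simp only [MonoidAlgebra.coeff_sum, Finsupp.finsetSum_apply, hact] at h1
    have h2 : ∀ s : S, v'.coeff (s⁻¹ • y) = if s⁻¹ • y = y then v'.coeff y else 0 := by
      intro s
      split_ifs with h
      · rw [h]
      · by_contra h0
        have := hsupp _ h0
        rw [hr', hy'] at this
        exact h this.symm
    simp_rw [h2] at h1
    rw [← Finset.sum_filter, Finset.sum_const] at h1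
    rcases smul_eq_zero.mp h1 with h3 | h3
    · rw [Finset.card_eq_zero] at h3
      have : (1 : S) ∈ Finset.univ.filter fun s : S => s⁻¹ • y = y := by simp
      rw [h3] at this
      simp at this
    · exact hy h3
  rw [hv'0, sub_zero] at hvv'
  exact hvv'

end Flabby

/-! ### Flabby resolutions of `J_{G/H}` -/

section Lattices

/-- A sublattice of full rank has finite index. -/
theorem exists_smul_mem_of_finrank_eq {V : Type*} [AddCommGroup V] [Module.Finite ℤ V]
    {M₁ M₂ : Submodule ℤ V} (h : M₁ ≤ M₂) (hr : Module.finrank ℤ M₁ = Module.finrank ℤ M₂)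
    {x : V} (hx : x ∈ M₂) : ∃ c : ℤ, c ≠ 0 ∧ c • x ∈ M₁ := by
  have h1 := Submodule.finrank_quotient_add_finrank (M₁.submoduleOf M₂)
  rw [(Submodule.submoduleOfEquivOfLe h).finrank_eq, hr, Nat.add_eq_right,
    Module.finrank_eq_zero_iff] at h1
  obtain ⟨c, hc, h2⟩ := h1 (Submodule.Quotient.mk ⟨x, hx⟩)
  refine ⟨c, hc, ?_⟩
  rw [← Submodule.Quotient.mk_smul, Submodule.Quotient.mk_eq_zero] at h2
  exact h2

variable {G : Type*} [Group G] {M N V : Type*} [AddCommGroup M] [AddCommGroup N] [AddCommGroup V]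
  {ρ : Representation ℤ G M} {σ : Representation ℤ G N} {τ : Representation ℤ G V}

theorem IsFlabby.prod [Finite G] (h : IsFlabby ρ) (h' : IsFlabby σ) : IsFlabby (ρ.prod σ) := by
  intro S v hv
  have := Fintype.ofFinite S
  rw [finsum_eq_sum_of_fintype] at hv
  have h1 := h S v.1 (by
    rw [finsum_eq_sum_of_fintype]
    have := congrArg (Representation.IntertwiningMap.fst ℤ ρ σ) hv
    rw [map_sum, map_zero] at this
    exact this)
  have h2 := h' S v.2 (by
    rw [finsum_eq_sum_of_fintype]
    have := congrArg (Representation.IntertwiningMap.snd ℤ ρ σ) hv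
    rw [map_sum, map_zero] at this
    exact this)
  have h3 := Submodule.mem_map_of_mem (f := LinearMap.inl ℤ M N) h1
  have h4 := Submodule.mem_map_of_mem (f := LinearMap.inr ℤ M N) h2
  rw [Submodule.map_span] at h3 h4
  have h5 : v = LinearMap.inl ℤ M N v.1 + LinearMap.inr ℤ M N v.2 := by simp
  rw [h5]
  refine Submodule.add_mem _ (Submodule.span_mono ?_ h3) (Submodule.span_mono ?_ h4)
  · rintro _ ⟨_, ⟨s, w, rfl⟩, rfl⟩
    exact ⟨s, (w, 0), by simp⟩
  · rintro _ ⟨_, ⟨s, w, rfl⟩, rfl⟩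
    exact ⟨s, (0, w), by simp⟩

/-- Two injective maps with the same image identify their sources. -/
theorem equiv_of_range_eq (f : ρ.IntertwiningMap τ) (g : σ.IntertwiningMap τ)
    (hf : Function.Injective f) (hg : Function.Injective g) (hfg : ∀ x, ∃ y, g y = f x)
    (hgf : ∀ y, ∃ x, f x = g y) : Nonempty (ρ.Equiv σ) := by
  have hr : LinearMap.range f.toLinearMap = LinearMap.range g.toLinearMap := by
    apply le_antisymm
    · rintro _ ⟨x, rfl⟩
      exact hfg x
    · rintro _ ⟨x, rfl⟩
      exact hgf x
  let e : M ≃ₗ[ℤ] N := (LinearEquiv.ofInjective f.toLinearMap hf).trans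
    ((LinearEquiv.ofEq _ _ hr).trans (LinearEquiv.ofInjective g.toLinearMap hg).symm)
  have he : ∀ x, g (e x) = f x := fun x => by
    have := congrArg Subtype.val ((LinearEquiv.ofInjective g.toLinearMap hg).apply_symm_apply
      (LinearEquiv.ofEq _ _ hr (LinearEquiv.ofInjective f.toLinearMap hf x)))
    exact this
  refine ⟨.mk e fun γ => LinearMap.ext fun x => hg ?_⟩
  change g (e (ρ γ x)) = g (σ γ (e x))
  rw [he, f.isIntertwining, g.isIntertwining, he]

/-- The product of two isomorphisms of representations. -/
def prodEquiv {M' N' : Type*} [AddCommGroup M'] [AddCommGroup N'] {ρ' : Representation ℤ G M'}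
    {σ' : Representation ℤ G N'} (e : ρ.Equiv ρ') (e' : σ.Equiv σ') :
    (ρ.prod σ).Equiv (ρ'.prod σ') :=
  .mk (e.toLinearEquiv.prodCongr e'.toLinearEquiv) fun g => LinearMap.ext fun x =>
    Prod.ext (e.isIntertwining _ _ g x.1) (e'.isIntertwining _ _ g x.2)

theorem IsStablyPermutation.of_equiv (hσ : IsPermutationLattice σ) (hτ : IsPermutationLattice τ)
    (e : (ρ.prod σ).Equiv τ) : IsStablyPermutation ρ := by
  obtain ⟨m, b, -⟩ := id hσ
  obtain ⟨n, c, -⟩ := id hτ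
  let s := transportEquiv σ b.equivFun
  let t := transportEquiv τ c.equivFun
  exact ⟨m, n, _, _, hσ.equiv s, hτ.equiv t,
    ⟨(prodEquiv (.refl ρ) s.symm).trans (e.trans t)⟩⟩

theorem finrank_permLattice (X : Type*) :
    Module.finrank ℤ (MonoidAlgebra ℤ X) = Nat.card X :=
  Module.finrank_eq_nat_card_basis (permBasis X)

instance (X : Type*) : Module.Free ℤ (MonoidAlgebra ℤ X) := .of_basis (permBasis X)

instance (X : Type*) [Finite X] : Module.Finite ℤ (MonoidAlgebra ℤ X) := .of_basis (permBasis X)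

end Lattices

section Presentation

variable {G : Type*} [Group G] {H : Subgroup G}
variable {P : Type*} [MulAction G P]

/-- The dual `J_{G/H} → ℤ[P]` of a map `π : ℤ[P] → I_{G/H}`. -/
def dualHom [Fintype P] (π : (permLattice G P).IntertwiningMap (cosetLattice H))
    (hπ : ∀ x, π x ∈ (augmentation H).ker.toSubmodule) :
    (chevalley H).IntertwiningMap (permLattice G P) where
  toFun φ := ∑ p, φ ⟨π (.single p 1), hπ _⟩ • MonoidAlgebra.single p 1
  map_add' φ φ' := by simp [Finset.sum_add_distrib]
  map_smul' c φ := by simp [Finset.smul_sum, mul_comm]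
  isIntertwining' g := by
    refine LinearMap.ext fun φ => ?_
    change ∑ p, φ ((augmentation H).ker.toRepresentation g⁻¹ ⟨π (.single p 1), hπ _⟩) •
      MonoidAlgebra.single p (1 : ℤ) =
        permLattice G P g (∑ p, φ ⟨π (.single p 1), hπ _⟩ • MonoidAlgebra.single p 1)
    rw [map_sum]
    symm
    refine Fintype.sum_equiv (MulAction.toPerm g) _ _ fun p => ?_
    rw [map_smul, Representation.ofMulAction_single]
    refine congrArg₂ (· • ·) (congrArg φ (Subtype.ext ?_)) rfl
    change _ = cosetLattice H g⁻¹ (π (.single (g • p) 1))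
    rw [← π.isIntertwining, Representation.ofMulAction_single, inv_smul_smul]

theorem dualHom_coeff [Fintype P] (π : (permLattice G P).IntertwiningMap (cosetLattice H))
    (hπ : ∀ x, π x ∈ (augmentation H).ker.toSubmodule) (φ : ChevalleyModule H) (p : P) :
    (dualHom π hπ φ).coeff p = φ ⟨π (.single p 1), hπ _⟩ := by
  classical
  change (∑ p, φ ⟨π (.single p 1), hπ _⟩ • MonoidAlgebra.single p (1 : ℤ)).coeff p = _
  simp [MonoidAlgebra.coeff_sum, Finsupp.single_apply]

/-- The image of the dual of a surjection onto `I_{G/H}` is a saturated sublattice. -/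
theorem exists_dualHom_eq [Fintype P] (π : (permLattice G P).IntertwiningMap (cosetLattice H))
    (hπ : ∀ x, π x ∈ (augmentation H).ker.toSubmodule)
    (hsurj : ∀ i ∈ (augmentation H).ker.toSubmodule, ∃ x, π x = i)
    {c : ℤ} (hc : c ≠ 0) {x : MonoidAlgebra ℤ P} {φ : ChevalleyModule H}
    (h : c • x = dualHom π hπ φ) : ∃ ψ, dualHom π hπ ψ = x := by
  have hdvd : ∀ i, ∃ n, φ i = c * n := by
    rintro ⟨i, hi⟩
    obtain ⟨y, rfl⟩ := hsurj i hi
    induction y using MonoidAlgebra.induction_linear with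
    | zero => exact ⟨0, (congrArg φ (Subtype.ext (map_zero π))).trans
        ((map_zero φ).trans (mul_zero c).symm)⟩
    | add a b ha hb =>
      obtain ⟨m, hm⟩ := ha (hπ _)
      obtain ⟨n, hn⟩ := hb (hπ _)
      refine ⟨m + n, ?_⟩
      rw [mul_add, ← hm, ← hn, ← map_add]
      congr 1
      exact Subtype.ext (map_add π a b)
    | single p n =>
      refine ⟨n * x.coeff p, ?_⟩
      have h1 : (⟨π (.single p n), hi⟩ : (augmentation H).ker.toSubmodule) =
          n • ⟨π (.single p 1), hπ _⟩ := Subtype.ext (by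
        rw [SetLike.val_smul, ← map_smul]
        simp)
      rw [h1, map_smul, ← dualHom_coeff, ← h]
      simp
      ring
  choose ψ hψ using hdvd
  let ψ' : ChevalleyModule H :=
    { toFun := ψ
      map_add' := fun a b => mul_left_cancel₀ hc (by
        rw [← hψ, map_add, hψ, hψ, mul_add])
      map_smul' := fun n a => mul_left_cancel₀ hc (by
        rw [← hψ, map_smul, hψ, smul_eq_mul, smul_eq_mul, RingHom.id_apply, mul_left_comm]) }
  refine ⟨ψ', ?_⟩
  ext p
  refine mul_left_cancel₀ hc ?_
  rw [dualHom_coeff]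
  refine (hψ _).symm.trans ?_
  rw [← dualHom_coeff, ← h]
  simp

/-- The dual of a surjection is injective. -/
theorem dualHom_injective [Fintype P] (π : (permLattice G P).IntertwiningMap (cosetLattice H))
    (hπ : ∀ x, π x ∈ (augmentation H).ker.toSubmodule)
    (hsurj : ∀ i ∈ (augmentation H).ker.toSubmodule, ∃ x, π x = i) :
    Function.Injective (dualHom π hπ) := by
  rw [injective_iff_map_eq_zero]
  intro φ hφ
  refine LinearMap.ext fun ⟨i, hi⟩ => ?_
  obtain ⟨y, rfl⟩ := hsurj i hi
  have h0 : (φ ∘ₗ π.toLinearMap.codRestrict (augmentation H).ker.toSubmodule hπ) = 0 := by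
    refine (permBasis P).ext fun p => ?_
    refine (dualHom_coeff π hπ φ p).symm.trans ?_
    rw [hφ]
    rfl
  exact LinearMap.congr_fun h0 y

/-- A flabby resolution of `J_{G/H}` together with an isomorphism that shows that the flabby class
is stably permutation. The lattice `F` is the image of `f`. Both sides of the isomorphism are
identified with the fibre product of `ℤ[Q]` and `ℤ[Y]` over `ℤ[Q] / (f, f₀) ≃ ℤ[Y] / w`, as in
Schanuel's lemma. -/
theorem exists_flabbyClass [Finite G] [Finite P] {Q₀ Q Y : Type*} [MulAction G Q₀] [MulAction G Q]
    [MulAction G Y] [Finite Q₀] [Finite Q] [Finite Y]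
    (π : (permLattice G P).IntertwiningMap (cosetLattice H))
    (hπ : ∀ x, π x ∈ (augmentation H).ker.toSubmodule)
    (hsurj : ∀ i ∈ (augmentation H).ker.toSubmodule, ∃ x, π x = i)
    (f : (permLattice G P).IntertwiningMap (permLattice G Q))
    (f₀ : (permLattice G Q₀).IntertwiningMap (permLattice G Q))
    (a : (permLattice G Q).IntertwiningMap (permLattice G Y))
    (b : (permLattice G Y).IntertwiningMap (permLattice G Q))
    (w : (permLattice G Y).IntertwiningMap (permLattice G Y))
    (hf : ∀ [Fintype P], ∀ φ, f (dualHom π hπ φ) = 0)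
    (hab : ∀ q, ∃ x z, f x + f₀ z = q - b (a q))
    (hbw : ∀ y, ∃ x z, f x + f₀ z = b (w y))
    (haf : ∀ x, ∃ y, w y = a (f x)) (haf₀ : ∀ z, ∃ y, w y = a (f₀ z))
    (hba : ∀ y, ∃ y', w y' = y - a (b y))
    {N : ℤ} (hN : N ≠ 0) (hw : ∀ y, ∃ y', w y' = N • y)
    {n : ℕ} (hn : Nat.card P + 1 = n + H.index)
    (hcard : Nat.card P + Nat.card Q₀ + 1 = Nat.card Q + H.index) :
    ∃ F : Representation ℤ G (Fin n → ℤ), IsFlabbyClassOf (chevalley H) F ∧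
      IsStablyPermutation F ∧ Nonempty
        ((F.prod ((permLattice G Q₀).prod (permLattice G Y))).Equiv
          ((permLattice G Q).prod (permLattice G Y))) := by
  have := Fintype.ofFinite P
  have hP : Module.finrank ℤ (MonoidAlgebra ℤ P) = Nat.card P := finrank_permLattice P
  have hQ₀ : Module.finrank ℤ (MonoidAlgebra ℤ Q₀) = Nat.card Q₀ := finrank_permLattice Q₀
  have hQ : Module.finrank ℤ (MonoidAlgebra ℤ Q) = Nat.card Q := finrank_permLattice Q
  have hY : Module.finrank ℤ (MonoidAlgebra ℤ Y) = Nat.card Y := finrank_permLattice Y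
  have hH : 0 < H.index := Nat.pos_of_ne_zero Subgroup.index_ne_zero_of_finite
  -- The image of `w` contains `N • ℤ[Y]`, hence it has full rank.
  have hwinj : Function.Injective w := by
    have h1 : Module.finrank ℤ (LinearMap.range w.toLinearMap) = Module.finrank ℤ
        (MonoidAlgebra ℤ Y) := by
      refine le_antisymm (Submodule.finrank_le _) ?_
      refine LinearMap.finrank_le_finrank_of_injective
        (f := (LinearMap.lsmul ℤ (MonoidAlgebra ℤ Y) N).codRestrict _ hw) ?_
      intro y y' h
      exact smul_right_injective _ hN (congrArg Subtype.val h)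
    have h2 := Submodule.finrank_quotient_add_finrank (LinearMap.ker w.toLinearMap)
    rw [w.toLinearMap.quotKerEquivRange.finrank_eq, h1, Nat.add_eq_left,
      Module.finrank_eq_zero_iff] at h2
    rw [injective_iff_map_eq_zero]
    intro y hy
    obtain ⟨c, hc, h3⟩ := h2 ⟨y, hy⟩
    exact (smul_eq_zero.mp (congrArg Subtype.val h3)).resolve_left hc
  let Φ₁ : ((permLattice G Q).prod (permLattice G Y)).IntertwiningMap
      ((permLattice G Q).prod (permLattice G Y)) :=
    (Representation.IntertwiningMap.fst ..).prod (a.comp (.fst ..) + w.comp (.snd ..))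
  have hΦ₁ : ∀ x, Φ₁ x = (x.1, a x.1 + w x.2) := fun x => rfl
  have hΦ₁inj : Function.Injective Φ₁ := by
    intro x x' h
    rw [hΦ₁, hΦ₁, Prod.mk.injEq] at h
    have h2 := h.2
    rw [h.1, add_right_inj] at h2
    exact Prod.ext h.1 (hwinj h2)
  let Ψ : ((permLattice G P).prod ((permLattice G Q₀).prod (permLattice G Y))).IntertwiningMap
      ((permLattice G Q).prod (permLattice G Y)) :=
    (f.comp (.fst ..) + f₀.comp (.comp (.fst ..) (.snd ..)) +
      b.comp (.comp (.snd ..) (.snd ..))).prod (.comp (.snd ..) (.snd ..))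
  have hΨ : ∀ x, Ψ x = (f x.1 + f₀ x.2.1 + b x.2.2, x.2.2) := fun x => rfl
  -- `Φ₁` and `Ψ` have the same image, the fibre product.
  have hΨΦ : ∀ x, ∃ y, Φ₁ y = Ψ x := by
    rintro ⟨x, z, y⟩
    obtain ⟨y₁, h1⟩ := haf x
    obtain ⟨y₂, h2⟩ := haf₀ z
    obtain ⟨y₃, h3⟩ := hba y
    refine ⟨(f x + f₀ z + b y, y₃ - y₁ - y₂), ?_⟩
    rw [hΦ₁, hΨ]
    refine Prod.ext rfl ?_
    simp only [map_add, map_sub, h1, h2, h3]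
    abel
  have hΦΨ : ∀ y, ∃ x, Ψ x = Φ₁ y := by
    rintro ⟨q, y⟩
    obtain ⟨x₁, z₁, h1⟩ := hab q
    obtain ⟨x₂, z₂, h2⟩ := hbw y
    refine ⟨(x₁ - x₂, z₁ - z₂, a q + w y), ?_⟩
    rw [hΦ₁, hΨ]
    refine Prod.ext ?_ rfl
    have : f (x₁ - x₂) + f₀ (z₁ - z₂) + b (a q + w y) =
      (f x₁ + f₀ z₁) - (f x₂ + f₀ z₂) + (b (a q) + b (w y)) := by
        simp only [map_sub, map_add]
        abel
    refine this.trans ?_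
    rw [h1, h2]
    abel
  -- The kernel of `Ψ` has the rank of `J_{G/H}`, by `hcard`.
  obtain ⟨bJ⟩ := exists_basis_chevalley (H := H)
  have hJ : Module.finrank ℤ (ChevalleyModule H) = H.index - 1 := by
    rw [Module.finrank_eq_card_basis bJ, Fintype.card_fin]
  let j : (chevalley H).IntertwiningMap
      ((permLattice G P).prod ((permLattice G Q₀).prod (permLattice G Y))) :=
    (Representation.IntertwiningMap.inl ..).comp (dualHom π hπ)
  have hj : ∀ φ, j φ = (dualHom π hπ φ, 0, 0) := fun φ => rfl
  have hjinj : Function.Injective j := fun φ φ' h =>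
    dualHom_injective π hπ hsurj (congrArg Prod.fst h)
  have hle : LinearMap.range j.toLinearMap ≤ LinearMap.ker Ψ.toLinearMap := by
    rintro _ ⟨φ, rfl⟩
    rw [LinearMap.mem_ker, Ψ.toLinearMap_apply, j.toLinearMap_apply, hj, hΨ]
    simp [hf]
  have hrank : Module.finrank ℤ (LinearMap.range j.toLinearMap) =
      Module.finrank ℤ (LinearMap.ker Ψ.toLinearMap) := by
    have h1 := Submodule.finrank_quotient_add_finrank (LinearMap.ker Ψ.toLinearMap)
    have h2 : LinearMap.range Ψ.toLinearMap = LinearMap.range Φ₁.toLinearMap := by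
      apply le_antisymm
      · rintro _ ⟨x, rfl⟩
        exact hΨΦ x
      · rintro _ ⟨x, rfl⟩
        exact hΦΨ x
    rw [Ψ.toLinearMap.quotKerEquivRange.finrank_eq, h2,
      LinearMap.finrank_range_of_inj hΦ₁inj, Module.finrank_prod, Module.finrank_prod,
      Module.finrank_prod, hP, hQ₀, hQ, hY] at h1
    rw [LinearMap.finrank_range_of_inj hjinj, hJ]
    omega
  -- The kernel of `Ψ` equals the image of `J_{G/H}`, because the latter is saturated.
  have hker : ∀ x z, f x + f₀ z = 0 → z = 0 ∧ ∃ φ, dualHom π hπ φ = x := by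
    intro x z h
    have hmem : (x, z, (0 : MonoidAlgebra ℤ Y)) ∈ LinearMap.ker Ψ.toLinearMap := by
      rw [LinearMap.mem_ker, Ψ.toLinearMap_apply, hΨ]
      simp [h]
    obtain ⟨c, hc, φ, hφ⟩ := exists_smul_mem_of_finrank_eq hle hrank hmem
    rw [j.toLinearMap_apply, hj] at hφ
    refine ⟨?_, exists_dualHom_eq π hπ hsurj hc (congrArg Prod.fst hφ).symm⟩
    exact (smul_eq_zero.mp (congrArg (fun x => x.2.1) hφ).symm).resolve_left hc
  have hkerf : ∀ x, f x = 0 → ∃ φ, dualHom π hπ φ = x := fun x hx =>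
    (hker x 0 (by rw [hx, map_zero, add_zero])).2
  -- The flabby lattice is the image of `f`.
  let F₀ := f.range.toRepresentation
  let ι : F₀.IntertwiningMap (permLattice G Q) :=
    { f.range.toSubmodule.subtype with isIntertwining' := fun _ => rfl }
  have hι : ∀ x, ι x = (x : MonoidAlgebra ℤ Q) := fun _ => rfl
  let p : (permLattice G P).IntertwiningMap F₀ :=
    { f.toLinearMap.rangeRestrict with
      isIntertwining' := fun g => LinearMap.ext fun x => Subtype.ext (f.isIntertwining _ _ g x) }
  have hp : ∀ x, (p x : MonoidAlgebra ℤ Q) = f x := fun _ => rfl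
  have hpsurj : Function.Surjective p := by
    rintro ⟨_, x, rfl⟩
    exact ⟨x, rfl⟩
  have hFrank : Module.finrank ℤ f.range.toSubmodule = n := by
    have h1 := Submodule.finrank_quotient_add_finrank (LinearMap.ker f.toLinearMap)
    have h2 : LinearMap.ker f.toLinearMap = LinearMap.range (dualHom π hπ).toLinearMap := by
      apply le_antisymm
      · exact fun x hx => hkerf x hx
      · rintro _ ⟨φ, rfl⟩
        exact hf φ
    rw [f.toLinearMap.quotKerEquivRange.finrank_eq, h2,
      LinearMap.finrank_range_of_inj (dualHom_injective π hπ hsurj), hJ, hP] at h1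
    change Module.finrank ℤ (LinearMap.range f.toLinearMap) = n
    omega
  let t := transportEquiv F₀ (Module.finBasisOfFinrankEq ℤ f.range.toSubmodule hFrank).equivFun
  let Φ₂ : (F₀.prod ((permLattice G Q₀).prod (permLattice G Y))).IntertwiningMap
      ((permLattice G Q).prod (permLattice G Y)) :=
    (ι.comp (.fst ..) + f₀.comp (.comp (.fst ..) (.snd ..)) +
      b.comp (.comp (.snd ..) (.snd ..))).prod (.comp (.snd ..) (.snd ..))
  have hΦ₂ : ∀ x, Φ₂ x = ((x.1 : MonoidAlgebra ℤ Q) + f₀ x.2.1 + b x.2.2, x.2.2) := fun x => rfl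
  have hΦ₂Ψ : ∀ x z y, Φ₂ (p x, z, y) = Ψ (x, z, y) := fun x z y => rfl
  have hΦ₂inj : Function.Injective Φ₂ := by
    rw [injective_iff_map_eq_zero]
    rintro ⟨r, z, y⟩ h
    obtain ⟨x, rfl⟩ := hpsurj r
    rw [hΦ₂, Prod.mk_eq_zero] at h
    obtain ⟨h1, h2⟩ := h
    dsimp only at h1 h2
    rw [h2, map_zero, add_zero, hp] at h1
    obtain ⟨hz, φ, hφ⟩ := hker x z h1
    rw [hz, map_zero, add_zero] at h1
    exact Prod.ext (Subtype.ext h1) (Prod.ext hz h2)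
  obtain ⟨E⟩ := equiv_of_range_eq Φ₂ Φ₁ hΦ₂inj hΦ₁inj
    (by
      rintro ⟨r, z, y⟩
      obtain ⟨x, rfl⟩ := hpsurj r
      exact hΨΦ (x, z, y))
    (fun y => by
      obtain ⟨⟨x, z, y'⟩, h⟩ := hΦΨ y
      exact ⟨(p x, z, y'), h⟩)
  have hQY : IsPermutationLattice ((permLattice G Q).prod (permLattice G Y)) :=
    (isPermutationLattice_permLattice Q).prod (isPermutationLattice_permLattice Y)
  let E' := (prodEquiv t.symm (.refl ((permLattice G Q₀).prod (permLattice G Y)))).trans E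
  refine ⟨transport F₀ _, ⟨inferInstance, inferInstance, ?_, ?_⟩, .of_equiv
    ((isPermutationLattice_permLattice Q₀).prod (isPermutationLattice_permLattice Y)) hQY E', ⟨E'⟩⟩
  · refine ((isFlabby_permLattice Q).prod (isFlabby_permLattice Y)).of_retract
      (E'.toIntertwiningMap.comp (.inl ..))
      (.comp (.fst ..) E'.symm.toIntertwiningMap) fun x => ?_
    exact congrArg Prod.fst (E'.symm_apply_apply (x, 0))
  · let s := transportEquiv (permLattice G P)
      ((permBasis P).reindex (Finite.equivFin P)).equivFun
    refine ⟨Nat.card P, _, s.toIntertwiningMap.comp (dualHom π hπ),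
      (t.toIntertwiningMap.comp p).comp s.symm.toIntertwiningMap,
      (isPermutationLattice_permLattice P).equiv s,
      s.toLinearEquiv.injective.comp (dualHom_injective π hπ hsurj), fun x => ?_,
      t.toLinearEquiv.surjective.comp (hpsurj.comp s.symm.toLinearEquiv.surjective)⟩
    obtain ⟨x, rfl⟩ := s.toLinearEquiv.surjective x
    have h1 : s.symm (s.toLinearEquiv x) = x := s.symm_apply_apply x
    constructor
    · intro h
      have h2 : t.toLinearEquiv (p (s.symm (s.toLinearEquiv x))) = 0 := h
      rw [h1, LinearEquiv.map_eq_zero_iff] at h2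
      obtain ⟨φ, rfl⟩ := hkerf x (congrArg Subtype.val h2)
      exact ⟨φ, rfl⟩
    · rintro ⟨φ, hφ⟩
      have h2 : dualHom π hπ φ = x := s.toLinearEquiv.injective hφ
      change t.toLinearEquiv (p (s.symm (s.toLinearEquiv x))) = 0
      rw [h1, LinearEquiv.map_eq_zero_iff, ← h2]
      exact Subtype.ext (hf φ)

end Presentation

/-! ### Computing in permutation lattices -/

section Codes

/-- The image of the point `i` under the map with code `c`: codes list the images of the points
`0, 1, …` as hexadecimal digits, beginning with the last digit. -/
def codeApp (c i : ℕ) : ℕ := Nat.land (Nat.shiftRight c (Nat.mul 4 i)) 15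

/-- The code of the composition of two maps of `{0, …, n - 1}`. -/
def codeMul (n c : ℕ) : ℕ → ℕ :=
  Nat.rec (fun _ => 0)
    (fun _ ih d => Nat.add (codeApp c (Nat.land d 15)) (Nat.mul 16 (ih (Nat.shiftRight d 4)))) n

theorem codeApp_eq (c i : ℕ) : codeApp c i = c / 16 ^ i % 16 := by
  change (c >>> (4 * i)) &&& (2 ^ 4 - 1) = _
  rw [Nat.and_two_pow_sub_one_eq_mod, Nat.shiftRight_eq_div_pow, pow_mul]
  norm_num

theorem codeApp_lt (c i : ℕ) : codeApp c i < 16 := by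
  rw [codeApp_eq]
  exact Nat.mod_lt _ (by norm_num)

theorem codeApp_codeMul (n c d i : ℕ) (hi : i < n) :
    codeApp (codeMul n c d) i = codeApp c (codeApp d i) := by
  induction n generalizing d i with
  | zero => omega
  | succ n ih =>
    have h : codeMul (n + 1) c d =
        codeApp c (codeApp d 0) + 16 * codeMul n c (d / 16) := by
      change codeApp c (d &&& (2 ^ 4 - 1)) + 16 * codeMul n c (d >>> 4) = _
      rw [codeApp_eq d, Nat.and_two_pow_sub_one_eq_mod, Nat.shiftRight_eq_div_pow]
      simp
    have h1 := codeApp_lt c (codeApp d 0)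
    rw [h, codeApp_eq]
    cases i with
    | zero => rw [pow_zero, Nat.div_one]; omega
    | succ i =>
      have h2 : (codeApp c (codeApp d 0) + 16 * codeMul n c (d / 16)) / 16 =
        codeMul n c (d / 16) := by omega
      rw [pow_succ', ← Nat.div_div_eq_div_mul, h2, ← codeApp_eq, ih _ _ (by omega)]
      congr 1
      rw [codeApp_eq, codeApp_eq, pow_succ', Nat.div_div_eq_div_mul]

/-- Evaluates a natural number before it is passed on. -/
def forceNat {α : Type*} (n : ℕ) (k : ℕ → α) : α := Nat.rec (k 0) (fun m _ => k (Nat.succ m)) n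

theorem forceNat_eq {α : Type*} (n : ℕ) (k : ℕ → α) : forceNat n k = k n := by
  cases n <;> rfl

/-- Evaluates an integer before it is passed on. -/
def forceInt {α : Type*} (z : ℤ) (k : ℤ → α) : α :=
  Int.rec (fun n => forceNat n fun n => k (.ofNat n)) (fun n => forceNat n fun n => k (.negSucc n)) z

theorem forceInt_eq {α : Type*} (z : ℤ) (k : ℤ → α) : forceInt z k = k z := by
  cases z with
  | ofNat n => exact forceNat_eq n fun n => k (.ofNat n)
  | negSucc n => exact forceNat_eq n fun n => k (.negSucc n)

/-- Binary search trees, to collect the coefficients of a linear combination. -/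
inductive Trie
  | leaf : Trie
  | node (v : ℤ) (l r : Trie) : Trie

namespace Trie

/-- Evaluates a tree before it is passed on. -/
def force {α : Type*} (t : Trie) (k : Trie → α) : α :=
  Trie.rec (k leaf) (fun v l r _ _ => k (node v l r)) t

theorem force_eq {α : Type*} (t : Trie) (k : Trie → α) : force t k = k t := by
  cases t <;> rfl

/-- Chooses the subtree that belongs to the last binary digit of `k`. -/
def branch (k : ℕ) (a b : Trie) : Trie := Nat.rec a (fun _ _ => b) (Nat.land k 1)

/-- Adds `c` at the position given by the last `n` binary digits of `k`. -/
def insert (n : ℕ) : ℕ → ℤ → Trie → Trie :=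
  Nat.rec
    (fun _ c t => Trie.rec (node c leaf leaf)
      (fun v l r _ _ => forceInt (Int.add c v) fun v' => node v' l r) t)
    (fun _ ih k c t => Trie.rec
      (branch k (force (ih (Nat.shiftRight k 1) c leaf) fun l => node 0 l leaf)
        (force (ih (Nat.shiftRight k 1) c leaf) fun r => node 0 leaf r))
      (fun v l r _ _ => branch k (force (ih (Nat.shiftRight k 1) c l) fun l => node v l r)
        (force (ih (Nat.shiftRight k 1) c r) fun r => node v l r)) t) n

/-- All coefficients are zero. -/
def isZero (t : Trie) : Bool :=
  Trie.rec true (fun v _ _ a b => Int.rec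
    (fun n => Nat.rec (Bool.rec false b a) (fun _ _ => false) n) (fun _ => false) v) t

/-- The sum of the coefficients, evaluated at a function on the positions. -/
def eval {M : Type*} [AddCommGroup M] : ℕ → Trie → (ℕ → M) → M
  | _, leaf, _ => 0
  | 0, node v _ _, f => v • f 0
  | n + 1, node _ l r, f => eval n l (fun k => f (2 * k)) + eval n r (fun k => f (2 * k + 1))

variable {M : Type*} [AddCommGroup M]

theorem branch_even (k : ℕ) (a b : Trie) : branch (2 * k) a b = a := by
  have : Nat.land (2 * k) 1 = 0 := by
    change 2 * k &&& 1 = 0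
    simp [Nat.and_one_is_mod]
  rw [branch, this]
  rfl

theorem branch_odd (k : ℕ) (a b : Trie) : branch (2 * k + 1) a b = b := by
  have : Nat.land (2 * k + 1) 1 = 1 := by
    change (2 * k + 1) &&& 1 = 1
    simp [Nat.and_one_is_mod, Nat.add_mod]
  rw [branch, this]
  rfl

/-- A trie stands for the linear combination of the terms that were inserted. -/
theorem eval_insert (n k : ℕ) (hk : k < 2 ^ n) (c : ℤ) (t : Trie) (f : ℕ → M) :
    eval n (insert n k c t) f = c • f k + eval n t f := by
  induction n generalizing k t f with
  | zero =>
    obtain rfl : k = 0 := by simpa using hk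
    cases t with
    | leaf => exact (add_zero _).symm
    | node v l r =>
      change eval 0 (forceInt (Int.add c v) fun v' => node v' l r) f = c • f 0 + v • f 0
      rw [forceInt_eq, ← add_smul]
      rfl
  | succ n ih =>
    have h2 : ∀ t, insert (n + 1) k c t = Trie.rec
      (branch k (force (insert n (k / 2) c leaf) fun l => node 0 l leaf)
        (force (insert n (k / 2) c leaf) fun r => node 0 leaf r))
      (fun v l r _ _ => branch k (force (insert n (k / 2) c l) fun l => node v l r)
        (force (insert n (k / 2) c r) fun r => node v l r)) t := fun t => by
      have : k / 2 = Nat.shiftRight k 1 := (Nat.shiftRight_one k).symm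
      rw [this]
      rfl
    have h3 : k / 2 < 2 ^ n := by rw [pow_succ] at hk; omega
    have hl : ∀ n f, eval n leaf f = (0 : M) := fun n f => by cases n <;> rfl
    rw [h2]
    simp only [force_eq]
    obtain ⟨m, rfl | rfl⟩ : ∃ m, k = 2 * m ∨ k = 2 * m + 1 := ⟨k / 2, by omega⟩
    · have h4 : 2 * m / 2 = m := by omega
      simp only [branch_even, h4] at h3 ⊢
      cases t with
      | leaf =>
        change eval n _ _ + eval n leaf _ = _
        rw [ih _ h3, hl, hl, hl, add_zero]
      | node v l r =>
        change eval n _ _ + eval n r _ = c • _ + (eval n l _ + eval n r _)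
        rw [ih _ h3, add_assoc]
    · have h4 : (2 * m + 1) / 2 = m := by omega
      simp only [branch_odd, h4] at h3 ⊢
      cases t with
      | leaf =>
        change eval n leaf _ + eval n _ _ = _
        rw [ih _ h3, hl, hl, hl, zero_add]
      | node v l r =>
        change eval n l _ + eval n _ _ = c • _ + (eval n l _ + eval n r _)
        rw [ih _ h3, add_left_comm]

theorem eval_eq_zero (n : ℕ) (t : Trie) (ht : isZero t = true) (f : ℕ → M) : eval n t f = 0 := by
  induction t generalizing n f with
  | leaf => cases n <;> rfl
  | node v l r hl hr =>
    have h : v = 0 ∧ isZero l = true ∧ isZero r = true := by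
      rcases v with (_ | v) | v
      · change Bool.rec false (isZero r) (isZero l) = true at ht
        cases h1 : isZero l <;> rw [h1] at ht
        · exact absurd ht Bool.false_ne_true
        · exact ⟨rfl, rfl, ht⟩
      · exact absurd ht (by intro h; cases h)
      · exact absurd ht (by intro h; cases h)
    cases n with
    | zero =>
      change v • f 0 = 0
      rw [h.1, zero_smul]
    | succ n =>
      change eval n l _ + eval n r _ = 0
      rw [hl n h.2.1, hr n h.2.2, add_zero]

end Trie

end Codes

section Represents

variable {G : Type*} [Group G] {n : ℕ} (θ : G →* Equiv.Perm (Fin n))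

/-- `c` is the code of the permutation by which `g` acts. -/
def Represents (c : ℕ) (g : G) : Prop := ∀ i : Fin n, codeApp c i = (θ g i : ℕ)

variable {θ}

theorem Represents.mul {c d : ℕ} {g h : G} (hc : Represents θ c g) (hd : Represents θ d h) :
    Represents θ (codeMul n c d) (g * h) := fun i => by
  rw [codeApp_codeMul _ _ _ _ i.2, hd, hc, map_mul]
  rfl

theorem Represents.unique (hθ : Function.Injective θ) {c d : ℕ} {g h : G} (hc : Represents θ c g)
    (hd : Represents θ d h) (hcd : ∀ i < n, codeApp c i = codeApp d i) : g = h :=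
  hθ (Equiv.ext fun i => Fin.ext (by rw [← hc, ← hd, hcd i i.2]))

/-- The linear combination with the terms `(k, c, x)`: coefficient, number of the summand, code. -/
abbrev Term := ℤ × ℕ × ℕ

/-- The sum of the permutation lattices `ℤ[G/A]` for the members `A` of a family of subgroups is
the permutation lattice of this `G`-set. -/
abbrev CosetSum {m : ℕ} (A : Fin m → Subgroup G) : Type _ := (c : Fin m) × (G ⧸ A c)

variable (θ) in
/-- The list of terms describes the element of the permutation lattice. -/
inductive Describes {m : ℕ} (A : Fin m → Subgroup G) :
    List Term → MonoidAlgebra ℤ (CosetSum A) → Prop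
  | nil : Describes A [] 0
  | cons {l : List Term} {v : MonoidAlgebra ℤ (CosetSum A)} (k : ℤ) (c : Fin m) {x : ℕ} {g : G}
      (hx : Represents θ x g) (hl : Describes A l v) :
      Describes A ((k, c, x) :: l) (k • MonoidAlgebra.single ⟨c, g⟩ 1 + v)

/-- Concatenation of lists. -/
def appendTerms (l l' : List Term) : List Term := List.rec l' (fun t _ ih => t :: ih) l

/-- Multiplies all terms by `k` and lets the group element with code `x` act. -/
def translate (n x : ℕ) (k : ℤ) (l : List Term) : List Term :=
  List.rec [] (fun t _ ih => (Int.mul k t.1, t.2.1, codeMul n x t.2.2) :: ih) l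

/-- The image of a linear combination under the map with given values on the base points. -/
def applyTerms (n : ℕ) (φ : ℕ → List Term) (l : List Term) : List Term :=
  List.rec [] (fun t _ ih => appendTerms
    (forceNat t.2.2 fun x => translate n x t.1 (φ t.2.1)) ih) l

/-- Sums over the group elements in a list. -/
def orbitTerms (n : ℕ) (s : List ℕ) (l : List Term) : List Term :=
  List.rec [] (fun x _ ih => appendTerms (translate n x 1 l) ih) s

namespace Describes

variable {m : ℕ} {A : Fin m → Subgroup G} {l l' : List Term} {v v' : MonoidAlgebra ℤ (CosetSum A)}

theorem append (h : Describes θ A l v) (h' : Describes θ A l' v') :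
    Describes θ A (appendTerms l l') (v + v') := by
  induction h with
  | nil => rw [zero_add]; exact h'
  | cons k c hx _ ih => rw [add_assoc]; exact .cons k c hx ih

theorem translate (h : Describes θ A l v) {x : ℕ} {g : G} (hx : Represents θ x g) (k : ℤ) :
    Describes θ A (translate n x k l) (k • permLattice G (CosetSum A) g v) := by
  induction h with
  | nil => rw [map_zero, smul_zero]; exact .nil
  | cons k' c hx' _ ih =>
    rw [map_add, smul_add, map_smul, smul_smul, Representation.ofMulAction_single]
    exact .cons _ c (hx.mul hx') ih

end Describes

/-- The map out of a permutation lattice with given values on the base points. -/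
theorem exists_intertwiningMap {m m' : ℕ} {A : Fin m → Subgroup G} {A' : Fin m' → Subgroup G}
    (v : Fin m → MonoidAlgebra ℤ (CosetSum A'))
    (hv : ∀ c, ∀ g ∈ A c, permLattice G (CosetSum A') g (v c) = v c) :
    ∃ f : (permLattice G (CosetSum A)).IntertwiningMap (permLattice G (CosetSum A')),
      ∀ c (g : G), f (.single ⟨c, g⟩ 1) = permLattice G (CosetSum A') g (v c) := by
  let F : CosetSum A → MonoidAlgebra ℤ (CosetSum A') := fun x =>
    Quotient.liftOn' x.2 (fun g => permLattice G (CosetSum A') g (v x.1)) fun g h hgh => by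
      rw [QuotientGroup.leftRel_apply] at hgh
      have := hv _ _ hgh
      conv_lhs => rw [← this, ← Module.End.mul_apply, ← map_mul, mul_inv_cancel_left]
  let f : MonoidAlgebra ℤ (CosetSum A) →ₗ[ℤ] MonoidAlgebra ℤ (CosetSum A') :=
    (permBasis _).constr ℤ F
  have hf : ∀ x, f (.single x 1) = F x := fun x => (permBasis _).constr_basis ℤ F x
  refine ⟨⟨f, fun g => (permBasis _).ext fun x => ?_⟩, fun c g => hf _⟩
  obtain ⟨c, x⟩ := x
  induction x using QuotientGroup.induction_on with
  | H h =>
  rw [permBasis_apply, LinearMap.comp_apply, LinearMap.comp_apply,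
    Representation.ofMulAction_single, hf, hf]
  change permLattice G _ (g * h) (v c) = permLattice G _ g (permLattice G _ h (v c))
  rw [map_mul]
  rfl

/-- A map that is given on the base points is computed on linear combinations by `applyTerms`. -/
theorem Describes.apply {m m' : ℕ} {A : Fin m → Subgroup G} {A' : Fin m' → Subgroup G}
    {f : (permLattice G (CosetSum A)).IntertwiningMap (permLattice G (CosetSum A'))}
    {v : Fin m → MonoidAlgebra ℤ (CosetSum A')}
    (hf : ∀ c (g : G), f (.single ⟨c, g⟩ 1) = permLattice G (CosetSum A') g (v c))
    {φ : ℕ → List Term} (hφ : ∀ c : Fin m, Describes θ A' (φ c) (v c)) {l : List Term}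
    {x : MonoidAlgebra ℤ (CosetSum A)} (h : Describes θ A l x) :
    Describes θ A' (applyTerms n φ l) (f x) := by
  induction h with
  | nil => rw [map_zero]; exact .nil
  | @cons l v k c x g hx _ ih =>
    rw [map_add, map_smul, hf]
    have h := ((hφ c).translate hx k).append ih
    change Describes θ A' (appendTerms (forceNat x fun x => NormOne.translate n x k (φ c)) _) _
    rw [forceNat_eq]
    exact h

/-- The sum of the translates of a described vector is described by `orbitTerms`. -/
theorem Describes.orbit {m : ℕ} {A : Fin m → Subgroup G} {l : List Term}
    {v : MonoidAlgebra ℤ (CosetSum A)} (h : Describes θ A l v) {s : List ℕ} {t : List G}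
    (hst : List.Forall₂ (Represents θ) s t) :
    Describes θ A (orbitTerms n s l) (t.map fun g => permLattice G (CosetSum A) g v).sum := by
  induction hst with
  | nil => exact .nil
  | cons hx _ ih =>
    have := (h.translate hx 1).append ih
    rwa [one_smul] at this

end Represents

section Keys

/-- The number in base `n` whose digits are the images of the points in `t` under `c`. -/
def tupleKey (n c : ℕ) (t : List ℕ) : ℕ :=
  List.rec (fun a => a) (fun i _ ih a => ih (Nat.add (Nat.mul n a) (codeApp c i))) t 0

/-- The least of the numbers `tupleKey`. If the tuples are the translates of one tuple under a
subgroup, this number is an invariant of the left coset. -/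
def cosetKey (n c : ℕ) (ts : List (List ℕ)) : ℕ :=
  List.rec 0 (fun t ts' ih => List.rec (tupleKey n c t)
    (fun _ _ _ => forceNat (tupleKey n c t) fun a => forceNat ih fun b =>
      Bool.rec b a (Nat.ble a b)) ts') ts

/-- The key of a coset is attained by one of the tuples. -/
theorem exists_cosetKey_eq (n c : ℕ) (ts : List (List ℕ)) (h : ts ≠ []) :
    ∃ t ∈ ts, cosetKey n c ts = tupleKey n c t := by
  induction ts with
  | nil => exact absurd rfl h
  | cons t ts ih =>
    cases ts with
    | nil => exact ⟨t, by simp, rfl⟩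
    | cons t' ts =>
      obtain ⟨s, hs, hs'⟩ := ih (by simp)
      have h1 : cosetKey n c (t :: t' :: ts) = Bool.rec (cosetKey n c (t' :: ts)) (tupleKey n c t)
          (Nat.ble (tupleKey n c t) (cosetKey n c (t' :: ts))) := by
        change (forceNat (tupleKey n c t) fun a => forceNat (cosetKey n c (t' :: ts)) fun b =>
          (Bool.rec b a (Nat.ble a b) : ℕ)) = _
        rw [forceNat_eq, forceNat_eq]
      rw [h1]
      cases Nat.ble (tupleKey n c t) (cosetKey n c (t' :: ts)) with
      | true => exact ⟨t, by simp, rfl⟩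
      | false => exact ⟨s, List.mem_cons_of_mem _ hs, hs'⟩

/-- The key of a tuple is the number with the images of its entries as its digits in base `n`, so it
determines the images. -/
theorem tupleKey_injective {n c d : ℕ} {s t : List ℕ} (hl : s.length = t.length)
    (hs : ∀ i ∈ s, codeApp c i < n) (ht : ∀ i ∈ t, codeApp d i < n)
    (h : tupleKey n c s = tupleKey n d t) :
    s.map (codeApp c) = t.map (codeApp d) := by
  -- The statement is proved for arbitrary initial values of the accumulator.
  have key : ∀ a b, (List.rec (fun a => a)
      (fun i _ ih a => ih (Nat.add (Nat.mul n a) (codeApp c i))) s a : ℕ) =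
      List.rec (fun a => a) (fun i _ ih a => ih (Nat.add (Nat.mul n a) (codeApp d i))) t b →
      a = b ∧ s.map (codeApp c) = t.map (codeApp d) := by
    clear h
    induction s generalizing t with
    | nil =>
      cases t with
      | nil => exact fun a b h => ⟨h, rfl⟩
      | cons => simp at hl
    | cons i s ih =>
      cases t with
      | nil => simp at hl
      | cons j t =>
        intro a b h
        obtain ⟨h1, h2⟩ := ih (t := t) (by simpa using hl)
          (fun i hi => hs i (List.mem_cons_of_mem _ hi))
          (fun i hi => ht i (List.mem_cons_of_mem _ hi)) _ _ h
        have hi := hs i (by simp)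
        have hj := ht j (by simp)
        have h1' : n * a + codeApp c i = n * b + codeApp d j := h1
        have h3 := congrArg (· % n) h1'
        simp only [Nat.mul_add_mod, Nat.mod_eq_of_lt hi, Nat.mod_eq_of_lt hj] at h3
        have h4 : n * a = n * b := by omega
        refine ⟨Nat.eq_of_mul_eq_mul_left (by omega) h4, ?_⟩
        rw [List.map_cons, List.map_cons, h3, h2]
  exact (key 0 0 h).2

end Keys

section Vanishing

variable {G : Type*} [Group G] {n : ℕ} (θ : G →* Equiv.Perm (Fin n))

/-- The number `cosetKey` for the tuples `ts` determines the left coset modulo `B`. -/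
def IsCosetKey (B : Subgroup G) (ts : List (List ℕ)) : Prop :=
  ∀ ⦃x y : ℕ⦄ ⦃g h : G⦄, Represents θ x g → Represents θ y h →
    cosetKey n x ts = cosetKey n y ts → (g : G ⧸ B) = h

/-- Collects the terms of a linear combination, at positions that depend on the summand and the
coset. -/
def collect (n m : ℕ) (ts : ℕ → List (List ℕ)) (l : List Term) : Trie → Trie :=
  List.rec (fun t => t) (fun a _ ih t => forceNat a.2.2 fun x =>
    forceNat (Nat.add (Nat.mul (cosetKey n x (ts a.2.1)) m) a.2.1) fun k =>
      Bool.rec (.node 1 .leaf .leaf) (Trie.force (Trie.insert 12 k a.1 t) ih) (Nat.blt k 4096)) l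

/-- The terms of the linear combination cancel. -/
def vanishes (n m : ℕ) (ts : ℕ → List (List ℕ)) (l : List Term) : Bool :=
  Trie.isZero (collect n m ts l .leaf)

variable {θ}

/-- If the coefficients of each key add up to zero, then so do the coefficients of each coset. -/
theorem Describes.eq_zero {m : ℕ} {A : Fin m → Subgroup G} {ts : ℕ → List (List ℕ)}
    (hts : ∀ c, IsCosetKey θ (A c) (ts c)) {l : List Term} {v : MonoidAlgebra ℤ (CosetSum A)}
    (h : Describes θ A l v) (hl : vanishes n m ts l = true) : v = 0 := by
  classical
  let key : Fin m → ℕ → ℕ := fun c x => cosetKey n x (ts c) * m + c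
  let F : ℕ → MonoidAlgebra ℤ (CosetSum A) := fun κ =>
    if h : ∃ (c : Fin m) (x : ℕ) (g : G), Represents θ x g ∧ key c x = κ then
      .single ⟨h.choose, h.choose_spec.choose_spec.choose⟩ 1 else 0
  have hF : ∀ (c : Fin m) (x : ℕ) (g : G), Represents θ x g →
      F (key c x) = .single ⟨c, g⟩ 1 := by
    intro c x g hx
    have h : ∃ (c' : Fin m) (x' : ℕ) (g' : G), Represents θ x' g' ∧ key c' x' = key c x :=
      ⟨c, x, g, hx, rfl⟩
    simp only [F, dif_pos h]
    have h1 := h.choose_spec.choose_spec.choose_spec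
    generalize h.choose_spec.choose_spec.choose = g' at h1 ⊢
    generalize h.choose_spec.choose = x' at h1
    generalize h.choose = c' at h1 ⊢
    obtain ⟨hx', hk⟩ := h1
    have h2 : cosetKey n x' (ts c') * m + c' = cosetKey n x (ts c) * m + c := hk
    have h3 : c' = c := Fin.ext (by
      have := congrArg (· % m) h2
      simpa [Nat.add_mod, Nat.mod_eq_of_lt] using this)
    subst h3
    have h4 : cosetKey n x' (ts c') = cosetKey n x (ts c') :=
      Nat.eq_of_mul_eq_mul_right c'.pos (by omega)
    rw [hts c' hx' hx h4]
  have key : ∀ t, (collect n m ts l t).isZero = true →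
      Trie.eval 12 (collect n m ts l t) F = v + Trie.eval 12 t F := by
    clear hl
    induction h with
    | nil => exact fun t _ => (zero_add _).symm
    | @cons l v k c x g hx hl ih =>
      intro t ht
      have h1 : collect n m ts ((k, c, x) :: l) t = Bool.rec (.node 1 .leaf .leaf)
          (collect n m ts l (Trie.insert 12 (key c x) k t)) (Nat.blt (key c x) 4096) := by
        change forceNat x (fun x => forceNat (Nat.add (Nat.mul (cosetKey n x (ts c)) m) c) fun κ =>
          (Bool.rec (.node 1 .leaf .leaf) (Trie.force (Trie.insert 12 κ k t) (collect n m ts l))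
            (Nat.blt κ 4096) : Trie)) = _
        rw [forceNat_eq, forceNat_eq, Trie.force_eq]
        rfl
      rw [h1] at ht ⊢
      cases hb : Nat.blt (key c x) 4096 with
      | false =>
        rw [hb] at ht
        exact absurd ht (by intro h; cases h)
      | true =>
        rw [hb] at ht
        dsimp only at ht ⊢
        rw [ih _ ht, Trie.eval_insert _ _ (by simpa [Nat.blt_eq] using hb), hF c x g hx]
        abel
  have h1 := key .leaf hl
  rw [Trie.eval_eq_zero _ _ hl] at h1
  exact (h1.trans (add_zero v)).symm

end Vanishing

/-! ### Codings of a group -/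

section Coded

variable {G : Type*} [Group G] {n : ℕ}

/-- The numbers `elt 0, …, elt (N - 1)` are codes of all the elements of the group, which acts
faithfully on `n` points. -/
structure IsCoding (θ : G →* Equiv.Perm (Fin n)) (N : ℕ) (elt : ℕ → ℕ) : Prop where
  injective : Function.Injective θ
  exists_represents : ∀ i < N, ∃ g, Represents θ (elt i) g
  exists_elt : ∀ g, ∃ i < N, Represents θ (elt i) g

/-- The subgroup generated by the elements with the numbers in a list. -/
def codedSubgroup (θ : G →* Equiv.Perm (Fin n)) (elt : ℕ → ℕ) (s : List ℕ) : Subgroup G :=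
  Subgroup.closure {g | ∃ i ∈ s, Represents θ (elt i) g}

/-- Membership in a list of natural numbers. -/
def memNat (x : ℕ) (s : List ℕ) : Bool :=
  List.rec false (fun y _ ih => Bool.rec ih true (Nat.beq x y)) s

theorem memNat_iff (x : ℕ) (s : List ℕ) : memNat x s = true ↔ x ∈ s := by
  induction s with
  | nil => simp [memNat]
  | cons y s ih =>
    rw [List.mem_cons, ← ih]
    change (Bool.rec (memNat x s) true (Nat.beq x y) : Bool) = true ↔ _
    cases h : Nat.beq x y with
    | true => simp [Nat.eq_of_beq_eq_true h]
    | false => simp [Nat.ne_of_beq_eq_false h]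

/-- The listed elements form a subgroup. -/
def checkSubgroup (n N : ℕ) (elt : ℕ → ℕ) (s : List ℕ) : Bool :=
  s.all (fun i => Nat.blt i N) && memNat 0 s && (s.all fun i => forceNat (elt i) fun x =>
    s.all fun j => forceNat (codeMul n x (elt j)) fun y => memNat y (s.map elt))

/-- The tuples `ts` are the translates of the first of them under the listed elements, and all
elements that fix the points of the first tuple are listed. -/
def checkTuples (n N : ℕ) (elt : ℕ → ℕ) (s : List ℕ) (ts : List (List ℕ)) : Bool :=
  ts.all (fun t => s.any fun r => decide (t = ts.headI.map (codeApp (elt r)))) &&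
  !ts.isEmpty && ts.headI.all (fun x => Nat.blt x n) &&
  (List.range N).all fun i => !(ts.headI.all fun x => Nat.beq (codeApp (elt i) x) x) || memNat i s

/-- The members of the list are distinct, and are not bits of `mask`. -/
def distinct (l : List ℕ) : ℕ → Bool :=
  List.rec (fun _ => true) (fun x _ ih mask => forceNat (Nat.pow 2 x) fun y =>
    Bool.rec false (forceNat (Nat.lor mask y) ih) (Nat.beq (Nat.land mask y) 0)) l

theorem distinct_nodup (l : List ℕ) (mask : ℕ) (h : distinct l mask = true) :
    l.Nodup ∧ ∀ x ∈ l, mask.testBit x = false := by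
  induction l generalizing mask with
  | nil => simp
  | cons x l ih =>
    change (forceNat (2 ^ x) fun y => Bool.rec false (forceNat (mask ||| y) (distinct l))
      (Nat.beq (mask &&& y) 0) : Bool) = true at h
    rw [forceNat_eq, forceNat_eq] at h
    cases hb : Nat.beq (mask &&& 2 ^ x) 0 with
    | false => rw [hb] at h; cases h
    | true =>
      rw [hb] at h
      obtain ⟨h1, h2⟩ := ih _ h
      have h3 : mask.testBit x = false := by
        have h4 := congrArg (Nat.testBit · x) (Nat.eq_of_beq_eq_true hb)
        simpa using h4
      have h5 : ∀ y ∈ l, mask.testBit y = false ∧ x ≠ y := fun y hy => by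
        simpa [Nat.testBit_two_pow] using h2 y hy
      refine ⟨List.nodup_cons.2 ⟨fun hx => (h5 x hx).2 rfl, h1⟩, fun y hy => ?_⟩
      rcases List.mem_cons.1 hy with rfl | hy
      · exact h3
      · exact (h5 y hy).1

/-- The listed elements have distinct values on the tuple `t`. -/
def distinctKeys (n : ℕ) (elt : ℕ → ℕ) (s t : List ℕ) : Bool :=
  distinct (s.map fun i => tupleKey n (elt i) t) 0

theorem tupleKey_congr {n c d : ℕ} (t : List ℕ) (h : ∀ p ∈ t, codeApp c p = codeApp d p) :
    tupleKey n c t = tupleKey n d t := by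
  have key : ∀ a, (List.rec (fun a => a)
      (fun i _ ih a => ih (Nat.add (Nat.mul n a) (codeApp c i))) t a : ℕ) =
      List.rec (fun a => a) (fun i _ ih a => ih (Nat.add (Nat.mul n a) (codeApp d i))) t a := by
    induction t with
    | nil => exact fun _ => rfl
    | cons i t ih =>
      intro a
      dsimp only
      rw [h i (by simp)]
      exact ih (fun p hp => h p (List.mem_cons_of_mem _ hp)) _
  exact key 0

namespace IsCoding

variable {θ : G →* Equiv.Perm (Fin n)} {N : ℕ} {elt : ℕ → ℕ}

theorem finite (h : IsCoding θ N elt) : Finite G :=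
  .of_injective θ h.injective

theorem mem_codedSubgroup (h : IsCoding θ N elt) {s : List ℕ}
    (hs : checkSubgroup n N elt s = true) {g : G} :
    g ∈ codedSubgroup θ elt s ↔ ∃ i ∈ s, Represents θ (elt i) g := by
  have := h.finite
  simp only [checkSubgroup, Bool.and_eq_true, List.all_eq_true, forceNat_eq, memNat_iff,
    List.mem_map] at hs
  obtain ⟨⟨hN, h0⟩, hmul⟩ := hs
  refine ⟨fun hg => ?_, fun hg => Subgroup.subset_closure hg⟩
  let S : Submonoid G := Submonoid.closure {g | ∃ i ∈ s, Represents θ (elt i) g}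
  have hclosed : ∀ g g' : G, (∃ i ∈ s, Represents θ (elt i) g) →
      (∃ i ∈ s, Represents θ (elt i) g') → ∃ i ∈ s, Represents θ (elt i) (g * g') := by
    rintro g g' ⟨i, hi, hg⟩ ⟨j, hj, hg'⟩
    obtain ⟨k, hk, hk'⟩ := hmul i hi j hj
    exact ⟨k, hk, hk' ▸ hg.mul hg'⟩
  have hpow : ∀ g : G, (∃ i ∈ s, Represents θ (elt i) g) → ∀ m : ℕ,
      ∃ i ∈ s, Represents θ (elt i) (g ^ (m + 1)) := by
    intro g hg m
    induction m with
    | zero => simpa using hg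
    | succ m ih => rw [pow_succ]; exact hclosed _ _ ih hg
  have hinv : ∀ g : G, (∃ i ∈ s, Represents θ (elt i) g) →
      ∃ i ∈ s, Represents θ (elt i) g⁻¹ := by
    intro g hg
    have h1 := hpow g hg (2 * orderOf g - 2)
    have h2 : 0 < orderOf g := orderOf_pos g
    have h3 : g ^ (2 * orderOf g - 2 + 1) = g⁻¹ := by
      refine eq_inv_of_mul_eq_one_left ?_
      rw [← pow_succ, show 2 * orderOf g - 2 + 1 + 1 = orderOf g * 2 by omega, pow_mul,
        pow_orderOf_eq_one, one_pow]
    rwa [h3] at h1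
  have h1 : ∃ i ∈ s, Represents θ (elt i) 1 := by
    obtain ⟨g, hg⟩ := h.exists_represents 0 (by simpa [Nat.blt_eq] using hN 0 h0)
    have h2 := hclosed g g⁻¹ ⟨0, h0, hg⟩ (hinv g ⟨0, h0, hg⟩)
    rwa [mul_inv_cancel] at h2
  induction hg using Subgroup.closure_induction with
  | mem x hx => exact hx
  | one => exact h1
  | mul x y _ _ hx hy => exact hclosed _ _ hx hy
  | inv x _ hx => exact hinv _ hx

/-- The checks on the tuples make the key of an element constant on its coset and different for
different cosets. -/
theorem isCosetKey (h : IsCoding θ N elt) {s : List ℕ} {ts : List (List ℕ)}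
    (hs : ∀ i ∈ s, i < N) (hts : checkTuples n N elt s ts = true) :
    IsCosetKey θ (codedSubgroup θ elt s) ts := by
  simp only [checkTuples, Bool.and_eq_true, List.all_eq_true, List.any_eq_true, decide_eq_true_eq,
    Bool.or_eq_true, Bool.not_eq_true', memNat_iff, List.mem_range, Nat.blt_eq] at hts
  obtain ⟨⟨⟨h1, h2⟩, h3⟩, h4⟩ := hts
  intro x y g g' hx hy hxy
  have hne : ts ≠ [] := by rintro rfl; simp at h2
  obtain ⟨t, ht, ht'⟩ := exists_cosetKey_eq n x ts hne
  obtain ⟨u, hu, hu'⟩ := exists_cosetKey_eq n y ts hne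
  obtain ⟨r, hr, hrt⟩ := h1 t ht
  obtain ⟨r', hr', hru⟩ := h1 u hu
  obtain ⟨ρ, hρ⟩ := h.exists_represents r (hs r hr)
  obtain ⟨ρ', hρ'⟩ := h.exists_represents r' (hs r' hr')
  have hlt : ∀ {x g}, Represents θ x g → ∀ i < n, codeApp x i < n := fun {x g} hx i hi =>
    (hx ⟨i, hi⟩).trans_lt (θ g ⟨i, hi⟩).2
  have h5 := tupleKey_injective (c := x) (d := y) (s := t) (t := u) (by simp [hrt, hru])
    (fun i hi => by
      rw [hrt, List.mem_map] at hi
      obtain ⟨p, hp, rfl⟩ := hi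
      exact hlt hx _ (hlt hρ _ (h3 p hp)))
    (fun i hi => by
      rw [hru, List.mem_map] at hi
      obtain ⟨p, hp, rfl⟩ := hi
      exact hlt hy _ (hlt hρ' _ (h3 p hp)))
    (by rw [← ht', ← hu', hxy])
  rw [hrt, hru, List.map_map, List.map_map, List.map_inj_left] at h5
  have h6 : ∀ p (hp : p < n), p ∈ ts.headI → θ ((g' * ρ')⁻¹ * (g * ρ)) ⟨p, hp⟩ = ⟨p, hp⟩ := by
    intro p hp hpt
    have h7 := h5 p hpt
    have h8 : θ (g * ρ) ⟨p, hp⟩ = θ (g' * ρ') ⟨p, hp⟩ := Fin.ext (by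
      rw [map_mul, map_mul, Equiv.Perm.mul_apply, Equiv.Perm.mul_apply, ← hx, ← hy, ← hρ ⟨p, hp⟩,
        ← hρ' ⟨p, hp⟩]
      exact h7)
    rw [map_mul, Equiv.Perm.mul_apply, h8, map_inv]
    exact (θ (g' * ρ')).symm_apply_apply _
  obtain ⟨i, hi, hi'⟩ := h.exists_elt ((g' * ρ')⁻¹ * (g * ρ))
  have h7 : i ∈ s := by
    rcases h4 i hi with h8 | h8
    · rw [List.all_eq_false] at h8
      obtain ⟨p, hp, h9⟩ := h8
      have h10 := hi' ⟨p, h3 p hp⟩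
      rw [h6 p (h3 p hp) hp] at h10
      exact absurd (by simpa using h10) h9
    · exact h8
  have mem : ∀ {i g}, i ∈ s → Represents θ (elt i) g → g ∈ codedSubgroup θ elt s :=
    fun hi hg => Subgroup.subset_closure ⟨_, hi, hg⟩
  have h8 := mem h7 hi'
  rw [QuotientGroup.eq, ← inv_mem_iff]
  have h9 := mul_mem (mul_mem (mem hr' hρ') h8) (inv_mem (mem hr hρ))
  convert h9 using 1
  group

theorem injOn_of_distinctKeys {s : List ℕ} {t : List ℕ} (ht : ∀ p ∈ t, p < n)
    (hnd : distinctKeys n elt s t = true) {i j : ℕ} (hi : i ∈ s) (hj : j ∈ s) {g : G}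
    (hg : Represents θ (elt i) g) (hg' : Represents θ (elt j) g) : i = j := by
  refine List.inj_on_of_nodup_map (distinct_nodup _ _ hnd).1 hi hj ?_
  have : ∀ p ∈ t, codeApp (elt i) p = codeApp (elt j) p := fun p hp =>
    (hg ⟨p, ht p hp⟩).trans (hg' ⟨p, ht p hp⟩).symm
  exact tupleKey_congr _ this

theorem card_codedSubgroup (h : IsCoding θ N elt) {s t : List ℕ}
    (hs : checkSubgroup n N elt s = true) (ht : ∀ p ∈ t, p < n)
    (hnd : distinctKeys n elt s t = true) :
    Nat.card (codedSubgroup θ elt s) = s.length := by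
  classical
  have hs' := hs
  simp only [checkSubgroup, Bool.and_eq_true, List.all_eq_true, Nat.blt_eq] at hs'
  have hN := hs'.1.1
  have hnd' : s.Nodup := (distinct_nodup _ _ hnd).1.of_map _
  choose! e he using h.exists_represents
  have hb : Function.Bijective (fun i : {i // i ∈ s} => (⟨e i, (h.mem_codedSubgroup hs).2
      ⟨i, i.2, he i (hN i i.2)⟩⟩ : codedSubgroup θ elt s)) := by
    constructor
    · intro i j hij
      have h1 : e i = e j := congrArg Subtype.val hij
      exact Subtype.ext (injOn_of_distinctKeys ht hnd i.2 j.2 (he i (hN i i.2))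
        (h1 ▸ he j (hN j j.2)))
    · rintro ⟨g, hg⟩
      obtain ⟨i, hi, hi'⟩ := (h.mem_codedSubgroup hs).1 hg
      exact ⟨⟨i, hi⟩, Subtype.ext ((he i (hN i hi)).unique h.injective hi' fun _ _ => rfl)⟩
  rw [← Nat.card_congr (Equiv.ofBijective _ hb), Nat.card_eq_fintype_card,
    ← List.toFinset_card_of_nodup hnd', ← Fintype.card_coe]
  exact Fintype.card_congr (Equiv.subtypeEquivRight fun _ => List.mem_toFinset.symm)

theorem card_eq (h : IsCoding θ N elt) {t : List ℕ} (ht : ∀ p ∈ t, p < n)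
    (hnd : distinctKeys n elt (List.range N) t = true) : Nat.card G = N := by
  choose! e he using h.exists_represents
  have hb : Function.Bijective (fun i : Fin N => e i) := by
    constructor
    · intro i j hij
      exact Fin.ext (injOn_of_distinctKeys ht hnd (List.mem_range.2 i.2) (List.mem_range.2 j.2)
        (he i i.2) ((show e i = e j from hij) ▸ he j j.2))
    · intro g
      obtain ⟨i, hi, hi'⟩ := h.exists_elt g
      exact ⟨⟨i, hi⟩, (he i hi).unique h.injective hi' fun _ _ => rfl⟩
  rw [← Nat.card_congr (Equiv.ofBijective _ hb), Nat.card_eq_fintype_card, Fintype.card_fin]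

end IsCoding

end Coded

/-! ### Families of subgroups and maps between their permutation lattices -/

section Families

variable {G : Type*} [Group G] {n : ℕ}

/-- A finite family of subgroups `A c`, given by generators, with tuples whose translates
distinguish the cosets modulo `A c`. -/
structure Family where
  /-- The number of subgroups. -/
  size : ℕ
  /-- The numbers of generators of the subgroups. -/
  gens : ℕ → List ℕ
  /-- The tuples that distinguish the cosets. -/
  tuples : ℕ → List (List ℕ)

/-- The subgroups of the family. -/
def Family.sub (𝒜 : Family) (θ : G →* Equiv.Perm (Fin n)) (elt : ℕ → ℕ) :
    Fin 𝒜.size → Subgroup G := fun c => codedSubgroup θ elt (𝒜.gens c)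

/-- The tuples of the family distinguish the cosets. -/
def Family.Valid (𝒜 : Family) (θ : G →* Equiv.Perm (Fin n)) (elt : ℕ → ℕ) : Prop :=
  ∀ c, IsCosetKey θ (𝒜.sub θ elt c) (𝒜.tuples c)

/-- The `G`-set `⨆ G/A` of the family. -/
abbrev Family.Points (𝒜 : Family) (θ : G →* Equiv.Perm (Fin n)) (elt : ℕ → ℕ) : Type _ :=
  CosetSum (𝒜.sub θ elt)

/-- Replaces the numbers of the group elements by their codes. -/
def codes (elt : ℕ → ℕ) (l : List Term) : List Term :=
  List.rec [] (fun t _ ih => forceNat (elt t.2.2) fun x => (t.1, t.2.1, x) :: ih) l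

/-- The numbers that occur are in range. -/
def inRange (m N : ℕ) (l : List Term) : Bool :=
  l.all fun t => Nat.blt t.2.1 m && Nat.blt t.2.2 N

/-- The two linear combinations are equal. -/
def sameTerms (n m id : ℕ) (ts : ℕ → List (List ℕ)) (l l' : List Term) : Bool :=
  vanishes n m ts (appendTerms l (translate n id (-1) l'))

variable {θ : G →* Equiv.Perm (Fin n)} {N : ℕ} {elt : ℕ → ℕ}

theorem IsCoding.exists_describes (h : IsCoding θ N elt) {m : ℕ} (A : Fin m → Subgroup G)
    {l : List Term} (hl : inRange m N l = true) :
    ∃ v, Describes θ A (codes elt l) v := by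
  induction l with
  | nil => exact ⟨0, .nil⟩
  | cons t l ih =>
    obtain ⟨k, c, i⟩ := t
    simp only [inRange, List.all_cons, Bool.and_eq_true, Nat.blt_eq] at hl ih
    obtain ⟨v, hv⟩ := ih hl.2
    obtain ⟨g, hg⟩ := h.exists_represents i hl.1.2
    have h1 : codes elt ((k, c, i) :: l) = (k, c, elt i) :: codes elt l := by
      change (forceNat (elt i) fun x => (k, c, x) :: codes elt l) = _
      rw [forceNat_eq]
    rw [h1]
    exact ⟨_, .cons k ⟨c, hl.1.1⟩ hg hv⟩

/-- Two linear combinations agree if the keys cancel in their difference. -/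
theorem Describes.eq {𝒜 : Family} (h𝒜 : 𝒜.Valid θ elt) {id : ℕ} (hid : Represents θ id 1)
    {l l' : List Term} {v v' : MonoidAlgebra ℤ (𝒜.Points θ elt)}
    (h : Describes θ (𝒜.sub θ elt) l v) (h' : Describes θ (𝒜.sub θ elt) l' v')
    (hl : sameTerms n 𝒜.size id 𝒜.tuples l l' = true) : v = v' := by
  have h1 := (h.append (h'.translate hid (-1))).eq_zero h𝒜 hl
  rwa [map_one, neg_one_smul, Module.End.one_apply, ← sub_eq_add_neg, sub_eq_zero] at h1

/-- The map out of the permutation lattice of a family with the listed values on the base points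
is well defined: the values are fixed by the generators of the subgroups. -/
def checkMap (n N : ℕ) (elt : ℕ → ℕ) (𝒜 ℬ : Family) (φ : ℕ → List Term) : Bool :=
  (List.range 𝒜.size).all fun c => inRange ℬ.size N (φ c) && (𝒜.gens c).all fun i =>
    sameTerms n ℬ.size (elt 0) ℬ.tuples (forceNat (elt i) fun x => translate n x 1 (codes elt (φ c)))
      (codes elt (φ c))

/-- The map has the listed values on the base points. -/
def Realizes {𝒜 ℬ : Family} (φ : ℕ → List Term)
    (f : (permLattice G (𝒜.Points θ elt)).IntertwiningMap
      (permLattice G (ℬ.Points θ elt))) : Prop :=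
  ∃ v : Fin 𝒜.size → MonoidAlgebra ℤ (ℬ.Points θ elt),
    (∀ c (g : G), f (.single ⟨c, g⟩ 1) = permLattice G (ℬ.Points θ elt) g (v c)) ∧
      ∀ c : Fin 𝒜.size, Describes θ (ℬ.sub θ elt) (codes elt (φ c)) (v c)

theorem Realizes.apply {𝒜 ℬ : Family} {φ : ℕ → List Term}
    {f : (permLattice G (𝒜.Points θ elt)).IntertwiningMap (permLattice G (ℬ.Points θ elt))}
    (h : Realizes φ f) {l : List Term} {x : MonoidAlgebra ℤ (𝒜.Points θ elt)}
    (hx : Describes θ (𝒜.sub θ elt) l x) :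
    Describes θ (ℬ.sub θ elt) (applyTerms n (fun c => codes elt (φ c)) l) (f x) :=
  hx.apply h.choose_spec.1 h.choose_spec.2

theorem Realizes.describes {𝒜 ℬ : Family} {φ : ℕ → List Term}
    {f : (permLattice G (𝒜.Points θ elt)).IntertwiningMap (permLattice G (ℬ.Points θ elt))}
    (h : Realizes φ f) (c : Fin 𝒜.size) :
    Describes θ (ℬ.sub θ elt) (codes elt (φ c)) (f (.single ⟨c, (1 : G)⟩ 1)) := by
  obtain ⟨v, hv, hv'⟩ := h
  rw [hv, map_one]
  exact hv' c

/-- A map exists if the values at the base points are fixed by the stabilizers. -/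
theorem IsCoding.exists_realizes (h : IsCoding θ N elt) (hid : Represents θ (elt 0) 1)
    {𝒜 ℬ : Family} (hℬ : ℬ.Valid θ elt) {φ : ℕ → List Term}
    (hφ : checkMap n N elt 𝒜 ℬ φ = true) :
    ∃ f : (permLattice G (𝒜.Points θ elt)).IntertwiningMap (permLattice G (ℬ.Points θ elt)),
      Realizes φ f := by
  simp only [checkMap, List.all_eq_true, List.mem_range, Bool.and_eq_true, forceNat_eq] at hφ
  choose v hv using fun c : Fin 𝒜.size => h.exists_describes (ℬ.sub θ elt) (hφ c c.2).1
  have hinv : ∀ c, ∀ g ∈ 𝒜.sub θ elt c, permLattice G (ℬ.Points θ elt) g (v c) = v c := by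
    intro c g hg
    induction hg using Subgroup.closure_induction with
    | mem g hg =>
      obtain ⟨i, hi, hg⟩ := hg
      have h1 := ((hv c).translate hg 1).eq hℬ hid (hv c) ((hφ c c.2).2 i hi)
      rwa [one_smul] at h1
    | one => rw [map_one]; rfl
    | mul x y _ _ hx hy => rw [map_mul, Module.End.mul_apply, hy, hx]
    | inv x _ hx =>
      conv_lhs => rw [← hx, ← Module.End.mul_apply, ← map_mul, inv_mul_cancel, map_one]
      rfl
  obtain ⟨f, hf⟩ := exists_intertwiningMap v hinv
  exact ⟨f, v, hf, hv⟩

/-- A property of the values of an equivariant map need only be tested on base points. -/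
theorem forall_mem_of_base {m : ℕ} {A : Fin m → Subgroup G} {V : Type*} [AddCommGroup V]
    {ρ : Representation ℤ G V} (D : (permLattice G (CosetSum A)).IntertwiningMap ρ)
    (S : Submodule ℤ V) (hS : ∀ g, ∀ x ∈ S, ρ g x ∈ S)
    (h : ∀ c, D (.single ⟨c, (1 : G)⟩ 1) ∈ S) (x : MonoidAlgebra ℤ (CosetSum A)) : D x ∈ S := by
  have h1 : (⊤ : Submodule ℤ (MonoidAlgebra ℤ (CosetSum A))) ≤ S.comap D.toLinearMap := by
    rw [← (permBasis (CosetSum A)).span_eq, Submodule.span_le]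
    rintro _ ⟨⟨c, y⟩, rfl⟩
    induction y using QuotientGroup.induction_on with
    | H g =>
    change D (.single ⟨c, (g : G ⧸ A c)⟩ 1) ∈ S
    have h2 : MonoidAlgebra.single (⟨c, (g : G ⧸ A c)⟩ : CosetSum A) (1 : ℤ) =
        permLattice G (CosetSum A) g (.single ⟨c, (1 : G)⟩ 1) := by
      rw [Representation.ofMulAction_single]
      change _ = MonoidAlgebra.single (⟨c, ((g * 1 : G) : G ⧸ A c)⟩ : CosetSum A) (1 : ℤ)
      rw [mul_one]
    rw [h2]
    have h3 := LinearMap.congr_fun (D.isIntertwining' g) (.single ⟨c, (1 : G)⟩ 1)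
    have h4 : D (permLattice G (CosetSum A) g (.single ⟨c, (1 : G)⟩ 1)) =
      ρ g (D (.single ⟨c, (1 : G)⟩ 1)) := h3
    rw [h4]
    exact hS g _ (h c)
  exact h1 trivial

end Families

section Kernel

variable {G : Type*} [Group G] [Fintype G] {H : Subgroup G}

/-- Sum over the group of the translates of a base point, with the coefficients of the translates of
`v` at the coset `H`. -/
def averageTerm {m : ℕ} (A : Fin m → Subgroup G) (c : Fin m) :
    MonoidAlgebra ℤ (G ⧸ H) →ₗ[ℤ] MonoidAlgebra ℤ (CosetSum A) where
  toFun v := ∑ g : G, (cosetLattice H g v).coeff (1 : G) • .single ⟨c, (g : G ⧸ A c)⟩ 1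
  map_add' v v' := by simp [add_smul, Finset.sum_add_distrib]
  map_smul' k v := by simp [Finset.smul_sum, mul_smul]

theorem averageTerm_single {m : ℕ} (A : Fin m → Subgroup G) (c : Fin m) (h : G) :
    averageTerm A c (.single (h : G ⧸ H) 1) = ∑ᶠ u : H, permLattice G (CosetSum A) u
      (.single ⟨c, (h⁻¹ : G)⟩ 1) := by
  classical
  have := Fintype.ofFinite H
  rw [finsum_eq_sum_of_fintype]
  change ∑ g : G, (cosetLattice H g (.single (h : G ⧸ H) 1)).coeff (1 : G) •
    MonoidAlgebra.single (⟨c, (g : G ⧸ A c)⟩ : CosetSum A) (1 : ℤ) = _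
  rw [← Fintype.sum_equiv (Equiv.mulRight h⁻¹) (fun g => (if g ∈ H then (1 : ℤ) else 0) •
    MonoidAlgebra.single (⟨c, ((g * h⁻¹ : G) : G ⧸ A c)⟩ : CosetSum A) (1 : ℤ))]
  · simp only [ite_smul, one_smul, zero_smul]
    rw [← Finset.sum_filter, Finset.sum_subtype (p := fun g => g ∈ H) _ (by simp)]
    refine Finset.sum_congr rfl fun u _ => ?_
    rw [Representation.ofMulAction_single]
    rfl
  · intro g
    rw [Equiv.coe_mulRight, Representation.ofMulAction_single, MonoidAlgebra.coeff_single,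
      Finsupp.single_apply]
    refine congrArg₂ (· • ·) (if_congr ?_ rfl rfl) rfl
    change _ ↔ ((g * h⁻¹ * h : G) : G ⧸ H) = _
    rw [inv_mul_cancel_right, eq_comm, QuotientGroup.eq, inv_one, one_mul]

/-- The dual map, in terms of sums over the group: the value at the coordinate of the coset `H`. -/
theorem dualHom_coordinate {m : ℕ} {A : Fin m → Subgroup G} [Fintype (CosetSum A)]
    (π : (permLattice G (CosetSum A)).IntertwiningMap (cosetLattice H))
    (hπ : ∀ x, π x ∈ (augmentation H).ker.toSubmodule) (w : Fin m → ℤ) (c : ℤ)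
    (hw : ∀ j, w j * Nat.card (A j) = c) :
    c • dualHom π hπ (coordinate H (1 : G)) =
      ∑ j, w j • averageTerm A j (π (.single ⟨j, (1 : G)⟩ 1)) := by
  classical
  have (j : Fin m) : Fintype (G ⧸ A j) := Fintype.ofFinite _
  change c • ∑ p : CosetSum A, coordinate H (1 : G) ⟨π (.single p 1), hπ _⟩ •
    MonoidAlgebra.single p 1 = _
  have h0 : ∀ F : CosetSum A → MonoidAlgebra ℤ (CosetSum A),
      ∑ p, F p = ∑ j, ∑ x : G ⧸ A j, F ⟨j, x⟩ := fun F => by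
    convert Fintype.sum_sigma F
  rw [h0, Finset.smul_sum]
  refine Finset.sum_congr rfl fun j _ => ?_
  rw [← hw j, mul_smul]
  congr 1
  change _ = ∑ g : G, (cosetLattice H g (π (.single ⟨j, (1 : G)⟩ 1))).coeff (1 : G) •
    MonoidAlgebra.single (⟨j, (g : G ⧸ A j)⟩ : CosetSum A) (1 : ℤ)
  have h1 : ∀ g : G, (cosetLattice H g (π (.single ⟨j, (1 : G)⟩ 1))).coeff (1 : G) =
      (π (.single ⟨j, (g : G ⧸ A j)⟩ 1)).coeff (1 : G) := fun g => by
    rw [← π.isIntertwining, Representation.ofMulAction_single]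
    change (π (.single ⟨j, ((g * 1 : G) : G ⧸ A j)⟩ 1)).coeff _ = _
    rw [mul_one]
  simp only [h1]
  have h2 : ∀ F : G ⧸ A j → MonoidAlgebra ℤ (CosetSum A),
      ∑ g : G, F g = (Nat.card (A j) : ℤ) • ∑ x, F x := fun F => by
    rw [← Fintype.sum_equiv (Subgroup.groupEquivQuotientProdSubgroup (s := A j)).symm
      (fun p => F p.1) (fun g => F g), Fintype.sum_prod_type]
    · simp [Finset.smul_sum, Nat.card_eq_fintype_card]
    · intro p
      conv_lhs => rw [← (Subgroup.groupEquivQuotientProdSubgroup (s := A j)).apply_symm_apply p]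
      rfl
  rw [h2 fun x => (π (.single ⟨j, x⟩ 1)).coeff (1 : G) • .single ⟨j, x⟩ 1]
  congr 1

end Kernel

/-! ### Certificates for flabby resolutions -/

section PermLattices

variable {G : Type*} [Group G]

/-- Isomorphic `G`-sets have isomorphic permutation lattices. -/
def permEquiv {X Y : Type*} [MulAction G X] [MulAction G Y] (e : X ≃ Y)
    (he : ∀ (g : G) x, e (g • x) = g • e x) : (permLattice G X).Equiv (permLattice G Y) :=
  .mk ((permBasis X).equiv (permBasis Y) e) fun g => (permBasis X).ext fun x => by
    have h : ∀ x, (permBasis X).equiv (permBasis Y) e (.single x 1) = .single (e x) 1 :=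
      fun x => (permBasis X).equiv_apply x (permBasis Y) e
    change (permBasis X).equiv (permBasis Y) e (permLattice G X g (.single x 1)) =
      permLattice G Y g ((permBasis X).equiv (permBasis Y) e (.single x 1))
    rw [Representation.ofMulAction_single, h, h, Representation.ofMulAction_single, he]

theorem permEquiv_single {X Y : Type*} [MulAction G X] [MulAction G Y] (e : X ≃ Y)
    (he : ∀ (g : G) x, e (g • x) = g • e x) (x : X) :
    permEquiv e he (.single x 1) = .single (e x) 1 :=
  (permBasis X).equiv_apply x (permBasis Y) e

end PermLattices

/-- The data that describe a resolution as in `exists_flabbyClass`, for permutation lattices of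
families of subgroups. Maps are given by their values on the base points, and solutions of equations
are given for the base points, too. -/
structure Certificate where
  /-- The family of `P`. -/
  P : Family
  /-- The family of `Q₀`. -/
  Q₀ : Family
  /-- The family of `Q`. -/
  Q : Family
  /-- The family of `Y`. -/
  Y : Family
  /-- The elements of the subgroup `H`. -/
  H : List ℕ
  /-- The tuples that distinguish the cosets of `H`. -/
  tuples : List (List ℕ)
  /-- The map `ℤ[P] → I_{G/H}`: coefficient, group element and inverse of the group element. -/
  aug : ℕ → List (ℤ × ℕ × ℕ)
  /-- The map `f : ℤ[P] → ℤ[Q]`. -/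
  f : ℕ → List Term
  /-- The map `f₀ : ℤ[Q₀] → ℤ[Q]`. -/
  f₀ : ℕ → List Term
  /-- The map `a : ℤ[Q] → ℤ[Y]`. -/
  a : ℕ → List Term
  /-- The map `b : ℤ[Y] → ℤ[Q]`. -/
  b : ℕ → List Term
  /-- The map `w : ℤ[Y] → ℤ[Y]`. -/
  w : ℕ → List Term
  /-- Numbers inversely proportional to the orders of the stabilizers in `P`. -/
  weight : ℕ → ℤ
  /-- The factor of proportionality. -/
  scale : ℤ
  /-- An integer which annihilates the cokernel of `w`. -/
  exponent : ℤ
  /-- Generators of the group. -/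
  gens : List ℕ
  /-- Elements of `ℤ[P]` that are mapped to `gH - H` for the generators `g`. -/
  augSol : ℕ → List Term
  /-- Solutions of `f x + f₀ z = q - b (a q)`. -/
  qSol : ℕ → List Term × List Term
  /-- Solutions of `f x + f₀ z = b (w y)`. -/
  bwSol : ℕ → List Term × List Term
  /-- Solutions of `w y = a (f x)`. -/
  afSol : ℕ → List Term
  /-- Solutions of `w y = a (f₀ z)`. -/
  af₀Sol : ℕ → List Term
  /-- Solutions of `w y' = y - a (b y)`. -/
  abSol : ℕ → List Term
  /-- Solutions of `w y' = exponent • y`. -/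
  wSol : ℕ → List Term

namespace Certificate

variable (n N : ℕ) (elt : ℕ → ℕ) (C : Certificate)

/-- The family with the one member `H`. -/
def base : Family := ⟨1, fun _ => C.H, fun _ => C.tuples⟩

/-- The map `ℤ[P] → I_{G/H} ⊆ ℤ[G/H]` in the form of the other maps. -/
def augTerms (c : ℕ) : List Term := (C.aug c).map fun t => (t.1, 0, t.2.1)

/-- The terms `k h⁻¹ c` for the terms `k h` of the image in `I_{G/H}` of the base point `c`. -/
def invTerms (c : ℕ) : List Term := (C.aug c).map fun t => (C.weight c * t.1, c, t.2.2)

/-- Applies a map between permutation lattices. -/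
def app (φ : ℕ → List Term) (l : List Term) : List Term := applyTerms n (fun c => codes elt (φ c)) l

/-- The base point `c`. -/
def pt (c : ℕ) : List Term := codes elt [(1, c, 0)]

/-- The difference of two linear combinations. -/
def diff (l l' : List Term) : List Term := appendTerms l (translate n (elt 0) (-1) l')

/-- The conditions on a certificate, which are decided by computation. -/
structure Holds : Prop where
  /-- The element with the number zero is neutral. -/
  one : Nat.beq (codeMul n (elt 0) (elt 0)) (elt 0) = true
  /-- The maps are well defined: their values at the base points are fixed by the stabilizers. -/
  augMap : checkMap n N elt C.P C.base C.augTerms = true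
  fMap : checkMap n N elt C.P C.Q C.f = true
  f₀Map : checkMap n N elt C.Q₀ C.Q C.f₀ = true
  aMap : checkMap n N elt C.Q C.Y C.a = true
  bMap : checkMap n N elt C.Y C.Q C.b = true
  wMap : checkMap n N elt C.Y C.Y C.w = true
  /-- The map `aug` has its values in the augmentation ideal. -/
  augSum : ((List.range C.P.size).all fun c => (C.augTerms c).foldr (fun t s => t.1 + s) 0 == 0) =
    true
  /-- The third entries in `aug` are the numbers of the inverses. -/
  inv : ((List.range C.P.size).all fun c => (C.aug c).all fun t => Nat.blt t.2.2 N &&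
    Nat.beq (codeMul n (elt t.2.1) (elt t.2.2)) (elt 0)) = true
  scale_ne : C.scale ≠ 0
  exponent_ne : C.exponent ≠ 0
  /-- The composition of `f` with the dual of `aug` vanishes on the coordinate of the coset `H`. -/
  ker : vanishes n C.Q.size C.Q.tuples (orbitTerms n (C.H.map elt) (app n elt C.f
    (List.flatMap (fun c => codes elt (C.invTerms c)) (List.range C.P.size)))) = true
  /-- The map `aug` is onto the augmentation ideal. -/
  aug_eq : (C.gens.all fun i => Nat.blt i N && inRange C.P.size N (C.augSol i) &&
    sameTerms n 1 (elt 0) (fun _ => C.tuples) (app n elt C.augTerms (codes elt (C.augSol i)))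
      (codes elt [(1, 0, i), (-1, 0, 0)])) = true
  /-- The solutions are correct. -/
  q_eq : ((List.range C.Q.size).all fun c => inRange C.P.size N (C.qSol c).1 &&
    inRange C.Q₀.size N (C.qSol c).2 && sameTerms n C.Q.size (elt 0) C.Q.tuples
      (appendTerms (app n elt C.f (codes elt (C.qSol c).1))
        (app n elt C.f₀ (codes elt (C.qSol c).2)))
      (diff n elt (pt elt c) (app n elt C.b (app n elt C.a (pt elt c))))) = true
  bw_eq : ((List.range C.Y.size).all fun c => inRange C.P.size N (C.bwSol c).1 &&
    inRange C.Q₀.size N (C.bwSol c).2 && sameTerms n C.Q.size (elt 0) C.Q.tuples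
      (appendTerms (app n elt C.f (codes elt (C.bwSol c).1))
        (app n elt C.f₀ (codes elt (C.bwSol c).2)))
      (app n elt C.b (app n elt C.w (pt elt c)))) = true
  af_eq : ((List.range C.P.size).all fun c => inRange C.Y.size N (C.afSol c) &&
    sameTerms n C.Y.size (elt 0) C.Y.tuples (app n elt C.w (codes elt (C.afSol c)))
      (app n elt C.a (app n elt C.f (pt elt c)))) = true
  af₀_eq : ((List.range C.Q₀.size).all fun c => inRange C.Y.size N (C.af₀Sol c) &&
    sameTerms n C.Y.size (elt 0) C.Y.tuples (app n elt C.w (codes elt (C.af₀Sol c)))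
      (app n elt C.a (app n elt C.f₀ (pt elt c)))) = true
  ab_eq : ((List.range C.Y.size).all fun c => inRange C.Y.size N (C.abSol c) &&
    sameTerms n C.Y.size (elt 0) C.Y.tuples (app n elt C.w (codes elt (C.abSol c)))
      (diff n elt (pt elt c) (app n elt C.a (app n elt C.b (pt elt c))))) = true
  w_eq : ((List.range C.Y.size).all fun c => inRange C.Y.size N (C.wSol c) &&
    sameTerms n C.Y.size (elt 0) C.Y.tuples (app n elt C.w (codes elt (C.wSol c)))
      (translate n (elt 0) C.exponent (pt elt c))) = true

variable {n N elt C} {G : Type*} [Group G] {θ : G →* Equiv.Perm (Fin n)}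

theorem describes_pt (hid : Represents θ (elt 0) 1) {m : ℕ}
    (A : Fin m → Subgroup G) (c : Fin m) :
    Describes θ A (pt elt c) (.single ⟨c, (1 : G)⟩ 1) := by
  have h1 : pt elt c = [((1 : ℤ), (c : ℕ), elt 0)] := by
    change forceNat (elt 0) (fun x => [((1 : ℤ), (c : ℕ), x)]) = _
    rw [forceNat_eq]
  rw [h1]
  convert Describes.cons 1 c hid .nil
  rw [one_smul, add_zero]

theorem diff_describes (hid : Represents θ (elt 0) 1) {m : ℕ} {A : Fin m → Subgroup G}
    {l l' : List Term} {v v' : MonoidAlgebra ℤ (CosetSum A)} (h : Describes θ A l v)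
    (h' : Describes θ A l' v') : Describes θ A (diff n elt l l') (v - v') := by
  have h1 := h.append (h'.translate hid (-1))
  rwa [map_one, neg_one_smul, Module.End.one_apply, ← sub_eq_add_neg] at h1

end Certificate

/-- An idempotent of a group is the neutral element. -/
theorem IsCoding.represents_one {G : Type*} [Group G] {n N : ℕ} {θ : G →* Equiv.Perm (Fin n)}
    {elt : ℕ → ℕ} (h : IsCoding θ N elt) (hN : 0 < N)
    (h1 : Nat.beq (codeMul n (elt 0) (elt 0)) (elt 0) = true) : Represents θ (elt 0) 1 := by
  obtain ⟨g, hg⟩ := h.exists_represents 0 hN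
  have h2 := hg.mul hg
  rw [Nat.eq_of_beq_eq_true h1] at h2
  have h3 := h2.unique h.injective hg fun _ _ => rfl
  rwa [mul_eq_left.mp h3] at hg

/-- The elements of a coded subgroup, in the order of the list. -/
theorem IsCoding.exists_sum_codedSubgroup {G : Type*} [Group G] {n N : ℕ}
    {θ : G →* Equiv.Perm (Fin n)} {elt : ℕ → ℕ} (h : IsCoding θ N elt) {s t : List ℕ}
    (hs : checkSubgroup n N elt s = true) (ht : ∀ p ∈ t, p < n)
    (hnd : distinctKeys n elt s t = true) :
    ∃ l : List G, List.Forall₂ (Represents θ) (s.map elt) l ∧ ∀ {M : Type*} [AddCommGroup M]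
      (F : G → M), (l.map F).sum = ∑ᶠ u : codedSubgroup θ elt s, F u := by
  classical
  have hs' := hs
  simp only [checkSubgroup, Bool.and_eq_true, List.all_eq_true, Nat.blt_eq] at hs'
  have hN := hs'.1.1
  have hnd' : s.Nodup := (distinct_nodup _ _ hnd).1.of_map _
  choose! e he using h.exists_represents
  refine ⟨s.map e, ?_, fun {M} _ F => ?_⟩
  · rw [List.forall₂_map_left_iff, List.forall₂_map_right_iff, List.forall₂_same]
    exact fun i hi => he i (hN i hi)
  · have hnd'' : (s.map e).Nodup := hnd'.map_on fun i hi j hj hij =>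
      injOn_of_distinctKeys ht hnd hi hj (he i (hN i hi)) (hij ▸ he j (hN j hj))
    rw [← List.sum_toFinset _ hnd'']
    have : Finite G := h.finite
    have := Fintype.ofFinite (codedSubgroup θ elt s)
    rw [finsum_eq_sum_of_fintype]
    refine Finset.sum_subtype _ (fun x => ?_) _
    rw [List.mem_toFinset, List.mem_map, h.mem_codedSubgroup hs]
    constructor
    · rintro ⟨i, hi, rfl⟩
      exact ⟨i, hi, he i (hN i hi)⟩
    · rintro ⟨i, hi, hx⟩
      exact ⟨i, hi, (he i (hN i hi)).unique h.injective hx fun _ _ => rfl⟩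

namespace Certificate

variable {G : Type*} [Group G] {n N : ℕ} {θ : G →* Equiv.Perm (Fin n)} {elt : ℕ → ℕ}
variable {C : Certificate}

/-- The `G`-set of the family with the one member `H` is `G/H`. -/
def baseEquiv (θ : G →* Equiv.Perm (Fin n)) (elt : ℕ → ℕ) (C : Certificate) :
    (permLattice G (C.base.Points θ elt)).Equiv (cosetLattice (codedSubgroup θ elt C.H)) :=
  permEquiv (X := C.base.Points θ elt) (Y := G ⧸ codedSubgroup θ elt C.H)
    ⟨fun x => x.2, fun x => ⟨(0 : Fin 1), x⟩, fun x => by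
      obtain ⟨c, x⟩ := x
      obtain rfl : c = (0 : Fin 1) := Subsingleton.elim (α := Fin 1) _ _
      rfl, fun x => rfl⟩ fun g x => rfl

theorem baseEquiv_single (g : G) : baseEquiv θ elt C (.single ⟨(0 : Fin 1), (g : G ⧸ _)⟩ 1) =
    .single (g : G ⧸ codedSubgroup θ elt C.H) 1 :=
  permEquiv_single _ _ _

/-- The inverse terms describe the sums in `averageTerm`. -/
theorem exists_describes_average [Fintype G] (hθ : Function.Injective θ)
    (hid : Represents θ (elt 0) 1) {m : ℕ} (A : Fin m → Subgroup G)
    (h : IsCoding θ N elt) (c : Fin m) (k : ℤ) {l : List (ℤ × ℕ × ℕ)}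
    {v : MonoidAlgebra ℤ (C.base.Points θ elt)}
    (hv : Describes θ (C.base.sub θ elt) (codes elt (l.map fun t => (t.1, 0, t.2.1))) v)
    (hl : (l.all fun t => Nat.blt t.2.2 N && Nat.beq (codeMul n (elt t.2.1) (elt t.2.2)) (elt 0)) =
      true) :
    ∃ y, Describes θ A (codes elt (l.map fun t => (k * t.1, c, t.2.2))) y ∧
      k • averageTerm A c (baseEquiv θ elt C v) =
        ∑ᶠ u : codedSubgroup θ elt C.H, permLattice G (CosetSum A) u y := by
  have hcodes : ∀ (k : ℤ) (c i : ℕ) (l : List Term),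
      codes elt ((k, c, i) :: l) = (k, c, elt i) :: codes elt l := fun k c i l => by
    change (forceNat (elt i) fun x => (k, c, x) :: codes elt l) = _
    rw [forceNat_eq]
  induction l generalizing v with
  | nil =>
    change Describes θ _ [] v at hv
    cases hv
    refine ⟨0, .nil, ?_⟩
    simp
  | cons t l ih =>
    obtain ⟨z, i, j⟩ := t
    rw [List.map_cons, hcodes] at hv
    simp only [List.all_cons, Bool.and_eq_true, Nat.blt_eq] at hl
    generalize hx : (_ :: _ : List Term) = L at hv
    cases hv with
    | nil => cases hx
    | @cons L' v' z' c' x g hg hL' =>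
      simp only [List.cons.injEq, Prod.mk.injEq] at hx
      obtain ⟨⟨rfl, -, rfl⟩, rfl⟩ := hx
      obtain rfl : c' = (0 : Fin 1) := Subsingleton.elim (α := Fin 1) _ _
      obtain ⟨y, hy, hy'⟩ := ih hL' (by simpa using hl.2)
      obtain ⟨g', hg'⟩ := h.exists_represents j hl.1.1
      have h1 := hg.mul hg'
      rw [Nat.eq_of_beq_eq_true hl.1.2] at h1
      have h2 : g' = g⁻¹ :=
        eq_inv_of_mul_eq_one_right (h1.unique hθ hid fun _ _ => rfl)
      refine ⟨(k * z) • .single ⟨c, (g' : G)⟩ 1 + y, ?_, ?_⟩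
      · rw [List.map_cons, hcodes]
        exact .cons _ c hg' hy
      · have := Fintype.ofFinite (codedSubgroup θ elt C.H)
        rw [finsum_eq_sum_of_fintype] at hy' ⊢
        simp only [map_add, map_smul, Finset.sum_add_distrib, smul_add, ← Finset.smul_sum]
        rw [hy', baseEquiv_single, averageTerm_single, finsum_eq_sum_of_fintype, h2, smul_smul]

theorem describes_flatMap {m : ℕ} {A : Fin m → Subgroup G} {L : ℕ → List Term}
    {y : Fin m → MonoidAlgebra ℤ (CosetSum A)} (h : ∀ c : Fin m, Describes θ A (L c) (y c)) :
    Describes θ A (List.flatMap L (List.range m)) (∑ c, y c) := by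
  have happ : ∀ l l' : List Term, appendTerms l l' = l ++ l' := fun l l' => by
    induction l with
    | nil => rfl
    | cons t l ih => exact congrArg (t :: ·) ih
  have key : ∀ s : List (Fin m), Describes θ A (List.flatMap (fun c : Fin m => L c) s)
      (s.map y).sum := by
    intro s
    induction s with
    | nil => exact .nil
    | cons c s ih =>
      rw [List.flatMap_cons, ← happ, List.map_cons, List.sum_cons]
      exact (h c).append ih
  have h1 := key (List.finRange m)
  rw [← List.map_coe_finRange_eq_range, List.flatMap_map]
  rwa [← List.sum_toFinset _ (List.nodup_finRange m), List.toFinset_finRange] at h1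

/-- The augmentation is the sum of the coefficients. -/
theorem augmentation_eq_of_describes {l : List Term} {v : MonoidAlgebra ℤ (C.base.Points θ elt)}
    (hv : Describes θ (C.base.sub θ elt) (codes elt l) v) :
    augmentation (codedSubgroup θ elt C.H) (baseEquiv θ elt C v) =
      l.foldr (fun t s => t.1 + s) 0 := by
  induction l generalizing v with
  | nil =>
    change Describes θ _ [] v at hv
    cases hv
    simp
  | cons t l ih =>
    obtain ⟨z, c, i⟩ := t
    have h1 : codes elt ((z, c, i) :: l) = (z, c, elt i) :: codes elt l := by
      change (forceNat (elt i) fun x => (z, c, x) :: codes elt l) = _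
      rw [forceNat_eq]
    rw [h1] at hv
    generalize hx : (_ :: _ : List Term) = L at hv
    cases hv with
    | nil => cases hx
    | @cons L' v' z' c' x g hg hL' =>
      simp only [List.cons.injEq, Prod.mk.injEq] at hx
      obtain ⟨⟨rfl, -, rfl⟩, rfl⟩ := hx
      obtain rfl : c' = (0 : Fin 1) := Subsingleton.elim (α := Fin 1) _ _
      rw [map_add, map_smul, map_add, map_smul, baseEquiv_single, ih hL', List.foldr_cons]
      congr 1
      change z • Finsupp.linearCombination ℤ (fun _ => (1 : ℤ)) (Finsupp.single _ (1 : ℤ)) = z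
      simp

/-- The augmentation ideal is generated by the differences `gH - H` for generators `g`. -/
theorem exists_map_eq_of_generators {H : Subgroup G} [Finite (G ⧸ H)] {M : Type*} [AddCommGroup M]
    {ρ : Representation ℤ G M} (π : ρ.IntertwiningMap (cosetLattice H)) {S : Set G}
    (hS : Subgroup.closure S = ⊤)
    (hπ : ∀ g ∈ S, ∃ x, π x = .single (g : G ⧸ H) 1 - .single ((1 : G) : G ⧸ H) 1) :
    ∀ i ∈ (augmentation H).ker.toSubmodule, ∃ x, π x = i := by
  have := Fintype.ofFinite (G ⧸ H)
  have htrans : ∀ g h : G, cosetLattice H g (.single (h : G ⧸ H) 1) =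
      .single ((g * h : G) : G ⧸ H) 1 := fun g h => by
    rw [Representation.ofMulAction_single]
    rfl
  have h1 : ∀ g : G, ∃ x, π x = .single (g : G ⧸ H) 1 - .single ((1 : G) : G ⧸ H) 1 := by
    intro g
    have hg : g ∈ Subgroup.closure S := hS ▸ Subgroup.mem_top g
    induction hg using Subgroup.closure_induction with
    | mem g hg => exact hπ g hg
    | one => exact ⟨0, by rw [map_zero, sub_self]⟩
    | mul g h _ _ hg hh =>
      obtain ⟨x, hx⟩ := hg
      obtain ⟨y, hy⟩ := hh
      refine ⟨ρ g y + x, ?_⟩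
      rw [map_add, π.isIntertwining, hx, hy, map_sub, htrans, htrans, mul_one, sub_add_sub_cancel]
    | inv g _ hg =>
      obtain ⟨x, hx⟩ := hg
      refine ⟨-ρ g⁻¹ x, ?_⟩
      rw [map_neg, π.isIntertwining, hx, map_sub, htrans, htrans, inv_mul_cancel, mul_one, neg_sub]
  have h2 : ∀ ω : G ⧸ H, ∃ x, π x = .single ω 1 - .single ((1 : G) : G ⧸ H) 1 := fun ω =>
    QuotientGroup.induction_on ω h1
  choose x hx using h2
  intro i hi
  refine ⟨∑ ω, i.coeff ω • x ω, ?_⟩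
  rw [mem_augmentation_ker] at hi
  have h3 : i = ∑ ω, i.coeff ω • MonoidAlgebra.single ω (1 : ℤ) :=
    ((permBasis (G ⧸ H)).sum_repr i).symm
  rw [map_sum]
  simp only [map_smul, hx, smul_sub, Finset.sum_sub_distrib]
  rw [← h3, ← Finset.sum_smul, hi, zero_smul, sub_zero]

variable [Finite G]

/-- A certificate that passes all checks yields a flabby resolution of `J_{G/H}`. -/
theorem Holds.exists_flabbyClass (hC : C.Holds n N elt) (h : IsCoding θ N elt) (hN : 0 < N)
    (hQ : C.Q.Valid θ elt) (hY : C.Y.Valid θ elt)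
    (hH : IsCosetKey θ (codedSubgroup θ elt C.H) C.tuples)
    (hs : checkSubgroup n N elt C.H = true) {t : List ℕ} (ht : ∀ p ∈ t, p < n)
    (hnd : distinctKeys n elt C.H t = true) (hgens : codedSubgroup θ elt C.gens = ⊤)
    (hw : ∀ j : Fin C.P.size, C.weight j * Nat.card (C.P.sub θ elt j) = C.scale) {d : ℕ}
    (hd : Nat.card (C.P.Points θ elt) + 1 = d + (codedSubgroup θ elt C.H).index)
    (hcard : Nat.card (C.P.Points θ elt) + Nat.card (C.Q₀.Points θ elt) + 1 =
      Nat.card (C.Q.Points θ elt) + (codedSubgroup θ elt C.H).index) :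
    ∃ F : Representation ℤ G (Fin d → ℤ), IsFlabbyClassOf (chevalley (codedSubgroup θ elt C.H)) F ∧
      IsStablyPermutation F ∧ Nonempty ((F.prod ((permLattice G (C.Q₀.Points θ elt)).prod
        (permLattice G (C.Y.Points θ elt)))).Equiv ((permLattice G (C.Q.Points θ elt)).prod
          (permLattice G (C.Y.Points θ elt)))) := by
  classical
  have := Fintype.ofFinite G
  have := Fintype.ofFinite (G ⧸ codedSubgroup θ elt C.H)
  have hid := h.represents_one hN hC.one
  have hB : C.base.Valid θ elt := fun _ => hH
  obtain ⟨π', hπ'⟩ := h.exists_realizes hid hB hC.augMap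
  obtain ⟨f, hf⟩ := h.exists_realizes hid hQ hC.fMap
  obtain ⟨f₀, hf₀⟩ := h.exists_realizes hid hQ hC.f₀Map
  obtain ⟨a, ha⟩ := h.exists_realizes hid hY hC.aMap
  obtain ⟨b, hb⟩ := h.exists_realizes hid hQ hC.bMap
  obtain ⟨w, hw'⟩ := h.exists_realizes hid hY hC.wMap
  let ι := baseEquiv θ elt C
  let π : (permLattice G (C.P.Points θ elt)).IntertwiningMap
      (cosetLattice (codedSubgroup θ elt C.H)) := ι.toIntertwiningMap.comp π'
  have hπι : ∀ x, π x = ι (π' x) := fun _ => rfl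
  have hsmul : ∀ (g : G), ∀ i ∈ (augmentation (codedSubgroup θ elt C.H)).ker.toSubmodule,
      cosetLattice (codedSubgroup θ elt C.H) g i ∈
        (augmentation (codedSubgroup θ elt C.H)).ker.toSubmodule :=
    fun g i hi => (augmentation (codedSubgroup θ elt C.H)).ker.apply_mem_toSubmodule g hi
  have hπ : ∀ x, π x ∈ (augmentation (codedSubgroup θ elt C.H)).ker.toSubmodule := by
    refine forall_mem_of_base π _ hsmul fun c => ?_
    have h1 := List.all_eq_true.mp hC.augSum c (List.mem_range.mpr c.2)
    have h2 := hπ'.describes c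
    change augmentation _ (ι (π' _)) = 0
    rw [augmentation_eq_of_describes h2]
    simpa using h1
  have hsurj : ∀ i ∈ (augmentation (codedSubgroup θ elt C.H)).ker.toSubmodule, ∃ x, π x = i := by
    refine exists_map_eq_of_generators π hgens ?_
    rintro g ⟨i, hi, hg⟩
    have h1 := List.all_eq_true.mp hC.aug_eq i hi
    simp only [Bool.and_eq_true] at h1
    obtain ⟨x, hx⟩ := h.exists_describes (C.P.sub θ elt) h1.1.2
    have hcodes : codes elt [(1, 0, i), (-1, 0, 0)] = [(1, 0, elt i), (-1, 0, elt 0)] := by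
      change (forceNat (elt i) fun x => ((1 : ℤ), 0, x) :: forceNat (elt 0) fun y =>
        [((-1 : ℤ), 0, y)]) = _
      rw [forceNat_eq, forceNat_eq]
    have h2 : Describes θ (C.base.sub θ elt) (codes elt [(1, 0, i), (-1, 0, 0)])
        ((1 : ℤ) • .single ⟨(0 : Fin 1), (g : G)⟩ 1 +
          ((-1 : ℤ) • .single ⟨(0 : Fin 1), (1 : G)⟩ 1 + 0)) := by
      rw [hcodes]
      exact .cons 1 (0 : Fin 1) hg (.cons (-1) (0 : Fin 1) hid .nil)
    refine ⟨x, ?_⟩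
    rw [hπι, (hπ'.apply hx).eq hB hid h2 h1.2, map_add, map_add, map_smul, map_smul, map_zero,
      baseEquiv_single, baseEquiv_single, one_smul, neg_one_smul, add_zero, sub_eq_add_neg]
  have hfsol : ∀ (l l' : List Term), inRange C.P.size N l = true → inRange C.Q₀.size N l' = true →
      ∃ x z, Describes θ (C.Q.sub θ elt) (appendTerms (app n elt C.f (codes elt l))
        (app n elt C.f₀ (codes elt l'))) (f x + f₀ z) := by
    intro l l' hl hl'
    obtain ⟨x, hx⟩ := h.exists_describes (C.P.sub θ elt) hl
    obtain ⟨z, hz⟩ := h.exists_describes (C.Q₀.sub θ elt) hl'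
    exact ⟨x, z, (hf.apply hx).append (hf₀.apply hz)⟩
  have hwsol : ∀ l : List Term, inRange C.Y.size N l = true → ∃ y, Describes θ (C.Y.sub θ elt)
      (app n elt C.w (codes elt l)) (w y) := by
    intro l hl
    obtain ⟨y, hy⟩ := h.exists_describes (C.Y.sub θ elt) hl
    exact ⟨y, hw'.apply hy⟩
  let R : Submodule ℤ (MonoidAlgebra ℤ (C.Q.Points θ elt)) :=
    LinearMap.range (f.toLinearMap.coprod f₀.toLinearMap)
  have hR : ∀ g, ∀ x ∈ R, permLattice G (C.Q.Points θ elt) g x ∈ R := by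
    rintro g _ ⟨⟨x, z⟩, rfl⟩
    refine ⟨(permLattice G _ g x, permLattice G _ g z), ?_⟩
    change f (permLattice G _ g x) + f₀ (permLattice G _ g z) = permLattice G _ g (f x + f₀ z)
    rw [map_add, f.isIntertwining, f₀.isIntertwining]
  have hRmem : ∀ q ∈ R, ∃ x z, f x + f₀ z = q := by
    rintro _ ⟨⟨x, z⟩, rfl⟩
    exact ⟨x, z, rfl⟩
  let W : Submodule ℤ (MonoidAlgebra ℤ (C.Y.Points θ elt)) := LinearMap.range w.toLinearMap
  have hW : ∀ g, ∀ x ∈ W, permLattice G (C.Y.Points θ elt) g x ∈ W := by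
    rintro g _ ⟨x, rfl⟩
    exact ⟨permLattice G _ g x, w.isIntertwining _ _ g x⟩
  refine NormOne.exists_flabbyClass (N := C.exponent) π hπ hsurj f f₀ a b w ?_ ?_ ?_ ?_ ?_ ?_
    hC.exponent_ne ?_ hd hcard
  -- `f ∘ dualHom` vanishes on the coordinate of the coset `H`, whose translates span `J_{G/H}`; up
  -- to the factor `scale`, its image in `ℤ[P]` is an explicit sum over `H`.
  · intro _ φ
    have h0 : f (dualHom π hπ (coordinate _ (1 : G))) = 0 := by
      refine (smul_eq_zero.mp (?_ : C.scale • _ = _)).resolve_left hC.scale_ne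
      rw [← map_smul, dualHom_coordinate π hπ (fun j => C.weight j) C.scale hw]
      choose y hy hy' using fun c : Fin C.P.size => exists_describes_average (N := N) h.injective hid
        (C.P.sub θ elt) h c (C.weight c) (hπ'.describes c)
        (List.all_eq_true.mp hC.inv c (List.mem_range.mpr c.2))
      have := Fintype.ofFinite (codedSubgroup θ elt C.H)
      have h1 : ∑ j : Fin C.P.size, C.weight j • averageTerm (H := codedSubgroup θ elt C.H)
          (C.P.sub θ elt) j (π (.single ⟨j, (1 : G)⟩ 1)) =
          ∑ᶠ u : codedSubgroup θ elt C.H, permLattice G (C.P.Points θ elt) u (∑ c, y c) := by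
        simp only [map_sum, finsum_eq_sum_of_fintype]
        rw [Finset.sum_comm]
        refine Finset.sum_congr rfl fun c _ => ?_
        rw [← finsum_eq_sum_of_fintype]
        exact hy' c
      obtain ⟨l, hl, hl'⟩ := h.exists_sum_codedSubgroup hs ht hnd
      have h2 := ((hf.apply (describes_flatMap hy)).orbit hl).eq_zero hQ hC.ker
      rw [hl' fun u => permLattice G (C.Q.Points θ elt) u (f (∑ c, y c)),
        finsum_eq_sum_of_fintype] at h2
      rw [h1, finsum_eq_sum_of_fintype, map_sum, ← h2]
      exact Finset.sum_congr rfl fun u _ => f.isIntertwining _ _ _ _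
    rw [← sum_smul_coordinate ((1 : G) : G ⧸ _) φ, map_sum, map_sum]
    refine Finset.sum_eq_zero fun x _ => ?_
    induction x using QuotientGroup.induction_on with
    | H g =>
    have h1 : coordinate (codedSubgroup θ elt C.H) (g : G ⧸ _) =
        chevalley (codedSubgroup θ elt C.H) g (coordinate _ (1 : G)) := by
      rw [chevalley_coordinate]
      change _ = coordinate _ ((g * 1 : G) : G ⧸ _)
      rw [mul_one]
    rw [map_smul, map_smul, h1, (dualHom π hπ).isIntertwining, f.isIntertwining, h0, map_zero,
      smul_zero]
  · refine fun q => hRmem _ (forall_mem_of_base (.id _ - b.comp a) R hR (fun c => ?_) q)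
    have h1 := List.all_eq_true.mp hC.q_eq c (List.mem_range.mpr c.2)
    simp only [Bool.and_eq_true] at h1
    obtain ⟨x, z, h2⟩ := hfsol _ _ h1.1.1 h1.1.2
    have h3 := h2.eq hQ hid (diff_describes hid (describes_pt hid _ c)
      (hb.apply (ha.apply (describes_pt hid _ c)))) h1.2
    exact ⟨(x, z), h3⟩
  · refine fun q => hRmem _ (forall_mem_of_base (b.comp w) R hR (fun c => ?_) q)
    have h1 := List.all_eq_true.mp hC.bw_eq c (List.mem_range.mpr c.2)
    simp only [Bool.and_eq_true] at h1
    obtain ⟨x, z, h2⟩ := hfsol _ _ h1.1.1 h1.1.2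
    exact ⟨(x, z), h2.eq hQ hid (hb.apply (hw'.apply (describes_pt hid _ c))) h1.2⟩
  · refine forall_mem_of_base (a.comp f) W hW fun c => ?_
    have h1 := List.all_eq_true.mp hC.af_eq c (List.mem_range.mpr c.2)
    simp only [Bool.and_eq_true] at h1
    obtain ⟨y, hy⟩ := hwsol _ h1.1
    exact ⟨y, hy.eq hY hid (ha.apply (hf.apply (describes_pt hid _ c))) h1.2⟩
  · refine forall_mem_of_base (a.comp f₀) W hW fun c => ?_
    have h1 := List.all_eq_true.mp hC.af₀_eq c (List.mem_range.mpr c.2)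
    simp only [Bool.and_eq_true] at h1
    obtain ⟨y, hy⟩ := hwsol _ h1.1
    exact ⟨y, hy.eq hY hid (ha.apply (hf₀.apply (describes_pt hid _ c))) h1.2⟩
  · refine forall_mem_of_base (.id _ - a.comp b) W hW fun c => ?_
    have h1 := List.all_eq_true.mp hC.ab_eq c (List.mem_range.mpr c.2)
    simp only [Bool.and_eq_true] at h1
    obtain ⟨y, hy⟩ := hwsol _ h1.1
    exact ⟨y, hy.eq hY hid (diff_describes hid (describes_pt hid _ c)
      (ha.apply (hb.apply (describes_pt hid _ c)))) h1.2⟩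
  · refine forall_mem_of_base (C.exponent • .id _) W hW fun c => ?_
    have h1 := List.all_eq_true.mp hC.w_eq c (List.mem_range.mpr c.2)
    simp only [Bool.and_eq_true] at h1
    obtain ⟨y, hy⟩ := hwsol _ h1.1
    have h2 := (describes_pt hid (C.Y.sub θ elt) c).translate hid C.exponent
    rw [map_one] at h2
    exact ⟨y, hy.eq hY hid h2 h1.2⟩

end Certificate

/-! ### The certificates -/

/-- The elements of the group of maps `x ↦ (a x + b)/(c x + d)` of the projective line over a field
with `n - 1` elements, in the order of the Bruhat decomposition: `x ↦ a x + b`, then the products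
of these maps with `x ↦ 1/x` and a translation. The arguments are the codes of the translations, of
the homotheties and of `x ↦ 1/x`; the last point is the point at infinity. -/
def bruhat (n : ℕ) (t s : List ℕ) (w i : ℕ) : ℕ :=
  let q := n - 1
  let borel : ℕ → ℕ := fun i => codeMul n (t.getD (i / (q - 1)) 0) (s.getD (i % (q - 1)) 0)
  let j := i - q * (q - 1)
  Bool.rec (codeMul n (codeMul n (borel (j / q)) w) (t.getD (j % q) 0)) (borel i)
    (Nat.blt i (q * (q - 1)))

/-- The elements of `S₃ = PGL₂(𝔽₂)`. -/
def elt₂ : ℕ → ℕ := bruhat 3 [0x210, 0x201] [0x210] 0x012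

/-- The elements of `A₅ = PSL₂(𝔽₄)`. -/
def elt₄ : ℕ → ℕ :=
  bruhat 5 [0x43210, 0x42301, 0x41032, 0x40123] [0x43210, 0x41320, 0x42130] 0x02314

/-- The codes of the translations of the line over the field with eight elements. -/
def translations : List ℕ := [0x876543210, 0x867452301, 0x854761032, 0x845670123, 0x832107654,
  0x823016745, 0x810325476, 0x801234567]

/-- The codes of the homotheties of the line over the field with eight elements. -/
def homotheties : List ℕ := [0x876543210, 0x857136420, 0x821475630, 0x815267340, 0x863724150,
  0x842351760, 0x834612570]

/-- The elements of `PSL₂(𝔽₈)`. -/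
def elt₈ : ℕ → ℕ := bruhat 9 translations homotheties 0x043276518

/-- The certificate for `S₃` and the trivial subgroup. Here `P` consists of two copies of the group,
and the map to the augmentation ideal sends their base points to `1 - g`, where `g` is a
transposition or a 3-cycle. -/
def certificate₁ : Certificate where
  P := ⟨2, (fun
    | 0 => [0]
    | _ => [0]), (fun
    | 0 => [[0, 1, 2]]
    | _ => [[0, 1, 2]])⟩
  Q₀ := ⟨1, (fun _ => [1, 2]), (fun _ => [[]])⟩
  Q := ⟨3, (fun
    | 0 => [0, 1]
    | 1 => [0, 1]
    | _ => [0, 3, 4]), (fun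
    | 0 => [[2]]
    | 1 => [[2]]
    | _ => [[0, 1, 2], [1, 2, 0], [2, 0, 1]])⟩
  Y := ⟨0, (fun _ => []), (fun _ => [])⟩
  H := [0]
  tuples := [[0, 1, 2]]
  aug := fun
    | 0 => [(1, 0, 0), (-1, 1, 1)]
    | _ => [(1, 0, 0), (-1, 3, 4)]
  f := fun
    | 0 => [(1, 0, 0), (-1, 1, 4)]
    | _ => [(1, 1, 4), (1, 2, 1)]
  f₀ := fun _ => [(-2, 0, 2), (-2, 0, 4), (-2, 0, 0), (1, 1, 2), (1, 1, 4), (1, 1, 0),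
      (-2, 2, 0), (-2, 2, 1)]
  a := fun _ => []
  b := fun _ => []
  w := fun _ => []
  weight := fun
    | 0 => 1
    | _ => 1
  scale := 1
  exponent := 1
  gens := [1, 2]
  augSol i := match i with
    | 1 => [(-1, 0, 0)]
    | _ => [(-1, 0, 0), (1, 1, 2)]
  qSol := fun
    | 0 => ([(2, 0, 0), (1, 0, 1), (1, 0, 2), (1, 0, 3), (2, 0, 4), (2, 1, 0), (2, 1, 1)],
      [(1, 0, 0)])
    | 1 => ([(1, 0, 0), (1, 0, 1), (2, 0, 2), (2, 0, 4), (2, 1, 0), (2, 1, 1)], [(1, 0, 0)])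
    | _ => ([(-2, 0, 0), (-1, 0, 2), (-1, 0, 3), (-2, 0, 4), (-2, 1, 0), (-1, 1, 1)],
      [(-1, 0, 0)])
  bwSol := fun _ => ([], [])
  afSol := fun _ => []
  af₀Sol := fun _ => []
  abSol := fun _ => []
  wSol := fun _ => []

/-- The certificate for `S₃` and a subgroup of order two, the stabilizer of a point. Here `P` is the
set of ordered pairs of different points, `Q` that of 2-subsets and 3-cycles, and the map to the
augmentation ideal sends `(x, y)` to `x - y`. The map `f` sends `(x, y)` to the sum of `{x, y}` and
the 3-cycles `σ` with `σ x = y`. -/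
def certificate₂ : Certificate where
  P := ⟨1, (fun _ => [0]), (fun _ => [[2, 0]])⟩
  Q₀ := ⟨1, (fun _ => [0, 1, 2, 3, 4, 5]), (fun _ => [[0, 1, 2], [1, 0, 2], [2, 1, 0],
      [1, 2, 0], [2, 0, 1], [0, 2, 1]])⟩
  Q := ⟨2, (fun
    | 0 => [0, 2]
    | _ => [0, 3, 4]), (fun
    | 0 => [[0, 2], [2, 0]]
    | _ => [[0, 1, 2], [1, 2, 0], [2, 0, 1]])⟩
  Y := ⟨0, (fun _ => []), (fun _ => [])⟩
  H := [0, 1]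
  tuples := [[2]]
  aug := fun _ => [(1, 0, 0), (-1, 2, 2)]
  f := fun _ => [(1, 0, 0), (1, 1, 0)]
  f₀ := fun _ => [(1, 0, 3), (1, 0, 0), (1, 0, 1), (1, 1, 0), (1, 1, 1)]
  a := fun _ => []
  b := fun _ => []
  w := fun _ => []
  weight := fun _ => 1
  scale := 1
  exponent := 1
  gens := [1, 2]
  augSol i := match i with
    | 1 => []
    | _ => [(1, 0, 2)]
  qSol := fun
    | 0 => ([(-1, 0, 3), (-1, 0, 1)], [(1, 0, 0)])
    | _ => ([(1, 0, 3), (1, 0, 0), (1, 0, 1)], [(-1, 0, 0)])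
  bwSol := fun _ => ([], [])
  afSol := fun _ => []
  af₀Sol := fun _ => []
  abSol := fun _ => []
  wSol := fun _ => []

/-- The certificate for `A₅` and a Klein four-group. Here `P` consists of `G/H` and the set of
ordered pairs of different points, `Q` of a class of twelve 5-cycles and two copies of the set of
points, and `Q₀` is a point. On pairs, `f` sends `(x, y)` to the sum of the point `y` in the first
copy and the 5-cycles `σ` in the class with `σ x = y`. -/
def certificate₃ : Certificate where
  P := ⟨2, (fun
    | 0 => [0, 3, 6, 9]
    | _ => [0, 1, 2]), (fun
    | 0 => [[0, 1, 4], [1, 0, 4], [2, 3, 4], [3, 2, 4]]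
    | _ => [[4, 0]])⟩
  Q₀ := ⟨1, (fun _ => [1, 2, 3, 6, 12]), (fun _ => [[]])⟩
  Q := ⟨3, (fun
    | 0 => [0, 14, 31, 36, 53]
    | 1 => [0, 1, 2, 3, 4, 5, 6, 7, 8, 9, 10, 11]
    | _ => [0, 1, 2, 3, 4, 5, 6, 7, 8, 9, 10, 11]), (fun
    | 0 => [[0, 1, 4], [3, 2, 0], [2, 0, 1], [4, 3, 2], [1, 4, 3]]
    | 1 => [[4]]
    | _ => [[4]])⟩
  Y := ⟨0, (fun _ => []), (fun _ => [])⟩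
  H := [0, 3, 6, 9]
  tuples := [[0, 1, 4], [1, 0, 4], [2, 3, 4], [3, 2, 4]]
  aug := fun
    | 0 => [(1, 0, 0), (-1, 1, 2)]
    | _ => [(1, 36, 14), (1, 52, 19), (1, 32, 21), (-1, 0, 0), (-1, 1, 2), (-1, 2, 1)]
  f := fun
    | 0 => [(1, 0, 1), (1, 0, 8), (1, 0, 7), (1, 0, 11), (1, 0, 2), (1, 0, 4), (1, 0, 10),
      (1, 0, 5), (1, 2, 0)]
    | _ => [(1, 0, 1), (1, 0, 2), (1, 0, 0), (1, 1, 12)]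
  f₀ := fun _ => [(2, 0, 1), (2, 0, 8), (2, 0, 7), (2, 0, 11), (2, 0, 9), (2, 0, 2), (2, 0, 4),
      (2, 0, 3), (2, 0, 0), (2, 0, 10), (2, 0, 5), (2, 0, 6), (-1, 1, 12), (-1, 1, 24),
      (-1, 1, 36), (-1, 1, 48), (-1, 1, 0), (1, 2, 12), (1, 2, 24), (1, 2, 36), (1, 2, 48),
      (1, 2, 0)]
  a := fun _ => []
  b := fun _ => []
  w := fun _ => []
  weight := fun
    | 0 => 3
    | _ => 4
  scale := 12
  exponent := 1
  gens := [1, 2, 3, 6, 12]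
  augSol i := match i with
    | 1 => [(-1, 0, 0)]
    | 2 => [(1, 0, 2)]
    | 3 => []
    | 6 => []
    | _ => [(1, 0, 48), (-1, 0, 28), (1, 0, 2), (-1, 1, 39), (1, 1, 36)]
  qSol := fun
    | 0 => ([(-29, 0, 0), (10, 0, 36), (-18, 0, 48), (19, 0, 52), (1, 0, 28), (30, 0, 2),
      (-35, 0, 44), (26, 0, 40), (-26, 0, 20), (27, 0, 16), (-3, 1, 15), (5, 1, 26),
      (-5, 1, 27), (-1, 1, 24), (7, 1, 38), (3, 1, 37), (-1, 1, 50), (-6, 1, 51), (-2, 1, 3),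
      (-3, 1, 6), (1, 1, 9)], [(-1, 0, 0)])
    | 1 => ([(92, 0, 0), (-31, 0, 36), (57, 0, 48), (-60, 0, 52), (-3, 0, 28), (-95, 0, 2),
      (111, 0, 44), (-83, 0, 40), (81, 0, 20), (-84, 0, 16), (8, 1, 15), (-13, 1, 26),
      (17, 1, 27), (4, 1, 24), (-21, 1, 38), (-11, 1, 37), (3, 1, 50), (20, 1, 51), (4, 1, 3),
      (8, 1, 6), (-3, 1, 9)], [(3, 0, 0)])
    | _ => ([(237, 0, 0), (-79, 0, 36), (145, 0, 48), (-153, 0, 52), (-8, 0, 28), (-244, 0, 2),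
      (285, 0, 44), (-214, 0, 40), (207, 0, 20), (-215, 0, 16), (20, 1, 15), (-32, 1, 26),
      (44, 1, 27), (8, 1, 24), (-52, 1, 38), (-28, 1, 37), (8, 1, 50), (52, 1, 51), (8, 1, 3),
      (20, 1, 6), (-8, 1, 9)], [(8, 0, 0)])
  bwSol := fun _ => ([], [])
  afSol := fun _ => []
  af₀Sol := fun _ => []
  abSol := fun _ => []
  wSol := fun _ => []

/-- The certificate for `A₅` and `A₄`, the stabilizer of a point. As for `S₃`, `P` is the set of
ordered pairs of different points, and `Q` consists of a class of twelve 5-cycles and of the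
2-subsets; `f` sends `(x, y)` to the sum of `{x, y}` and the 5-cycles `σ` in the class with `σ x =
y`. The set `Q₀` is that of the pairs `{σ, σ⁻¹}`. -/
def certificate₄ : Certificate where
  P := ⟨1, (fun _ => [0, 1, 2]), (fun _ => [[4, 0]])⟩
  Q₀ := ⟨1, (fun _ => [0, 6, 12, 14, 29, 31, 36, 38, 53, 55]), (fun _ => [[0, 1, 4], [2, 3, 4],
      [4, 1, 0], [3, 2, 0], [3, 4, 1], [2, 0, 1], [4, 3, 2], [1, 0, 2], [1, 4, 3], [0, 2, 3]])⟩
  Q := ⟨2, (fun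
    | 0 => [0, 14, 31, 36, 53]
    | _ => [0, 1, 2, 12, 16, 20]), (fun
    | 0 => [[0, 1, 4], [3, 2, 0], [2, 0, 1], [4, 3, 2], [1, 4, 3]]
    | _ => [[0, 4], [4, 0]])⟩
  Y := ⟨0, (fun _ => []), (fun _ => [])⟩
  H := [0, 1, 2, 3, 4, 5, 6, 7, 8, 9, 10, 11]
  tuples := [[4]]
  aug := fun _ => [(1, 0, 0), (-1, 12, 12)]
  f := fun _ => [(1, 0, 1), (1, 0, 2), (1, 0, 0), (1, 1, 0)]
  f₀ := fun _ => [(1, 0, 1), (1, 0, 8), (1, 0, 7), (1, 0, 11), (1, 0, 9), (1, 0, 2), (1, 0, 4),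
      (1, 0, 3), (2, 0, 0), (1, 0, 10), (1, 0, 5), (2, 0, 6), (1, 1, 14), (1, 1, 0), (1, 1, 26),
      (1, 1, 27), (1, 1, 6)]
  a := fun _ => []
  b := fun _ => []
  w := fun _ => []
  weight := fun _ => 1
  scale := 3
  exponent := 1
  gens := [1, 2, 3, 6, 12]
  augSol i := match i with
    | 1 => []
    | 2 => []
    | 3 => []
    | 6 => []
    | _ => [(1, 0, 12)]
  qSol := fun
    | 0 => ([(1, 0, 26), (-1, 0, 37), (1, 0, 50), (1, 0, 51), (1, 0, 49), (1, 0, 0), (1, 0, 6)],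
      [(-1, 0, 0)])
    | _ => ([(-1, 0, 25), (-1, 0, 26), (-1, 0, 27), (-1, 0, 39), (-1, 0, 38), (-1, 0, 37),
      (-1, 0, 50), (-1, 0, 51), (-1, 0, 49), (-2, 0, 0), (-1, 0, 3), (-1, 0, 6), (-1, 0, 9)],
      [(1, 0, 1), (1, 0, 2), (1, 0, 0)])
  bwSol := fun _ => ([], [])
  afSol := fun _ => []
  af₀Sol := fun _ => []
  abSol := fun _ => []
  wSol := fun _ => []

set_option maxHeartbeats 4000000 in
/-- The certificate for `PSL₂(𝔽₈)` and a Sylow 2-subgroup. The sets `P`, `Q` and `Q₀` are as for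
`A₅` and a Klein four-group, with a class of 56 elements of order nine in place of the 5-cycles. The
cokernel of `(f, f₀)` is not zero; it is isomorphic to the cokernel of `w` on `ℤ[Y]`, where `Y` is
the set of 3-subsets. -/
def certificate₅ : Certificate where
  P := ⟨2, (fun
    | 0 => [0, 7, 14, 21, 28, 35, 42, 49]
    | _ => [0, 1, 2, 3, 4, 5, 6]), (fun
    | 0 => [[0, 1, 8], [1, 0, 8], [2, 3, 8], [3, 2, 8], [4, 5, 8], [5, 4, 8], [6, 7, 8],
      [7, 6, 8]]
    | _ => [[8, 0]])⟩
  Q₀ := ⟨1, (fun _ => [1, 2, 3, 4, 5, 6, 7, 14, 28, 56]), (fun _ => [[]])⟩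
  Q := ⟨3, (fun
    | 0 => [0, 58, 123, 168, 233, 310, 391, 420, 501]
    | 1 => [0, 1, 2, 3, 4, 5, 6, 7, 8, 9, 10, 11, 12, 13, 14, 15, 16, 17, 18, 19, 20, 21, 22, 23,
      24, 25, 26, 27, 28, 29, 30, 31, 32, 33, 34, 35, 36, 37, 38, 39, 40, 41, 42, 43, 44, 45, 46,
      47, 48, 49, 50, 51, 52, 53, 54, 55]
    | _ => [0, 1, 2, 3, 4, 5, 6, 7, 8, 9, 10, 11, 12, 13, 14, 15, 16, 17, 18, 19, 20, 21, 22, 23,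
      24, 25, 26, 27, 28, 29, 30, 31, 32, 33, 34, 35, 36, 37, 38, 39, 40, 41, 42, 43, 44, 45, 46,
      47, 48, 49, 50, 51, 52, 53, 54, 55]), (fun
    | 0 => [[0, 1, 8], [5, 6, 0], [6, 0, 1], [8, 3, 2], [1, 8, 3], [3, 2, 4], [4, 7, 5],
      [7, 5, 6], [2, 4, 7]]
    | 1 => [[8]]
    | _ => [[8]])⟩
  Y := ⟨1, (fun _ => [0, 7, 56, 57, 112, 113]), (fun _ => [[0, 1, 8], [0, 8, 1], [1, 0, 8],
      [1, 8, 0], [8, 0, 1], [8, 1, 0]])⟩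
  H := [0, 7, 14, 21, 28, 35, 42, 49]
  tuples := [[0, 1, 8], [1, 0, 8], [2, 3, 8], [3, 2, 8], [4, 5, 8], [5, 4, 8], [6, 7, 8],
      [7, 6, 8]]
  aug := fun
    | 0 => [(1, 0, 0), (-1, 1, 4)]
    | _ => [(1, 344, 69), (1, 136, 81), (1, 320, 100), (1, 184, 74), (1, 448, 63),
      (1, 272, 107), (1, 424, 94), (-1, 0, 0), (-1, 1, 4), (-1, 2, 5), (-1, 3, 6), (-1, 4, 1),
      (-1, 5, 2), (-1, 6, 3)]
  f := fun
    | 0 => [(1, 0, 45), (1, 0, 1), (1, 0, 31), (1, 0, 32), (1, 0, 36), (1, 0, 8), (1, 0, 3),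
      (1, 0, 10), (1, 0, 50), (1, 0, 52), (1, 0, 33), (1, 0, 5), (1, 0, 38), (1, 0, 40),
      (1, 0, 43), (1, 0, 17), (1, 0, 47), (1, 0, 22), (1, 0, 15), (1, 0, 53), (1, 0, 25),
      (1, 0, 39), (1, 0, 18), (1, 0, 19), (1, 0, 26), (1, 0, 12), (1, 0, 46), (1, 0, 4),
      (1, 0, 29), (1, 0, 24), (1, 0, 54), (1, 0, 11), (1, 2, 0)]
    | _ => [(1, 0, 35), (1, 0, 8), (1, 0, 30), (1, 0, 17), (1, 0, 53), (1, 0, 26), (1, 0, 48),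
      (-12, 1, 56), (1, 1, 112), (1, 1, 168), (1, 1, 224), (1, 1, 280), (1, 1, 336),
      (1, 1, 392), (1, 1, 448), (1, 1, 0)]
  f₀ := fun _ => [(-10, 0, 45), (-10, 0, 1), (-10, 0, 42), (-10, 0, 31), (-10, 0, 35),
      (-10, 0, 32), (-10, 0, 36), (-10, 0, 8), (-10, 0, 3), (-10, 0, 10), (-10, 0, 23),
      (-10, 0, 50), (-10, 0, 51), (-10, 0, 21), (-10, 0, 52), (-10, 0, 9), (-10, 0, 33),
      (-10, 0, 5), (-10, 0, 55), (-10, 0, 13), (-10, 0, 30), (-10, 0, 38), (-10, 0, 2),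
      (-10, 0, 40), (-10, 0, 16), (-10, 0, 43), (-10, 0, 17), (-10, 0, 47), (-10, 0, 49),
      (-10, 0, 22), (-10, 0, 15), (-10, 0, 53), (-10, 0, 0), (-10, 0, 20), (-10, 0, 25),
      (-10, 0, 39), (-10, 0, 37), (-10, 0, 6), (-10, 0, 27), (-10, 0, 18), (-10, 0, 19),
      (-10, 0, 26), (-10, 0, 28), (-10, 0, 12), (-10, 0, 48), (-10, 0, 7), (-10, 0, 46),
      (-10, 0, 4), (-10, 0, 34), (-10, 0, 29), (-10, 0, 44), (-10, 0, 14), (-10, 0, 24),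
      (-10, 0, 54), (-10, 0, 41), (-10, 0, 11), (-1, 1, 56), (-1, 1, 112), (-1, 1, 168),
      (-1, 1, 224), (-1, 1, 280), (-1, 1, 336), (-1, 1, 392), (-1, 1, 448), (-1, 1, 0),
      (-2, 2, 56), (-2, 2, 112), (-2, 2, 168), (-2, 2, 224), (-2, 2, 280), (-2, 2, 336),
      (-2, 2, 392), (-2, 2, 448), (-2, 2, 0)]
  a := fun
    | 0 => [(1, 0, 60), (1, 0, 108), (1, 0, 3), (1, 0, 146), (1, 0, 132), (1, 0, 124),
      (1, 0, 20), (1, 0, 246), (1, 0, 42)]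
    | 1 => [(1, 0, 0), (1, 0, 1), (1, 0, 2), (1, 0, 3), (1, 0, 4), (1, 0, 5), (1, 0, 6),
      (1, 0, 9), (1, 0, 8), (1, 0, 11), (1, 0, 10), (1, 0, 13), (1, 0, 12), (1, 0, 14),
      (1, 0, 19), (1, 0, 20), (1, 0, 17), (1, 0, 18), (1, 0, 27), (1, 0, 26), (1, 0, 25),
      (1, 0, 24), (1, 0, 28), (1, 0, 29), (1, 0, 30), (1, 0, 37), (1, 0, 36), (1, 0, 42)]
    | _ => []
  b := fun _ => [(1, 0, 35), (1, 0, 3), (1, 0, 10), (1, 0, 28), (1, 0, 34), (1, 0, 41),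
      (5, 1, 56), (5, 1, 112), (5, 1, 0)]
  w := fun _ => [(1, 0, 110), (1, 0, 84), (1, 0, 74), (1, 0, 102), (1, 0, 92), (1, 0, 66),
      (1, 0, 0), (-1, 0, 94), (-1, 0, 76), (1, 0, 1), (-1, 0, 90), (1, 0, 2), (1, 0, 3),
      (-1, 0, 78), (1, 0, 4), (1, 0, 5), (1, 0, 6), (-1, 0, 146), (1, 0, 9), (-1, 0, 150),
      (-1, 0, 132), (1, 0, 8), (-1, 0, 134), (1, 0, 11), (1, 0, 10), (1, 0, 13), (1, 0, 12),
      (-1, 0, 198), (-1, 0, 19), (-1, 0, 190), (-1, 0, 180), (-1, 0, 254), (-1, 0, 246),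
      (-1, 0, 26), (-1, 0, 236), (-1, 0, 29), (-1, 0, 36)]
  weight := fun
    | 0 => 7
    | _ => 8
  scale := 56
  exponent := 221
  gens := [1, 2, 3, 4, 5, 6, 7, 14, 28, 56]
  augSol i := match i with
    | 1 => [(-1, 0, 0)]
    | 2 => [(-1, 0, 0), (-1, 0, 1), (-1, 0, 3)]
    | 3 => [(-1, 0, 0), (-1, 0, 1)]
    | 4 => [(1, 0, 4)]
    | 5 => [(1, 0, 4), (1, 0, 5), (1, 0, 6)]
    | 6 => [(1, 0, 4), (1, 0, 6)]
    | 7 => []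
    | 14 => []
    | 28 => []
    | _ => [(-1, 0, 0), (1, 0, 208), (-1, 0, 416), (1, 0, 288), (-1, 0, 264), (-1, 0, 1),
      (1, 0, 376), (-1, 0, 3), (1, 0, 184), (1, 0, 312), (1, 0, 120), (1, 0, 280), (1, 0, 192),
      (1, 0, 304), (-1, 0, 240), (1, 0, 112), (-1, 1, 452), (1, 1, 448)]
  qSol := fun
    | 0 => ([(-2314, 0, 6), (-2314, 0, 304), (-2314, 0, 240), (-2314, 0, 496), (-2314, 0, 432),
      (-2314, 0, 176), (-2314, 0, 368), (-2314, 0, 112), (-2314, 0, 56), (-135819, 1, 57),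
      (-134166, 1, 61), (-135488, 1, 62), (-134826, 1, 63), (-135157, 1, 58), (-136148, 1, 59),
      (-118263, 1, 56), (-152020, 1, 113), (-156318, 1, 118), (-154996, 1, 117),
      (-151360, 1, 114), (-153343, 1, 119), (-157640, 1, 116), (-15541, 1, 115),
      (-134465, 1, 112), (-152673, 1, 173), (-158624, 1, 174), (-154325, 1, 169),
      (-159284, 1, 171), (-153004, 1, 172), (-157963, 1, 175), (-23797, 1, 170),
      (-136770, 1, 168), (-158626, 1, 230), (-161932, 1, 229), (-158956, 1, 225),
      (-164576, 1, 228), (-163916, 1, 227), (-165237, 1, 226), (-23469, 1, 231),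
      (-141400, 1, 224), (-155649, 1, 287), (-155979, 1, 282), (-161597, 1, 283),
      (-162259, 1, 284), (-161268, 1, 281), (-157301, 1, 285), (-24127, 1, 286),
      (-139084, 1, 280), (-149041, 1, 338), (-151025, 1, 343), (-148379, 1, 340),
      (-154660, 1, 339), (-154329, 1, 337), (-149371, 1, 342), (-15866, 1, 341),
      (-132147, 1, 336), (-161601, 1, 395), (-166891, 1, 396), (-164906, 1, 399),
      (-167552, 1, 394), (-161931, 1, 397), (-160939, 1, 398), (-31402, 1, 393),
      (-143715, 1, 392), (929903, 1, 452), (930563, 1, 451), (924615, 1, 450), (929573, 1, 455),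
      (926599, 1, 454), (927920, 1, 453), (923953, 1, 449), (946137, 1, 448), (134495, 1, 49)],
      [(-1157, 0, 0)])
    | 1 => ([(-7210, 0, 6), (-7210, 0, 304), (-7210, 0, 240), (-7210, 0, 496), (-7210, 0, 432),
      (-7210, 0, 176), (-7210, 0, 368), (-7210, 0, 112), (-7210, 0, 56), (-423212, 1, 57),
      (-418062, 1, 61), (-422182, 1, 62), (-420122, 1, 63), (-421152, 1, 58), (-424242, 1, 59),
      (-368507, 1, 56), (-473682, 1, 113), (-487072, 1, 118), (-482952, 1, 117),
      (-471622, 1, 114), (-477802, 1, 119), (-491192, 1, 116), (-48410, 1, 115),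
      (-418977, 1, 112), (-475742, 1, 173), (-494282, 1, 174), (-480892, 1, 169),
      (-496342, 1, 171), (-476772, 1, 172), (-492222, 1, 175), (-74160, 1, 170),
      (-426187, 1, 168), (-494282, 1, 230), (-504582, 1, 229), (-495312, 1, 225),
      (-512822, 1, 228), (-510762, 1, 227), (-514882, 1, 226), (-73130, 1, 231),
      (-440607, 1, 224), (-485012, 1, 287), (-486042, 1, 282), (-503552, 1, 283),
      (-505612, 1, 284), (-502522, 1, 281), (-490162, 1, 285), (-75190, 1, 286),
      (-433397, 1, 280), (-464412, 1, 338), (-470592, 1, 343), (-462352, 1, 340),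
      (-481922, 1, 339), (-480892, 1, 337), (-465442, 1, 342), (-49440, 1, 341),
      (-411767, 1, 336), (-503552, 1, 395), (-520032, 1, 396), (-513852, 1, 399),
      (-522092, 1, 394), (-504582, 1, 397), (-501492, 1, 398), (-97850, 1, 393),
      (-447817, 1, 392), (2897594, 1, 452), (2899654, 1, 451), (2881114, 1, 450),
      (2896564, 1, 455), (2887294, 1, 454), (2891414, 1, 453), (2879054, 1, 449),
      (2948179, 1, 448), (419092, 1, 49)], [(-3605, 0, 0)])
    | _ => ([(-255, 0, 6), (-256, 0, 304), (-256, 0, 240), (-256, 0, 496), (-256, 0, 432),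
      (-256, 0, 176), (-256, 0, 368), (-256, 0, 112), (-256, 0, 56), (-15027, 1, 57),
      (-14845, 1, 61), (-14991, 1, 62), (-14918, 1, 63), (-14954, 1, 58), (-15064, 1, 59),
      (-13085, 1, 56), (-16819, 1, 113), (-17295, 1, 118), (-17149, 1, 117), (-16746, 1, 114),
      (-16966, 1, 119), (-17441, 1, 116), (-1719, 1, 115), (-14877, 1, 112), (-16893, 1, 173),
      (-17551, 1, 174), (-17075, 1, 169), (-17624, 1, 171), (-16929, 1, 172), (-17478, 1, 175),
      (-2633, 1, 170), (-15133, 1, 168), (-17551, 1, 230), (-17917, 1, 229), (-17587, 1, 225),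
      (-18209, 1, 228), (-18136, 1, 227), (-18282, 1, 226), (-2597, 1, 231), (-15645, 1, 224),
      (-17222, 1, 287), (-17258, 1, 282), (-17880, 1, 283), (-17953, 1, 284), (-17843, 1, 281),
      (-17405, 1, 285), (-2670, 1, 286), (-15389, 1, 280), (-16490, 1, 338), (-16710, 1, 343),
      (-16417, 1, 340), (-17112, 1, 339), (-17075, 1, 337), (-16527, 1, 342), (-1756, 1, 341),
      (-14621, 1, 336), (-17880, 1, 395), (-18465, 1, 396), (-18246, 1, 399), (-18538, 1, 394),
      (-17917, 1, 397), (-17807, 1, 398), (-3474, 1, 393), (-15901, 1, 392), (102887, 1, 452),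
      (102960, 1, 451), (102302, 1, 450), (102850, 1, 455), (102521, 1, 454), (102667, 1, 453),
      (102229, 1, 449), (104683, 1, 448), (14881, 1, 49)], [(-128, 0, 0)])
  bwSol := fun _ => ([(258, 0, 6), (258, 0, 304), (258, 0, 240), (258, 0, 496), (258, 0, 432),
      (258, 0, 176), (258, 0, 368), (258, 0, 112), (258, 0, 56), (15172, 1, 57), (14986, 1, 61),
      (15134, 1, 62), (15062, 1, 63), (15100, 1, 58), (15210, 1, 59), (13211, 1, 56),
      (16978, 1, 113), (17456, 1, 118), (17308, 1, 117), (16906, 1, 114), (17126, 1, 119),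
      (17604, 1, 116), (1734, 1, 115), (15017, 1, 112), (17047, 1, 173), (17711, 1, 174),
      (17234, 1, 169), (17787, 1, 171), (17086, 1, 172), (17638, 1, 175), (2652, 1, 170),
      (15271, 1, 168), (17711, 1, 230), (18079, 1, 229), (17750, 1, 225), (18376, 1, 228),
      (18303, 1, 227), (18450, 1, 226), (2614, 1, 231), (15787, 1, 224), (17393, 1, 287),
      (17430, 1, 282), (18056, 1, 283), (18130, 1, 284), (18022, 1, 281), (17579, 1, 285),
      (2704, 1, 286), (15542, 1, 280), (16656, 1, 338), (16877, 1, 343), (16582, 1, 340),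
      (17282, 1, 339), (17248, 1, 337), (16696, 1, 342), (1781, 1, 341), (14768, 1, 336),
      (18052, 1, 395), (18641, 1, 396), (18421, 1, 399), (18716, 1, 394), (18090, 1, 397),
      (17982, 1, 398), (3508, 1, 393), (16054, 1, 392), (-103873, 1, 452), (-103946, 1, 451),
      (-103282, 1, 450), (-103835, 1, 455), (-103500, 1, 454), (-103650, 1, 453),
      (-103208, 1, 449), (-105686, 1, 448), (-15024, 1, 49)], [(129, 0, 0)])
  afSol := fun
    | 0 => [(5, 0, 110), (5, 0, 84), (2, 0, 74), (2, 0, 102), (1, 0, 92), (1, 0, 66), (2, 0, 0),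
      (5, 0, 98), (2, 0, 94), (6, 0, 82), (2, 0, 76), (6, 0, 60), (6, 0, 1), (7, 0, 62),
      (1, 0, 108), (1, 0, 70), (7, 0, 90), (2, 0, 68), (2, 0, 106), (7, 0, 100), (1, 0, 58),
      (6, 0, 78), (6, 0, 4), (1, 0, 86), (8, 0, 5), (2, 0, 6), (5, 0, 154), (1, 0, 164),
      (7, 0, 118), (7, 0, 146), (1, 0, 126), (6, 0, 138), (2, 0, 150), (6, 0, 116), (2, 0, 132),
      (6, 0, 8), (2, 0, 124), (6, 0, 134), (1, 0, 114), (6, 0, 11), (7, 0, 156), (2, 0, 162),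
      (1, 0, 142), (2, 0, 13), (8, 0, 12), (1, 0, 204), (1, 0, 178), (2, 0, 186), (2, 0, 214),
      (2, 0, 14), (1, 0, 198), (2, 0, 218), (1, 0, 170), (8, 0, 19), (7, 0, 212), (6, 0, 190),
      (2, 0, 20), (2, 0, 180), (6, 0, 18), (1, 0, 254), (6, 0, 246), (7, 0, 268), (2, 0, 27),
      (1, 0, 226), (2, 0, 274), (8, 0, 26), (2, 0, 236), (6, 0, 25), (5, 0, 334), (5, 0, 308),
      (2, 0, 28), (5, 0, 322), (6, 0, 29), (5, 0, 378), (6, 0, 36), (2, 0, 42)]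
    | _ => [(-3, 0, 84), (-1, 0, 74), (-3, 0, 92), (-1, 0, 66), (-1, 0, 0), (-1, 0, 98),
      (-1, 0, 82), (-3, 0, 76), (-3, 0, 60), (-1, 0, 1), (-3, 0, 108), (-1, 0, 90), (-1, 0, 2),
      (-3, 0, 68), (-1, 0, 106), (-3, 0, 100), (-1, 0, 3), (-1, 0, 58), (-1, 0, 4), (-1, 0, 5),
      (-1, 0, 6), (-1, 0, 154), (1, 0, 146), (1, 0, 126), (1, 0, 138), (1, 0, 150), (1, 0, 116),
      (-2, 0, 132), (-2, 0, 8), (-1, 0, 124), (-2, 0, 134), (-2, 0, 114), (1, 0, 11),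
      (1, 0, 156), (-1, 0, 142), (-2, 0, 13), (1, 0, 12), (-2, 0, 178), (1, 0, 186),
      (-2, 0, 214), (1, 0, 14), (1, 0, 198), (-1, 0, 218), (1, 0, 170), (-2, 0, 212),
      (-1, 0, 190), (1, 0, 20), (1, 0, 180), (-2, 0, 17), (-2, 0, 18), (1, 0, 254),
      (-1, 0, 268), (-1, 0, 226), (1, 0, 274), (-2, 0, 26), (1, 0, 24), (-2, 0, 334),
      (1, 0, 308), (-2, 0, 28), (1, 0, 322), (1, 0, 29), (-2, 0, 30), (1, 0, 37)]
  af₀Sol := fun _ => [(-63, 0, 110), (-63, 0, 84), (-63, 0, 74), (-63, 0, 102), (-63, 0, 92),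
      (-63, 0, 66), (-63, 0, 0), (-63, 0, 98), (-63, 0, 94), (-63, 0, 82), (-63, 0, 76),
      (-63, 0, 60), (-63, 0, 1), (-63, 0, 62), (-63, 0, 108), (-63, 0, 70), (-63, 0, 90),
      (-63, 0, 2), (-63, 0, 68), (-63, 0, 106), (-63, 0, 100), (-63, 0, 3), (-63, 0, 58),
      (-63, 0, 78), (-63, 0, 4), (-63, 0, 86), (-63, 0, 5), (-63, 0, 6), (-63, 0, 154),
      (-63, 0, 164), (-63, 0, 118), (-63, 0, 146), (-63, 0, 126), (-63, 0, 9), (-63, 0, 138),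
      (-63, 0, 150), (-63, 0, 116), (-63, 0, 132), (-63, 0, 8), (-63, 0, 124), (-63, 0, 134),
      (-63, 0, 114), (-63, 0, 11), (-63, 0, 156), (-63, 0, 162), (-63, 0, 10), (-63, 0, 142),
      (-63, 0, 13), (-63, 0, 12), (-63, 0, 204), (-63, 0, 178), (-63, 0, 186), (-63, 0, 214),
      (-63, 0, 14), (-63, 0, 198), (-63, 0, 218), (-63, 0, 170), (-63, 0, 19), (-63, 0, 212),
      (-63, 0, 190), (-63, 0, 20), (-63, 0, 180), (-63, 0, 17), (-63, 0, 18), (-63, 0, 254),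
      (-63, 0, 246), (-63, 0, 268), (-63, 0, 27), (-63, 0, 226), (-63, 0, 274), (-63, 0, 26),
      (-63, 0, 236), (-63, 0, 25), (-63, 0, 24), (-63, 0, 334), (-63, 0, 308), (-63, 0, 28),
      (-63, 0, 322), (-63, 0, 29), (-63, 0, 30), (-63, 0, 378), (-63, 0, 37), (-63, 0, 36),
      (-63, 0, 42)]
  abSol := fun _ => [(-6, 0, 110), (-6, 0, 84), (-6, 0, 74), (-6, 0, 102), (-4, 0, 92),
      (-4, 0, 66), (-8, 0, 0), (-4, 0, 98), (-7, 0, 94), (-7, 0, 82), (-6, 0, 76), (-5, 0, 60),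
      (-4, 0, 1), (-7, 0, 62), (-7, 0, 108), (-6, 0, 70), (-7, 0, 90), (-6, 0, 2), (-6, 0, 68),
      (-7, 0, 106), (-4, 0, 100), (-6, 0, 3), (-5, 0, 58), (-6, 0, 78), (-4, 0, 4), (-7, 0, 86),
      (-6, 0, 5), (-6, 0, 6), (-4, 0, 154), (-7, 0, 164), (-7, 0, 118), (-7, 0, 146),
      (-6, 0, 126), (-6, 0, 9), (-7, 0, 138), (-7, 0, 150), (-5, 0, 116), (-6, 0, 132),
      (-4, 0, 8), (-6, 0, 124), (-6, 0, 134), (-5, 0, 114), (-4, 0, 11), (-4, 0, 156),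
      (-7, 0, 162), (-6, 0, 10), (-7, 0, 142), (-6, 0, 13), (-6, 0, 12), (-3, 0, 204),
      (-3, 0, 178), (-7, 0, 186), (-7, 0, 214), (-5, 0, 14), (-5, 0, 198), (-3, 0, 218),
      (-7, 0, 170), (-6, 0, 19), (-3, 0, 212), (-5, 0, 190), (-7, 0, 20), (-5, 0, 180),
      (-7, 0, 17), (-6, 0, 18), (-5, 0, 254), (-5, 0, 246), (-3, 0, 268), (-7, 0, 27),
      (-7, 0, 226), (-3, 0, 274), (-6, 0, 26), (-5, 0, 236), (-6, 0, 25), (-7, 0, 24),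
      (-7, 0, 334), (-7, 0, 308), (-5, 0, 28), (-3, 0, 322), (-7, 0, 29), (-4, 0, 30),
      (-3, 0, 378), (-4, 0, 37), (-7, 0, 36), (-7, 0, 42)]
  wSol := fun _ => [(20, 0, 110), (20, 0, 84), (124, 0, 74), (124, 0, 102), (-123, 0, 92),
      (-123, 0, 66), (-25, 0, 0), (-39, 0, 98), (-13, 0, 94), (65, 0, 82), (182, 0, 76),
      (78, 0, 60), (-123, 0, 1), (26, 0, 62), (-156, 0, 108), (-13, 0, 70), (-13, 0, 90),
      (124, 0, 2), (-13, 0, 68), (-156, 0, 106), (-39, 0, 100), (20, 0, 3), (-130, 0, 58),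
      (182, 0, 78), (-123, 0, 4), (65, 0, 86), (124, 0, 5), (20, 0, 6), (-39, 0, 154),
      (-156, 0, 164), (26, 0, 118), (-13, 0, 146), (-13, 0, 126), (124, 0, 9), (65, 0, 138),
      (-13, 0, 150), (78, 0, 116), (182, 0, 132), (-123, 0, 8), (-13, 0, 124), (182, 0, 134),
      (-130, 0, 114), (-123, 0, 11), (-39, 0, 156), (-156, 0, 162), (20, 0, 10), (65, 0, 142),
      (20, 0, 13), (124, 0, 12), (-59, 0, 204), (-59, 0, 178), (-7, 0, 186), (-7, 0, 214),
      (-130, 0, 14), (32, 0, 198), (123, 0, 218), (-7, 0, 170), (182, 0, 19), (-59, 0, 212),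
      (32, 0, 190), (65, 0, 20), (32, 0, 180), (-156, 0, 17), (-13, 0, 18), (32, 0, 254),
      (32, 0, 246), (-59, 0, 268), (65, 0, 27), (-7, 0, 226), (123, 0, 274), (182, 0, 26),
      (32, 0, 236), (-13, 0, 25), (-156, 0, 24), (-7, 0, 334), (-7, 0, 308), (78, 0, 28),
      (-59, 0, 322), (-13, 0, 29), (-39, 0, 30), (-59, 0, 378), (-39, 0, 37), (-13, 0, 36),
      (26, 0, 42)]

set_option maxHeartbeats 4000000 in
/-- The certificate for `PSL₂(𝔽₈)` and the stabilizer of a point. The sets `P`, `Q` and `Q₀` and the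
map `f` are as for `A₅` and `A₄`, with a class of 56 elements of order nine in place of the
5-cycles. The cokernel of `(f, f₀)` is not zero; it is isomorphic to the cokernel of `w` on `ℤ[Y]`,
where `Y` is the set of 3-subsets with a cyclic order. -/
def certificate₆ : Certificate where
  P := ⟨1, (fun _ => [0, 1, 2, 3, 4, 5, 6]), (fun _ => [[8, 0]])⟩
  Q₀ := ⟨1, (fun _ => [0, 14, 56, 58, 121, 123, 168, 170, 233, 235, 308, 310, 389, 391, 420, 422,
      501, 503]), (fun _ => [[0, 1, 8], [2, 3, 8], [8, 1, 0], [5, 6, 0], [3, 8, 1], [6, 0, 1],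
      [8, 3, 2], [7, 4, 2], [1, 8, 3], [4, 2, 3], [5, 7, 4], [3, 2, 4], [0, 6, 5], [4, 7, 5],
      [7, 5, 6], [1, 0, 6], [2, 4, 7], [6, 5, 7]])⟩
  Q := ⟨2, (fun
    | 0 => [0, 58, 123, 168, 233, 310, 391, 420, 501]
    | _ => [0, 1, 2, 3, 4, 5, 6, 56, 64, 72, 80, 88, 96, 104]), (fun
    | 0 => [[0, 1, 8], [5, 6, 0], [6, 0, 1], [8, 3, 2], [1, 8, 3], [3, 2, 4], [4, 7, 5],
      [7, 5, 6], [2, 4, 7]]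
    | _ => [[0, 8], [8, 0]])⟩
  Y := ⟨1, (fun _ => [0, 57, 112]), (fun _ => [[0, 1, 8], [1, 8, 0], [8, 0, 1]])⟩
  H := [0, 1, 2, 3, 4, 5, 6, 7, 8, 9, 10, 11, 12, 13, 14, 15, 16, 17, 18, 19, 20, 21, 22, 23, 24,
      25, 26, 27, 28, 29, 30, 31, 32, 33, 34, 35, 36, 37, 38, 39, 40, 41, 42, 43, 44, 45, 46, 47,
      48, 49, 50, 51, 52, 53, 54, 55]
  tuples := [[8]]
  aug := fun _ => [(1, 0, 0), (-1, 56, 56)]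
  f := fun _ => [(1, 0, 1), (1, 0, 3), (1, 0, 5), (1, 0, 2), (1, 0, 0), (1, 0, 6), (1, 0, 4),
      (1, 1, 0)]
  f₀ := fun _ => [(2, 0, 1), (2, 0, 35), (1, 0, 32), (1, 0, 36), (1, 0, 8), (2, 0, 3),
      (2, 0, 10), (1, 0, 50), (1, 0, 21), (1, 0, 5), (2, 0, 55), (1, 0, 30), (1, 0, 2),
      (1, 0, 40), (1, 0, 16), (2, 0, 43), (2, 0, 17), (2, 0, 49), (1, 0, 22), (2, 0, 15),
      (1, 0, 53), (4, 0, 0), (2, 0, 20), (2, 0, 25), (1, 0, 39), (2, 0, 6), (2, 0, 18),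
      (1, 0, 19), (1, 0, 7), (1, 0, 46), (2, 0, 4), (2, 0, 29), (1, 0, 44), (4, 0, 14),
      (2, 0, 24), (1, 0, 54), (2, 0, 41), (2, 0, 11), (1, 1, 58), (1, 1, 0), (1, 1, 117),
      (1, 1, 116), (1, 1, 170), (1, 1, 14), (1, 1, 228), (1, 1, 281), (1, 1, 393)]
  a := fun
    | 0 => [(1, 0, 1), (1, 0, 68), (1, 0, 4), (1, 0, 139), (1, 0, 116), (1, 0, 142),
      (1, 0, 181), (1, 0, 53), (1, 0, 255)]
    | _ => []
  b := fun _ => [(1, 0, 23), (-1, 0, 13), (1, 0, 30), (-1, 0, 16), (-1, 0, 49), (1, 0, 53),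
      (-1, 0, 37), (-1, 0, 46), (-1, 0, 24)]
  w := fun _ => [(1, 0, 66), (1, 0, 95), (-1, 0, 100), (1, 0, 4), (-1, 0, 92), (-1, 0, 15),
      (-1, 0, 154), (-1, 0, 11), (1, 0, 146), (1, 0, 22), (-1, 0, 219), (1, 0, 29), (-1, 0, 44)]
  weight := fun _ => 1
  scale := 7
  exponent := 17
  gens := [1, 2, 3, 4, 5, 6, 7, 14, 28, 56]
  augSol i := match i with
    | 1 => []
    | 2 => []
    | 3 => []
    | 4 => []
    | 5 => []
    | 6 => []
    | 7 => []
    | 14 => []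
    | 28 => []
    | _ => [(1, 0, 56)]
  qSol := fun
    | 0 => ([(2, 0, 57), (5, 0, 61), (1, 0, 62), (1, 0, 63), (5, 0, 58), (1, 0, 59), (1, 0, 60),
      (4, 0, 113), (4, 0, 118), (4, 0, 117), (4, 0, 114), (4, 0, 119), (4, 0, 116), (3, 0, 115),
      (3, 0, 173), (1, 0, 174), (1, 0, 169), (1, 0, 171), (3, 0, 172), (3, 0, 175), (3, 0, 170),
      (4, 0, 230), (5, 0, 229), (5, 0, 225), (4, 0, 228), (7, 0, 227), (3, 0, 226), (3, 0, 231),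
      (7, 0, 287), (4, 0, 282), (5, 0, 283), (5, 0, 284), (7, 0, 281), (3, 0, 285), (4, 0, 286),
      (4, 0, 338), (1, 0, 343), (2, 0, 340), (1, 0, 339), (2, 0, 337), (1, 0, 342), (1, 0, 341),
      (5, 0, 395), (5, 0, 396), (5, 0, 399), (5, 0, 394), (2, 0, 397), (5, 0, 398), (5, 0, 393),
      (4, 0, 452), (5, 0, 451), (6, 0, 450), (2, 0, 455), (2, 0, 454), (5, 0, 453), (4, 0, 449),
      (9, 0, 0), (6, 0, 7), (9, 0, 14), (6, 0, 21), (5, 0, 28), (8, 0, 35), (5, 0, 42),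
      (8, 0, 49)], [(-1, 0, 1), (-1, 0, 35), (-2, 0, 32), (-2, 0, 8), (-1, 0, 3), (-1, 0, 10),
      (-2, 0, 22), (-2, 0, 7), (-2, 0, 5), (-1, 0, 20), (-2, 0, 16), (-2, 0, 2), (-2, 0, 19),
      (-1, 0, 15), (-2, 0, 46), (-1, 0, 0), (-1, 0, 18), (-1, 0, 6), (-1, 0, 4)])
    | _ => ([(2, 0, 57), (2, 0, 61), (2, 0, 62), (2, 0, 63), (2, 0, 58), (2, 0, 59), (2, 0, 60),
      (-3, 0, 113), (-1, 0, 118), (-2, 0, 117), (-1, 0, 119), (-2, 0, 116), (-3, 0, 173),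
      (-1, 0, 174), (-1, 0, 171), (-2, 0, 175), (-2, 0, 170), (-3, 0, 230), (-2, 0, 229),
      (-1, 0, 228), (-2, 0, 227), (-1, 0, 226), (-3, 0, 287), (-1, 0, 283), (-1, 0, 284),
      (-2, 0, 281), (-2, 0, 286), (-3, 0, 338), (-1, 0, 343), (-2, 0, 339), (-2, 0, 337),
      (-1, 0, 341), (-3, 0, 395), (-2, 0, 396), (-2, 0, 399), (-1, 0, 394), (-1, 0, 393),
      (-3, 0, 452), (-2, 0, 450), (-2, 0, 454), (-1, 0, 453), (-1, 0, 449), (-6, 0, 0),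
      (-1, 0, 7), (-1, 0, 14), (-1, 0, 21), (-1, 0, 28), (-1, 0, 35), (-1, 0, 42), (-1, 0, 49)],
      [(1, 0, 1), (1, 0, 3), (1, 0, 5), (1, 0, 2), (1, 0, 0), (1, 0, 6), (1, 0, 4)])
  bwSol := fun _ => ([(3, 0, 57), (1, 0, 61), (4, 0, 62), (1, 0, 63), (2, 0, 58), (3, 0, 59),
      (1, 0, 60), (-3, 0, 113), (-2, 0, 118), (1, 0, 114), (1, 0, 119), (2, 0, 174),
      (1, 0, 169), (2, 0, 171), (1, 0, 172), (1, 0, 175), (1, 0, 170), (-2, 0, 230),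
      (-2, 0, 227), (-1, 0, 226), (-1, 0, 287), (-1, 0, 283), (1, 0, 284), (1, 0, 285),
      (-1, 0, 286), (1, 0, 343), (2, 0, 339), (2, 0, 342), (-1, 0, 341), (-2, 0, 395),
      (1, 0, 396), (1, 0, 394), (-1, 0, 398), (-1, 0, 452), (2, 0, 451), (-1, 0, 450),
      (2, 0, 454), (1, 0, 453), (1, 0, 449), (1, 0, 14), (2, 0, 21), (1, 0, 28), (2, 0, 49)],
      [(-1, 0, 22), (-1, 0, 26), (-1, 0, 20)])
  afSol := fun _ => [(-46, 0, 111), (-2, 0, 84), (26, 0, 75), (-19, 0, 102), (21, 0, 93),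
      (40, 0, 66), (-4, 0, 0), (-19, 0, 110), (26, 0, 99), (-46, 0, 95), (40, 0, 82),
      (-2, 0, 76), (21, 0, 61), (-4, 0, 1), (21, 0, 85), (40, 0, 98), (-19, 0, 62),
      (-2, 0, 108), (-46, 0, 71), (26, 0, 91), (-4, 0, 2), (40, 0, 74), (-19, 0, 94),
      (-46, 0, 63), (21, 0, 69), (26, 0, 107), (-2, 0, 100), (-4, 0, 3), (-46, 0, 103),
      (26, 0, 83), (21, 0, 109), (-2, 0, 68), (40, 0, 58), (-19, 0, 78), (-4, 0, 4),
      (-2, 0, 92), (21, 0, 77), (-19, 0, 70), (40, 0, 106), (26, 0, 59), (-46, 0, 87),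
      (-4, 0, 5), (26, 0, 67), (-2, 0, 60), (40, 0, 90), (21, 0, 101), (-46, 0, 79),
      (-19, 0, 86), (-4, 0, 6), (-19, 0, 7), (-19, 0, 15), (-19, 0, 23), (-19, 0, 31),
      (-19, 0, 39), (-19, 0, 47), (-19, 0, 55), (-16, 0, 154), (27, 0, 164), (27, 0, 118),
      (-4, 0, 147), (-28, 0, 127), (19, 0, 9), (-1, 0, 155), (-44, 0, 138), (-4, 0, 151),
      (-4, 0, 117), (-9, 0, 132), (-9, 0, 8), (39, 0, 165), (-28, 0, 139), (-16, 0, 124),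
      (-9, 0, 134), (-9, 0, 114), (24, 0, 11), (39, 0, 119), (20, 0, 150), (-1, 0, 125),
      (-44, 0, 156), (39, 0, 163), (-24, 0, 10), (20, 0, 146), (20, 0, 116), (-10, 0, 135),
      (-28, 0, 157), (-16, 0, 142), (-11, 0, 13), (-44, 0, 126), (-10, 0, 133), (-10, 0, 115),
      (27, 0, 162), (-1, 0, 143), (21, 0, 12), (-24, 0, 16), (-11, 0, 22), (21, 0, 32),
      (19, 0, 38), (-9, 0, 48), (24, 0, 54), (39, 0, 205), (-9, 0, 178), (-28, 0, 187),
      (-9, 0, 214), (24, 0, 14), (27, 0, 204), (-28, 0, 199), (-16, 0, 218), (-4, 0, 171),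
      (19, 0, 19), (-10, 0, 179), (-44, 0, 198), (-10, 0, 213), (-1, 0, 191), (21, 0, 20),
      (-44, 0, 186), (-1, 0, 219), (-9, 0, 212), (-4, 0, 181), (-9, 0, 17), (-10, 0, 215),
      (20, 0, 170), (-16, 0, 190), (20, 0, 180), (-11, 0, 18), (21, 0, 21), (-24, 0, 33),
      (24, 0, 41), (-11, 0, 45), (-9, 0, 53), (20, 0, 254), (39, 0, 247), (-1, 0, 269),
      (-24, 0, 27), (-4, 0, 255), (-1, 0, 227), (-44, 0, 274), (-9, 0, 26), (27, 0, 246),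
      (-16, 0, 226), (27, 0, 236), (19, 0, 25), (-16, 0, 268), (-28, 0, 275), (39, 0, 237),
      (24, 0, 24), (19, 0, 34), (-11, 0, 40), (-24, 0, 46), (21, 0, 52), (-10, 0, 335),
      (20, 0, 308), (-11, 0, 28), (-9, 0, 334), (-28, 0, 323), (24, 0, 29), (-4, 0, 309),
      (-44, 0, 322), (-9, 0, 30), (-9, 0, 35), (21, 0, 43), (-11, 0, 51), (27, 0, 378),
      (21, 0, 37), (39, 0, 379), (-24, 0, 36), (24, 0, 44), (19, 0, 50), (19, 0, 42),
      (-24, 0, 49)]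
  af₀Sol := fun _ => [(-4, 0, 111), (-196, 0, 84), (-33, 0, 75), (-70, 0, 102), (119, 0, 93),
      (97, 0, 66), (119, 0, 0), (97, 0, 110), (-4, 0, 99), (-33, 0, 95), (35, 0, 82),
      (-33, 0, 76), (-21, 0, 61), (-42, 0, 1), (-70, 0, 85), (97, 0, 98), (35, 0, 62),
      (-21, 0, 108), (-4, 0, 71), (252, 0, 91), (-196, 0, 2), (-33, 0, 74), (-33, 0, 94),
      (-21, 0, 63), (-42, 0, 69), (97, 0, 107), (-4, 0, 100), (35, 0, 3), (-196, 0, 103),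
      (-21, 0, 83), (35, 0, 109), (-42, 0, 68), (119, 0, 58), (-70, 0, 78), (-42, 0, 4),
      (119, 0, 92), (-33, 0, 77), (97, 0, 70), (-4, 0, 106), (119, 0, 59), (-196, 0, 87),
      (-70, 0, 5), (-4, 0, 67), (35, 0, 60), (252, 0, 90), (97, 0, 101), (-196, 0, 79),
      (-70, 0, 86), (-21, 0, 6), (119, 0, 7), (-42, 0, 15), (-70, 0, 23), (-21, 0, 31),
      (-42, 0, 39), (-196, 0, 47), (35, 0, 55), (-196, 0, 154), (97, 0, 164), (252, 0, 118),
      (-21, 0, 147), (35, 0, 127), (-70, 0, 9), (-70, 0, 155), (-42, 0, 138), (35, 0, 151),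
      (-42, 0, 117), (-21, 0, 132), (119, 0, 8), (-4, 0, 165), (-42, 0, 139), (-21, 0, 124),
      (35, 0, 134), (-33, 0, 114), (97, 0, 11), (252, 0, 119), (-21, 0, 150), (35, 0, 125),
      (-196, 0, 156), (97, 0, 163), (-4, 0, 10), (35, 0, 146), (-42, 0, 116), (-21, 0, 135),
      (-70, 0, 157), (-42, 0, 142), (-196, 0, 13), (-21, 0, 126), (35, 0, 133), (-33, 0, 115),
      (-4, 0, 162), (-42, 0, 143), (-33, 0, 12), (-196, 0, 16), (119, 0, 22), (-4, 0, 32),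
      (97, 0, 38), (-70, 0, 48), (-33, 0, 54), (119, 0, 205), (97, 0, 178), (-33, 0, 187),
      (-70, 0, 214), (119, 0, 14), (119, 0, 204), (-196, 0, 199), (-4, 0, 218), (119, 0, 171),
      (-70, 0, 19), (-4, 0, 179), (-70, 0, 198), (97, 0, 213), (-196, 0, 191), (-21, 0, 20),
      (-33, 0, 186), (97, 0, 219), (-4, 0, 212), (-42, 0, 181), (35, 0, 17), (-196, 0, 215),
      (119, 0, 170), (-70, 0, 190), (-42, 0, 180), (-42, 0, 18), (119, 0, 21), (-196, 0, 33),
      (35, 0, 41), (-21, 0, 45), (-42, 0, 53), (-42, 0, 254), (-21, 0, 247), (-70, 0, 269),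
      (-196, 0, 27), (-42, 0, 255), (-33, 0, 227), (-4, 0, 274), (-33, 0, 26), (35, 0, 246),
      (-33, 0, 226), (-21, 0, 236), (97, 0, 25), (-196, 0, 268), (97, 0, 275), (35, 0, 237),
      (-4, 0, 24), (-70, 0, 34), (-33, 0, 40), (-4, 0, 46), (97, 0, 52), (-70, 0, 335),
      (119, 0, 308), (35, 0, 28), (-196, 0, 334), (-70, 0, 323), (252, 0, 29), (119, 0, 309),
      (-196, 0, 322), (97, 0, 30), (-21, 0, 35), (252, 0, 43), (-4, 0, 51), (119, 0, 378),
      (-4, 0, 37), (119, 0, 379), (-33, 0, 36), (97, 0, 44), (-33, 0, 50), (35, 0, 42),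
      (-21, 0, 49)]
  abSol := fun _ => [(20, 0, 111), (-59, 0, 84), (-48, 0, 75), (6, 0, 102), (-36, 0, 93),
      (19, 0, 66), (3, 0, 0), (15, 0, 110), (45, 0, 99), (17, 0, 95), (-56, 0, 82), (7, 0, 76),
      (-50, 0, 61), (-36, 0, 1), (-34, 0, 85), (25, 0, 98), (7, 0, 62), (17, 0, 108),
      (10, 0, 71), (-65, 0, 91), (6, 0, 2), (-8, 0, 74), (69, 0, 94), (12, 0, 63), (-23, 0, 69),
      (29, 0, 107), (7, 0, 100), (20, 0, 3), (18, 0, 103), (-46, 0, 83), (22, 0, 109),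
      (-22, 0, 68), (-31, 0, 58), (49, 0, 78), (19, 0, 4), (-18, 0, 92), (-31, 0, 77),
      (9, 0, 70), (1, 0, 106), (-5, 0, 59), (66, 0, 87), (-48, 0, 5), (60, 0, 67), (25, 0, 60),
      (-26, 0, 90), (-55, 0, 101), (-12, 0, 79), (72, 0, 86), (-59, 0, 6), (51, 0, 7),
      (-18, 0, 15), (18, 0, 23), (15, 0, 31), (60, 0, 39), (-8, 0, 47), (-34, 0, 55),
      (7, 0, 154), (29, 0, 164), (12, 0, 118), (69, 0, 147), (-23, 0, 127), (-8, 0, 9),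
      (-55, 0, 155), (72, 0, 138), (-26, 0, 151), (25, 0, 117), (-12, 0, 132), (60, 0, 8),
      (1, 0, 165), (66, 0, 139), (9, 0, 124), (-31, 0, 134), (-5, 0, 114), (-18, 0, 11),
      (7, 0, 119), (-65, 0, 150), (10, 0, 125), (25, 0, 156), (17, 0, 163), (-34, 0, 10),
      (17, 0, 146), (-50, 0, 116), (7, 0, 135), (45, 0, 157), (-56, 0, 142), (15, 0, 13),
      (-22, 0, 126), (49, 0, 133), (-31, 0, 115), (22, 0, 162), (-46, 0, 143), (18, 0, 12),
      (-48, 0, 16), (19, 0, 22), (-36, 0, 32), (-59, 0, 38), (20, 0, 48), (6, 0, 54),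
      (-23, 0, 205), (-6, 0, 178), (38, 0, 187), (19, 0, 214), (-5, 0, 14), (7, 0, 204),
      (4, 0, 199), (-90, 0, 218), (38, 0, 171), (-31, 0, 19), (-19, 0, 179), (32, 0, 198),
      (7, 0, 213), (-12, 0, 191), (66, 0, 20), (-4, 0, 186), (-66, 0, 219), (-23, 0, 212),
      (32, 0, 181), (1, 0, 17), (-4, 0, 170), (-43, 0, 190), (4, 0, 180), (9, 0, 18),
      (-31, 0, 21), (7, 0, 33), (72, 0, 41), (29, 0, 45), (10, 0, 53), (-43, 0, 254),
      (4, 0, 247), (-6, 0, 269), (-46, 0, 27), (-12, 0, 255), (65, 0, 274), (49, 0, 26),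
      (32, 0, 246), (19, 0, 226), (-12, 0, 236), (-22, 0, 25), (-19, 0, 268), (24, 0, 275),
      (-43, 0, 237), (22, 0, 24), (-56, 0, 34), (-12, 0, 40), (-23, 0, 46), (17, 0, 52),
      (-4, 0, 335), (-50, 0, 28), (38, 0, 334), (7, 0, 323), (17, 0, 29), (19, 0, 309),
      (-23, 0, 322), (45, 0, 30), (25, 0, 35), (69, 0, 43), (25, 0, 51), (-19, 0, 378),
      (-55, 0, 37), (-6, 0, 379), (-26, 0, 36), (7, 0, 44), (-65, 0, 50), (12, 0, 42), (7, 0, 49)]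
  wSol := fun _ => [(-19, 0, 111), (9, 0, 84), (16, 0, 75), (14, 0, 102), (50, 0, 93),
      (-16, 0, 66), (-24, 0, 0), (-33, 0, 110), (-23, 0, 99), (-33, 0, 95), (52, 0, 82),
      (-40, 0, 76), (17, 0, 61), (50, 0, 1), (-22, 0, 85), (3, 0, 98), (9, 0, 62), (40, 0, 108),
      (-26, 0, 71), (56, 0, 91), (14, 0, 2), (15, 0, 74), (-33, 0, 94), (-14, 0, 63),
      (-22, 0, 69), (15, 0, 107), (20, 0, 100), (-19, 0, 3), (-27, 0, 103), (22, 0, 83),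
      (18, 0, 109), (3, 0, 68), (14, 0, 58), (-11, 0, 78), (-16, 0, 4), (18, 0, 92),
      (18, 0, 77), (-52, 0, 70), (60, 0, 106), (6, 0, 59), (-27, 0, 87), (16, 0, 5),
      (-23, 0, 67), (-16, 0, 60), (15, 0, 90), (33, 0, 101), (-2, 0, 79), (-33, 0, 86),
      (9, 0, 6), (-9, 0, 7), (18, 0, 15), (-27, 0, 23), (-33, 0, 31), (-23, 0, 39), (15, 0, 47),
      (-22, 0, 55), (20, 0, 154), (15, 0, 164), (-14, 0, 118), (-33, 0, 147), (-22, 0, 127),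
      (15, 0, 9), (33, 0, 155), (-33, 0, 138), (15, 0, 151), (-16, 0, 117), (-2, 0, 132),
      (-23, 0, 8), (60, 0, 165), (-27, 0, 139), (-52, 0, 124), (18, 0, 134), (6, 0, 114),
      (18, 0, 11), (9, 0, 119), (56, 0, 150), (-26, 0, 125), (3, 0, 156), (40, 0, 163),
      (-22, 0, 10), (-33, 0, 146), (17, 0, 116), (-40, 0, 135), (-23, 0, 157), (52, 0, 142),
      (-33, 0, 13), (3, 0, 126), (-11, 0, 133), (14, 0, 115), (18, 0, 162), (22, 0, 143),
      (-27, 0, 12), (16, 0, 16), (-16, 0, 22), (50, 0, 32), (9, 0, 38), (-19, 0, 48),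
      (14, 0, 54), (3, 0, 205), (-11, 0, 178), (-14, 0, 187), (-29, 0, 214), (6, 0, 14),
      (17, 0, 204), (6, 0, 199), (21, 0, 218), (-14, 0, 171), (18, 0, 19), (-20, 0, 179),
      (-33, 0, 198), (17, 0, 213), (40, 0, 191), (-27, 0, 20), (3, 0, 186), (-24, 0, 219),
      (3, 0, 212), (-33, 0, 181), (60, 0, 17), (15, 0, 215), (3, 0, 170), (40, 0, 190),
      (6, 0, 180), (-52, 0, 18), (14, 0, 21), (-40, 0, 33), (-33, 0, 41), (15, 0, 45),
      (-26, 0, 53), (40, 0, 254), (6, 0, 247), (-11, 0, 269), (22, 0, 27), (40, 0, 255),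
      (15, 0, 227), (-131, 0, 274), (-11, 0, 26), (-33, 0, 246), (-29, 0, 226), (40, 0, 236),
      (3, 0, 25), (-20, 0, 268), (-54, 0, 275), (40, 0, 237), (18, 0, 24), (52, 0, 34),
      (-2, 0, 40), (-22, 0, 46), (40, 0, 52), (3, 0, 335), (15, 0, 308), (17, 0, 28),
      (-14, 0, 334), (17, 0, 323), (-33, 0, 29), (-29, 0, 309), (3, 0, 322), (-23, 0, 30),
      (-16, 0, 35), (-33, 0, 43), (3, 0, 51), (-20, 0, 378), (33, 0, 37), (-11, 0, 379),
      (15, 0, 36), (20, 0, 44), (56, 0, 50), (-14, 0, 42), (9, 0, 49)]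

/-! ### Codings of the groups -/

section Codings

open scoped Pointwise

variable {G : Type*} [Group G] {n N : ℕ} {θ : G →* Equiv.Perm (Fin n)} {elt : ℕ → ℕ}

/-- A coding can be transported along an isomorphism of groups. -/
theorem IsCoding.comp (h : IsCoding θ N elt) {G' : Type*} [Group G'] (e : G' ≃* G) :
    IsCoding (θ.comp e.toMonoidHom) N elt where
  injective := h.injective.comp e.injective
  exists_represents i hi := by
    obtain ⟨g, hg⟩ := h.exists_represents i hi
    refine ⟨e.symm g, fun p => (hg p).trans ?_⟩
    change _ = ((θ (e (e.symm g)) p : Fin n) : ℕ)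
    rw [e.apply_symm_apply]
  exists_elt g := h.exists_elt (e g)

theorem codedSubgroup_comp {G' : Type*} [Group G'] (e : G' ≃* G) (s : List ℕ) :
    codedSubgroup (θ.comp e.toMonoidHom) elt s = (codedSubgroup θ elt s).comap e.toMonoidHom := by
  rw [codedSubgroup, codedSubgroup, Subgroup.comap_equiv_eq_map_symm', MonoidHom.map_closure]
  congr 1
  ext g
  constructor
  · rintro ⟨i, hi, hg⟩
    exact ⟨e g, ⟨i, hi, hg⟩, e.symm_apply_apply g⟩
  · rintro ⟨g, ⟨i, hi, hg⟩, rfl⟩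
    refine ⟨i, hi, fun p => (hg p).trans ?_⟩
    change _ = ((θ (e (e.symm g)) p : Fin n) : ℕ)
    rw [e.apply_symm_apply]

/-- The two subgroups are conjugate. -/
def AreConj (A B : Subgroup G) : Prop := ∃ g : G, A = MulAut.conj g • B

/-- A conjugate of a coded subgroup is itself a coded subgroup, for a conjugate coding. -/
theorem IsCoding.exists_eq_codedSubgroup (h : IsCoding θ N elt) {H : Subgroup G} {s : List ℕ}
    (hH : AreConj H (codedSubgroup θ elt s)) :
    ∃ θ' : G →* Equiv.Perm (Fin n), IsCoding θ' N elt ∧ codedSubgroup θ' elt s = H := by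
  obtain ⟨g, rfl⟩ := hH
  refine ⟨_, h.comp (MulAut.conj g⁻¹), ?_⟩
  rw [codedSubgroup_comp]
  ext x
  rw [Subgroup.mem_comap, Subgroup.mem_pointwise_smul_iff_inv_smul_mem, ← map_inv]
  rfl

/-- The element with code `c` lies in the subgroup. -/
def CodeMem (θ : G →* Equiv.Perm (Fin n)) (C : Subgroup G) (c : ℕ) : Prop :=
  ∃ g ∈ C, Represents θ c g

theorem CodeMem.mul {C : Subgroup G} {c d : ℕ} (hc : CodeMem θ C c) (hd : CodeMem θ C d) :
    CodeMem θ C (codeMul n c d) := by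
  obtain ⟨g, hg, hg'⟩ := hc
  obtain ⟨h, hh, hh'⟩ := hd
  exact ⟨g * h, mul_mem hg hh, hg'.mul hh'⟩

theorem CodeMem.mul_eq {C : Subgroup G} {c d e : ℕ} (hc : CodeMem θ C c) (hd : CodeMem θ C d)
    (h : codeMul n c d = e) : CodeMem θ C e := h ▸ hc.mul hd

theorem IsCoding.codeMem (h : IsCoding θ N elt) {s : List ℕ} {i c : ℕ} (hi : i ∈ s) (hN : i < N)
    (hc : elt i = c) : CodeMem θ (codedSubgroup θ elt s) c := by
  obtain ⟨g, hg⟩ := h.exists_represents i hN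
  exact ⟨g, Subgroup.subset_closure ⟨i, hi, hg⟩, hc ▸ hg⟩

/-- A subgroup that contains the translations, the homotheties and `x ↦ 1/x` contains every element
of the enumeration. -/
theorem CodeMem.bruhat {C : Subgroup G} {t s : List ℕ} {w : ℕ}
    (ht : ∀ c ∈ t, CodeMem θ C c) (hs : ∀ c ∈ s, CodeMem θ C c) (hw : CodeMem θ C w)
    (htl : t.length = n - 1) (hsl : s.length = n - 1 - 1) (hn : 3 ≤ n) {i : ℕ}
    (hi : i < (n - 1) * (n - 1 - 1) * n) : CodeMem θ C (bruhat n t s w i) := by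
  obtain ⟨m, rfl⟩ : ∃ m, n = m + 2 := ⟨n - 2, by omega⟩
  simp only [Nat.add_sub_cancel, show m + 2 - 1 = m + 1 from rfl] at htl hsl hi
  have ht' : ∀ b < m + 1, CodeMem θ C (t.getD b 0) := fun b hb => by
    rw [List.getD_eq_getElem _ _ (by omega)]
    exact ht _ (List.getElem_mem _)
  have hs' : ∀ b < m, CodeMem θ C (s.getD b 0) := fun b hb => by
    rw [List.getD_eq_getElem _ _ (by omega)]
    exact hs _ (List.getElem_mem _)
  have hb : ∀ i < (m + 1) * m,
      CodeMem θ C (codeMul (m + 2) (t.getD (i / m) 0) (s.getD (i % m) 0)) := fun i hi => by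
    have hm : 0 < m := by omega
    exact (ht' _ (Nat.div_lt_of_lt_mul (by rwa [mul_comm] at hi))).mul (hs' _ (Nat.mod_lt _ hm))
  change CodeMem θ C (Bool.rec (codeMul (m + 2) (codeMul (m + 2) (codeMul (m + 2)
    (t.getD ((i - (m + 1) * m) / (m + 1) / m) 0) (s.getD ((i - (m + 1) * m) / (m + 1) % m) 0)) w)
      (t.getD ((i - (m + 1) * m) % (m + 1)) 0))
    (codeMul (m + 2) (t.getD (i / m) 0) (s.getD (i % m) 0)) (Nat.blt i ((m + 1) * m)))
  cases h : Nat.blt i ((m + 1) * m) with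
  | true => exact hb i (by simpa [Nat.blt_eq] using h)
  | false =>
    refine ((hb _ ?_).mul hw).mul (ht' _ (Nat.mod_lt _ (by omega)))
    refine Nat.div_lt_of_lt_mul ?_
    have : (m + 1) * m * (m + 2) = (m + 1) * m + (m + 1) * ((m + 1) * m) := by ring
    have h3 : 0 < (m + 1) * ((m + 1) * m) := by
      have : 0 < m := by omega
      positivity
    omega

/-- The Bruhat decomposition gives a coding. -/
theorem isCoding_bruhat (hθ : Function.Injective θ) {t s : List ℕ} {w : ℕ}
    (ht : ∀ c ∈ t, ∃ g, Represents θ c g) (hs : ∀ c ∈ s, ∃ g, Represents θ c g)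
    (hw : ∃ g, Represents θ w g) (htl : t.length = n - 1) (hsl : s.length = n - 1 - 1) (hn : 3 ≤ n)
    (hN : (n - 1) * (n - 1 - 1) * n = N) (hG : Nat.card G ≤ N) {p : List ℕ} (hp : ∀ x ∈ p, x < n)
    (hd : distinctKeys n (bruhat n t s w) (List.range N) p = true) :
    IsCoding θ N (bruhat n t s w) := by
  have : Finite G := .of_injective θ hθ
  have hmem : ∀ {c}, (∃ g, Represents θ c g) → CodeMem θ ⊤ c := fun ⟨g, hg⟩ => ⟨g, trivial, hg⟩
  have hr : ∀ i < N, ∃ g, Represents θ (bruhat n t s w i) g := fun i hi => by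
    obtain ⟨g, -, hg⟩ := CodeMem.bruhat (fun c hc => hmem (ht c hc)) (fun c hc => hmem (hs c hc))
      (hmem hw) htl hsl hn (hN ▸ hi)
    exact ⟨g, hg⟩
  refine ⟨hθ, hr, fun g => ?_⟩
  choose! e he using hr
  have hinj : Function.Injective (fun i : Fin N => e i) := fun i j hij =>
    Fin.ext (IsCoding.injOn_of_distinctKeys hp hd (List.mem_range.2 i.2) (List.mem_range.2 j.2)
      (he i i.2) ((show e i = e j from hij) ▸ he j j.2))
  have hbij := hinj.bijective_of_nat_card_le (by rwa [Nat.card_fin])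
  obtain ⟨i, rfl⟩ := hbij.2 g
  exact ⟨i, i.2, he i i.2⟩

/-- The translations, the homotheties and `x ↦ 1/x` generate the group. -/
theorem IsCoding.eq_top_of_codeMem {t s : List ℕ} {w : ℕ} (h : IsCoding θ N (bruhat n t s w))
    {C : Subgroup G} (ht : ∀ c ∈ t, CodeMem θ C c) (hs : ∀ c ∈ s, CodeMem θ C c)
    (hw : CodeMem θ C w) (htl : t.length = n - 1) (hsl : s.length = n - 1 - 1) (hn : 3 ≤ n)
    (hN : (n - 1) * (n - 1 - 1) * n = N) : C = ⊤ := by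
  rw [Subgroup.eq_top_iff']
  intro g
  obtain ⟨i, hi, hg⟩ := h.exists_elt g
  obtain ⟨g', hg', hg''⟩ := CodeMem.bruhat ht hs hw htl hsl hn (hN ▸ hi)
  rwa [hg.unique h.injective hg'' fun _ _ => rfl]

theorem codedSubgroup_gens₂ {θ : G →* Equiv.Perm (Fin 3)} (h : IsCoding θ 6 elt₂) :
    codedSubgroup θ elt₂ [1, 2] = ⊤ := by
  have h0 : CodeMem θ (codedSubgroup θ elt₂ [1, 2]) 0x201 := h.codeMem (i := 1) (by simp) (by simp)
      (by decide +kernel)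
  have h1 : CodeMem θ (codedSubgroup θ elt₂ [1, 2]) 0x012 := h.codeMem (i := 2) (by simp) (by simp)
      (by decide +kernel)
  refine h.eq_top_of_codeMem ?_ ?_ h1 rfl rfl (by simp) rfl
  · simp only [List.forall_mem_cons]
    exact ⟨h0.mul_eq h0 (by decide +kernel), h0, by simp⟩
  · simp only [List.forall_mem_cons]
    exact ⟨h0.mul_eq h0 (by decide +kernel), by simp⟩

theorem codedSubgroup_gens₄ {θ : G →* Equiv.Perm (Fin 5)} (h : IsCoding θ 60 elt₄) :
    codedSubgroup θ elt₄ [1, 2, 3, 6, 12] = ⊤ := by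
  set C := codedSubgroup θ elt₄ [1, 2, 3, 6, 12]
  have h1 : CodeMem θ C 0x41320 := h.codeMem (i := 1) (by simp) (by simp)
      (by decide +kernel)
  have h2 : CodeMem θ C 0x42130 := h.codeMem (i := 2) (by simp) (by simp)
      (by decide +kernel)
  have h3 : CodeMem θ C 0x42301 := h.codeMem (i := 3) (by simp) (by simp)
      (by decide +kernel)
  have h6 : CodeMem θ C 0x41032 := h.codeMem (i := 6) (by simp) (by simp)
      (by decide +kernel)
  have h12 : CodeMem θ C 0x02314 := h.codeMem (i := 12) (by simp) (by simp)
      (by decide +kernel)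
  have h0 : CodeMem θ C 0x43210 := h3.mul_eq h3 (by decide +kernel)
  refine h.eq_top_of_codeMem ?_ ?_ h12 rfl rfl (by simp) rfl
  · simp only [List.forall_mem_cons]
    exact ⟨h0, h3, h6, h3.mul_eq h6 (by decide +kernel), by simp⟩
  · simp only [List.forall_mem_cons]
    exact ⟨h0, h1, h2, by simp⟩

theorem codedSubgroup_gens₈ {θ : G →* Equiv.Perm (Fin 9)} (h : IsCoding θ 504 elt₈) :
    codedSubgroup θ elt₈ [1, 2, 3, 4, 5, 6, 7, 14, 28, 56] = ⊤ := by
  set C := codedSubgroup θ elt₈ [1, 2, 3, 4, 5, 6, 7, 14, 28, 56]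
  have h1 : CodeMem θ C 0x857136420 := h.codeMem (i := 1) (by simp) (by simp)
      (by decide +kernel)
  have h2 : CodeMem θ C 0x821475630 := h.codeMem (i := 2) (by simp) (by simp)
      (by decide +kernel)
  have h3 : CodeMem θ C 0x815267340 := h.codeMem (i := 3) (by simp) (by simp)
      (by decide +kernel)
  have h4 : CodeMem θ C 0x863724150 := h.codeMem (i := 4) (by simp) (by simp)
      (by decide +kernel)
  have h5 : CodeMem θ C 0x842351760 := h.codeMem (i := 5) (by simp) (by simp)
      (by decide +kernel)
  have h6 : CodeMem θ C 0x834612570 := h.codeMem (i := 6) (by simp) (by simp)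
      (by decide +kernel)
  have h7 : CodeMem θ C 0x867452301 := h.codeMem (i := 7) (by simp) (by simp)
      (by decide +kernel)
  have h14 : CodeMem θ C 0x854761032 := h.codeMem (i := 14) (by simp) (by simp)
      (by decide +kernel)
  have h28 : CodeMem θ C 0x832107654 := h.codeMem (i := 28) (by simp) (by simp)
      (by decide +kernel)
  have h56 : CodeMem θ C 0x043276518 := h.codeMem (i := 56) (by simp) (by simp)
      (by decide +kernel)
  have h0 : CodeMem θ C 0x876543210 := h7.mul_eq h7 (by decide +kernel)
  refine h.eq_top_of_codeMem ?_ ?_ h56 rfl rfl (by simp) rfl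
  · simp only [translations, List.forall_mem_cons]
    exact ⟨h0, h7, h14, h7.mul_eq h14 (by decide +kernel), h28, h7.mul_eq h28 (by decide +kernel),
      h14.mul_eq h28 (by decide +kernel), (h7.mul h14).mul_eq h28 (by decide +kernel), by simp⟩
  · simp only [homotheties, List.forall_mem_cons]
    exact ⟨h0, h1, h2, h3, h4, h5, h6, by simp⟩

end Codings

section Models

theorem isCoding_perm : IsCoding (MonoidHom.id (Equiv.Perm (Fin 3))) 6 elt₂ := by
  refine isCoding_bruhat Function.injective_id ?_ ?_ ?_ rfl rfl (by norm_num) rfl ?_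
    (p := [0, 1, 2]) (by decide) (by decide +kernel)
  · simp only [List.forall_mem_cons]
    exact ⟨⟨1, by unfold Represents; decide⟩, ⟨Equiv.swap 0 1, by unfold Represents; decide⟩, by simp⟩
  · simp only [List.forall_mem_cons]
    exact ⟨⟨1, by unfold Represents; decide⟩, by simp⟩
  · exact ⟨Equiv.swap 0 2, by unfold Represents; decide⟩
  · rw [Nat.card_perm, Nat.card_fin]
    decide

theorem isCoding_alternatingGroup :
    IsCoding (alternatingGroup (Fin 5)).subtype 60 elt₄ := by
  have key : ∀ (c : ℕ) (σ : Equiv.Perm (Fin 5)), Equiv.Perm.sign σ = 1 →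
      (∀ i : Fin 5, codeApp c i = σ i) →
        ∃ g, Represents (alternatingGroup (Fin 5)).subtype c g :=
    fun c σ hσ h => ⟨⟨σ, Equiv.Perm.mem_alternatingGroup.2 hσ⟩, h⟩
  have h1 := key 0x43210 1 (by decide) (by decide)
  refine isCoding_bruhat Subtype.val_injective ?_ ?_ ?_ rfl rfl (by norm_num) rfl ?_
    (p := [0, 1, 4]) (by decide) (by decide +kernel)
  · simp only [List.forall_mem_cons]
    refine ⟨h1, key _ (Equiv.swap 0 1 * Equiv.swap 2 3) (by decide) (by decide),
      key _ (Equiv.swap 0 2 * Equiv.swap 1 3) (by decide) (by decide),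
      key _ (Equiv.swap 0 3 * Equiv.swap 1 2) (by decide) (by decide), by simp⟩
  · simp only [List.forall_mem_cons]
    refine ⟨h1, key _ (Equiv.swap 1 2 * Equiv.swap 2 3) (by decide) (by decide),
      key _ (Equiv.swap 1 3 * Equiv.swap 2 3) (by decide) (by decide), by simp⟩
  · exact key _ (Equiv.swap 0 4 * Equiv.swap 2 3) (by decide) (by decide)
  · rw [nat_card_alternatingGroup, Nat.card_fin]
    decide

/-- The field with eight elements; the digits of `4 a + 2 b + c` in base two are the coefficients of
`a x² + b x + c`, where `x³ = x + 1`. Addition and multiplication are read off from the codes of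
translations and homotheties. -/
def F₈ : Type := Fin 8

namespace F₈

instance : DecidableEq F₈ := inferInstanceAs (DecidableEq (Fin 8))
instance : Fintype F₈ := inferInstanceAs (Fintype (Fin 8))

instance : Zero F₈ := ⟨(0 : Fin 8)⟩
instance : One F₈ := ⟨(1 : Fin 8)⟩
instance : Add F₈ := ⟨fun a b => Fin.ofNat 8 (codeApp (translations.getD a.val 0) b.val)⟩
instance : Neg F₈ := ⟨fun a => a⟩
instance : Mul F₈ := ⟨fun a b => Nat.rec (0 : Fin 8)
  (fun a _ => Fin.ofNat 8 (codeApp (homotheties.getD a 0) b.val)) a.val⟩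
instance : Inv F₈ := ⟨fun a => Nat.rec (0 : Fin 8)
  (fun _ _ => Fin.ofNat 8 (codeApp 0x043276518 a.val)) a.val⟩

instance : Field F₈ where
  add_assoc := by decide +kernel
  zero_add := by decide +kernel
  add_zero := by decide +kernel
  add_comm := by decide +kernel
  neg_add_cancel := by decide +kernel
  mul_assoc := by decide +kernel
  one_mul := by decide +kernel
  mul_one := by decide +kernel
  mul_comm := by decide +kernel
  zero_mul := by decide +kernel
  mul_zero := by decide +kernel
  left_distrib := by decide +kernel
  right_distrib := by decide +kernel
  exists_pair_ne := ⟨0, 1, by decide⟩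
  mul_inv_cancel := by decide +kernel
  inv_zero := by decide +kernel
  nsmul := nsmulRec
  zsmul := zsmulRec
  nnqsmul := _
  qsmul := _

end F₈

variable {K : Type*} [Field K]

/-- The numbering of the points of the projective line. -/
def lineEquiv (e : K ≃+* F₈) : OnePoint K ≃ Fin 9 :=
  (e.toEquiv.optionCongr).trans finSuccEquivLast.symm

theorem lineEquiv_infty (e : K ≃+* F₈) : lineEquiv e OnePoint.infty = Fin.last 8 :=
  finSuccEquivLast_symm_none

theorem lineEquiv_coe (e : K ≃+* F₈) (x : K) : (lineEquiv e (x : OnePoint K) : ℕ) = (e x).val := by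
  exact congrArg Fin.val (finSuccEquivLast_symm_some (n := 8) (e x))

variable [DecidableEq K]

/-- The action of `SL₂` on the projective line. -/
def slAction (K : Type*) [Field K] [DecidableEq K] :
    Matrix.SpecialLinearGroup (Fin 2) K →* Equiv.Perm (OnePoint K) :=
  (MulAction.toPermHom (Matrix.GeneralLinearGroup (Fin 2) K) (OnePoint K)).comp
    Matrix.SpecialLinearGroup.toGL

theorem slAction_infty (A : Matrix.SpecialLinearGroup (Fin 2) K) :
    slAction K A OnePoint.infty = if A 1 0 = 0 then OnePoint.infty else ((A 0 0 / A 1 0 : K)) :=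
  OnePoint.smul_infty_eq_ite _

theorem slAction_coe (A : Matrix.SpecialLinearGroup (Fin 2) K) (x : K) :
    slAction K A x = if A 1 0 * x + A 1 1 = 0 then OnePoint.infty else
      (((A 0 0 * x + A 0 1) / (A 1 0 * x + A 1 1) : K)) :=
  OnePoint.smul_some_eq_ite

/-- A matrix which fixes three points of the projective line is scalar. -/
theorem mem_center_of_slAction {A : Matrix.SpecialLinearGroup (Fin 2) K}
    (hi : slAction K A OnePoint.infty = OnePoint.infty) (h0 : slAction K A (0 : K) = (0 : K))
    (h1 : slAction K A (1 : K) = (1 : K)) : A ∈ Subgroup.center _ := by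
  have hdet := A.det_coe
  rw [Matrix.det_fin_two] at hdet
  rw [slAction_infty] at hi
  have h10 : A 1 0 = 0 := by
    by_contra h
    rw [if_neg h] at hi
    exact OnePoint.coe_ne_infty _ hi
  rw [h10, mul_zero, sub_zero] at hdet
  have h11 : A 1 1 ≠ 0 := right_ne_zero_of_mul_eq_one hdet
  rw [slAction_coe, h10] at h0 h1
  simp only [zero_add, mul_zero, if_neg h11, OnePoint.coe_eq_coe, mul_one] at h0 h1
  have h01 : A 0 1 = 0 := by
    rcases div_eq_zero_iff.1 h0 with h | h
    · exact h
    · exact absurd h h11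
  rw [h01, add_zero, div_eq_one_iff_eq h11] at h1
  rw [Matrix.SpecialLinearGroup.mem_center_iff]
  refine ⟨A 0 0, by rw [Fintype.card_fin, pow_two]; nth_rewrite 2 [h1]; exact hdet, ?_⟩
  ext i j
  fin_cases i <;> fin_cases j <;> simp [h10, h01, h1]

theorem slAction_eq_one {A : Matrix.SpecialLinearGroup (Fin 2) K} (hA : A ∈ Subgroup.center _) :
    slAction K A = 1 := by
  obtain ⟨r, hr, hA⟩ := Matrix.SpecialLinearGroup.mem_center_iff.1 hA
  have hr0 : r ≠ 0 := by
    rintro rfl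
    simp at hr
  have h : ∀ i j, A i j = if i = j then r else 0 := fun i j => by
    rw [← hA, Matrix.scalar_apply, Matrix.diagonal_apply]
  have h00 := h 0 0
  have h01 := h 0 1
  have h10 := h 1 0
  have h11 := h 1 1
  rw [if_pos rfl] at h00 h11
  rw [if_neg (by decide)] at h01 h10
  ext x
  induction x using OnePoint.rec with
  | infty => rw [slAction_infty, if_pos h10]; rfl
  | coe x => rw [slAction_coe, h00, h01, h10, h11]; simp [hr0]

/-- The action of `PSL₂` on the projective line, with numbered points. -/
def pslAction (e : K ≃+* F₈) :
    Matrix.ProjectiveSpecialLinearGroup (Fin 2) K →* Equiv.Perm (Fin 9) :=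
  QuotientGroup.lift _ ((lineEquiv e).permCongrHom.toMonoidHom.comp (slAction K)) fun A hA => by
    rw [MonoidHom.mem_ker, MonoidHom.comp_apply, slAction_eq_one hA, map_one]

theorem pslAction_mk (e : K ≃+* F₈) (A : Matrix.SpecialLinearGroup (Fin 2) K) (i : Fin 9) :
    pslAction e (QuotientGroup.mk A) i = lineEquiv e (slAction K A ((lineEquiv e).symm i)) := rfl

/-- A map `x ↦ (a x + b)/(c x + d)` that fixes `0`, `1` and `∞` is the identity. -/
theorem eq_one_of_pslAction (e : K ≃+* F₈) {g : Matrix.ProjectiveSpecialLinearGroup (Fin 2) K}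
    (h : ∀ i ∈ ({0, 1, 8} : Finset (Fin 9)), pslAction e g i = i) : g = 1 := by
  induction g using QuotientGroup.induction_on with
  | H A =>
  have h8 : (8 : Fin 9) = lineEquiv e OnePoint.infty := (lineEquiv_infty e).symm
  have h0 : (0 : Fin 9) = lineEquiv e (0 : K) := Fin.ext (by rw [lineEquiv_coe, map_zero]; rfl)
  have h1 : (1 : Fin 9) = lineEquiv e (1 : K) := Fin.ext (by rw [lineEquiv_coe, map_one]; rfl)
  have key : ∀ x, pslAction e (QuotientGroup.mk A) (lineEquiv e x) = lineEquiv e x →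
      slAction K A x = x := fun x hx => by
    rwa [pslAction_mk, Equiv.symm_apply_apply, (lineEquiv e).apply_eq_iff_eq] at hx
  rw [QuotientGroup.eq_one_iff]
  exact mem_center_of_slAction (key _ (h8 ▸ h 8 (by decide))) (key _ (h0 ▸ h 0 (by decide)))
    (key _ (h1 ▸ h 1 (by decide)))

theorem pslAction_injective (e : K ≃+* F₈) : Function.Injective (pslAction e) := by
  rw [injective_iff_map_eq_one]
  exact fun g hg => eq_one_of_pslAction e fun i _ => by rw [hg]; rfl

/-- The group acts faithfully on the triples of distinct points. -/
theorem card_psl_le (e : K ≃+* F₈) :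
    Nat.card (Matrix.ProjectiveSpecialLinearGroup (Fin 2) K) ≤ 504 := by
  have : Finite (Matrix.ProjectiveSpecialLinearGroup (Fin 2) K) :=
    .of_injective _ (pslAction_injective e)
  let F : Matrix.ProjectiveSpecialLinearGroup (Fin 2) K → (Fin 3 ↪ Fin 9) := fun g =>
    (⟨![0, 1, 8], by decide⟩ : Fin 3 ↪ Fin 9).trans (pslAction e g).toEmbedding
  have hF : Function.Injective F := by
    intro g h hgh
    have h1 : ∀ i, pslAction e g (![0, 1, 8] i) = pslAction e h (![0, 1, 8] i) := fun i =>
      DFunLike.congr_fun hgh i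
    rw [← inv_mul_eq_one]
    refine eq_one_of_pslAction e fun i hi => ?_
    obtain ⟨j, rfl⟩ : ∃ j, (![0, 1, 8] : Fin 3 → Fin 9) j = i := by
      revert i
      decide
    rw [map_mul, Equiv.Perm.mul_apply, ← h1, map_inv]
    exact (pslAction e g).symm_apply_apply _
  refine (Nat.card_le_card_of_injective F hF).trans ?_
  rw [Nat.card_eq_fintype_card, Fintype.card_embedding_eq, Fintype.card_fin, Fintype.card_fin]
  decide

/-- A code that lists the values of `x ↦ (a x + b)/(c x + d)` belongs to an element of the group. -/
theorem exists_represents_psl (e : K ≃+* F₈) (a b c d : F₈) (hdet : a * d - b * c = 1) {k : ℕ}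
    (hi : codeApp k 8 = if c = 0 then 8 else (a / c).val)
    (hx : ∀ x : F₈, codeApp k x.val =
      if c * x + d = 0 then 8 else ((a * x + b) / (c * x + d)).val) :
    ∃ g, Represents (pslAction e) k g := by
  let A : Matrix.SpecialLinearGroup (Fin 2) K := ⟨!![e.symm a, e.symm b; e.symm c, e.symm d], by
    rw [Matrix.det_fin_two_of, ← map_mul, ← map_mul, ← map_sub, hdet, map_one]⟩
  have h00 : A 0 0 = e.symm a := rfl
  have h01 : A 0 1 = e.symm b := rfl
  have h10 : A 1 0 = e.symm c := rfl
  have h11 : A 1 1 = e.symm d := rfl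
  refine ⟨QuotientGroup.mk A, fun i => ?_⟩
  rw [pslAction_mk]
  obtain ⟨x, rfl⟩ := (lineEquiv e).surjective i
  rw [Equiv.symm_apply_apply]
  induction x using OnePoint.rec with
  | infty =>
    rw [lineEquiv_infty, slAction_infty, h10, h00, ← map_div₀]
    refine hi.trans ?_
    by_cases hc : c = 0
    · rw [if_pos hc, if_pos (by rw [hc, map_zero]), lineEquiv_infty]
      rfl
    · rw [if_neg hc, if_neg (by simpa using hc), lineEquiv_coe, e.apply_symm_apply]
  | coe x =>
    obtain ⟨x, rfl⟩ := e.symm.surjective x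
    rw [lineEquiv_coe, e.apply_symm_apply, hx, slAction_coe, h00, h01, h10, h11]
    simp only [← map_mul, ← map_add, ← map_div₀]
    by_cases hc : c * x + d = 0
    · rw [if_pos hc, if_pos (by rw [hc, map_zero]), lineEquiv_infty]
      rfl
    · rw [if_neg hc, if_neg fun h => hc (EmbeddingLike.map_eq_zero_iff.1 h), lineEquiv_coe, e.apply_symm_apply]

/-- The 504 codes are different and belong to elements of the group, whose order is at most 504. -/
theorem isCoding_psl (e : K ≃+* F₈) : IsCoding (pslAction e) 504 elt₈ := by
  refine isCoding_bruhat (pslAction_injective e) ?_ ?_ ?_ rfl rfl (by norm_num) rfl (card_psl_le e)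
    (p := [0, 1, 8]) (by decide) (by decide +kernel)
  · have key : ∀ c ∈ translations, ∃ b : F₈, (1 * 1 - b * 0 : F₈) = 1 ∧
        codeApp c 8 = (if (0 : F₈) = 0 then 8 else (1 / 0 : F₈).val) ∧ ∀ x : F₈,
          codeApp c x.val = if 0 * x + 1 = 0 then 8 else ((1 * x + b) / (0 * x + 1)).val := by
      decide +kernel
    intro c hc
    obtain ⟨b, h1, h2, h3⟩ := key c hc
    exact exists_represents_psl e 1 b 0 1 h1 h2 h3
  · have key : ∀ c ∈ homotheties, ∃ a : F₈, (a * a⁻¹ - 0 * 0 : F₈) = 1 ∧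
        codeApp c 8 = (if (0 : F₈) = 0 then 8 else (a / 0 : F₈).val) ∧ ∀ x : F₈,
          codeApp c x.val = if 0 * x + a⁻¹ = 0 then 8 else ((a * x + 0) / (0 * x + a⁻¹)).val := by
      decide +kernel
    intro c hc
    obtain ⟨a, h1, h2, h3⟩ := key c hc
    exact exists_represents_psl e a 0 0 a⁻¹ h1 h2 h3
  · exact exists_represents_psl e 0 1 1 0 (by decide +kernel) (by decide +kernel)
      (by decide +kernel)

theorem exists_ringEquiv : Nonempty (GaloisField 2 3 ≃+* F₈) := by
  have : Fintype (GaloisField 2 3) := Fintype.ofFinite _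
  refine ⟨FiniteField.ringEquivOfCardEq ?_⟩
  rw [← Nat.card_eq_fintype_card, GaloisField.card 2 3 (by norm_num)]
  rfl

end Models

/-! ### Conjugacy of subgroups -/

section Conjugacy

open scoped Pointwise

variable {G : Type*} [Group G]

namespace AreConj

variable {A B C : Subgroup G}

theorem refl (A : Subgroup G) : AreConj A A := ⟨1, by rw [map_one, one_smul]⟩

theorem symm (h : AreConj A B) : AreConj B A := by
  obtain ⟨g, rfl⟩ := h
  exact ⟨g⁻¹, by rw [map_inv, inv_smul_smul]⟩

theorem trans (h : AreConj A B) (h' : AreConj B C) : AreConj A C := by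
  obtain ⟨g, rfl⟩ := h
  obtain ⟨g', rfl⟩ := h'
  exact ⟨g * g', by rw [map_mul, mul_smul]⟩

theorem card_eq (h : AreConj A B) : Nat.card A = Nat.card B := by
  obtain ⟨g, rfl⟩ := h
  exact Nat.card_congr (Subgroup.equivSMul (MulAut.conj g) B).symm.toEquiv

/-- Conjugate subgroups have isomorphic permutation lattices. -/
theorem cosetLattice_equiv (h : AreConj A B) :
    Nonempty ((cosetLattice A).Equiv (cosetLattice B)) := by
  obtain ⟨g, rfl⟩ := h
  have hmem : ∀ x y : G, x⁻¹ * y ∈ MulAut.conj g • B ↔ (x * g)⁻¹ * (y * g) ∈ B := fun x y => by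
    rw [Subgroup.mem_pointwise_smul_iff_inv_smul_mem, ← map_inv]
    have : (MulAut.conj g⁻¹) • (x⁻¹ * y) = (x * g)⁻¹ * (y * g) := by
      change g⁻¹ * (x⁻¹ * y) * g⁻¹⁻¹ = _
      group
    rw [this]
  let e : G ⧸ (MulAut.conj g • B : Subgroup G) ≃ G ⧸ B :=
    Quotient.congr (Equiv.mulRight g) fun x y => by
      rw [QuotientGroup.leftRel_apply, QuotientGroup.leftRel_apply]
      exact hmem x y
  refine ⟨permEquiv e fun h x => ?_⟩
  induction x using QuotientGroup.induction_on with
  | H x =>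
  change ((h * x * g : G) : G ⧸ B) = ((h * (x * g) : G) : G ⧸ B)
  rw [mul_assoc]

end AreConj

/-- Normalizers of conjugate subgroups are conjugate. -/
theorem mem_normalizer_of_conj {Q : Subgroup G} (g : G) {x : G}
    (hx : x ∈ Subgroup.normalizer ((MulAut.conj g • Q : Subgroup G) : Set G)) :
    (MulAut.conj g)⁻¹ • x ∈ Subgroup.normalizer (Q : Set G) := by
  rw [Subgroup.mem_normalizer_iff] at hx ⊢
  intro h
  have h1 := hx (MulAut.conj g • h)
  rw [Subgroup.smul_mem_pointwise_smul_iff,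
    Subgroup.mem_pointwise_smul_iff_inv_smul_mem] at h1
  rw [h1, smul_mul', smul_mul', inv_smul_smul, smul_inv']

/-- Subgroups of the same order in a finite cyclic group are equal. -/
theorem eq_of_le_isCyclic {A B C : Subgroup G} [Finite C] (hC : IsCyclic C) (hA : A ≤ C)
    (hB : B ≤ C) (h : Nat.card A = Nat.card B) : A = B := by
  classical
  have := Fintype.ofFinite C
  have key : ∀ A ≤ C, (A : Set G) = (↑) '' {x : C | x ^ Nat.card A = 1} := by
    intro A hA
    have hfin : Finite A := .of_injective _ (Subgroup.inclusion_injective hA)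
    have hsub : (A : Set G) ⊆ (↑) '' {x : C | x ^ Nat.card A = 1} := fun x hx => by
      have h1 : x ^ Nat.card A = 1 :=
        orderOf_dvd_iff_pow_eq_one.1 (A.orderOf_dvd_natCard hx)
      exact ⟨⟨x, hA hx⟩, Subtype.ext h1, rfl⟩
    refine Set.eq_of_subset_of_ncard_le hsub ?_ (Set.toFinite _)
    rw [Set.ncard_image_of_injective _ Subtype.val_injective, ← Nat.card_coe_set_eq (A : Set G)]
    have := IsCyclic.card_pow_eq_one_le (α := C) (n := Nat.card A) Nat.card_pos
    change _ ≤ Nat.card A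
    convert this using 1
    rw [Set.ncard_eq_toFinset_card']
    congr 1
    ext
    simp
  exact SetLike.coe_injective (by rw [key A hA, key B hB, h])

variable [Finite G]

/-- Subgroups whose order is the full power of `p` in the order of the group are conjugate. -/
theorem areConj_of_card_eq_pow {A B : Subgroup G} (p : ℕ) [Fact p.Prime]
    (hA : Nat.card A = p ^ (Nat.card G).factorization p)
    (hB : Nat.card B = p ^ (Nat.card G).factorization p) : AreConj A B := by
  obtain ⟨g, hg⟩ := MulAction.exists_smul_eq G (Sylow.ofCard B hB) (Sylow.ofCard A hA)
  exact ⟨g, (congrArg Sylow.toSubgroup hg).symm⟩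

/-- If `B` contains the normalizer of `Q`, and `A`, of the same order, normalizes a conjugate of
`Q`, then `A` is a conjugate of `B`, and `B` is that normalizer. -/
theorem areConj_of_le_normalizer {A B P Q : Subgroup G} (hP : A ≤ Subgroup.normalizer P)
    (hQ : Subgroup.normalizer (Q : Set G) ≤ B) (hPQ : AreConj P Q) (hAB : Nat.card A = Nat.card B) :
    AreConj A B := by
  obtain ⟨g, rfl⟩ := hPQ
  refine ⟨g, Subgroup.eq_of_le_of_card_ge (fun x hx => ?_) ?_⟩
  · rw [Subgroup.mem_pointwise_smul_iff_inv_smul_mem]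
    exact hQ (mem_normalizer_of_conj g (hP hx))
  · rw [hAB, Nat.card_congr (Subgroup.equivSMul (MulAut.conj g) B).symm.toEquiv]

/-- In a group with cyclic Sylow `p`-subgroups, `p`-subgroups of the same order are conjugate. -/
theorem areConj_of_isCyclic {A B C : Subgroup G} (p : ℕ) [Fact p.Prime] {m : ℕ}
    (hC : Nat.card C = p ^ (Nat.card G).factorization p) (hcyc : IsCyclic C)
    (hA : Nat.card A = p ^ m) (hB : Nat.card B = p ^ m) : AreConj A B := by
  have key : ∀ A : Subgroup G, Nat.card A = p ^ m → ∃ A' ≤ C, AreConj A A' := by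
    intro A hA
    obtain ⟨S, hS⟩ := (IsPGroup.of_card hA).exists_le_sylow
    obtain ⟨g, hg⟩ := areConj_of_card_eq_pow p S.card_eq_multiplicity hC
    refine ⟨MulAut.conj g⁻¹ • A, ?_, AreConj.symm ⟨g⁻¹, rfl⟩⟩
    rw [hg] at hS
    rw [map_inv]
    exact Subgroup.pointwise_smul_subset_iff.2 (by rwa [inv_inv])
  obtain ⟨A', hA', hAA'⟩ := key A hA
  obtain ⟨B', hB', hBB'⟩ := key B hB
  refine hAA'.trans (AreConj.symm ?_)
  rwa [eq_of_le_isCyclic hcyc hA' hB' (by rw [← hAA'.card_eq, ← hBB'.card_eq, hA, hB])]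

/-- Subgroups `A` and `B` that are generated by conjugate normal subgroups of odd order `m` and an
involution are conjugate if the 2-part of the normalizers of these normal subgroups is two. -/
theorem areConj_of_involution {A B P Q : Subgroup G} {m : ℕ} (hPA : P ≤ A) (hQB : Q ≤ B)
    (hP : A ≤ Subgroup.normalizer P) (hQ : B ≤ Subgroup.normalizer Q) (hPQ : AreConj P Q)
    (hm : Odd m) (hcQ : Nat.card Q = m) (hA : Nat.card A = 2 * m) (hB : Nat.card B = 2 * m)
    (hN : ¬ 4 ∣ Nat.card (Subgroup.normalizer (Q : Set G))) : AreConj A B := by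
  obtain ⟨g, rfl⟩ := hPQ
  have hconj : AreConj A (MulAut.conj g⁻¹ • A) := AreConj.symm ⟨g⁻¹, rfl⟩
  refine hconj.trans ?_
  have hA' : Nat.card (MulAut.conj g⁻¹ • A : Subgroup G) = 2 * m := by rw [← hconj.card_eq, hA]
  have hQA : Q ≤ MulAut.conj g⁻¹ • A := by
    rw [map_inv]
    exact Subgroup.subset_pointwise_smul_iff.2 (by rwa [inv_inv])
  have hAN : MulAut.conj g⁻¹ • A ≤ Subgroup.normalizer (Q : Set G) := by
    intro x hx
    rw [Subgroup.mem_pointwise_smul_iff_inv_smul_mem] at hx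
    have := mem_normalizer_of_conj g (hP hx)
    rwa [map_inv, inv_inv, inv_smul_smul] at this
  generalize (MulAut.conj g⁻¹ • A : Subgroup G) = A' at *
  clear hconj hP hPA
  -- `A'` and `B` are generated by `Q` and involutions of its normalizer, which are conjugate there.
  obtain ⟨⟨a, ha⟩, hao⟩ := exists_prime_orderOf_dvd_card' (G := A') 2 (hA' ▸ dvd_mul_right 2 m)
  obtain ⟨⟨b, hb⟩, hbo⟩ := exists_prime_orderOf_dvd_card' (G := B) 2 (hB ▸ dvd_mul_right 2 m)
  rw [Subgroup.orderOf_mk] at hao hbo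
  let a' : Subgroup.normalizer (Q : Set G) := ⟨a, hAN ha⟩
  let b' : Subgroup.normalizer (Q : Set G) := ⟨b, hQ hb⟩
  have hcard : (Nat.card (Subgroup.normalizer (Q : Set G))).factorization 2 = 1 := by
    have h1 : 2 ∣ Nat.card (Subgroup.normalizer (Q : Set G)) :=
      (dvd_mul_right 2 m).trans (hB ▸ Subgroup.card_dvd_of_le hQ)
    refine le_antisymm (Nat.lt_succ_iff.1 ?_)
      ((Nat.prime_two.dvd_iff_one_le_factorization Nat.card_pos.ne').1 h1)
    by_contra h2
    exact hN ((Nat.prime_two.pow_dvd_iff_le_factorization Nat.card_pos.ne' (k := 2)).2 (by omega))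
  have ha' : Nat.card (Subgroup.zpowers a') = 2 := by
    rw [Nat.card_zpowers, Subgroup.orderOf_mk, hao]
  have hb' : Nat.card (Subgroup.zpowers b') = 2 := by
    rw [Nat.card_zpowers, Subgroup.orderOf_mk, hbo]
  obtain ⟨n, hn⟩ := areConj_of_card_eq_pow 2 (by rw [ha', hcard, pow_one])
    (by rw [hb', hcard, pow_one] : Nat.card (Subgroup.zpowers b') = _)
  have hna : a ∈ MulAut.conj (n : G) • B := by
    have h1 : a' ∈ MulAut.conj n • Subgroup.zpowers b' := hn ▸ Subgroup.mem_zpowers a'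
    obtain ⟨c, hc, hc'⟩ := h1
    obtain ⟨k, rfl⟩ := Subgroup.mem_zpowers_iff.1 hc
    refine ⟨b ^ k, zpow_mem hb k, ?_⟩
    exact congrArg Subtype.val hc'
  have hnQ : Q ≤ MulAut.conj (n : G) • B := by
    intro x hx
    rw [Subgroup.mem_pointwise_smul_iff_inv_smul_mem]
    refine hQB ?_
    have h1 := (Subgroup.mem_normalizer_iff''.1 n.2 x).1 hx
    exact h1
  have key : ∀ D : Subgroup G, Q ≤ D → a ∈ D → Nat.card D = 2 * m →
      Q ⊔ Subgroup.zpowers a = D := by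
    intro D hQD haD hD
    have hle : Q ⊔ Subgroup.zpowers a ≤ D := sup_le hQD (by rwa [Subgroup.zpowers_le])
    refine Subgroup.eq_of_le_of_card_ge hle (Nat.le_of_dvd Nat.card_pos ?_)
    rw [hD]
    refine Nat.Coprime.mul_dvd_of_dvd_of_dvd (Nat.coprime_two_left.2 hm) ?_ ?_
    · rw [← hao, ← Nat.card_zpowers]
      exact Subgroup.card_dvd_of_le le_sup_right
    · rw [← hcQ]
      exact Subgroup.card_dvd_of_le le_sup_left
  refine ⟨n, ?_⟩
  rw [← key A' hQA ha hA', ← key _ hnQ hna]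
  rw [← hB]
  exact Nat.card_congr (Subgroup.equivSMul (MulAut.conj (n : G)) B).symm.toEquiv

end Conjugacy

/-! ### Isomorphism types of subgroups -/

section Types

variable {G : Type*} [Group G]

/-- The group `A` has a normal subgroup of order `m`. -/
def HasNormalSubgroup (A : Subgroup G) (m : ℕ) : Prop :=
  ∃ P ≤ A, A ≤ Subgroup.normalizer (P : Set G) ∧ Nat.card P = m

theorem HasNormalSubgroup.of_mulEquiv {A : Subgroup G} {X : Type*} [Group X] (e : A ≃* X)
    (N : Subgroup X) [hN : N.Normal] : HasNormalSubgroup A (Nat.card N) := by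
  refine ⟨N.map (A.subtype.comp e.symm.toMonoidHom), ?_, ?_, ?_⟩
  · rintro _ ⟨x, -, rfl⟩
    exact (e.symm x).2
  · rw [Subgroup.le_normalizer_iff]
    rintro a ha _ ⟨x, hx, rfl⟩
    exact ⟨e ⟨a, ha⟩ * x * (e ⟨a, ha⟩)⁻¹, hN.conj_mem x hx _, by simp⟩
  · exact Nat.card_congr (N.equivMapOfInjective _
      (A.subtype_injective.comp e.symm.injective)).symm.toEquiv

/-- The rotations form a normal subgroup. -/
theorem hasNormalSubgroup_of_isD {A : Subgroup G} {n : ℕ} [NeZero n] (h : IsD n A) :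
    HasNormalSubgroup A n ∧ Nat.card A = 2 * n := by
  obtain ⟨e⟩ := h
  have h1 : Nat.card (Subgroup.zpowers (DihedralGroup.r (1 : ZMod n))) = n := by
    rw [Nat.card_zpowers, DihedralGroup.orderOf_r_one]
  have h2 : (Subgroup.zpowers (DihedralGroup.r (1 : ZMod n))).Normal := by
    refine Subgroup.normal_of_index_eq_two ?_
    have h3 := (Subgroup.zpowers (DihedralGroup.r (1 : ZMod n))).card_mul_index
    rw [h1, DihedralGroup.nat_card, mul_comm] at h3
    exact Nat.eq_of_mul_eq_mul_right (NeZero.pos n) h3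
  refine ⟨?_, (Nat.card_congr e.toEquiv).trans DihedralGroup.nat_card⟩
  have := HasNormalSubgroup.of_mulEquiv e (Subgroup.zpowers (DihedralGroup.r (1 : ZMod n)))
  rwa [h1] at this

theorem hasNormalSubgroup_of_isS {A : Subgroup G} (h : IsS 3 A) :
    HasNormalSubgroup A 3 ∧ Nat.card A = 6 := by
  obtain ⟨e⟩ := h
  refine ⟨?_, by rw [Nat.card_congr e.toEquiv, Nat.card_perm, Nat.card_fin]; rfl⟩
  have := HasNormalSubgroup.of_mulEquiv e (alternatingGroup (Fin 3))
  rwa [nat_card_alternatingGroup, Nat.card_fin] at this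

theorem hasNormalSubgroup_of_isA {A : Subgroup G} (h : IsA 4 A) :
    HasNormalSubgroup A 4 ∧ Nat.card A = 12 := by
  obtain ⟨e⟩ := h
  refine ⟨?_, by rw [Nat.card_congr e.toEquiv, nat_card_alternatingGroup, Nat.card_fin]; rfl⟩
  have := alternatingGroup.normal_kleinFour (α := Fin 4) (Nat.card_fin 4)
  have := HasNormalSubgroup.of_mulEquiv e (alternatingGroup.kleinFour (Fin 4))
  rwa [alternatingGroup.kleinFour_card_of_card_eq_four (Nat.card_fin 4)] at this

theorem hasNormalSubgroup_of_isE8C7 {A : Subgroup G} (h : IsE8C7 A) :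
    HasNormalSubgroup A 8 ∧ Nat.card A = 56 := by
  obtain ⟨φ, ⟨e⟩⟩ := h
  have h1 : Nat.card (Multiplicative (Fin 3 → ZMod 2)) = 8 := by
    rw [Nat.card_congr Multiplicative.toAdd, Nat.card_eq_fintype_card]
    rfl
  have h2 : Nat.card (Multiplicative (ZMod 7)) = 7 := by
    rw [Nat.card_congr Multiplicative.toAdd, Nat.card_zmod]
  refine ⟨?_, by rw [Nat.card_congr e.toEquiv, SemidirectProduct.card, h1, h2]⟩
  have := HasNormalSubgroup.of_mulEquiv e (SemidirectProduct.rightHom (φ := φ)).ker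
  rwa [← SemidirectProduct.range_inl_eq_ker_rightHom, ← Nat.card_congr
    (MonoidHom.ofInjective (SemidirectProduct.inl_injective (φ := φ))).toEquiv, h1] at this

theorem card_of_isC {A : Subgroup G} {n : ℕ} (h : IsC n A) : Nat.card A = n := by
  obtain ⟨e⟩ := h
  rw [Nat.card_congr e.toEquiv, Nat.card_congr Multiplicative.toAdd, Nat.card_zmod]

theorem card_of_isE {A : Subgroup G} {n : ℕ} (h : IsE n A) : Nat.card A = 2 ^ n := by
  obtain ⟨e⟩ := h
  rw [Nat.card_congr e.toEquiv, Nat.card_congr Multiplicative.toAdd, Nat.card_fun, Nat.card_zmod,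
    Nat.card_fin]

theorem isC_zpowers (x : G) : IsC (orderOf x) (Subgroup.zpowers x) := by
  rw [← Nat.card_zpowers]
  exact ⟨(zmodCyclicMulEquiv inferInstance).symm⟩

theorem exists_isC [Finite G] (p : ℕ) [Fact p.Prime] (h : p ∣ Nat.card G) :
    ∃ A : Subgroup G, IsC p A := by
  obtain ⟨x, rfl⟩ := exists_prime_orderOf_dvd_card' p h
  exact ⟨_, isC_zpowers x⟩

/-- Recognition of dihedral groups: a group of order `2 n` is dihedral if it has an element `x` of
order `n` and an element `y` with `y² = (y x)² = 1`. For `n ≥ 3` this excludes that `y` is a power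
of `x`. -/
theorem isD_of_orderOf {n : ℕ} (hn : 3 ≤ n) {D : Subgroup G} {x y : G} (hx : x ∈ D) (hy : y ∈ D)
    (hxn : orderOf x = n) (hyy : y * y = 1) (hyx : y * x * (y * x) = 1)
    (hD : Nat.card D = 2 * n) : IsD n D := by
  have hy' : y⁻¹ = y := inv_eq_of_mul_eq_one_left hyy
  have hyx' : y * x * y⁻¹ = x⁻¹ := by
    rw [hy', ← mul_left_inj x, inv_mul_cancel, mul_assoc (y * x), hyx]
  let φ : ZMod n →+ Additive G := ZMod.lift n ⟨zmultiplesHom (Additive G) (Additive.ofMul x), by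
    rw [zmultiplesHom_apply, natCast_zsmul, ← ofMul_pow, ← hxn, pow_orderOf_eq_one, ofMul_one]⟩
  let p : ZMod n → G := fun i => (φ i).toMul
  have hp : ∀ m : ℤ, p m = x ^ m := fun m => by
    simp only [p, φ, ZMod.lift_coe]
    rfl
  have hadd : ∀ i j, p (i + j) = p i * p j := fun i j => by simp only [p, map_add, toMul_add]
  have hconj : ∀ i, p i * y = y * p (-i) := fun i => by
    obtain ⟨m, rfl⟩ := ZMod.intCast_surjective i
    rw [← Int.cast_neg, hp, hp, zpow_neg, ← inv_zpow, ← hyx', conj_zpow, mul_assoc y,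
      ← mul_assoc y y, hyy, one_mul, hy']
  let f : DihedralGroup n → G := fun
    | .r i => p i
    | .sr i => y * p i
  let F : DihedralGroup n →* G := MonoidHom.mk' f fun a b => by
    rcases a with i | i <;> rcases b with j | j
    · exact hadd i j
    · change y * p (j - i) = p i * (y * p j)
      rw [← mul_assoc, hconj, mul_assoc, ← hadd, neg_add_eq_sub]
    · change y * p (i + j) = y * p i * p j
      rw [hadd, mul_assoc]
    · change p (j - i) = y * p i * (y * p j)
      rw [← mul_assoc, mul_assoc y, hconj, ← mul_assoc, hyy, one_mul, ← hadd, neg_add_eq_sub]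
  have hF : Function.Injective F := by
    rw [injective_iff_map_eq_one]
    rintro (i | i) hi
    · obtain ⟨m, rfl⟩ := ZMod.intCast_surjective i
      have h1 : x ^ m = 1 := (hp m).symm.trans hi
      rw [← orderOf_dvd_iff_zpow_eq_one, hxn] at h1
      rw [(ZMod.intCast_zmod_eq_zero_iff_dvd m n).2 h1, DihedralGroup.r_zero]
    · obtain ⟨m, rfl⟩ := ZMod.intCast_surjective i
      have h1 : y * x ^ m = 1 := (congrArg (y * ·) (hp m)).symm.trans hi
      have h2 : y = x ^ (-m) := by rw [zpow_neg]; exact eq_inv_of_mul_eq_one_left h1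
      have h3 : x * x = 1 := by
        have h4 : Commute y x := h2 ▸ (Commute.refl x).zpow_left (-m)
        rwa [h4.symm.mul_mul_mul_comm, hyy, one_mul] at hyx
      rw [← pow_two, ← orderOf_dvd_iff_pow_eq_one, hxn] at h3
      exact absurd (Nat.le_of_dvd two_pos h3) (by omega)
  have hfin : Finite D := Nat.finite_of_card_ne_zero (by omega)
  have hle : F.range ≤ D := by
    have h1 : ∀ i, p i ∈ D := fun i => by
      obtain ⟨m, rfl⟩ := ZMod.intCast_surjective i
      rw [hp]
      exact zpow_mem hx m
    rintro _ ⟨i | i, rfl⟩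
    · exact h1 i
    · exact mul_mem hy (h1 i)
  have heq : F.range = D := Subgroup.eq_of_le_of_card_ge hle (by
    rw [hD, ← Nat.card_congr (MonoidHom.ofInjective hF).toEquiv, DihedralGroup.nat_card])
  exact ⟨((MonoidHom.ofInjective hF).trans (MulEquiv.subgroupCongr heq)).symm⟩

/-- `D₃` is `S₃`. -/
theorem isS_of_isD {A : Subgroup G} (h : IsD 3 A) : IsS 3 A := by
  have h1 : IsD 3 (⊤ : Subgroup (Equiv.Perm (Fin 3))) :=
    isD_of_orderOf le_rfl (x := finRotate 3) (y := Equiv.swap 0 1) trivial trivial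
      (orderOf_eq_prime (p := 3) (by decide) (by decide)) (by decide) (by decide)
      (by rw [Subgroup.card_top, Nat.card_perm, Nat.card_fin]; rfl)
  exact ⟨(h.some.trans h1.some.symm).trans Subgroup.topEquiv⟩

/-- A point stabilizer in `A₅` is isomorphic to `A₄`. -/
theorem exists_isA (h : IsA 5 G) : ∃ A : Subgroup G, IsA 4 A := by
  obtain ⟨e⟩ := h
  let s : Finset (Fin 5) := Finset.univ.erase 4
  let f := e.symm.toMonoidHom.comp (alternatingGroup.ofSubtype s)
  have hf : Function.Injective f := e.symm.injective.comp alternatingGroup.ofSubtype_injective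
  exact ⟨f.range, ⟨(MonoidHom.ofInjective hf).symm.trans
    (Equiv.altCongrHom (s.equivFinOfCardEq (by decide)))⟩⟩

/-- A subgroup of order 56 of the normalizer of an elementary abelian group of order eight. -/
theorem isE8C7_of_le_normalizer {A H : Subgroup G} (hH : IsE 3 H) (hHA : H ≤ A)
    (hA : A ≤ Subgroup.normalizer (H : Set G)) (hcard : Nat.card A = 56) : IsE8C7 A := by
  have hfin : Finite A := Nat.finite_of_card_ne_zero (by omega)
  have : Fact (Nat.Prime 7) := ⟨by norm_num⟩
  obtain ⟨c, hc⟩ := exists_isC (G := A) 7 (by rw [hcard]; norm_num)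
  have hc7 := card_of_isC hc
  have e := Subgroup.subgroupOfEquivOfLe hHA
  have h8 : Nat.card (H.subgroupOf A) = 8 := by
    rw [Nat.card_congr e.toEquiv, card_of_isE hH]
    rfl
  have hn : (H.subgroupOf A).Normal := Subgroup.normal_subgroupOf_of_le_normalizer hA
  have hcompl := Subgroup.isComplement'_of_coprime (H := H.subgroupOf A) (K := c)
    (by rw [h8, hc7, hcard]) (by rw [h8, hc7]; norm_num)
  exact ⟨_, ⟨(SemidirectProduct.mulEquivSubgroup hcompl).symm.trans
    (SemidirectProduct.congr' (e.trans hH.some) hc.some)⟩⟩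

end Types

/-! ### Orders, normalizers and conjugacy of listed subgroups -/

section CodedGroups

variable {G : Type*} [Group G] {n N : ℕ} {θ : G →* Equiv.Perm (Fin n)} {elt : ℕ → ℕ}

/-- The two codes describe the same map of `{0, …, n - 1}`. -/
def sameCode (n c d : ℕ) : Bool := (List.range n).all fun i => Nat.beq (codeApp c i) (codeApp d i)

/-- The code of the `(m + 1)`-st power. -/
def powCode (n c m : ℕ) : ℕ := Nat.rec c (fun _ ih => codeMul n c ih) m

/-- The `b`-th power of the element number `i` is trivial and the `a`-th power is not. -/
def checkOrder (n : ℕ) (elt : ℕ → ℕ) (i a b : ℕ) : Bool :=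
  !sameCode n (powCode n (elt i) (a - 1)) (elt 0) && sameCode n (powCode n (elt i) (b - 1)) (elt 0)

/-- The elements number `j` and `j * i` are involutions, or trivial. -/
def checkDihedral (n : ℕ) (elt : ℕ → ℕ) (i j : ℕ) : Bool :=
  sameCode n (codeMul n (elt j) (elt j)) (elt 0) &&
    sameCode n (codeMul n (codeMul n (elt j) (elt i)) (codeMul n (elt j) (elt i))) (elt 0)

/-- The elements that normalize the subgroup with the elements `s` are those with numbers in `t`. -/
def checkNormalizer (n N : ℕ) (elt : ℕ → ℕ) (s t : List ℕ) : Bool :=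
  (List.range N).all fun i => memNat i t == s.all fun j => s.any fun k =>
    sameCode n (codeMul n (elt i) (elt j)) (codeMul n (elt k) (elt i))

/-- The list consists of the numbers of the distinct elements of a subgroup. The elements of
the groups in question are determined by their values at `0`, `1` and `n - 1`. -/
structure IsSubgroupList (n N : ℕ) (elt : ℕ → ℕ) (s : List ℕ) : Prop where
  check : checkSubgroup n N elt s = true
  distinct : distinctKeys n elt s [0, 1, n - 1] = true

theorem sameCode_iff (hθ : Function.Injective θ) {c d : ℕ} {g h : G} (hc : Represents θ c g)
    (hd : Represents θ d h) : sameCode n c d = true ↔ g = h := by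
  simp only [sameCode, List.all_eq_true, List.mem_range, Nat.beq_eq]
  refine ⟨fun H => hc.unique hθ hd H, ?_⟩
  rintro rfl i hi
  exact (hc ⟨i, hi⟩).trans (hd ⟨i, hi⟩).symm

theorem Represents.powCode {c : ℕ} {g : G} (hc : Represents θ c g) (m : ℕ) :
    Represents θ (powCode n c m) (g ^ (m + 1)) := by
  induction m with
  | zero => rwa [zero_add, pow_one]
  | succ m ih =>
    rw [pow_succ']
    exact hc.mul ih

namespace IsCoding

/-- An element has order `p ^ (k + 1)` if its power with exponent `p ^ (k + 1)` is trivial and that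
with exponent `p ^ k` is not. -/
theorem orderOf_eq (h : IsCoding θ N elt) (h1 : Represents θ (elt 0) 1) {i : ℕ} {g : G}
    (hi : Represents θ (elt i) g) {p : ℕ} (k : ℕ) [hp : Fact p.Prime]
    (hc : checkOrder n elt i (p ^ k) (p ^ (k + 1)) = true) : orderOf g = p ^ (k + 1) := by
  have key : ∀ m, Represents θ (NormOne.powCode n (elt i) (p ^ m - 1)) (g ^ p ^ m) := fun m => by
    have := hi.powCode (p ^ m - 1)
    rwa [Nat.sub_add_cancel (Nat.pow_pos hp.out.pos)] at this
  simp only [checkOrder, Bool.and_eq_true, Bool.not_eq_true', ← Bool.not_eq_true] at hc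
  rw [sameCode_iff h.injective (key _) h1, sameCode_iff h.injective (key _) h1] at hc
  exact orderOf_eq_prime_pow hc.1 hc.2

theorem lt_of_mem {s : List ℕ} (hs : IsSubgroupList n N elt s) {i : ℕ} (hi : i ∈ s) : i < N := by
  have := hs.check
  simp only [checkSubgroup, Bool.and_eq_true, List.all_eq_true, Nat.blt_eq] at this
  exact this.1.1 i hi

theorem card (h : IsCoding θ N elt) (hn : 1 < n) {s : List ℕ} (hs : IsSubgroupList n N elt s) :
    Nat.card (codedSubgroup θ elt s) = s.length :=
  h.card_codedSubgroup hs.check (t := [0, 1, n - 1]) (by simp; omega) hs.distinct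

theorem isD (h : IsCoding θ N elt) (h1 : Represents θ (elt 0) 1) (hn : 1 < n)
    {s : List ℕ} (hs : IsSubgroupList n N elt s)
    {i j : ℕ} (hi : i ∈ s) (hj : j ∈ s) {p : ℕ} (k : ℕ) [hp : Fact p.Prime]
    (hp3 : 3 ≤ p ^ (k + 1)) (hc : checkOrder n elt i (p ^ k) (p ^ (k + 1)) = true)
    (hd : checkDihedral n elt i j = true) (hl : s.length = 2 * p ^ (k + 1)) :
    IsD (p ^ (k + 1)) (codedSubgroup θ elt s) := by
  obtain ⟨x, hx⟩ := h.exists_represents i (lt_of_mem hs hi)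
  obtain ⟨y, hy⟩ := h.exists_represents j (lt_of_mem hs hj)
  rw [checkDihedral, Bool.and_eq_true, sameCode_iff h.injective (hy.mul hy) h1,
    sameCode_iff h.injective ((hy.mul hx).mul (hy.mul hx)) h1] at hd
  exact isD_of_orderOf hp3 (Subgroup.subset_closure ⟨i, hi, hx⟩)
    (Subgroup.subset_closure ⟨j, hj, hy⟩) (h.orderOf_eq h1 hx k hc) hd.1 hd.2
    ((h.card hn hs).trans hl)

/-- The normalizer of a listed subgroup is found by an exhaustive check of the group. -/
theorem normalizer_eq (h : IsCoding θ N elt) {s t : List ℕ} (hs : IsSubgroupList n N elt s)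
    (ht : IsSubgroupList n N elt t) (hc : checkNormalizer n N elt s t = true) :
    Subgroup.normalizer (codedSubgroup θ elt s : Set G) = codedSubgroup θ elt t := by
  have := h.finite
  simp only [checkNormalizer, List.all_eq_true, List.mem_range, beq_iff_eq] at hc
  have key : ∀ i < N, ∀ g, Represents θ (elt i) g →
      (g ∈ Subgroup.normalizer (codedSubgroup θ elt s : Set G) ↔ i ∈ t) := by
    intro i hi g hg
    rw [← memNat_iff, hc i hi, List.all_eq_true]
    refine ⟨fun hgn j hj => List.any_eq_true.2 ?_, fun H => Subgroup.mem_normalizer_fintype ?_⟩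
    · obtain ⟨x, hx⟩ := h.exists_represents j (lt_of_mem hs hj)
      obtain ⟨k, hk, hgk⟩ := (h.mem_codedSubgroup hs.check).1
        ((Subgroup.mem_normalizer_iff.1 hgn x).1 (Subgroup.subset_closure ⟨j, hj, hx⟩))
      exact ⟨k, hk, (sameCode_iff h.injective (hg.mul hx) (hgk.mul hg)).2 (by group)⟩
    · intro x hx
      obtain ⟨j, hj, hx'⟩ := (h.mem_codedSubgroup hs.check).1 hx
      obtain ⟨k, hk, hjk⟩ := List.any_eq_true.1 (H j hj)
      obtain ⟨y, hy⟩ := h.exists_represents k (lt_of_mem hs hk)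
      rw [(sameCode_iff h.injective (hg.mul hx') (hy.mul hg)).1 hjk, mul_inv_cancel_right]
      exact Subgroup.subset_closure ⟨k, hk, hy⟩
  ext g
  rw [h.mem_codedSubgroup ht.check]
  constructor
  · intro hg
    obtain ⟨i, hi, hgi⟩ := h.exists_elt g
    exact ⟨i, (key i hi g hgi).1 hg, hgi⟩
  · rintro ⟨i, hi, hgi⟩
    exact (key i (lt_of_mem ht hi) g hgi).2 hi

end IsCoding

theorem factorization_eq {p e r m : ℕ} [hp : Fact p.Prime] (hm : m = p ^ e * r) (hr : ¬ p ∣ r) :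
    m.factorization p = e := by
  rw [hm, Nat.factorization_mul (Nat.pow_pos hp.out.pos).ne' (by rintro rfl; simp at hr),
    Finsupp.add_apply, hp.out.factorization_pow, Finsupp.single_eq_same,
    Nat.factorization_eq_zero_of_not_dvd hr, add_zero]

/-- Subgroups of order the full power of a prime in the order of the group are conjugate. -/
theorem IsCoding.areConj_of_card (h : IsCoding θ N elt) (hn : 1 < n) {p e r : ℕ} [Fact p.Prime]
    (hG : Nat.card G = p ^ e * r) (hr : ¬ p ∣ r) {A : Subgroup G} {s : List ℕ}
    (hA : Nat.card A = p ^ e) (hs : IsSubgroupList n N elt s) (hl : s.length = p ^ e) :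
    AreConj A (codedSubgroup θ elt s) := by
  have := h.finite
  exact areConj_of_card_eq_pow p ((factorization_eq hG hr).symm ▸ hA)
    ((factorization_eq hG hr).symm ▸ (h.card hn hs).trans hl)

/-- A subgroup that has a normal subgroup of order the full power of a prime, and that has the order
of the normalizer of a Sylow subgroup, is conjugate to this normalizer. -/
theorem IsCoding.areConj (h : IsCoding θ N elt) (hn : 1 < n) {p e r : ℕ} [Fact p.Prime]
    (hG : Nat.card G = p ^ e * r) (hr : ¬ p ∣ r) {A : Subgroup G} {s t : List ℕ}
    (hA : HasNormalSubgroup A (p ^ e) ∧ Nat.card A = t.length) (hs : IsSubgroupList n N elt s)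
    (ht : IsSubgroupList n N elt t) (hl : s.length = p ^ e)
    (hc : checkNormalizer n N elt s t = true) : AreConj A (codedSubgroup θ elt t) := by
  have := h.finite
  obtain ⟨⟨P, -, hPA, hP⟩, hcA⟩ := hA
  exact areConj_of_le_normalizer hPA (h.normalizer_eq hs ht hc).le
    (areConj_of_card_eq_pow p ((factorization_eq hG hr).symm ▸ hP)
      ((factorization_eq hG hr).symm ▸ (h.card hn hs).trans hl)) (hcA.trans (h.card hn ht).symm)

end CodedGroups

section Decomposition

variable {G : Type*} [Group G]

/-- The permutation lattice of a family of subgroups, with the first of them split off. -/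
theorem permLattice_cosetSum_succ {m : ℕ} (A : Fin (m + 1) → Subgroup G) :
    Nonempty ((permLattice G (CosetSum A)).Equiv
      ((cosetLattice (A 0)).prod (permLattice G (CosetSum fun i : Fin m => A i.succ)))) := by
  let b : Module.Basis (CosetSum A) ℤ (MonoidAlgebra ℤ (G ⧸ A 0) ×
      MonoidAlgebra ℤ (CosetSum fun i : Fin m => A i.succ)) :=
    ((permBasis _).prod (permBasis _)).reindex
      { toFun := Sum.elim (fun x => ⟨0, x⟩) fun y => ⟨y.1.succ, y.2⟩
        invFun := fun z => Fin.cases (motive := fun i => G ⧸ A i → _) (fun x => Sum.inl x)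
          (fun i x => Sum.inr ⟨i, x⟩) z.1 z.2
        left_inv := by rintro (x | ⟨i, y⟩) <;> rfl
        right_inv := by
          rintro ⟨i, x⟩
          cases i using Fin.cases <;> rfl }
  have h0 : ∀ x : G ⧸ A 0, b ⟨0, x⟩ = (.single x 1, 0) := fun x => by
    simp [b, permBasis_apply]
  have h1 : ∀ (i : Fin m) (x : G ⧸ A i.succ), b ⟨i.succ, x⟩ = (0, .single ⟨i, x⟩ 1) := fun i x => by
    simp [b, permBasis_apply]
  refine ⟨.mk ((permBasis _).equiv b (.refl _)) fun g => (permBasis _).ext fun x => ?_⟩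
  obtain ⟨i, x⟩ := x
  have h2 : ∀ z, (permBasis (CosetSum A)).equiv b (.refl _) (.single z 1) = b z :=
    fun z => (permBasis _).equiv_apply z b (.refl _)
  change (permBasis _).equiv b (.refl _) (permLattice G _ g (.single ⟨i, x⟩ 1)) =
    ((cosetLattice (A 0)).prod _) g ((permBasis _).equiv b (.refl _) (.single ⟨i, x⟩ 1))
  rw [Representation.ofMulAction_single, h2, h2]
  cases i using Fin.cases with
  | zero =>
    change b ⟨0, g • x⟩ = _
    rw [h0, h0]
    refine Prod.ext (Representation.ofMulAction_single ..).symm ?_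
    exact (map_zero (permLattice G (CosetSum fun i : Fin m => A i.succ) g)).symm
  | succ i =>
    change b ⟨i.succ, g • x⟩ = _
    rw [h1, h1]
    refine Prod.ext (map_zero (cosetLattice (A 0) g)).symm ?_
    change _ = permLattice G (CosetSum fun i : Fin m => A i.succ) g (.single ⟨i, x⟩ 1)
    rw [Representation.ofMulAction_single]
    rfl

end Decomposition

/-! ### Verification of the certificates -/

section Verification

set_option maxRecDepth 100000 in
theorem certificate₁_holds : certificate₁.Holds 3 6 elt₂ := by
  constructor <;> decide +kernel

set_option maxRecDepth 100000 in
theorem certificate₂_holds : certificate₂.Holds 3 6 elt₂ := by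
  constructor <;> decide +kernel

set_option maxRecDepth 100000 in
theorem certificate₃_holds : certificate₃.Holds 5 60 elt₄ := by
  constructor <;> decide +kernel

set_option maxRecDepth 100000 in
theorem certificate₄_holds : certificate₄.Holds 5 60 elt₄ := by
  constructor <;> decide +kernel

set_option maxRecDepth 100000 in
theorem certificate₅_holds : certificate₅.Holds 9 504 elt₈ := by
  constructor <;> decide +kernel

set_option maxRecDepth 100000 in
theorem certificate₆_holds : certificate₆.Holds 9 504 elt₈ := by
  constructor <;> decide +kernel

end Verification

/-! ### Direct sums of coset lattices -/

section Products

variable {G : Type*} [Group G] {M N V : Type*} [AddCommGroup M] [AddCommGroup N] [AddCommGroup V]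
  (ρ : Representation ℤ G M) (σ : Representation ℤ G N) (τ : Representation ℤ G V)

/-- `M ⊕ N ≃ N ⊕ M`. -/
def prodComm : (ρ.prod σ).Equiv (σ.prod ρ) := .mk (LinearEquiv.prodComm ℤ M N) fun _ => rfl

/-- `(M ⊕ N) ⊕ V ≃ M ⊕ (N ⊕ V)`. -/
def prodAssoc : ((ρ.prod σ).prod τ).Equiv (ρ.prod (σ.prod τ)) :=
  .mk (LinearEquiv.prodAssoc ℤ M N V) fun _ => rfl

/-- The zero lattice is a neutral element for products. -/
def zeroProd [Subsingleton M] : (ρ.prod σ).Equiv σ :=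
  .mk (LinearEquiv.ofBijective (LinearMap.snd ℤ M N)
    ⟨fun _ _ h => Prod.ext (Subsingleton.elim _ _) h, Prod.snd_surjective⟩) fun _ => rfl

/-- The permutation lattice of the group modulo itself. -/
def topEquiv {G : Type*} [Group G] : (cosetLattice (⊤ : Subgroup G)).Equiv (trivialLattice G) :=
  have := QuotientGroup.subsingleton_quotient_top (G := G)
  have : Unique (G ⧸ (⊤ : Subgroup G)) := Unique.mk' _
  let b := (permBasis (G ⧸ (⊤ : Subgroup G))).equiv (Module.Basis.singleton _ ℤ) (.refl _)
  .mk b fun g => (permBasis _).ext fun x => by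
    change b (permLattice G _ g (.single x 1)) = b (.single x 1)
    rw [Representation.ofMulAction_single, Subsingleton.elim (g • x) x]

variable {ρ σ τ}

/-- `M ⊕ (N ⊕ V) ≃ N ⊕ (M ⊕ V)`. -/
def prodLeftComm : (ρ.prod (σ.prod τ)).Equiv (σ.prod (ρ.prod τ)) :=
  .mk (LinearEquiv.prodAssoc ℤ M N V |>.symm.trans (((LinearEquiv.prodComm ℤ M N).prodCongr
    (.refl ℤ V)).trans (LinearEquiv.prodAssoc ℤ N M V))) fun _ => rfl

/-- A permutation lattice of the empty family is zero and can be cancelled. -/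
theorem cosetSum_zero {A : Fin 0 → Subgroup G} (h : Nonempty (((permLattice G (CosetSum A)).prod
    ρ).Equiv ((permLattice G (CosetSum A)).prod σ))) : Nonempty (ρ.Equiv σ) := by
  have : Subsingleton (MonoidAlgebra ℤ (CosetSum A)) := (permBasis _).repr.toEquiv.subsingleton
  obtain ⟨e⟩ := h
  exact ⟨(zeroProd _ _).symm.trans (e.trans (zeroProd _ _))⟩

theorem cosetSum_one {A : Fin 1 → Subgroup G} {B : Subgroup G} (hB : AreConj B (A 0)) :
    Nonempty ((permLattice G (CosetSum A)).Equiv (cosetLattice B)) := by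
  obtain ⟨e⟩ := permLattice_cosetSum_succ A
  obtain ⟨e'⟩ := hB.symm.cosetLattice_equiv
  have : Subsingleton (MonoidAlgebra ℤ (CosetSum fun i : Fin 0 => A i.succ)) :=
    (permBasis _).repr.toEquiv.subsingleton
  exact ⟨(e.trans ((prodComm _ _).trans (zeroProd _ _))).trans e'⟩

theorem cosetSum_one_top {A : Fin 1 → Subgroup G} (hA : A 0 = ⊤) :
    Nonempty ((permLattice G (CosetSum A)).Equiv (trivialLattice G)) :=
  let ⟨e⟩ := cosetSum_one (hA ▸ AreConj.refl _ : AreConj ⊤ (A 0))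
  ⟨e.trans topEquiv⟩

theorem card_cosetSum_top {A : Fin 1 → Subgroup G} (hA : A 0 = ⊤) : Nat.card (CosetSum A) = 1 := by
  obtain ⟨e⟩ := cosetSum_one_top hA
  rw [← finrank_permLattice, e.toLinearEquiv.finrank_eq, Module.finrank_self]

theorem cosetSum_two {A : Fin 2 → Subgroup G} {B C : Subgroup G} (hB : AreConj B (A 0))
    (hC : AreConj C (A 1)) :
    Nonempty ((permLattice G (CosetSum A)).Equiv ((cosetLattice B).prod (cosetLattice C))) := by
  obtain ⟨e⟩ := permLattice_cosetSum_succ A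
  obtain ⟨e'⟩ := hB.symm.cosetLattice_equiv
  obtain ⟨e''⟩ := cosetSum_one (A := fun i : Fin 1 => A i.succ) hC
  exact ⟨e.trans (prodEquiv e' e'')⟩

theorem cosetSum_three {A : Fin 3 → Subgroup G} {B C D : Subgroup G} (hB : AreConj B (A 0))
    (hC : AreConj C (A 1)) (hD : AreConj D (A 2)) :
    Nonempty ((permLattice G (CosetSum A)).Equiv
      ((cosetLattice B).prod ((cosetLattice C).prod (cosetLattice D)))) := by
  obtain ⟨e⟩ := permLattice_cosetSum_succ A
  obtain ⟨e'⟩ := hB.symm.cosetLattice_equiv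
  obtain ⟨e''⟩ := cosetSum_two (A := fun i : Fin 2 => A i.succ) hC hD
  exact ⟨e.trans (prodEquiv e' e'')⟩

end Products

section Resolutions

variable {G : Type*} [Group G] {n N : ℕ} {θ : G →* Equiv.Perm (Fin n)} {elt : ℕ → ℕ}

/-- The subgroups of the family are listed completely, and the tuples distinguish the cosets. -/
def Family.check (n N : ℕ) (elt : ℕ → ℕ) (𝒜 : Family) : Bool :=
  (List.range 𝒜.size).all fun c => checkSubgroup n N elt (𝒜.gens c) &&
    distinctKeys n elt (𝒜.gens c) [0, 1, n - 1] && checkTuples n N elt (𝒜.gens c) (𝒜.tuples c)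

theorem index_eq [Finite G] {A : Subgroup G} {m r : ℕ} (hG : Nat.card G = m * r)
    (hA : Nat.card A = m) : A.index = r := by
  have := A.card_mul_index
  rw [hG, hA] at this
  exact Nat.eq_of_mul_eq_mul_left (hA ▸ Nat.card_pos) this

namespace IsCoding

theorem valid (h : IsCoding θ N elt) {𝒜 : Family} (h𝒜 : 𝒜.check n N elt = true) :
    (∀ c : Fin 𝒜.size, IsSubgroupList n N elt (𝒜.gens c)) ∧ 𝒜.Valid θ elt := by
  simp only [Family.check, List.all_eq_true, List.mem_range, Bool.and_eq_true] at h𝒜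
  have h1 : ∀ c : Fin 𝒜.size, IsSubgroupList n N elt (𝒜.gens c) := fun c =>
    ⟨(h𝒜 c c.2).1.1, (h𝒜 c c.2).1.2⟩
  exact ⟨h1, fun c => h.isCosetKey (fun i hi => lt_of_mem (h1 c) hi) (h𝒜 c c.2).2⟩

theorem card_points (h : IsCoding θ N elt) (hn : 1 < n) (hG : Nat.card G = N) {𝒜 : Family}
    (h𝒜 : 𝒜.check n N elt = true) :
    Nat.card (𝒜.Points θ elt) = ∑ c : Fin 𝒜.size, N / (𝒜.gens c).length := by
  have := h.finite
  rw [Nat.card_sigma]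
  refine Finset.sum_congr rfl fun c _ => ?_
  have h1 : Nat.card (𝒜.sub θ elt c) = (𝒜.gens c).length := h.card hn ((h.valid h𝒜).1 c)
  rw [← h1, ← hG, ← (𝒜.sub θ elt c).card_mul_index, Nat.mul_div_cancel_left _ Nat.card_pos]
  rfl

end IsCoding

/-- The resolution that belongs to a certificate, with the orders of the `G`-sets computed from the
lists. -/
theorem Certificate.Holds.exists_equiv [Finite G] {C : Certificate} (hC : C.Holds n N elt)
    (h : IsCoding θ N elt) (hn : 1 < n) (hG : Nat.card G = N) (hP : C.P.check n N elt = true)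
    (hQ : C.Q.check n N elt = true) (hY : C.Y.check n N elt = true)
    (hH : IsSubgroupList n N elt C.H) (ht : checkTuples n N elt C.H C.tuples = true)
    (hgens : codedSubgroup θ elt C.gens = ⊤)
    (hw : ∀ j : Fin C.P.size, C.weight j * (C.P.gens j).length = C.scale) {d r : ℕ}
    (hr : Nat.card (C.Q₀.Points θ elt) = r)
    (hd : ∑ c : Fin C.P.size, N / (C.P.gens c).length + 1 = d + N / C.H.length)
    (hcard : ∑ c : Fin C.P.size, N / (C.P.gens c).length + r + 1 =
      ∑ c : Fin C.Q.size, N / (C.Q.gens c).length + N / C.H.length) :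
    ∃ F : Representation ℤ G (Fin d → ℤ), IsFlabbyClassOf (chevalley (codedSubgroup θ elt C.H)) F ∧
      IsStablyPermutation F ∧ Nonempty (((permLattice G (C.Y.Points θ elt)).prod
        (permLattice G (C.Q.Points θ elt))).Equiv ((permLattice G (C.Y.Points θ elt)).prod
          ((permLattice G (C.Q₀.Points θ elt)).prod F))) := by
  have hN : 0 < N := hG ▸ Nat.card_pos
  have h1 : (codedSubgroup θ elt C.H).index = N / C.H.length := by
    rw [← h.card hn hH, ← hG, ← (codedSubgroup θ elt C.H).card_mul_index,
      Nat.mul_div_cancel_left _ Nat.card_pos]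
  obtain ⟨F, hF, hs, ⟨e⟩⟩ := hC.exists_flabbyClass h hN (h.valid hQ).2 (h.valid hY).2
    (h.isCosetKey (fun i hi => IsCoding.lt_of_mem hH hi) ht) hH.check (t := [0, 1, n - 1])
    (by simp; omega) hH.distinct hgens
    (fun j => by
      rw [← hw j]
      exact congrArg _ (congrArg Nat.cast (h.card hn ((h.valid hP).1 j))))
    (d := d) (by rw [h.card_points hn hG hP, h1, hd])
    (by rw [h.card_points hn hG hP, h.card_points hn hG hQ, h1, hr, hcard])
  refine ⟨F, hF, hs, ⟨(prodComm _ _).trans (e.symm.trans ((prodAssoc _ _ _).symm.trans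
    ((prodComm _ _).trans (prodEquiv (.refl _) (prodComm _ _)))))⟩⟩

end Resolutions

/-! ### The groups `S₃` and `A₅` -/

section SymmetricGroup

variable {G : Type*} [Group G] {θ : G →* Equiv.Perm (Fin 3)}

theorem exists_isCoding_of_isS (hG : IsS 3 G) :
    ∃ θ : G →* Equiv.Perm (Fin 3), IsCoding θ 6 elt₂ :=
  let ⟨e⟩ := hG
  ⟨_, isCoding_perm.comp e⟩

theorem card_of_isCoding₂ (h : IsCoding θ 6 elt₂) : Nat.card G = 6 :=
  h.card_eq (t := [0, 1, 2]) (by simp) (by decide +kernel)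

theorem areConj_of_isC_two (h : IsCoding θ 6 elt₂) {A : Subgroup G} (hA : IsC 2 A) (s : List ℕ)
    (hs : IsSubgroupList 3 6 elt₂ s) (hl : s.length = 2) : AreConj A (codedSubgroup θ elt₂ s) :=
  h.areConj_of_card (p := 2) (e := 1) (r := 3) (by norm_num) (card_of_isCoding₂ h) (by norm_num)
    (card_of_isC hA) hs hl

theorem areConj_of_isC_three (h : IsCoding θ 6 elt₂) {A : Subgroup G} (hA : IsC 3 A) :
    AreConj A (codedSubgroup θ elt₂ [0, 3, 4]) :=
  have : Fact (Nat.Prime 3) := ⟨by norm_num⟩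
  h.areConj_of_card (p := 3) (e := 1) (r := 2) (by norm_num) (card_of_isCoding₂ h) (by norm_num)
    (card_of_isC hA) ⟨by decide +kernel, by decide +kernel⟩ rfl

variable [Finite G]

/-- The resolution for `S₃` and its trivial subgroup; `Q` consists of `G/C₂`, twice, and `G/C₃`, and
`Q₀` is a point. -/
theorem exists_flabbyClass_symmetric_bot (hG : IsS 3 G) {H : Subgroup G} (hH : H = ⊥) :
    H.index = 6 ∧ ∃ F : Representation ℤ G (Fin 7 → ℤ),
      IsFlabbyClassOf (chevalley H) F ∧ IsStablyPermutation F ∧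
      (∃ A : Subgroup G, IsC 2 A) ∧ (∃ B : Subgroup G, IsC 3 B) ∧
      ∀ A B : Subgroup G, IsC 2 A → IsC 3 B →
        Nonempty (((cosetLattice A).prod ((cosetLattice A).prod (cosetLattice B))).Equiv
          ((trivialLattice G).prod F)) ∧ A.index = 3 ∧ B.index = 2 := by
  have : Fact (Nat.Prime 3) := ⟨by norm_num⟩
  obtain ⟨θ, h⟩ := exists_isCoding_of_isS hG
  have hcard := card_of_isCoding₂ h
  have hl : IsSubgroupList 3 6 elt₂ certificate₁.H := ⟨by decide +kernel, by decide +kernel⟩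
  obtain rfl : codedSubgroup θ elt₂ certificate₁.H = H :=
    (Subgroup.eq_bot_of_card_eq _ (h.card (by norm_num) hl)).trans hH.symm
  have htop := codedSubgroup_gens₂ h
  obtain ⟨F, hF, hs, he⟩ := certificate₁_holds.exists_equiv h (by norm_num) hcard
    (by decide +kernel) (by decide +kernel) (by decide +kernel) hl (by decide +kernel) htop
    (by decide) (card_cosetSum_top htop) (d := 7) (by decide) (by decide)
  refine ⟨index_eq (m := 1) hcard (h.card (by norm_num) hl), F, hF, hs,
    exists_isC 2 (by simp [hcard]), exists_isC 3 (by simp [hcard]), fun A B hA hB =>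
    ⟨?_, index_eq hcard (card_of_isC hA), index_eq hcard (card_of_isC hB)⟩⟩
  obtain ⟨e⟩ := cosetSum_zero he
  have hA' := areConj_of_isC_two h hA [0, 1] ⟨by decide +kernel, by decide +kernel⟩ rfl
  obtain ⟨eQ⟩ := cosetSum_three (A := certificate₁.Q.sub θ elt₂) hA' hA' (areConj_of_isC_three h hB)
  obtain ⟨eR⟩ := cosetSum_one_top (A := certificate₁.Q₀.sub θ elt₂) htop
  exact ⟨eQ.symm.trans (e.trans (prodEquiv eR (.refl F)))⟩

/-- The resolution for `S₃` and a subgroup of order two; `Q` consists of `G/C₂` and `G/C₃`, and `Q₀`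
is a point. -/
theorem exists_flabbyClass_symmetric_two (hG : IsS 3 G) {H : Subgroup G} (hH : IsC 2 H) :
    H.index = 3 ∧ ∃ F : Representation ℤ G (Fin 4 → ℤ),
      IsFlabbyClassOf (chevalley H) F ∧ IsStablyPermutation F ∧
      (∃ A : Subgroup G, IsC 2 A) ∧ (∃ B : Subgroup G, IsC 3 B) ∧
      ∀ A B : Subgroup G, IsC 2 A → IsC 3 B →
        Nonempty (((cosetLattice A).prod (cosetLattice B)).Equiv
          ((trivialLattice G).prod F)) ∧ A.index = 3 ∧ B.index = 2 := by
  have : Fact (Nat.Prime 3) := ⟨by norm_num⟩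
  obtain ⟨θ₀, h₀⟩ := exists_isCoding_of_isS hG
  have hcard := card_of_isCoding₂ h₀
  have hl : IsSubgroupList 3 6 elt₂ certificate₂.H := ⟨by decide +kernel, by decide +kernel⟩
  obtain ⟨θ, h, hθ⟩ := h₀.exists_eq_codedSubgroup (areConj_of_isC_two h₀ hH certificate₂.H hl rfl)
  subst hθ
  have htop : codedSubgroup θ elt₂ [0, 1, 2, 3, 4, 5] = ⊤ :=
    Subgroup.eq_top_of_card_eq _ ((h.card (by norm_num)
      ⟨by decide +kernel, by decide +kernel⟩).trans hcard.symm)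
  obtain ⟨F, hF, hs, he⟩ := certificate₂_holds.exists_equiv h (by norm_num) hcard
    (by decide +kernel) (by decide +kernel) (by decide +kernel) hl (by decide +kernel)
    (codedSubgroup_gens₂ h) (by decide) (card_cosetSum_top htop) (d := 4) (by decide) (by decide)
  refine ⟨index_eq hcard (card_of_isC hH), F, hF, hs, ⟨_, hH⟩, exists_isC 3 (by simp [hcard]),
    fun A B hA hB => ⟨?_, index_eq hcard (card_of_isC hA), index_eq hcard (card_of_isC hB)⟩⟩
  obtain ⟨e⟩ := cosetSum_zero he
  obtain ⟨eQ⟩ := cosetSum_two (A := certificate₂.Q.sub θ elt₂)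
    (areConj_of_isC_two h hA [0, 2] ⟨by decide +kernel, by decide +kernel⟩ rfl)
    (areConj_of_isC_three h hB)
  obtain ⟨eR⟩ := cosetSum_one_top (A := certificate₂.Q₀.sub θ elt₂) htop
  exact ⟨eQ.symm.trans (e.trans (prodEquiv eR (.refl F)))⟩

end SymmetricGroup

section AlternatingGroup

variable {G : Type*} [Group G] {θ : G →* Equiv.Perm (Fin 5)}

theorem exists_isCoding_of_isA (hG : IsA 5 G) :
    ∃ θ : G →* Equiv.Perm (Fin 5), IsCoding θ 60 elt₄ :=
  let ⟨e⟩ := hG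
  ⟨_, isCoding_alternatingGroup.comp e⟩

theorem card_of_isCoding₄ (h : IsCoding θ 60 elt₄) : Nat.card G = 60 :=
  h.card_eq (t := [0, 1, 4]) (by simp) (by decide +kernel)

theorem areConj_of_isC_five (h : IsCoding θ 60 elt₄) {A : Subgroup G} (hA : IsC 5 A) :
    AreConj A (codedSubgroup θ elt₄ [0, 14, 31, 36, 53]) :=
  have : Fact (Nat.Prime 5) := ⟨by norm_num⟩
  h.areConj_of_card (p := 5) (e := 1) (r := 12) (by norm_num) (card_of_isCoding₄ h) (by norm_num)
    (card_of_isC hA) ⟨by decide +kernel, by decide +kernel⟩ rfl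

theorem areConj_of_isA_four (h : IsCoding θ 60 elt₄) {A : Subgroup G} (hA : IsA 4 A) :
    AreConj A (codedSubgroup θ elt₄ [0, 1, 2, 3, 4, 5, 6, 7, 8, 9, 10, 11]) :=
  h.areConj (p := 2) (e := 2) (r := 15) (by norm_num) (card_of_isCoding₄ h) (by norm_num)
    (hasNormalSubgroup_of_isA hA) (s := [0, 3, 6, 9]) ⟨by decide +kernel, by decide +kernel⟩
    ⟨by decide +kernel, by decide +kernel⟩ rfl (by decide +kernel)

variable [Finite G]

/-- The resolution for `A₅` and a Klein four-group; `Q` consists of `G/C₅` and `G/A₄`, twice, and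
`Q₀` is a point. -/
theorem exists_flabbyClass_alternating_klein (hG : IsA 5 G) {H : Subgroup G} (hH : IsE 2 H) :
    H.index = 15 ∧ ∃ F : Representation ℤ G (Fin 21 → ℤ),
      IsFlabbyClassOf (chevalley H) F ∧ IsStablyPermutation F ∧
      (∃ A : Subgroup G, IsC 5 A) ∧ (∃ B : Subgroup G, IsA 4 B) ∧
      ∀ A B : Subgroup G, IsC 5 A → IsA 4 B →
        Nonempty (((cosetLattice A).prod ((cosetLattice B).prod (cosetLattice B))).Equiv
          ((trivialLattice G).prod F)) ∧ A.index = 12 ∧ B.index = 5 := by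
  have : Fact (Nat.Prime 5) := ⟨by norm_num⟩
  obtain ⟨θ₀, h₀⟩ := exists_isCoding_of_isA hG
  have hcard := card_of_isCoding₄ h₀
  have hl : IsSubgroupList 5 60 elt₄ certificate₃.H := ⟨by decide +kernel, by decide +kernel⟩
  obtain ⟨θ, h, hθ⟩ := h₀.exists_eq_codedSubgroup (h₀.areConj_of_card (p := 2) (e := 2) (r := 15)
    (by norm_num) hcard (by norm_num) (card_of_isE hH) hl rfl)
  subst hθ
  have htop := codedSubgroup_gens₄ h
  obtain ⟨F, hF, hs, he⟩ := certificate₃_holds.exists_equiv h (by norm_num) hcard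
    (by decide +kernel) (by decide +kernel) (by decide +kernel) hl (by decide +kernel) htop
    (by decide) (card_cosetSum_top htop) (d := 21) (by decide) (by decide)
  refine ⟨index_eq hcard (card_of_isE hH), F, hF, hs, exists_isC 5 (by simp [hcard]),
    exists_isA hG, fun A B hA hB => ⟨?_, index_eq hcard (card_of_isC hA),
      index_eq hcard (hasNormalSubgroup_of_isA hB).2⟩⟩
  obtain ⟨e⟩ := cosetSum_zero he
  have hB' := areConj_of_isA_four h hB
  obtain ⟨eQ⟩ := cosetSum_three (A := certificate₃.Q.sub θ elt₄) (areConj_of_isC_five h hA) hB' hB'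
  obtain ⟨eR⟩ := cosetSum_one_top (A := certificate₃.Q₀.sub θ elt₄) htop
  exact ⟨eQ.symm.trans (e.trans (prodEquiv eR (.refl F)))⟩

/-- The resolution for `A₅` and `A₄`; `Q` consists of `G/C₅` and `G/S₃`, and `Q₀` is `G/D₅`. -/
theorem exists_flabbyClass_alternating_alternating (hG : IsA 5 G) {H : Subgroup G}
    (hH : IsA 4 H) :
    H.index = 5 ∧ ∃ F : Representation ℤ G (Fin 16 → ℤ),
      IsFlabbyClassOf (chevalley H) F ∧ IsStablyPermutation F ∧
      (∃ A : Subgroup G, IsC 5 A) ∧ (∃ B : Subgroup G, IsS 3 B) ∧ (∃ C : Subgroup G, IsD 5 C) ∧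
      ∀ A B C : Subgroup G, IsC 5 A → IsS 3 B → IsD 5 C →
        Nonempty (((cosetLattice A).prod (cosetLattice B)).Equiv ((cosetLattice C).prod F)) ∧
        A.index = 12 ∧ B.index = 10 ∧ C.index = 6 := by
  have : Fact (Nat.Prime 3) := ⟨by norm_num⟩
  have : Fact (Nat.Prime 5) := ⟨by norm_num⟩
  obtain ⟨θ₀, h₀⟩ := exists_isCoding_of_isA hG
  have hcard := card_of_isCoding₄ h₀
  have hl : IsSubgroupList 5 60 elt₄ certificate₄.H := ⟨by decide +kernel, by decide +kernel⟩
  obtain ⟨θ, h, hθ⟩ := h₀.exists_eq_codedSubgroup (areConj_of_isA_four h₀ hH :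
    AreConj H (codedSubgroup θ₀ elt₄ certificate₄.H))
  subst hθ
  have h1 := h.represents_one (by norm_num) (by decide +kernel)
  have hD : IsSubgroupList 5 60 elt₄ [0, 6, 12, 14, 29, 31, 36, 38, 53, 55] :=
    ⟨by decide +kernel, by decide +kernel⟩
  have hS : IsSubgroupList 5 60 elt₄ [0, 1, 2, 12, 16, 20] :=
    ⟨by decide +kernel, by decide +kernel⟩
  have hcardD : Nat.card (CosetSum (certificate₄.Q₀.sub θ elt₄)) = 6 :=
    h.card_points (by norm_num) hcard (by decide +kernel)
  obtain ⟨F, hF, hs, he⟩ := certificate₄_holds.exists_equiv h (by norm_num) hcard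
    (by decide +kernel) (by decide +kernel) (by decide +kernel) hl (by decide +kernel)
    (codedSubgroup_gens₄ h) (by decide) hcardD (d := 16) (by decide) (by decide)
  refine ⟨index_eq hcard (hasNormalSubgroup_of_isA hH).2, F, hF, hs, exists_isC 5 (by simp [hcard]),
    ⟨_, isS_of_isD (h.isD h1 (by norm_num) hS (i := 1) (j := 12) (by simp) (by simp) (p := 3) 0
      (by norm_num) (by decide +kernel) (by decide +kernel) rfl)⟩,
    ⟨_, h.isD h1 (by norm_num) hD (i := 14) (j := 6) (by simp) (by simp) (p := 5) 0
      (by norm_num) (by decide +kernel) (by decide +kernel) rfl⟩,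
    fun A B C hA hB hC => ⟨?_, index_eq hcard (card_of_isC hA),
      index_eq hcard (hasNormalSubgroup_of_isS hB).2,
      index_eq hcard (hasNormalSubgroup_of_isD hC).2⟩⟩
  obtain ⟨e⟩ := cosetSum_zero he
  obtain ⟨eQ⟩ := cosetSum_two (A := certificate₄.Q.sub θ elt₄) (areConj_of_isC_five h hA)
    (h.areConj (p := 3) (e := 1) (r := 20) (by norm_num) hcard (by norm_num)
      (hasNormalSubgroup_of_isS hB) (s := [0, 1, 2]) ⟨by decide +kernel, by decide +kernel⟩ hS rfl
      (by decide +kernel))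
  obtain ⟨eR⟩ := cosetSum_one (A := certificate₄.Q₀.sub θ elt₄)
    (h.areConj (p := 5) (e := 1) (r := 12) (by norm_num) hcard (by norm_num)
      (hasNormalSubgroup_of_isD hC) (s := [0, 14, 31, 36, 53])
      ⟨by decide +kernel, by decide +kernel⟩ hD rfl (by decide +kernel))
  exact ⟨eQ.symm.trans (e.trans (prodEquiv eR (.refl F)))⟩

end AlternatingGroup

/-! ### The group `PSL₂(𝔽₈)` -/

section ProjectiveLinearGroup

variable {G : Type*} [Group G] {θ : G →* Equiv.Perm (Fin 9)}

theorem exists_isCoding_of_isPSL28 (hG : IsPSL28 G) :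
    ∃ θ : G →* Equiv.Perm (Fin 9), IsCoding θ 504 elt₈ := by
  classical
  obtain ⟨e⟩ := hG
  obtain ⟨f⟩ := exists_ringEquiv
  exact ⟨_, (isCoding_psl f).comp e⟩

theorem card_of_isCoding₈ (h : IsCoding θ 504 elt₈) : Nat.card G = 504 :=
  h.card_eq (t := [0, 1, 8]) (by simp) (by decide +kernel)

theorem codedSubgroup_mono {n : ℕ} {θ : G →* Equiv.Perm (Fin n)} {elt : ℕ → ℕ} {s t : List ℕ}
    (h : s ⊆ t) : codedSubgroup θ elt s ≤ codedSubgroup θ elt t :=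
  Subgroup.closure_mono fun _ ⟨i, hi, hg⟩ => ⟨i, h hi, hg⟩

/-- The numbers of the elements of a cyclic subgroup of order nine. -/
abbrev cyclicNine : List ℕ := [0, 58, 123, 168, 233, 310, 391, 420, 501]

theorem isSubgroupList_cyclicNine : IsSubgroupList 9 504 elt₈ cyclicNine :=
  ⟨by decide +kernel, by decide +kernel⟩

theorem isC_cyclicNine (h : IsCoding θ 504 elt₈) :
    IsC 9 (codedSubgroup θ elt₈ cyclicNine) := by
  have : Fact (Nat.Prime 3) := ⟨by norm_num⟩
  have := h.finite
  obtain ⟨x, hx⟩ := h.exists_represents 58 (by norm_num)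
  have hx9 : orderOf x = 9 := h.orderOf_eq (h.represents_one (by norm_num) (by decide +kernel)) hx
    (p := 3) 1 (by decide +kernel)
  have heq : Subgroup.zpowers x = codedSubgroup θ elt₈ cyclicNine :=
    Subgroup.eq_of_le_of_card_ge
      ((Subgroup.zpowers_le).2 (Subgroup.subset_closure ⟨58, by simp, hx⟩))
      (by rw [h.card (by norm_num) isSubgroupList_cyclicNine, Nat.card_zpowers, hx9]; rfl)
  rw [← heq]
  have := isC_zpowers x
  rwa [hx9] at this

theorem areConj_of_isC_nine (h : IsCoding θ 504 elt₈) {A : Subgroup G} (hA : IsC 9 A) :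
    AreConj A (codedSubgroup θ elt₈ cyclicNine) :=
  have : Fact (Nat.Prime 3) := ⟨by norm_num⟩
  h.areConj_of_card (p := 3) (e := 2) (r := 56) (by norm_num) (card_of_isCoding₈ h) (by norm_num)
    (card_of_isC hA) isSubgroupList_cyclicNine rfl

/-- A Sylow 3-subgroup is cyclic of order nine, so that all subgroups of order three are conjugate.
-/
theorem areConj_of_card_three (h : IsCoding θ 504 elt₈) {A : Subgroup G} (hA : Nat.card A = 3) :
    AreConj A (codedSubgroup θ elt₈ [0, 57, 112]) := by
  have : Fact (Nat.Prime 3) := ⟨by norm_num⟩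
  have := h.finite
  obtain ⟨e⟩ := isC_cyclicNine h
  refine areConj_of_isCyclic 3 (m := 1) ?_ (isCyclic_of_surjective e.symm e.symm.surjective) hA
    (h.card (by norm_num) ⟨by decide +kernel, by decide +kernel⟩)
  rw [factorization_eq (p := 3) (e := 2) (r := 56) (card_of_isCoding₈ h) (by norm_num)]
  exact h.card (by norm_num) isSubgroupList_cyclicNine

/-- The normalizer of a subgroup of order three is dihedral of order 18, so its Sylow 2-subgroups
have order two. -/
theorem areConj_of_isS_three (h : IsCoding θ 504 elt₈) {A : Subgroup G} (hA : IsS 3 A) :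
    AreConj A (codedSubgroup θ elt₈ [0, 7, 56, 57, 112, 113]) := by
  have := h.finite
  obtain ⟨⟨P, hPA, hAP, hP⟩, hcA⟩ := hasNormalSubgroup_of_isS hA
  have h3 : IsSubgroupList 9 504 elt₈ [0, 57, 112] := ⟨by decide +kernel, by decide +kernel⟩
  have h18 : IsSubgroupList 9 504 elt₈ [0, 7, 56, 57, 112, 113, 218, 219, 274, 275, 300, 301, 356,
    357, 430, 431, 486, 487] := ⟨by decide +kernel, by decide +kernel⟩
  have hN := h.normalizer_eq h3 h18 (by decide +kernel)
  refine areConj_of_involution hPA (codedSubgroup_mono (s := [0, 57, 112]) (by simp)) hAP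
    (hN ▸ codedSubgroup_mono (by simp)) (areConj_of_card_three h hP) (m := 3) (by decide)
    (h.card (by norm_num) h3) hcA
    (h.card (by norm_num) ⟨by decide +kernel, by decide +kernel⟩) ?_
  rw [hN, h.card (by norm_num) h18]
  decide

theorem areConj_of_isE_three (h : IsCoding θ 504 elt₈) {A : Subgroup G} (hA : IsE 3 A) :
    AreConj A (codedSubgroup θ elt₈ certificate₅.H) :=
  h.areConj_of_card (p := 2) (e := 3) (r := 63) (by norm_num) (card_of_isCoding₈ h) (by norm_num)
    (card_of_isE hA) ⟨by decide +kernel, by decide +kernel⟩ rfl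

theorem areConj_of_isE8C7 (h : IsCoding θ 504 elt₈) {A : Subgroup G} (hA : IsE8C7 A) :
    AreConj A (codedSubgroup θ elt₈ certificate₆.H) :=
  h.areConj (p := 2) (e := 3) (r := 63) (by norm_num) (card_of_isCoding₈ h) (by norm_num)
    (hasNormalSubgroup_of_isE8C7 hA) (s := certificate₅.H) ⟨by decide +kernel, by decide +kernel⟩
    ⟨by decide +kernel, by decide +kernel⟩ rfl (by decide +kernel)

variable [Finite G]

/-- The resolution for `PSL₂(𝔽₈)` and a Sylow 2-subgroup; `Q` consists of `G/C₉` and `G/((C₂)³ ⋊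
C₇)`, twice, `Q₀` is a point, and `Y` is `G/S₃`. -/
theorem exists_flabbyClass_projective_elementary (hG : IsPSL28 G) {H : Subgroup G}
    (hH : IsE 3 H) :
    H.index = 63 ∧ ∃ F : Representation ℤ G (Fin 73 → ℤ),
      IsFlabbyClassOf (chevalley H) F ∧ IsStablyPermutation F ∧
      (∃ A : Subgroup G, IsS 3 A) ∧ (∃ B : Subgroup G, IsC 9 B) ∧ (∃ C : Subgroup G, IsE8C7 C) ∧
      ∀ A B C : Subgroup G, IsS 3 A → IsC 9 B → IsE8C7 C →
        Nonempty (((cosetLattice A).prod ((cosetLattice B).prod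
            ((cosetLattice C).prod (cosetLattice C)))).Equiv
          ((cosetLattice A).prod ((trivialLattice G).prod F))) ∧
        A.index = 84 ∧ B.index = 56 ∧ C.index = 9 := by
  have : Fact (Nat.Prime 3) := ⟨by norm_num⟩
  obtain ⟨θ₀, h₀⟩ := exists_isCoding_of_isPSL28 hG
  have hcard := card_of_isCoding₈ h₀
  obtain ⟨θ, h, hθ⟩ := h₀.exists_eq_codedSubgroup (areConj_of_isE_three h₀ hH)
  subst hθ
  have h1 := h.represents_one (by norm_num) (by decide +kernel)
  have hl : IsSubgroupList 9 504 elt₈ certificate₅.H := ⟨by decide +kernel, by decide +kernel⟩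
  have hB : IsSubgroupList 9 504 elt₈ certificate₆.H := ⟨by decide +kernel, by decide +kernel⟩
  have hN := h.normalizer_eq hl hB (by decide +kernel)
  have htop := codedSubgroup_gens₈ h
  obtain ⟨F, hF, hs, ⟨e⟩⟩ := certificate₅_holds.exists_equiv h (by norm_num) hcard
    (by decide +kernel) (by decide +kernel) (by decide +kernel) hl (by decide +kernel) htop
    (by decide) (card_cosetSum_top htop) (d := 73) (by decide) (by decide)
  refine ⟨index_eq hcard (card_of_isE hH), F, hF, hs,
    ⟨codedSubgroup θ elt₈ [0, 7, 56, 57, 112, 113], isS_of_isD (h.isD h1 (by norm_num)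
      ⟨by decide +kernel, by decide +kernel⟩ (i := 57) (j := 7) (by simp) (by simp) (p := 3) 0
      (by norm_num) (by decide +kernel) (by decide +kernel) rfl)⟩,
    ⟨_, isC_cyclicNine h⟩,
    ⟨_, isE8C7_of_le_normalizer hH (hN ▸ Subgroup.le_normalizer) hN.ge (h.card (by norm_num) hB)⟩,
    fun A B C hA hB hC => ⟨?_, index_eq hcard (hasNormalSubgroup_of_isS hA).2,
      index_eq hcard (card_of_isC hB), index_eq hcard (hasNormalSubgroup_of_isE8C7 hC).2⟩⟩
  have hC' := areConj_of_isE8C7 h hC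
  obtain ⟨eQ⟩ := cosetSum_three (A := certificate₅.Q.sub θ elt₈) (areConj_of_isC_nine h hB) hC' hC'
  obtain ⟨eR⟩ := cosetSum_one_top (A := certificate₅.Q₀.sub θ elt₈) htop
  obtain ⟨eY⟩ := cosetSum_one (A := certificate₅.Y.sub θ elt₈) (areConj_of_isS_three h hA)
  exact ⟨(prodEquiv eY.symm eQ.symm).trans (e.trans (prodEquiv eY (prodEquiv eR (.refl F))))⟩

/-- The resolution for `PSL₂(𝔽₈)` and a Borel subgroup; `Q` consists of `G/C₉` and `G/D₇`, `Q₀` is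
`G/D₉`, and `Y` is `G/C₃`. -/
theorem exists_flabbyClass_projective_borel (hG : IsPSL28 G) {H : Subgroup G} (hH : IsE8C7 H) :
    H.index = 9 ∧ ∃ F : Representation ℤ G (Fin 64 → ℤ),
      IsFlabbyClassOf (chevalley H) F ∧ IsStablyPermutation F ∧
      (∃ A : Subgroup G, IsC 3 A) ∧ (∃ B : Subgroup G, IsC 9 B) ∧
      (∃ C : Subgroup G, IsD 7 C) ∧ (∃ D : Subgroup G, IsD 9 D) ∧
      ∀ A B C D : Subgroup G, IsC 3 A → IsC 9 B → IsD 7 C → IsD 9 D →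
        Nonempty (((cosetLattice A).prod ((cosetLattice B).prod (cosetLattice C))).Equiv
          ((cosetLattice A).prod ((cosetLattice D).prod F))) ∧
        A.index = 168 ∧ B.index = 56 ∧ C.index = 36 ∧ D.index = 28 := by
  have : Fact (Nat.Prime 3) := ⟨by norm_num⟩
  have : Fact (Nat.Prime 7) := ⟨by norm_num⟩
  obtain ⟨θ₀, h₀⟩ := exists_isCoding_of_isPSL28 hG
  have hcard := card_of_isCoding₈ h₀
  obtain ⟨θ, h, hθ⟩ := h₀.exists_eq_codedSubgroup (areConj_of_isE8C7 h₀ hH)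
  subst hθ
  have h1 := h.represents_one (by norm_num) (by decide +kernel)
  have hl : IsSubgroupList 9 504 elt₈ certificate₆.H := ⟨by decide +kernel, by decide +kernel⟩
  have h7 : IsSubgroupList 9 504 elt₈ [0, 1, 2, 3, 4, 5, 6, 56, 64, 72, 80, 88, 96, 104] :=
    ⟨by decide +kernel, by decide +kernel⟩
  have h9 : IsSubgroupList 9 504 elt₈ [0, 14, 56, 58, 121, 123, 168, 170, 233, 235, 308, 310, 389,
    391, 420, 422, 501, 503] := ⟨by decide +kernel, by decide +kernel⟩
  have hcardD : Nat.card (CosetSum (certificate₆.Q₀.sub θ elt₈)) = 28 :=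
    h.card_points (by norm_num) hcard (by decide +kernel)
  obtain ⟨F, hF, hs, ⟨e⟩⟩ := certificate₆_holds.exists_equiv h (by norm_num) hcard
    (by decide +kernel) (by decide +kernel) (by decide +kernel) hl (by decide +kernel)
    (codedSubgroup_gens₈ h) (by decide) hcardD (d := 64) (by decide) (by decide)
  refine ⟨index_eq hcard (hasNormalSubgroup_of_isE8C7 hH).2, F, hF, hs,
    exists_isC 3 (by simp [hcard]), ⟨_, isC_cyclicNine h⟩,
    ⟨_, h.isD h1 (by norm_num) h7 (i := 1) (j := 56) (by simp) (by simp) (p := 7) 0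
      (by norm_num) (by decide +kernel) (by decide +kernel) rfl⟩,
    ⟨_, h.isD h1 (by norm_num) h9 (i := 58) (j := 14) (by simp) (by simp) (p := 3) 1
      (by norm_num) (by decide +kernel) (by decide +kernel) rfl⟩,
    fun A B C D hA hB hC hD => ⟨?_, index_eq hcard (card_of_isC hA), index_eq hcard (card_of_isC hB),
      index_eq hcard (hasNormalSubgroup_of_isD hC).2,
      index_eq hcard (hasNormalSubgroup_of_isD hD).2⟩⟩
  obtain ⟨eQ⟩ := cosetSum_two (A := certificate₆.Q.sub θ elt₈) (areConj_of_isC_nine h hB)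
    (h.areConj (p := 7) (e := 1) (r := 72) (by norm_num) hcard (by norm_num)
      (hasNormalSubgroup_of_isD hC) (s := [0, 1, 2, 3, 4, 5, 6])
      ⟨by decide +kernel, by decide +kernel⟩ h7 rfl (by decide +kernel))
  obtain ⟨eR⟩ := cosetSum_one (A := certificate₆.Q₀.sub θ elt₈)
    (h.areConj (p := 3) (e := 2) (r := 56) (by norm_num) hcard (by norm_num)
      (hasNormalSubgroup_of_isD hD) isSubgroupList_cyclicNine h9 rfl (by decide +kernel))
  obtain ⟨eY⟩ := cosetSum_one (A := certificate₆.Y.sub θ elt₈)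
    (areConj_of_card_three h (card_of_isC hA))
  exact ⟨(prodEquiv eY.symm eQ.symm).trans (e.trans (prodEquiv eY (prodEquiv eR (.refl F))))⟩

end ProjectiveLinearGroup

/-! ### Rationality of the norm one torus -/

section Rationality

theorem isPermutationLattice_trivialLattice {G : Type*} [Group G] :
    IsPermutationLattice (trivialLattice G) :=
  (isPermutationLattice_permLattice _).equiv topEquiv

theorem latticeRank_prod {G : Type*} [Group G] {M N : Type*} [AddCommGroup M] [AddCommGroup N]
    [Module.Free ℤ M] [Module.Finite ℤ M] [Module.Free ℤ N] [Module.Finite ℤ N]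
    (ρ : Representation ℤ G M) (σ : Representation ℤ G N) :
    latticeRank (ρ.prod σ) = latticeRank ρ + latticeRank σ := Module.finrank_prod

theorem latticeRank_cosetLattice {G : Type*} [Group G] (A : Subgroup G) :
    latticeRank (cosetLattice A) = A.index := finrank_permLattice _

variable {k : Type u} {L : Type v} [Field k] [Field L] [Algebra k L] [FiniteDimensional k L]
  [IsGalois k L] {K : IntermediateField k L}

/-- If the flabby class of the Chevalley module is the difference of two permutation lattices, the
norm one torus is stably rational, and rational after multiplication by the torus of the first of
these lattices. -/
theorem rational_of_equiv {d : ℕ} {F : Representation ℤ Gal(L/k) (Fin d → ℤ)}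
    (hF : IsFlabbyClassOf (chevalley K.fixingSubgroup) F) {M N : Type*} [AddCommGroup M]
    [AddCommGroup N] {ρ : Representation ℤ Gal(L/k) M} {σ : Representation ℤ Gal(L/k) N}
    (hρ : IsPermutationLattice ρ) (hσ : IsPermutationLattice σ)
    (he : Nonempty (ρ.Equiv (σ.prod F))) {r : ℕ} (hr : latticeRank ρ = r) :
    IsStablyRational k (CoordRing k K) ∧ HasRationalComplement k L (CoordRing k K) ρ r := by
  obtain ⟨e⟩ := he
  obtain ⟨m, b, -⟩ := id hρ
  obtain rfl : m = r := by rw [← hr, latticeRank, Module.finrank_eq_card_basis b, Fintype.card_fin]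
  obtain ⟨B, _, _, hB⟩ := exists_torus m (transport ρ b.equivFun)
  have hB' : IsTorusOf B ρ := hB.equiv (transportEquiv ρ b.equivFun).symm
  have h := (isTorusOf_coordRing (K := K)).isFormOf.rational_of_flabbyClass hF hσ hρ
    ((prodComm _ _).trans e.symm) hB'.isFormOf fun n τ _ =>
      let ⟨C, i, j, hC⟩ := exists_torus n τ
      ⟨C, i, inferInstance, hC.isFormOf⟩
  exact ⟨h.1, B, _, _, hB'.isTorusSplitBy b, hB'.hasCharacterLattice,
    hB'.isFormOf.isRational hρ, h.2⟩

end Rationality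

end NormOne

end

theorem theorem1p3 {k : Type*} {L : Type*} [Field k] [Field L] [Algebra k L]
    [FiniteDimensional k L] [IsGalois k L] (K : IntermediateField k L)
    (hKL : IntermediateField.normalClosure k K L = ⊤) (hK : K.fixingSubgroup < ⊤) :
    -- the norm one torus has dimension `[K : k] - 1` and character module `J_{G/H}`
    (IsTorusSplitBy k L (CoordRing k K) (Module.finrank k K - 1) ∧
      HasCharacterLattice k L (CoordRing k K) (chevalley K.fixingSubgroup)) ∧
    -- `G ≃ S₃`, `H = 1`
    (IsS 3 Gal(L/k) → K.fixingSubgroup = ⊥ →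
      K.fixingSubgroup.index = 6 ∧ IsStablyRational k (CoordRing k K) ∧
      ∃ F : Representation ℤ Gal(L/k) (Fin 7 → ℤ),
        IsFlabbyClassOf (chevalley K.fixingSubgroup) F ∧ IsStablyPermutation F ∧
        (∃ A : Subgroup Gal(L/k), IsC 2 A) ∧ (∃ B : Subgroup Gal(L/k), IsC 3 B) ∧
        ∀ A B : Subgroup Gal(L/k), IsC 2 A → IsC 3 B →
          Nonempty (((cosetLattice A).prod ((cosetLattice A).prod (cosetLattice B))).Equiv
            ((trivialLattice Gal(L/k)).prod F)) ∧
          A.index = 3 ∧ B.index = 2 ∧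
          latticeRank ((cosetLattice A).prod ((cosetLattice A).prod (cosetLattice B))) = 8 ∧
          HasRationalComplement k L (CoordRing k K)
            ((cosetLattice A).prod ((cosetLattice A).prod (cosetLattice B))) 8) ∧
    -- `G ≃ S₃`, `H ≃ C₂`
    (IsS 3 Gal(L/k) → IsC 2 K.fixingSubgroup →
      K.fixingSubgroup.index = 3 ∧ IsStablyRational k (CoordRing k K) ∧
      ∃ F : Representation ℤ Gal(L/k) (Fin 4 → ℤ),
        IsFlabbyClassOf (chevalley K.fixingSubgroup) F ∧ IsStablyPermutation F ∧
        (∃ A : Subgroup Gal(L/k), IsC 2 A) ∧ (∃ B : Subgroup Gal(L/k), IsC 3 B) ∧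
        ∀ A B : Subgroup Gal(L/k), IsC 2 A → IsC 3 B →
          Nonempty (((cosetLattice A).prod (cosetLattice B)).Equiv
            ((trivialLattice Gal(L/k)).prod F)) ∧
          A.index = 3 ∧ B.index = 2 ∧
          latticeRank ((cosetLattice A).prod (cosetLattice B)) = 5 ∧
          Nonempty (((cosetLattice A).prod ((cosetLattice A).prod (cosetLattice B))).Equiv
            ((trivialLattice Gal(L/k)).prod ((cosetLattice A).prod F))) ∧
          latticeRank ((cosetLattice A).prod ((cosetLattice A).prod (cosetLattice B))) = 8 ∧
          HasRationalComplement k L (CoordRing k K)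
            ((cosetLattice A).prod (cosetLattice B)) 5) ∧
    -- `G ≃ A₅`, `H ≃ V₄`
    (IsA 5 Gal(L/k) → IsE 2 K.fixingSubgroup →
      K.fixingSubgroup.index = 15 ∧ IsStablyRational k (CoordRing k K) ∧
      ∃ F : Representation ℤ Gal(L/k) (Fin 21 → ℤ),
        IsFlabbyClassOf (chevalley K.fixingSubgroup) F ∧ IsStablyPermutation F ∧
        (∃ A : Subgroup Gal(L/k), IsC 5 A) ∧ (∃ B : Subgroup Gal(L/k), IsA 4 B) ∧
        ∀ A B : Subgroup Gal(L/k), IsC 5 A → IsA 4 B →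
          Nonempty (((cosetLattice A).prod ((cosetLattice B).prod (cosetLattice B))).Equiv
            ((trivialLattice Gal(L/k)).prod F)) ∧
          A.index = 12 ∧ B.index = 5 ∧
          latticeRank ((cosetLattice A).prod ((cosetLattice B).prod (cosetLattice B))) = 22 ∧
          HasRationalComplement k L (CoordRing k K)
            ((cosetLattice A).prod ((cosetLattice B).prod (cosetLattice B))) 22) ∧
    -- `G ≃ A₅`, `H ≃ A₄`
    (IsA 5 Gal(L/k) → IsA 4 K.fixingSubgroup →
      K.fixingSubgroup.index = 5 ∧ IsStablyRational k (CoordRing k K) ∧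
      ∃ F : Representation ℤ Gal(L/k) (Fin 16 → ℤ),
        IsFlabbyClassOf (chevalley K.fixingSubgroup) F ∧ IsStablyPermutation F ∧
        (∃ A : Subgroup Gal(L/k), IsC 5 A) ∧ (∃ B : Subgroup Gal(L/k), IsS 3 B) ∧
        (∃ C : Subgroup Gal(L/k), IsD 5 C) ∧
        ∀ A B C : Subgroup Gal(L/k), IsC 5 A → IsS 3 B → IsD 5 C →
          Nonempty (((cosetLattice A).prod (cosetLattice B)).Equiv
            ((cosetLattice C).prod F)) ∧
          A.index = 12 ∧ B.index = 10 ∧ C.index = 6 ∧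
          latticeRank ((cosetLattice A).prod (cosetLattice B)) = 22 ∧
          HasRationalComplement k L (CoordRing k K)
            ((cosetLattice A).prod (cosetLattice B)) 22) ∧
    -- `G ≃ PSL₂(𝔽₈)`, `H ≃ (C₂)³`
    (IsPSL28 Gal(L/k) → IsE 3 K.fixingSubgroup →
      K.fixingSubgroup.index = 63 ∧ IsStablyRational k (CoordRing k K) ∧
      ∃ F : Representation ℤ Gal(L/k) (Fin 73 → ℤ),
        IsFlabbyClassOf (chevalley K.fixingSubgroup) F ∧ IsStablyPermutation F ∧
        (∃ A : Subgroup Gal(L/k), IsS 3 A) ∧ (∃ B : Subgroup Gal(L/k), IsC 9 B) ∧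
        (∃ C : Subgroup Gal(L/k), IsE8C7 C) ∧
        ∀ A B C : Subgroup Gal(L/k), IsS 3 A → IsC 9 B → IsE8C7 C →
          Nonempty (((cosetLattice A).prod ((cosetLattice B).prod
              ((cosetLattice C).prod (cosetLattice C)))).Equiv
            ((cosetLattice A).prod ((trivialLattice Gal(L/k)).prod F))) ∧
          A.index = 84 ∧ B.index = 56 ∧ C.index = 9 ∧
          latticeRank ((cosetLattice A).prod ((cosetLattice B).prod
            ((cosetLattice C).prod (cosetLattice C)))) = 158 ∧
          HasRationalComplement k L (CoordRing k K)
            ((cosetLattice A).prod ((cosetLattice B).prod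
              ((cosetLattice C).prod (cosetLattice C)))) 158) ∧
    -- `G ≃ PSL₂(𝔽₈)`, `H ≃ (C₂)³ ⋊ C₇`
    (IsPSL28 Gal(L/k) → IsE8C7 K.fixingSubgroup →
      K.fixingSubgroup.index = 9 ∧ IsStablyRational k (CoordRing k K) ∧
      ∃ F : Representation ℤ Gal(L/k) (Fin 64 → ℤ),
        IsFlabbyClassOf (chevalley K.fixingSubgroup) F ∧ IsStablyPermutation F ∧
        (∃ A : Subgroup Gal(L/k), IsC 3 A) ∧ (∃ B : Subgroup Gal(L/k), IsC 9 B) ∧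
        (∃ C : Subgroup Gal(L/k), IsD 7 C) ∧ (∃ D : Subgroup Gal(L/k), IsD 9 D) ∧
        ∀ A B C D : Subgroup Gal(L/k), IsC 3 A → IsC 9 B → IsD 7 C → IsD 9 D →
          Nonempty (((cosetLattice A).prod ((cosetLattice B).prod (cosetLattice C))).Equiv
            ((cosetLattice A).prod ((cosetLattice D).prod F))) ∧
          A.index = 168 ∧ B.index = 56 ∧ C.index = 36 ∧ D.index = 28 ∧
          latticeRank ((cosetLattice A).prod ((cosetLattice B).prod (cosetLattice C))) = 260 ∧
          HasRationalComplement k L (CoordRing k K)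
            ((cosetLattice A).prod ((cosetLattice B).prod (cosetLattice C))) 260) := by
  have hP (A : Subgroup Gal(L/k)) : IsPermutationLattice (cosetLattice A) :=
    isPermutationLattice_permLattice _
  have hZ := isPermutationLattice_trivialLattice (G := Gal(L/k))
  refine ⟨⟨isTorusSplitBy_coordRing, isTorusOf_coordRing.hasCharacterLattice⟩, fun hG hH => ?_,
    fun hG hH => ?_, fun hG hH => ?_, fun hG hH => ?_, fun hG hH => ?_, fun hG hH => ?_⟩
  · obtain ⟨hi, F, hF, hs, ⟨A₀, hA₀⟩, ⟨B₀, hB₀⟩, h⟩ := exists_flabbyClass_symmetric_bot hG hH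
    have hr : ∀ A B : Subgroup Gal(L/k), IsC 2 A → IsC 3 B → latticeRank
        ((cosetLattice A).prod ((cosetLattice A).prod (cosetLattice B))) = 8 := by
      intro A B hA hB
      obtain ⟨-, hA', hB'⟩ := h A B hA hB
      rw [latticeRank_prod, latticeRank_prod, latticeRank_cosetLattice, latticeRank_cosetLattice,
        hA', hB']
    have hR := fun A B hA hB => rational_of_equiv hF ((hP A).prod ((hP A).prod (hP B))) hZ
      (h A B hA hB).1 (hr A B hA hB)
    exact ⟨hi, (hR A₀ B₀ hA₀ hB₀).1, F, hF, hs, ⟨A₀, hA₀⟩, ⟨B₀, hB₀⟩, fun A B hA hB =>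
      ⟨(h A B hA hB).1, (h A B hA hB).2.1, (h A B hA hB).2.2, hr A B hA hB, (hR A B hA hB).2⟩⟩
  · obtain ⟨hi, F, hF, hs, ⟨A₀, hA₀⟩, ⟨B₀, hB₀⟩, h⟩ := exists_flabbyClass_symmetric_two hG hH
    have hr : ∀ A B : Subgroup Gal(L/k), IsC 2 A → IsC 3 B → latticeRank
        ((cosetLattice A).prod (cosetLattice B)) = 5 := by
      intro A B hA hB
      obtain ⟨-, hA', hB'⟩ := h A B hA hB
      rw [latticeRank_prod, latticeRank_cosetLattice, latticeRank_cosetLattice, hA', hB']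
    have hR := fun A B hA hB => rational_of_equiv hF ((hP A).prod (hP B)) hZ
      (h A B hA hB).1 (hr A B hA hB)
    refine ⟨hi, (hR A₀ B₀ hA₀ hB₀).1, F, hF, hs, ⟨A₀, hA₀⟩, ⟨B₀, hB₀⟩, fun A B hA hB =>
      ⟨(h A B hA hB).1, (h A B hA hB).2.1, (h A B hA hB).2.2, hr A B hA hB, ?_, ?_,
        (hR A B hA hB).2⟩⟩
    · obtain ⟨e⟩ := (h A B hA hB).1
      exact ⟨(prodEquiv (.refl _) e).trans prodLeftComm⟩
    · rw [latticeRank_prod, hr A B hA hB, latticeRank_cosetLattice, (h A B hA hB).2.1]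
  · obtain ⟨hi, F, hF, hs, ⟨A₀, hA₀⟩, ⟨B₀, hB₀⟩, h⟩ := exists_flabbyClass_alternating_klein hG hH
    have hr : ∀ A B : Subgroup Gal(L/k), IsC 5 A → IsA 4 B → latticeRank
        ((cosetLattice A).prod ((cosetLattice B).prod (cosetLattice B))) = 22 := by
      intro A B hA hB
      obtain ⟨-, hA', hB'⟩ := h A B hA hB
      rw [latticeRank_prod, latticeRank_prod, latticeRank_cosetLattice, latticeRank_cosetLattice,
        hA', hB']
    have hR := fun A B hA hB => rational_of_equiv hF ((hP A).prod ((hP B).prod (hP B))) hZ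
      (h A B hA hB).1 (hr A B hA hB)
    exact ⟨hi, (hR A₀ B₀ hA₀ hB₀).1, F, hF, hs, ⟨A₀, hA₀⟩, ⟨B₀, hB₀⟩, fun A B hA hB =>
      ⟨(h A B hA hB).1, (h A B hA hB).2.1, (h A B hA hB).2.2, hr A B hA hB, (hR A B hA hB).2⟩⟩
  · obtain ⟨hi, F, hF, hs, ⟨A₀, hA₀⟩, ⟨B₀, hB₀⟩, ⟨C₀, hC₀⟩, h⟩ :=
      exists_flabbyClass_alternating_alternating hG hH
    have hr : ∀ A B C : Subgroup Gal(L/k), IsC 5 A → IsS 3 B → IsD 5 C → latticeRank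
        ((cosetLattice A).prod (cosetLattice B)) = 22 := by
      intro A B C hA hB hC
      obtain ⟨-, hA', hB', -⟩ := h A B C hA hB hC
      rw [latticeRank_prod, latticeRank_cosetLattice, latticeRank_cosetLattice, hA', hB']
    have hR := fun A B C hA hB hC => rational_of_equiv hF ((hP A).prod (hP B)) (hP C)
      (h A B C hA hB hC).1 (hr A B C hA hB hC)
    exact ⟨hi, (hR A₀ B₀ C₀ hA₀ hB₀ hC₀).1, F, hF, hs, ⟨A₀, hA₀⟩, ⟨B₀, hB₀⟩, ⟨C₀, hC₀⟩,
      fun A B C hA hB hC => ⟨(h A B C hA hB hC).1, (h A B C hA hB hC).2.1,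
        (h A B C hA hB hC).2.2.1, (h A B C hA hB hC).2.2.2, hr A B C hA hB hC,
        (hR A B C hA hB hC).2⟩⟩
  · obtain ⟨hi, F, hF, hs, ⟨A₀, hA₀⟩, ⟨B₀, hB₀⟩, ⟨C₀, hC₀⟩, h⟩ :=
      exists_flabbyClass_projective_elementary hG hH
    have hr : ∀ A B C : Subgroup Gal(L/k), IsS 3 A → IsC 9 B → IsE8C7 C → latticeRank
        ((cosetLattice A).prod ((cosetLattice B).prod
          ((cosetLattice C).prod (cosetLattice C)))) = 158 := by
      intro A B C hA hB hC
      obtain ⟨-, hA', hB', hC'⟩ := h A B C hA hB hC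
      rw [latticeRank_prod, latticeRank_prod, latticeRank_prod, latticeRank_cosetLattice,
        latticeRank_cosetLattice, latticeRank_cosetLattice, hA', hB', hC']
    have hR := fun A B C hA hB hC => rational_of_equiv hF
      ((hP A).prod ((hP B).prod ((hP C).prod (hP C)))) ((hP A).prod hZ)
      ((h A B C hA hB hC).1.map fun e => e.trans (prodAssoc _ _ _).symm) (hr A B C hA hB hC)
    exact ⟨hi, (hR A₀ B₀ C₀ hA₀ hB₀ hC₀).1, F, hF, hs, ⟨A₀, hA₀⟩, ⟨B₀, hB₀⟩, ⟨C₀, hC₀⟩,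
      fun A B C hA hB hC => ⟨(h A B C hA hB hC).1, (h A B C hA hB hC).2.1,
        (h A B C hA hB hC).2.2.1, (h A B C hA hB hC).2.2.2, hr A B C hA hB hC,
        (hR A B C hA hB hC).2⟩⟩
  · obtain ⟨hi, F, hF, hs, ⟨A₀, hA₀⟩, ⟨B₀, hB₀⟩, ⟨C₀, hC₀⟩, ⟨D₀, hD₀⟩, h⟩ :=
      exists_flabbyClass_projective_borel hG hH
    have hr : ∀ A B C D : Subgroup Gal(L/k), IsC 3 A → IsC 9 B → IsD 7 C → IsD 9 D → latticeRank
        ((cosetLattice A).prod ((cosetLattice B).prod (cosetLattice C))) = 260 := by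
      intro A B C D hA hB hC hD
      obtain ⟨-, hA', hB', hC', -⟩ := h A B C D hA hB hC hD
      rw [latticeRank_prod, latticeRank_prod, latticeRank_cosetLattice, latticeRank_cosetLattice,
        latticeRank_cosetLattice, hA', hB', hC']
    have hR := fun A B C D hA hB hC hD => rational_of_equiv hF
      ((hP A).prod ((hP B).prod (hP C))) ((hP A).prod (hP D))
      ((h A B C D hA hB hC hD).1.map fun e => e.trans (prodAssoc _ _ _).symm)
      (hr A B C D hA hB hC hD)
    exact ⟨hi, (hR A₀ B₀ C₀ D₀ hA₀ hB₀ hC₀ hD₀).1, F, hF, hs, ⟨A₀, hA₀⟩, ⟨B₀, hB₀⟩, ⟨C₀, hC₀⟩,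
      ⟨D₀, hD₀⟩, fun A B C D hA hB hC hD => ⟨(h A B C D hA hB hC hD).1,
        (h A B C D hA hB hC hD).2.1, (h A B C D hA hB hC hD).2.2.1,
        (h A B C D hA hB hC hD).2.2.2.1, (h A B C D hA hB hC hD).2.2.2.2, hr A B C D hA hB hC hD,
        (hR A B C D hA hB hC hD).2⟩⟩
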